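/- Let $n\ge 1$, $m\ge 0$, $e\in\{0,1\}$, $N=2n$, $M=2m+e\ge 1$. Let $V=V_{\bar0}\oplus V_{\bar1}$ be the superspace with basis $\varphi^i,\varphi^{i*}$ ($1\le i\le n$) of $V_{\bar0}$ and $\psi^i,\psi^{i*}$ ($1\le i\le m$), together with $\psi$ if $e=1$, of $V_{\bar1}$, and with the super-skewsymmetric form whose non-zero products of basis vectors are $\langle\varphi^{i*}|\varphi^i\rangle=-\langle\varphi^i|\varphi^{i*}\rangle=1$, $\langle\psi^{i*}|\psi^i\rangle=\langle\psi^i|\psi^{i*}\rangle=1$, $\langle\psi|\psi\rangle=1$. Let $\mathfrak g=\mathfrak{osp}(M|N)=\mathfrak{osp}(V)$ with invariant form $(X|Y)=-\frac12\mathrm{str}(XY)$, so that on weights $(\epsilon_i|\epsilon_j)=\delta_{ij}$, $(\delta_i|\delta_j)=-\delta_{ij}$, $(\epsilon_i|\delta_j)=0$ ($\epsilon_i$, $\delta_i$ being the weights of $\psi^i$, $\varphi^i$), and let $\hat{\mathfrak g}=\mathfrak g[t,t^{-1}]\oplus\mathbb CK\oplus\mathbb Cd$, $d=t\,\frac{d}{dt}$.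 Let $\Phi_V$ (resp. $\Phi_V^{tw}$) be the superspace generated from an even vector $|0\rangle\ne0$ by operators $a_r$ ($a\in B$, the above basis) of parity $p(a)$, with $r\in\frac12+\mathbb Z$ (resp. $r\in\mathbb Z$), such that (i) $[a_r,b_s]=\langle a|b\rangle\delta_{r,-s}$; (ii) $a_r|0\rangle=0$ exactly for $r>0$, resp. exactly for $r>0$ and, if $a=\varphi^i$ or $\psi^i$, also for $r=0$; (iii) it is irreducible (has no proper non-zero graded invariant subspace) with respect to all $a_r$. Put $:ab:_r=\sum_{j}(\text{terms } a_jb_{r-j}\text{ with } a_j|0\rangle\neq0,\ \text{and } (-1)^{p(a)p(b)}b_{r-j}a_j\text{ with } a_j|0\rangle=0)-s_a\langle a|b\rangle\delta_{r,0}$, where $s_a=0$ for $\Phi_V$, and for $\Phi_V^{tw}$ $s_a=-\frac12$ if $a=\varphi^i,\psi^i$ and $s_a=\frac12$ otherwise; and $:a(z)b(z):=\sum_r:ab:_rz^{-r-1}$. Let $\Phi_{even}$, $\Phi_{odd}$ (resp. $\Phi^{tw}_{even}$, $\Phi^{tw}_{odd}$) be the spans of monomials in the $a_r$ of even, odd degree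 applied to $|0\rangle$. Weights of $\hat{\mathfrak g}$ are taken with $(\Lambda_0|\delta)=1$. For simple roots $\hat\Pi=\{\alpha_0,\dots,\alpha_\ell\}$, $\ell=m+n$, the fundamental weight $\Lambda_i$ is defined, up to adding a multiple of $\delta$, by $(\Lambda_i|\alpha_j^\vee)=\delta_{ij}$, with $\alpha^\vee=2\alpha/(\alpha|\alpha)$ if $(\alpha|\alpha)\ne0$ and $\alpha^\vee=\alpha$ otherwise; $L(\Lambda)$ is the irreducible highest weight module, with even highest weight vector, and isomorphisms with $L(\Lambda)$ are up to a shift of parity. An ordering $w_0>\dots>w_{\ell-1}$ of the $\epsilon_i,\delta_j$ and a root $\theta$ define $\alpha_0=\delta-\theta$, $\alpha_j=w_{j-1}-w_j$ ($1\le j<\ell$), and $\alpha_\ell=w_{\ell-1}$ for odd $M$, $\alpha_\ell=w_{\ell-2}+w_{\ell-1}$ for even $M$. The distinguished $\hat\Pi$ is given by $\delta_1>\dots>\delta_n>\epsilon_1>\dots>\epsilon_m$, $\theta=2\delta_1$. For $n\le m$ the $\hat\Pi$ adapted to integrable modules is given by $\theta=w_0+w_1$ and $\epsilon_m>\dots>\epsilon_{n+1}>\epsilon_n>\delta_n>\dots>\epsilon_1>\delta_1$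 for odd $M$, $\epsilon_m>\dots>\epsilon_{n+1}>\delta_n>\epsilon_n>\dots>\delta_1>\epsilon_1$ for even $M$. Put $T=\{\epsilon_i-\delta_i\}_{1\le i\le n}$ for odd $M$; $T=\{\delta_i-\epsilon_i\}_{1\le i\le n}$ and $T'=\{\delta_1+\epsilon_1,\ \delta_i-\epsilon_i\ (2\le i\le n)\}$ for even $M$. On $X=\{(\tau,x,y,t)\mid \mathrm{Im}\,\tau>0,\ x\in\mathbb C^m,\ y\in\mathbb C^n,\ t\in\mathbb C\}$ let $h=2\pi i(-\tau\Lambda_0-\sum x_i\epsilon_i+\sum y_j\delta_j+t\delta)$, $q=e^{2\pi i\tau}$, and let $SL_2(\mathbb Z)$ act by $\begin{pmatrix}a&b\\c&d\end{pmatrix}(\tau,x,y,t)=\Big(\frac{a\tau+b}{c\tau+d},\frac x{c\tau+d},\frac y{c\tau+d},t-\frac{c(\sum x_i^2-\sum y_j^2)}{2(c\tau+d)}\Big)$. The normalized supercharacter of $L(\Lambda)$ is $\mathrm{ch}^-_\Lambda=q^{m_\Lambda}\,\mathrm{str}_{L(\Lambda)}e^h$, $m_\Lambda=\frac{|\Lambda+\hat\rho|^2}{2(k+h^\vee)}-\frac{\mathrm{sdim}\,\mathfrak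 g}{24}$, where $k$ is the level and $\hat\rho=h^\vee\Lambda_0+\rho$ (so that $(\hat\rho|\alpha_j)=\frac12(\alpha_j|\alpha_j)$ and $\hat\rho(d)=0$); for $\mathfrak{osp}(3|2)$, where $k+h^\vee=0$, one takes $m_\Lambda=-\frac1{48}$ for $\Lambda_0,\Lambda_1$ and $\frac1{24}$ for $-\Lambda_2$. Let $\vartheta_{ab}(\tau,z)=\sum_{k\in\mathbb Z}e^{\pi i(k+\frac a2)^2\tau+2\pi i(k+\frac a2)(z+\frac b2)}$ and $\Theta_{ab}=e^{2\pi it}\eta(\tau)^{n-m}\prod_{i=1}^m\vartheta_{ab}(\tau,x_i)\big/\prod_{j=1}^n\vartheta_{ab}(\tau,y_j)$, $a,b\in\{0,1\}$. **(1)** The superspaces $\Phi_V$ and $\Phi^{tw}_V$ exist. On each of them there is a unique representation of $\hat{\mathfrak g}$ with $K=1$, $d|0\rangle=0$, $[d,a_r]=r\,a_r$, in which the current $\sum_r(Xt^r)z^{-r-1}$ of $X\in\mathfrak g$ is $\frac12\sum_{a\in B}:(Xa)(z)\,a^\vee(z):$, where $\langle a^\vee|b\rangle=\delta_{ab}$ for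 $b\in B$. It is integrable over $\mathfrak{so}(M)\hat{\ }$, and $\Phi_V=\Phi_{even}\oplus\Phi_{odd}$, $\Phi^{tw}_V=\Phi^{tw}_{even}\oplus\Phi^{tw}_{odd}$. **(2)** For the distinguished simple roots, $\Phi^{tw}_{even}$ and $\Phi^{tw}_{odd}$ are irreducible highest weight $\hat{\mathfrak g}$-modules. Their highest weight vectors are $|0\rangle$ and $\psi_0|0\rangle$ if $M=2m+1$; and, if $M=2m$, they are $|0\rangle$, of weight $\Lambda_{m+n}$, and $\psi^{m*}_0|0\rangle$, of weight $\Lambda_{m+n-1}$. **(3)** Let $M=2m+1$, and let $m>n$ or $m=n=1$. For the simple roots adapted to integrable modules, $\Phi_{even}\cong L(\Lambda_0)$, $\Phi_{odd}\cong L(\Lambda_1)$, $\Phi^{tw}_{even}\cong\Phi^{tw}_{odd}\cong L(-\Lambda_{m+n})$, and if $m>n$ these three highest weights vanish on $T$. The supercharacters converge absolutely for $\mathrm{Re}\,\alpha_j(h)>0$ ($0\le j\le\ell$), and there $$\mathrm{ch}^-_{\Lambda_0}+\mathrm{ch}^-_{\Lambda_1}=\frac{\eta(\tau)^2}{\eta(\frac\tau2)\eta(2\tau)}\Theta_{00},\quad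 \mathrm{ch}^-_{\Lambda_0}-\mathrm{ch}^-_{\Lambda_1}=\frac{\eta(\frac\tau2)}{\eta(\tau)}\Theta_{01},\quad \mathrm{ch}^-_{-\Lambda_{m+n}}=\frac{\eta(2\tau)}{\eta(\tau)}\Theta_{10}.$$ **(4)** Let $M=2m$ and $m>n$. For the simple roots adapted to integrable modules, $\Phi_{even}\cong L(\Lambda_0)$, $\Phi_{odd}\cong L(\Lambda_1)$, $\Phi^{tw}_{even}\cong L(\Lambda_{m+n})$, $\Phi^{tw}_{odd}\cong L(\Lambda_{m+n-1})$; the first three highest weights vanish on $T$, and the last one vanishes on $T'$. The supercharacters converge absolutely for $\mathrm{Re}\,\alpha_j(h)>0$ ($0\le j\le\ell$), and there $$\mathrm{ch}^-_{\Lambda_0}+\mathrm{ch}^-_{\Lambda_1}=\Theta_{00},\quad \mathrm{ch}^-_{\Lambda_0}-\mathrm{ch}^-_{\Lambda_1}=\Theta_{01},\quad \mathrm{ch}^-_{\Lambda_{m+n}}+\mathrm{ch}^-_{\Lambda_{m+n-1}}=\Theta_{10},\quad \mathrm{ch}^-_{\Lambda_{m+n}}-\mathrm{ch}^-_{\Lambda_{m+n-1}}=i^{\,m-n}\Theta_{11}.$$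 **(5)** The functions given by the formulas in (3) extend to meromorphic functions on $X$, for all $m,n\ge0$. With $S:\tau\mapsto-1/\tau$, $$(\mathrm{ch}^-_{\Lambda_0}+\mathrm{ch}^-_{\Lambda_1})|_S=\mathrm{ch}^-_{\Lambda_0}+\mathrm{ch}^-_{\Lambda_1},\quad (\mathrm{ch}^-_{\Lambda_0}-\mathrm{ch}^-_{\Lambda_1})|_S=\sqrt2\,\mathrm{ch}^-_{-\Lambda_{m+n}},\quad \mathrm{ch}^-_{-\Lambda_{m+n}}|_S=\tfrac1{\sqrt2}(\mathrm{ch}^-_{\Lambda_0}-\mathrm{ch}^-_{\Lambda_1}),$$ and $\mathrm{ch}^-_{\Lambda_0}$, $\mathrm{ch}^-_{\Lambda_1}$, $\mathrm{ch}^-_{-\Lambda_{m+n}}$ are multiplied by $e^{\frac{\pi i}{12}(n-m-\frac12)}$, $-e^{\frac{\pi i}{12}(n-m-\frac12)}$, $e^{\frac{\pi i}6(m-n+\frac12)}$ under $T:\tau\mapsto\tau+1$. Hence their span is $SL_2(\mathbb Z)$-invariant; in particular this holds for $\mathfrak{osp}(3|2)$ ($m=n=1$). **(6)** The functions given by the formulas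 in (4) extend to meromorphic functions on $X$, for all $m,n\ge0$, and $$(\mathrm{ch}^-_{\Lambda_0}+\mathrm{ch}^-_{\Lambda_1})|_S=\mathrm{ch}^-_{\Lambda_0}+\mathrm{ch}^-_{\Lambda_1},\quad (\mathrm{ch}^-_{\Lambda_0}-\mathrm{ch}^-_{\Lambda_1})|_S=\mathrm{ch}^-_{\Lambda_{m+n}}+\mathrm{ch}^-_{\Lambda_{m+n-1}},$$ $$(\mathrm{ch}^-_{\Lambda_{m+n}}+\mathrm{ch}^-_{\Lambda_{m+n-1}})|_S=\mathrm{ch}^-_{\Lambda_0}-\mathrm{ch}^-_{\Lambda_1},\quad (\mathrm{ch}^-_{\Lambda_{m+n}}-\mathrm{ch}^-_{\Lambda_{m+n-1}})|_S=(-i)^{m-n}(\mathrm{ch}^-_{\Lambda_{m+n}}-\mathrm{ch}^-_{\Lambda_{m+n-1}}),$$ and $\mathrm{ch}^-_{\Lambda_0}$, $\mathrm{ch}^-_{\Lambda_1}$, $\mathrm{ch}^-_{\Lambda_{m+n}}$, $\mathrm{ch}^-_{\Lambda_{m+n-1}}$ are multiplied by $e^{\frac{\pi i}{12}(n-m)}$,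 $-e^{\frac{\pi i}{12}(n-m)}$, $e^{-\frac{\pi i}6(n-m)}$, $e^{-\frac{\pi i}6(n-m)}$ under $T$. Hence their span is $SL_2(\mathbb Z)$-invariant. -/

import Mathlib

open Complex
open scoped TensorProduct MatrixGroups

noncomputable section

namespace OspFermions

/-! ### The superspace `V`, with `dim V₀ = 2n`, `dim V₁ = 2m + e` -/

/-- The basis `B` of `V`: `ph i = φ^i`, `phs i = φ^{i*}` (even, `i < n`), `ps i = ψ^i`,
`pss i = ψ^{i*}` (odd, `i < m`) and, if `e = 1`, the odd vector `z 0 = ψ`. -/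
inductive J (m n e : ℕ) : Type
  | ph (i : Fin n)
  | phs (i : Fin n)
  | ps (i : Fin m)
  | pss (i : Fin m)
  | z (i : Fin e)
  deriving DecidableEq, Fintype

variable {m n e : ℕ}

/-- Parity of a basis vector of `V`. -/
def J.par : J m n e → ZMod 2
  | .ph _ => 0
  | .phs _ => 0
  | _ => 1

/-- The basis vector that pairs non-trivially with the given one. -/
def J.conj : J m n e → J m n e
  | .ph i => .phs i
  | .phs i => .ph i
  | .ps i => .pss i
  | .pss i => .ps i
  | .z i => .z i

/-- `⟨a | a.conj⟩`. -/
def J.sgn : J m n e → ℂ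
  | .ph _ => -1
  | _ => 1

/-- The super-skewsymmetric form: `⟨φ*|φ⟩ = -⟨φ|φ*⟩ = 1`, `⟨ψ*|ψ⟩ = ⟨ψ|ψ*⟩ = 1` (same index),
`⟨ψ|ψ⟩ = 1` for the self-dual `ψ`, all other products being zero. -/
def B (a b : J m n e) : ℂ := if b = a.conj then a.sgn else 0

/-- The sign `(-1)^{s u}`. -/
def kz (s u : ZMod 2) : ℂ := if s = 1 ∧ u = 1 then -1 else 1

/-! ### The Lie superalgebra `osp(2m+e | 2n)` -/

/-- The homogeneous part of parity `s` of `osp(M|N)`: matrices `X` (acting by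
`X u = ∑ c, X c u • c`) of parity `s` with `⟨X u|v⟩ + (-1)^{s p(u)} ⟨u|X v⟩ = 0`. -/
def osp (m n e : ℕ) (s : ZMod 2) : Submodule ℂ (Matrix (J m n e) (J m n e) ℂ) where
  carrier := {X | (∀ a b, a.par + b.par ≠ s → X a b = 0) ∧
    ∀ u v, ∑ c, X c u * B c v + kz s u.par * ∑ c, B u c * X c v = 0}
  zero_mem' := by simp
  add_mem' := by
    rintro X Y ⟨h1, h2⟩ ⟨h3, h4⟩
    refine ⟨fun a b h => by simp [h1 a b h, h3 a b h], fun u v => ?_⟩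
    have e1 := h2 u v
    have e2 := h4 u v
    simp only [Matrix.add_apply, add_mul, mul_add, Finset.sum_add_distrib]
    linear_combination e1 + e2
  smul_mem' := by
    rintro r X ⟨h1, h2⟩
    refine ⟨fun a b h => by simp [h1 a b h], fun u v => ?_⟩
    have e1 := h2 u v
    have t1 : ∑ c, (r • X) c u * B c v = r * ∑ c, X c u * B c v := by
      rw [Finset.mul_sum]; exact Finset.sum_congr rfl fun c _ => by simp [mul_assoc]
    have t2 : ∑ c, B u c * (r • X) c v = r * ∑ c, B u c * X c v := by
      rw [Finset.mul_sum]; exact Finset.sum_congr rfl fun c _ => by simp [mul_left_comm]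
    rw [t1, t2]
    linear_combination r * e1

theorem kz_mul (s u t : ZMod 2) : kz (s + u) t = kz s t * kz u t := by
  have h2 : ∀ x : ZMod 2, x = 0 ∨ x = 1 := by decide
  have h11 : (1 : ZMod 2) + 1 = 0 := by decide
  unfold kz
  rcases h2 s with rfl | rfl <;> rcases h2 u with rfl | rfl <;> rcases h2 t with rfl | rfl <;>
    simp [h11]

theorem kz_comm (s u : ZMod 2) : kz s u = kz u s := by
  unfold kz; simp [and_comm]

theorem kz_sq (s u : ZMod 2) : kz s u * kz s u = 1 := by
  unfold kz; split_ifs <;> norm_num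

theorem mem_osp_iff {s : ZMod 2} {X : Matrix (J m n e) (J m n e) ℂ} :
    X ∈ osp m n e s ↔ (∀ a b, a.par + b.par ≠ s → X a b = 0) ∧
      X.transpose * Matrix.of B +
        Matrix.diagonal (fun a : J m n e => kz s a.par) * (Matrix.of B * X) = 0 := by
  refine and_congr Iff.rfl ⟨fun h => ?_, fun h u v => ?_⟩
  · ext u v
    rw [Matrix.add_apply, Matrix.diagonal_mul, Matrix.mul_apply, Matrix.mul_apply]
    exact h u v
  · have h' := congrFun (congrFun h u) v
    rw [Matrix.add_apply, Matrix.diagonal_mul, Matrix.mul_apply, Matrix.mul_apply] at h'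
    exact h'

theorem diag_mul {s : ZMod 2} (u : ZMod 2) {X : Matrix (J m n e) (J m n e) ℂ}
    (h : ∀ a b, a.par + b.par ≠ s → X a b = 0) :
    Matrix.diagonal (fun a : J m n e => kz u a.par) * X =
      kz u s • (X * Matrix.diagonal (fun a : J m n e => kz u a.par)) := by
  ext a b
  rw [Matrix.diagonal_mul, Matrix.smul_apply, Matrix.mul_diagonal, smul_eq_mul]
  by_cases hab : a.par + b.par = s
  · rw [← hab, kz_comm u (a.par + b.par), kz_mul, kz_comm b.par]
    rw [kz_comm a.par]
    linear_combination -(kz u a.par * X a b) * kz_sq u b.par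
  · simp [h a b hab]

theorem superBr_mem {s u : ZMod 2} (X : osp m n e s) (Y : osp m n e u) :
    X.1 * Y.1 - kz s u • (Y.1 * X.1) ∈ osp m n e (s + u) := by
  obtain ⟨X, hX⟩ := X
  obtain ⟨Y, hY⟩ := Y
  rw [mem_osp_iff] at hX hY ⊢
  obtain ⟨pX, fX⟩ := hX
  obtain ⟨pY, fY⟩ := hY
  have aux : ∀ {s u : ZMod 2} {X Y : Matrix (J m n e) (J m n e) ℂ},
      (∀ a b, a.par + b.par ≠ s → X a b = 0) → (∀ a b, a.par + b.par ≠ u → Y a b = 0) →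
      ∀ a b : J m n e, a.par + b.par ≠ s + u → (X * Y) a b = 0 := by
    intro s u X Y pX pY a b hab
    rw [Matrix.mul_apply]
    refine Finset.sum_eq_zero fun c _ => ?_
    by_cases h1 : a.par + c.par = s
    · by_cases h2 : c.par + b.par = u
      · exfalso
        apply hab
        rw [← h1, ← h2]
        generalize a.par = x; generalize b.par = y; generalize c.par = w
        revert x y w; decide
      · simp [pY c b h2]
    · simp [pX a c h1]
  refine ⟨fun a b hab => ?_, ?_⟩
  · simp [aux pX pY a b hab, aux pY pX a b (by rwa [add_comm u s])]
  · have dt : ∀ (s u : ZMod 2) (Y : Matrix (J m n e) (J m n e) ℂ),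
        (∀ a b, a.par + b.par ≠ u → Y a b = 0) →
        Y.transpose * Matrix.diagonal (fun a : J m n e => kz s a.par) =
          kz s u • (Matrix.diagonal (fun a : J m n e => kz s a.par) * Y.transpose) := by
      intro s u Y pY
      have h := congrArg Matrix.transpose (diag_mul s pY)
      have h' : ∀ Z W : Matrix (J m n e) (J m n e) ℂ, Z = kz s u • W → W = kz s u • Z := by
        intro Z W hZ
        rw [hZ, smul_smul, kz_sq, one_smul]
      simp only [Matrix.transpose_mul, Matrix.transpose_smul, Matrix.diagonal_transpose] at h
      exact h
    have dd : Matrix.diagonal (fun a : J m n e => kz s a.par) *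
        Matrix.diagonal (fun a : J m n e => kz u a.par) =
          Matrix.diagonal (fun a : J m n e => kz (s + u) a.par) := by
      rw [Matrix.diagonal_mul_diagonal]
      congr 1
      ext a
      rw [kz_mul]
    have dd' : Matrix.diagonal (fun a : J m n e => kz u a.par) *
        Matrix.diagonal (fun a : J m n e => kz s a.par) =
          Matrix.diagonal (fun a : J m n e => kz (s + u) a.par) := by
      rw [add_comm, Matrix.diagonal_mul_diagonal]
      congr 1
      ext a
      rw [kz_mul]
    have dX := dt u s X pX
    have dY := dt s u Y pY
    rw [← dd]
    generalize hDs : Matrix.diagonal (fun a : J m n e => kz s a.par) = Ds at *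
    generalize hDu : Matrix.diagonal (fun a : J m n e => kz u a.par) = Du at *
    generalize hB : (Matrix.of B : Matrix (J m n e) (J m n e) ℂ) = Bm at *
    have eX : X.transpose * Bm = -(Ds * (Bm * X)) := eq_neg_of_add_eq_zero_left fX
    have eY : Y.transpose * Bm = -(Du * (Bm * Y)) := eq_neg_of_add_eq_zero_left fY
    have k1 : (X * Y).transpose * Bm = kz s u • (Ds * Du * (Bm * (Y * X))) := by
      rw [Matrix.transpose_mul, Matrix.mul_assoc, eX, Matrix.mul_neg, ← Matrix.mul_assoc, dY,
        Matrix.smul_mul, Matrix.mul_assoc, ← Matrix.mul_assoc _ Bm, eY]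
      simp [Matrix.mul_assoc]
    have k2 : (Y * X).transpose * Bm = kz s u • (Ds * Du * (Bm * (X * Y))) := by
      rw [Matrix.transpose_mul, Matrix.mul_assoc, eY, Matrix.mul_neg, ← Matrix.mul_assoc, dX,
        Matrix.smul_mul, Matrix.mul_assoc, ← Matrix.mul_assoc _ Bm, eX, dd, ← dd', kz_comm u s]
      simp [Matrix.mul_assoc]
    simp only [Matrix.transpose_sub, Matrix.transpose_smul, Matrix.sub_mul, Matrix.smul_mul, k1, k2,
      Matrix.mul_sub, Matrix.mul_smul, smul_smul, kz_sq, one_smul]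
    abel

/-- Supercommutator of homogeneous elements of `osp(M|N)`. -/
def superBr {s u : ZMod 2} (X : osp m n e s) (Y : osp m n e u) : osp m n e (s + u) :=
  ⟨X.1 * Y.1 - kz s u • (Y.1 * X.1), superBr_mem X Y⟩

/-- The invariant form `(X|Y) = -½ str(XY)`; it satisfies `(α|α) = 2` for the long roots of
`so(M)`. -/
def form (X Y : Matrix (J m n e) (J m n e) ℂ) : ℂ :=
  -(1 / 2) * ∑ a, (if a.par = 0 then (X * Y) a a else -(X * Y) a a)

/-- `dim osp(M|N)₀ - dim osp(M|N)₁`. -/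
def sdim (m n e : ℕ) : ℂ :=
  (Module.finrank ℂ (osp m n e 0) : ℂ) - (Module.finrank ℂ (osp m n e 1) : ℂ)

theorem diagonal_mem {f : J m n e → ℂ} (hf : ∀ a, f a.conj = -f a) :
    Matrix.diagonal f ∈ osp m n e 0 := by
  refine ⟨fun a b hab => ?_, fun u v => ?_⟩
  · refine Matrix.diagonal_apply_ne _ fun h => hab ?_
    subst h
    generalize a.par = x
    revert x; decide
  · have hk : kz 0 u.par = 1 := by simp [kz]
    rw [hk, one_mul, Finset.sum_eq_single u, Finset.sum_eq_single v]
    · by_cases h : v = u.conj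
      · subst h; simp [hf]; ring
      · simp [B, h]
    · intro b _ hb; simp [Matrix.diagonal_apply_ne _ hb]
    · simp
    · intro b _ hb; simp [Matrix.diagonal_apply_ne _ hb]
    · simp

/-- Element `H` of the Cartan subalgebra with `ε_j(H) = δ_{ij}`, `δ_j(H) = 0`. -/
def hE (i : Fin m) : osp m n e 0 :=
  ⟨Matrix.diagonal fun a => (if a = .ps i then 1 else 0) - (if a = .pss i then 1 else 0),
    diagonal_mem fun a => by cases a <;> simp [J.conj]⟩

/-- Element `H` of the Cartan subalgebra with `ε_j(H) = 0`, `δ_j(H) = δ_{ij}`. -/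
def hD (i : Fin n) : osp m n e 0 :=
  ⟨Matrix.diagonal fun a => (if a = .ph i then 1 else 0) - (if a = .phs i then 1 else 0),
    diagonal_mem fun a => by cases a <;> simp [J.conj]⟩

/-! ### Modules over the affine Lie superalgebra -/

/-- A module over `osp(2m+e|2n)^ = osp ⊗ ℂ[t,t⁻¹] ⊕ ℂK ⊕ ℂd` on the superspace
`W = par 0 ⊕ par 1`; `loop s k X` is the action of `X t^k` for `X` homogeneous of parity `s`. -/
structure AffRep (m n e : ℕ) (W : Type) [AddCommGroup W] [Module ℂ W] where
  par : ZMod 2 → Submodule ℂ W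
  loop : (s : ZMod 2) → ℤ → osp m n e s →ₗ[ℂ] Module.End ℂ W
  K : Module.End ℂ W
  d : Module.End ℂ W
  par_isCompl : IsCompl (par 0) (par 1)
  loop_par : ∀ s u k X, ∀ v ∈ par u, loop s k X v ∈ par (s + u)
  K_par : ∀ u, ∀ v ∈ par u, K v ∈ par u
  d_par : ∀ u, ∀ v ∈ par u, d v ∈ par u
  loop_loop : ∀ s u k l (X : osp m n e s) (Y : osp m n e u),
    loop s k X * loop u l Y - kz s u • (loop u l Y * loop s k X) =
      loop (s + u) (k + l) (superBr X Y) +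
        (if k + l = 0 then (k : ℂ) * form X.1 Y.1 else 0) • K
  K_loop : ∀ s k X, K * loop s k X = loop s k X * K
  K_d : K * d = d * K
  d_loop : ∀ s k X, d * loop s k X - loop s k X * d = (k : ℂ) • loop s k X

/-- The weight `∑ e i • ε_i + ∑ f j • δ_j + k • Λ₀ + u • δ` of `osp(2m+e|2n)^`; `k` is its value
on `K` (the level) and `u` its value on `d`. -/
@[ext]
structure Wt (m n : ℕ) : Type where
  e : Fin m → ℂ
  f : Fin n → ℂ
  k : ℂ
  u : ℂ

namespace Wt

instance : Add (Wt m n) := ⟨fun a b => ⟨a.e + b.e, a.f + b.f, a.k + b.k, a.u + b.u⟩⟩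
instance : Neg (Wt m n) := ⟨fun a => ⟨-a.e, -a.f, -a.k, -a.u⟩⟩
instance : Sub (Wt m n) := ⟨fun a b => ⟨a.e - b.e, a.f - b.f, a.k - b.k, a.u - b.u⟩⟩

/-- The form on weights: `(ε_i|ε_i) = 1`, `(δ_j|δ_j) = -1`, `(Λ₀|δ) = 1`. -/
def ip (a b : Wt m n) : ℂ :=
  ∑ i, a.e i * b.e i - ∑ j, a.f j * b.f j + a.k * b.u + a.u * b.k

/-- `(Λ|α^∨)`, where `α^∨ = 2α/(α|α)` if `α` is not isotropic and `α^∨ = α` otherwise. -/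
def coroot (a α : Wt m n) : ℂ := if α.ip α = 0 then a.ip α else 2 * a.ip α / α.ip α

/-- `ε_{i+1}`, indexed from `i = 0`. -/
def eps (i : ℕ) : Wt m n := ⟨fun a => if a.val = i then 1 else 0, 0, 0, 0⟩

/-- `δ_{j+1}`, indexed from `j = 0`. -/
def del (j : ℕ) : Wt m n := ⟨0, fun a => if a.val = j then 1 else 0, 0, 0⟩

/-- The imaginary root `δ`. -/
def imag : Wt m n := ⟨0, 0, 0, 1⟩

end Wt

/-! Simple roots. Each choice is given by an order `w₀ > w₁ > ⋯` of the `m + n` weights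
`ε_i, δ_j`. -/

/-- The weight in position `p`, if `ε_{i+1}` is in position `pE i` and `δ_{j+1}` in position
`pD j`. -/
def ordWt (pE : Fin m → ℕ) (pD : Fin n → ℕ) (p : ℕ) : Wt m n :=
  ⟨fun i => if pE i = p then 1 else 0, fun j => if pD j = p then 1 else 0, 0, 0⟩

/-- The affine simple roots `α₀ = δ - θ`, `α_j = w_{j-1} - w_j` for `0 < j < ℓ`, and `α_ℓ = w_{ℓ-1}`
(for odd `M`) or `α_ℓ = w_{ℓ-2} + w_{ℓ-1}` (for even `M`), where `ℓ = m + n`. -/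
def affRoots (e : ℕ) (w : ℕ → Wt m n) (θ : Wt m n) (j : Fin (m + n + 1)) : Wt m n :=
  if j.val = 0 then Wt.imag - θ
  else if j.val < m + n then w (j.val - 1) - w j.val
  else if e = 1 then w (j.val - 1) else w (j.val - 2) + w (j.val - 1)

/-- The distinguished simple roots: order `δ_1 > ⋯ > δ_n > ε_1 > ⋯ > ε_m`, `θ = 2δ_1`. -/
def distRoots (m n e : ℕ) : Fin (m + n + 1) → Wt m n :=
  let w : ℕ → Wt m n := ordWt (fun i => n + i.val) (fun j => j.val)
  affRoots e w (w 0 + w 0)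

/-- The simple roots adapted to integrable modules, for `n ≤ m`. The order is
`ε_m > ⋯ > ε_{n+1} > ε_n > δ_n > ⋯ > ε_1 > δ_1` for odd `M`, and
`ε_m > ⋯ > ε_{n+1} > δ_n > ε_n > ⋯ > δ_1 > ε_1` for even `M`; the highest root is `θ = w₀ + w₁`. -/
def intRoots (m n e : ℕ) : Fin (m + n + 1) → Wt m n :=
  let w : ℕ → Wt m n :=
    ordWt (fun i => if n ≤ i.val then m - 1 - i.val else (m - n) + 2 * (n - 1 - i.val) + (1 - e))
      (fun j => (m - n) + 2 * (n - 1 - j.val) + e)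
  affRoots e w (w 0 + w 1)

/-- `Λ` is a fundamental weight `Λ_i` (it is unique up to adding a multiple of `δ`). -/
def IsFund (α : Fin (m + n + 1) → Wt m n) (i : ℕ) (Λ : Wt m n) : Prop :=
  ∀ j, Λ.coroot (α j) = if j.val = i then 1 else 0

/-- `r` is the affine Weyl vector `h^∨ Λ₀ + ρ`; its level is the dual Coxeter number. -/
def IsRho (α : Fin (m + n + 1) → Wt m n) (r : Wt m n) : Prop :=
  (∀ j, 2 * r.ip (α j) = (α j).ip (α j)) ∧ r.u = 0

/-- `m_Λ = |Λ + ρ̂|² / (2 (k + h^∨)) - sdim 𝔤 / 24`, to be used when `k + h^∨ ≠ 0`. -/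
def normExp (e : ℕ) (r Λ : Wt m n) : ℂ :=
  (Λ + r).ip (Λ + r) / (2 * (Λ + r).k) - sdim m n e / 24

section Modules

variable {W : Type} [AddCommGroup W] [Module ℂ W]

/-- `S` is a graded subspace of the superspace `P 0 ⊕ P 1`. -/
def IsGraded (P : ZMod 2 → Submodule ℂ W) (S : Submodule ℂ W) : Prop :=
  S = (S ⊓ P 0) ⊔ (S ⊓ P 1)

/-- `S` is invariant under the affine Lie superalgebra. -/
def AffRep.Inv (R : AffRep m n e W) (S : Submodule ℂ W) : Prop :=
  (∀ s k X, ∀ v ∈ S, R.loop s k X v ∈ S) ∧ (∀ v ∈ S, R.K v ∈ S) ∧ ∀ v ∈ S, R.d v ∈ S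

/-- The weight space of weight `μ`. -/
def AffRep.wtSpace (R : AffRep m n e W) (μ : Wt m n) : Submodule ℂ W where
  carrier := {v | (∀ i, R.loop 0 0 (hE i) v = μ.e i • v) ∧ (∀ j, R.loop 0 0 (hD j) v = μ.f j • v) ∧
    R.K v = μ.k • v ∧ R.d v = μ.u • v}
  zero_mem' := by simp
  add_mem' := by
    rintro v w ⟨h1, h2, h3, h4⟩ ⟨g1, g2, g3, g4⟩
    exact ⟨fun i => by rw [map_add, h1, g1, smul_add], fun j => by rw [map_add, h2, g2, smul_add],
      by rw [map_add, h3, g3, smul_add], by rw [map_add, h4, g4, smul_add]⟩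
  smul_mem' := by
    rintro r v ⟨h1, h2, h3, h4⟩
    exact ⟨fun i => by rw [map_smul, h1, smul_comm], fun j => by rw [map_smul, h2, smul_comm],
      by rw [map_smul, h3, smul_comm], by rw [map_smul, h4, smul_comm]⟩

/-- `X` is a vector of weight `∑ α.e i • ε_i + ∑ α.f j • δ_j` in the adjoint representation. -/
def IsRootVec {s : ZMod 2} (X : osp m n e s) (α : Wt m n) : Prop :=
  (∀ i, (hE i).1 * X.1 - X.1 * (hE i).1 = α.e i • X.1) ∧
    ∀ j, (hD j).1 * X.1 - X.1 * (hD j).1 = α.f j • X.1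

/-- The submodule `S` of `W` is, after shifting its parity by `ω`, the irreducible highest weight
module `L(Λ)` for the simple roots `α`, with highest weight vector `v` (which is even in `L(Λ)`,
hence of parity `ω` in `W`). -/
def AffRep.IsHW (R : AffRep m n e W) (S : Submodule ℂ W) (ω : ZMod 2)
    (α : Fin (m + n + 1) → Wt m n) (Λ : Wt m n) (v : W) : Prop :=
  R.Inv S ∧ IsGraded R.par S ∧
  (∀ U ≤ S, R.Inv U → IsGraded R.par U → U = ⊥ ∨ U = S) ∧
  v ∈ S ∧ v ∈ R.par ω ∧ v ≠ 0 ∧ v ∈ R.wtSpace Λ ∧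
  ∀ j s (k : ℤ) (X : osp m n e s), IsRootVec X (α j) → (k : ℂ) = (α j).u → R.loop s k X v = 0

/-- The submodule `S` of `W` is, after shifting its parity by `ω`, isomorphic to `L(Λ)`. -/
def AffRep.IsL (R : AffRep m n e W) (S : Submodule ℂ W) (ω : ZMod 2)
    (α : Fin (m + n + 1) → Wt m n) (Λ : Wt m n) : Prop :=
  ∃ v, R.IsHW S ω α Λ v

/-- Integrability with respect to `so(M)^`: all real root vectors of `so(M)^` act locally
nilpotently. -/
def AffRep.SoIntegrable (R : AffRep m n e W) : Prop :=
  ∀ (X : osp m n e 0) (α : Wt m n), (∀ a b, X.1 a b ≠ 0 → a.par = 1 ∧ b.par = 1) →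
    IsRootVec X α → α.e ≠ 0 → ∀ (k : ℤ) (v : W), ∃ N : ℕ, (R.loop 0 k X ^ N) v = 0

end Modules

/-! ### Functions on `X = {(τ, x, y, t) | Im τ > 0}` -/

/-- The point `(τ, x, y, t)` stands for
`h = 2πi (-τ Λ₀ - ∑ x_i ε_i + ∑ y_j δ_j + t δ)` in the Cartan subalgebra, which is identified with
its dual by the invariant form. -/
abbrev Pt (m n : ℕ) : Type := UpperHalfPlane × (Fin m → ℂ) × (Fin n → ℂ) × ℂ

/-- The value `μ(h)` of a weight; note that `δ_j(δ_j) = (δ_j|δ_j) = -1`. -/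
def Wt.eval (μ : Wt m n) (p : Pt m n) : ℂ :=
  2 * Real.pi * I * (-(p.1 : ℂ) * μ.u - ∑ i, p.2.1 i * μ.e i - ∑ j, p.2.2.1 j * μ.f j +
    p.2.2.2 * μ.k)

/-- The domain `Re α_j(h) > 0`, `j = 0, …, ℓ`. -/
def dom (α : Fin (m + n + 1) → Wt m n) : Set (Pt m n) := {p | ∀ j, 0 < ((α j).eval p).re}

/-- The supercharacter `str e^h` of `S`, with parity shifted by `ω`, converges absolutely on the
domain `dom α`, and multiplied by `q^s` it is equal to `F` there. -/
def AffRep.HasNormSch {W : Type} [AddCommGroup W] [Module ℂ W] (R : AffRep m n e W)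
    (S : Submodule ℂ W) (ω : ZMod 2) (α : Fin (m + n + 1) → Wt m n) (s : ℂ)
    (F : Pt m n → ℂ) : Prop :=
  (∀ μ, Module.Finite ℂ ↥(S ⊓ R.wtSpace μ)) ∧ S = ⨆ μ, S ⊓ R.wtSpace μ ∧
  ∀ p ∈ dom α, HasSum (fun μ : Wt m n => exp (2 * Real.pi * I * p.1 * s) *
    (((Module.finrank ℂ ↥(S ⊓ R.wtSpace μ ⊓ R.par ω) : ℂ) -
      (Module.finrank ℂ ↥(S ⊓ R.wtSpace μ ⊓ R.par (1 + ω)) : ℂ)) * exp (μ.eval p))) (F p)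

/-- `F` is (given by) a meromorphic function on `X`. -/
def IsMero (F : Pt m n → ℂ) : Prop :=
  ∃ num den : ℂ × (Fin m → ℂ) × (Fin n → ℂ) × ℂ → ℂ,
    DifferentiableOn ℂ num {z | 0 < z.1.im} ∧ DifferentiableOn ℂ den {z | 0 < z.1.im} ∧
    (∃ z, 0 < z.1.im ∧ den z ≠ 0) ∧
    ∀ p : Pt m n, den (↑p.1, p.2) ≠ 0 → F p = num (↑p.1, p.2) / den (↑p.1, p.2)

/-- The action of `SL₂(ℤ)` on `X`. -/
def slAct (g : SL(2, ℤ)) (p : Pt m n) : Pt m n :=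
  let D : ℂ := (g 1 0 : ℂ) * p.1 + (g 1 1 : ℂ)
  (g • p.1, fun i => p.2.1 i / D, fun j => p.2.2.1 j / D,
    p.2.2.2 - (g 1 0 : ℂ) * (∑ i, p.2.1 i ^ 2 - ∑ j, p.2.2.1 j ^ 2) / (2 * D))

/-- The Jacobi theta function `ϑ_{ab}(τ, z)`, `a, b ∈ {0, 1}`. -/
def theta (a b : ℕ) (τ z : ℂ) : ℂ :=
  ∑' k : ℤ, exp (Real.pi * I * ((k : ℂ) + (a : ℂ) / 2) ^ 2 * τ +
    2 * Real.pi * I * ((k : ℂ) + (a : ℂ) / 2) * (z + (b : ℂ) / 2))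

/-- `e^{2πit} η(τ)^{n-m} ∏ ϑ_{ab}(τ, x_i) / ∏ ϑ_{ab}(τ, y_j)`. -/
def thetaQuot (a b : ℕ) (p : Pt m n) : ℂ :=
  exp (2 * Real.pi * I * p.2.2.2) * ModularForm.eta p.1 ^ ((n : ℤ) - m) *
    ((∏ i, theta a b p.1 (p.2.1 i)) / ∏ j, theta a b p.1 (p.2.2.1 j))

/-- Odd `M`: `ch_{Λ₀} + ch_{Λ₁}`. -/
def oddPlus (p : Pt m n) : ℂ :=
  ModularForm.eta p.1 ^ 2 / (ModularForm.eta ((p.1 : ℂ) / 2) * ModularForm.eta (2 * (p.1 : ℂ))) *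
    thetaQuot 0 0 p

/-- Odd `M`: `ch_{Λ₀} - ch_{Λ₁}`. -/
def oddMinus (p : Pt m n) : ℂ :=
  ModularForm.eta ((p.1 : ℂ) / 2) / ModularForm.eta p.1 * thetaQuot 0 1 p

/-- Odd `M`: `ch_{-Λ_{m+n}}`. -/
def oddTw (p : Pt m n) : ℂ :=
  ModularForm.eta (2 * (p.1 : ℂ)) / ModularForm.eta p.1 * thetaQuot 1 0 p

/-- Even `M`: `ch_{Λ_{m+n}} - ch_{Λ_{m+n-1}}`. -/
def evenTwMinus (p : Pt m n) : ℂ := I ^ ((m : ℤ) - n) * thetaQuot 1 1 p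

/-- The normalized supercharacters for `M = 2m + 1`, of `L(Λ₀)`, `L(Λ₁)`, `L(-Λ_{m+n})`. -/
def chOdd (m n : ℕ) : Fin 3 → Pt m n → ℂ :=
  ![fun p => (oddPlus p + oddMinus p) / 2, fun p => (oddPlus p - oddMinus p) / 2, oddTw]

/-- The normalized supercharacters for `M = 2m`, of `L(Λ₀)`, `L(Λ₁)`, `L(Λ_{m+n})`,
`L(Λ_{m+n-1})`. -/
def chEven (m n : ℕ) : Fin 4 → Pt m n → ℂ :=
  ![fun p => (thetaQuot 0 0 p + thetaQuot 0 1 p) / 2,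
    fun p => (thetaQuot 0 0 p - thetaQuot 0 1 p) / 2,
    fun p => (thetaQuot 1 0 p + evenTwMinus p) / 2,
    fun p => (thetaQuot 1 0 p - evenTwMinus p) / 2]

/-- The linear span of a family of functions on `X` is `SL₂(ℤ)`-invariant. -/
def SpanInvariant {ι : Type} (f : ι → Pt m n → ℂ) : Prop :=
  ∀ g : SL(2, ℤ), ∀ F ∈ Submodule.span ℂ (Set.range f),
    (fun p => F (slAct g p)) ∈ Submodule.span ℂ (Set.range f)

/-! ### Superfermions

Both sectors are treated together: the untwisted one (`tw = false`), where the modes are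
`a_{k+1/2}`, and the twisted one (`tw = true`), where the modes are `a_k`, with `k ∈ ℤ`. -/

/-- Twice the fractional part of the mode numbers: the operator `mode tw a k` below is the mode
`a_{k + shift/2}`. -/
def shift (tw : Bool) : ℤ := if tw then 0 else 1

/-- The vectors `φ^{i*}`, `ψ^{i*}` and `ψ`, whose twisted zero modes do not kill the vacuum. -/
def J.low : J m n e → Bool
  | .ph _ => false
  | .ps _ => false
  | _ => true

/-- `(a, k)` labels a creation operator, that is, one that does not kill the vacuum. -/
def Cr (tw : Bool) (p : J m n e × ℤ) : Prop := p.2 < 0 ∨ (tw = true ∧ p.2 = 0 ∧ p.1.low = true)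

instance (tw : Bool) : DecidablePred (Cr (m := m) (n := n) (e := e) tw) := fun p => by
  unfold Cr; infer_instance

/-- The label of the mode that has a non-zero supercommutator with the given one. -/
def dualMode (tw : Bool) (p : J m n e × ℤ) : J m n e × ℤ := (p.1.conj, -p.2 - shift tw)

theorem par_conj (a : J m n e) : a.conj.par = a.par := by cases a <;> rfl

/-- Labels of the bosonic (`u = 0`) or fermionic (`u = 1`) creation operators. -/
abbrev CrMode (m n e : ℕ) (tw : Bool) (u : ZMod 2) : Type :=
  {p : J m n e × ℤ // p.1.par = u ∧ Cr tw p}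

/-- The Fock space: polynomials in the bosonic creation operators, tensored with the exterior
algebra on the fermionic creation operators. -/
abbrev Fock (m n e : ℕ) (tw : Bool) : Type :=
  MvPolynomial (CrMode m n e tw 0) ℂ ⊗[ℂ] ExteriorAlgebra ℂ (CrMode m n e tw 1 →₀ ℂ)

/-- The vacuum vector. -/
def vac (m n e : ℕ) (tw : Bool) : Fock m n e tw := 1 ⊗ₜ[ℂ] 1

/-- A bosonic mode: multiplication by a variable, or a multiple of a partial derivative. -/
def bosonOp (tw : Bool) (p : J m n e × ℤ) (hp : p.1.par = 0) :
    Module.End ℂ (MvPolynomial (CrMode m n e tw 0) ℂ) :=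
  (if h : Cr tw p then LinearMap.mulLeft ℂ (MvPolynomial.X ⟨p, hp, h⟩) else 0) +
  (if h : Cr tw (dualMode tw p) then
    p.1.sgn • (MvPolynomial.pderiv (R := ℂ)
      (⟨dualMode tw p, (par_conj p.1).trans hp, h⟩ : CrMode m n e tw 0)).toLinearMap else 0)

/-- A fermionic mode: exterior multiplication by a creation operator, or contraction with one.
The twisted zero mode of `ψ` is the sum of both, normalized so that its square is `1/2`. -/
def fermionOp (tw : Bool) (p : J m n e × ℤ) (hp : p.1.par = 1) :
    Module.End ℂ (ExteriorAlgebra ℂ (CrMode m n e tw 1 →₀ ℂ)) :=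
  (if h : Cr tw p then
    LinearMap.mulLeft ℂ (ExteriorAlgebra.ι ℂ (Finsupp.single ⟨p, hp, h⟩ 1)) else 0) +
  (if h : Cr tw (dualMode tw p) then
    (if dualMode tw p = p then (1 / 2 : ℂ) else 1) • CliffordAlgebra.contractLeft
      (Finsupp.lapply (R := ℂ)
        (⟨dualMode tw p, (par_conj p.1).trans hp, h⟩ : CrMode m n e tw 1)) else 0)

/-- The operator `a_{k + shift/2}` on the Fock space. -/
def mode (tw : Bool) (a : J m n e) (k : ℤ) : Module.End ℂ (Fock m n e tw) :=
  if h : a.par = 0 then LinearMap.rTensor _ (bosonOp tw (a, k) h)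
  else LinearMap.lTensor _ (fermionOp tw (a, k) (by cases a <;> simp_all [J.par]))

/-- The monomial in the modes with the given list of labels, applied to the vacuum. -/
def word (tw : Bool) (l : List (J m n e × ℤ)) : Fock m n e tw :=
  (l.map fun p => mode tw p.1 p.2).prod (vac m n e tw)

/-- The even and the odd part of the superspace (the vacuum is even). -/
def parSub (m n e : ℕ) (tw : Bool) (s : ZMod 2) : Submodule ℂ (Fock m n e tw) :=
  Submodule.span ℂ {v | ∃ l : List (J m n e × ℤ), (l.map fun p => p.1.par).sum = s ∧ word tw l = v}

/-- The span of monomials of even (`s = 0`) or odd (`s = 1`) degree in the modes. -/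
def degSub (m n e : ℕ) (tw : Bool) (s : ZMod 2) : Submodule ℂ (Fock m n e tw) :=
  Submodule.span ℂ {v | ∃ l : List (J m n e × ℤ), (l.length : ZMod 2) = s ∧ word tw l = v}

/-- The Fock space is the superspace `Φ_V`, resp. `Φ_V^{tw}`: canonical (super)commutation
relations, vacuum conditions, and irreducibility under all modes. -/
def IsFreeFieldModule (m n e : ℕ) (tw : Bool) : Prop :=
  (∀ (a b : J m n e) (k l : ℤ),
    mode tw a k * mode tw b l - kz a.par b.par • (mode tw b l * mode tw a k) =
      (if k + l + shift tw = 0 then B a b else 0) • 1) ∧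
  vac m n e tw ≠ 0 ∧
  (∀ (a : J m n e) (k : ℤ), mode tw a k (vac m n e tw) = 0 ↔ ¬ Cr tw (a, k)) ∧
  IsCompl (parSub m n e tw 0) (parSub m n e tw 1) ∧
  ∀ S : Submodule ℂ (Fock m n e tw), IsGraded (parSub m n e tw) S →
    (∀ a k, ∀ v ∈ S, mode tw a k v ∈ S) → S = ⊥ ∨ S = ⊤

/-- The constant `s_a` of the twisted normally ordered product. -/
def sConst (tw : Bool) (a : J m n e) : ℂ :=
  if tw then (if a.low then 1 / 2 else -1 / 2) else 0

/-- The mode `:ab:_r` of the normally ordered product `:a(z)b(z): = ∑ :ab:_r z^{-r-1}`. Only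
finitely many terms are non-zero on each vector `v`. -/
def normOrd (tw : Bool) (a b : J m n e) (r : ℤ) (v : Fock m n e tw) : Fock m n e tw :=
  (∑ᶠ k : ℤ, if Cr tw (a, k) then mode tw a k (mode tw b (r - shift tw - k) v)
    else kz a.par b.par • mode tw b (r - shift tw - k) (mode tw a k v)) -
  (if r = 0 then sConst tw a * B a b else 0) • v

/-- `R` is the fermionic representation of `osp(2m+e|2n)^` on the Fock space. An element `X` acts by
the current `½ ∑_a :(X a)(z) a^∨(z):`, where `⟨a^∨|b⟩ = δ_{ab}`; equivalently, `:a(z)b(z):` is the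
current of the element `v ↦ ⟨b|v⟩ a + (-1)^{p(a)p(b)} ⟨a|v⟩ b` of `osp(V)`. -/
def IsFermionic {tw : Bool} (R : AffRep m n e (Fock m n e tw)) : Prop :=
  R.par = parSub m n e tw ∧ R.K = 1 ∧ R.d (vac m n e tw) = 0 ∧
  (∀ a k, R.d * mode tw a k - mode tw a k * R.d = ((k : ℂ) + (shift tw : ℂ) / 2) • mode tw a k) ∧
  ∀ s r (X : osp m n e s) v, R.loop s r X v =
    (1 / 2 : ℂ) • ∑ a, ∑ c, (X.1 c a * B a.conj a) • normOrd tw c a.conj r v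

end OspFermions

end

open Complex
open scoped TensorProduct MatrixGroups

noncomputable section

namespace OspFermions

variable {m n e : ℕ}

/-! ### Theta functions and the Dedekind eta function -/

/-- The principal branch of `(-iτ)^{1/2}`. -/
def csq (τ : ℂ) : ℂ := (-I * τ) ^ (1 / 2 : ℂ)

theorem csq_ne_zero {τ : ℂ} (h : 0 < τ.im) : csq τ ≠ 0 := by
  have : τ ≠ 0 := by rintro rfl; simp at h
  simp [csq, cpow_eq_zero_iff, this]

theorem csq_mul_ofReal {τ : ℂ} {r : ℝ} (hr : 0 < r) :
    csq (r * τ) = (Real.sqrt r : ℂ) * csq τ := by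
  rcases eq_or_ne τ 0 with rfl | h0
  · simp [csq]
  have h1 : -I * τ ≠ 0 := by simp [h0]
  have h2 : (r : ℂ) ≠ 0 := by exact_mod_cast hr.ne'
  unfold csq
  rw [show -I * (r * τ) = r * (-I * τ) by ring, Real.sqrt_eq_rpow, ofReal_cpow hr.le,
    cpow_def_of_ne_zero (mul_ne_zero h2 h1), cpow_def_of_ne_zero h1, cpow_def_of_ne_zero h2,
    Complex.log_ofReal_mul hr h1, ← Complex.exp_add, Complex.ofReal_log hr.le]
  congr 1
  push_cast
  ring

theorem theta_eq_jacobiTheta₂ (a b : ℕ) (τ z : ℂ) :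
    theta a b τ z = exp (Real.pi * I * ((a : ℂ) / 2) ^ 2 * τ +
      2 * Real.pi * I * ((a : ℂ) / 2) * (z + (b : ℂ) / 2)) *
      jacobiTheta₂ (z + (b : ℂ) / 2 + (a : ℂ) / 2 * τ) τ := by
  unfold theta jacobiTheta₂ jacobiTheta₂_term
  rw [← tsum_mul_left]
  refine tsum_congr fun k => ?_
  rw [← Complex.exp_add]
  congr 1
  ring

theorem exp_eq_of_int {x y : ℂ} (k : ℤ) (h : x = y + k * (2 * Real.pi * I)) : exp x = exp y := by
  rw [Complex.exp_eq_exp_iff_exists_int]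
  exact ⟨k, h⟩

theorem jacobiTheta₂_S (z : ℂ) {τ : ℂ} (hτ : 0 < τ.im) :
    jacobiTheta₂ (z / τ) (-1 / τ) = csq τ * exp (Real.pi * I * z ^ 2 / τ) * jacobiTheta₂ z τ := by
  rw [jacobiTheta₂_functional_equation z τ]
  have h1 : exp (-Real.pi * I * z ^ 2 / τ) * exp (Real.pi * I * z ^ 2 / τ) = 1 := by
    rw [← Complex.exp_add]
    simp [neg_mul, neg_div]
  have h2 : csq τ * (1 / csq τ) = 1 := mul_one_div_cancel (csq_ne_zero hτ)
  change _ = csq τ * _ * (1 / csq τ * _ * _)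
  linear_combination -jacobiTheta₂ (z / τ) (-1 / τ) *
    (csq τ * (1 / csq τ) * h1 + h2)

theorem theta_S {a b : ℕ} (ha : a ≤ 1) {τ : ℂ} (hτ : 0 < τ.im) (z : ℂ) :
    theta a b (-1 / τ) (z / τ) =
      exp (-(Real.pi * I * a * b / 2)) * csq τ * exp (Real.pi * I * z ^ 2 / τ) * theta b a τ z := by
  have h0 : τ ≠ 0 := by rintro rfl; simp at hτ
  rw [theta_eq_jacobiTheta₂, theta_eq_jacobiTheta₂,
    show z / τ + (b : ℂ) / 2 + (a : ℂ) / 2 * (-1 / τ) = (z + b / 2 * τ - a / 2) / τ by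
      field_simp; ring, jacobiTheta₂_S _ hτ]
  have hp : jacobiTheta₂ (z + b / 2 * τ - a / 2) τ = jacobiTheta₂ (z + a / 2 + b / 2 * τ) τ := by
    interval_cases a
    · simp
    · rw [← jacobiTheta₂_add_left]
      congr 1
      push_cast
      ring
  rw [hp]
  have : exp (Real.pi * I * ((a : ℂ) / 2) ^ 2 * (-1 / τ) +
      2 * Real.pi * I * ((a : ℂ) / 2) * (z / τ + (b : ℂ) / 2)) *
      exp (Real.pi * I * (z + b / 2 * τ - a / 2) ^ 2 / τ) =
      exp (-(Real.pi * I * a * b / 2)) * exp (Real.pi * I * z ^ 2 / τ) *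
      exp (Real.pi * I * ((b : ℂ) / 2) ^ 2 * τ +
      2 * Real.pi * I * ((b : ℂ) / 2) * (z + (a : ℂ) / 2)) := by
    simp only [← Complex.exp_add]
    congr 1
    field_simp
    ring
  linear_combination csq τ * jacobiTheta₂ (z + a / 2 + b / 2 * τ) τ * this

theorem theta_zero_zero_T (τ z : ℂ) : theta 0 0 (τ + 1) z = theta 0 1 τ z := by
  unfold theta
  refine tsum_congr fun k => ?_
  obtain ⟨c, hc⟩ := Int.even_mul_succ_self k
  refine exp_eq_of_int (c - k) ?_
  have hc' : (k : ℂ) * (k + 1) = c + c := by exact_mod_cast hc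
  push_cast
  linear_combination (Real.pi * I) * hc'

theorem theta_zero_one_T (τ z : ℂ) : theta 0 1 (τ + 1) z = theta 0 0 τ z := by
  unfold theta
  refine tsum_congr fun k => ?_
  obtain ⟨c, hc⟩ := Int.even_mul_succ_self k
  refine exp_eq_of_int c ?_
  have hc' : (k : ℂ) * (k + 1) = c + c := by exact_mod_cast hc
  push_cast
  linear_combination (Real.pi * I) * hc'

theorem theta_one_T (b : ℕ) (τ z : ℂ) :
    theta 1 b (τ + 1) z = exp (Real.pi * I / 4) * theta 1 b τ z := by
  unfold theta
  rw [← tsum_mul_left]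
  refine tsum_congr fun k => ?_
  rw [← Complex.exp_add]
  obtain ⟨c, hc⟩ := Int.even_mul_succ_self k
  refine exp_eq_of_int c ?_
  have hc' : (k : ℂ) * (k + 1) = c + c := by exact_mod_cast hc
  push_cast
  linear_combination (Real.pi * I) * hc'

theorem eta_T (τ : ℂ) :
    ModularForm.eta (τ + 1) = exp (Real.pi * I / 12) * ModularForm.eta τ := by
  unfold ModularForm.eta
  have h1 : Function.Periodic.qParam 24 (τ + 1) =
      exp (Real.pi * I / 12) * Function.Periodic.qParam 24 τ := by
    unfold Function.Periodic.qParam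
    rw [← Complex.exp_add]
    congr 1
    push_cast
    ring
  have h2 : ∀ k, ModularForm.eta_q k (τ + 1) = ModularForm.eta_q k τ := by
    intro k
    unfold ModularForm.eta_q Function.Periodic.qParam
    congr 1
    refine exp_eq_of_int 1 ?_
    push_cast
    ring
  rw [h1, mul_assoc]
  simp only [h2]

theorem eta_S {τ : ℂ} (hτ : 0 < τ.im) :
    ModularForm.eta (-1 / τ) = csq τ * ModularForm.eta τ := by
  have h := ModularForm.eta_comp_eq_csqrt_I_inv hτ
  simp only [Function.comp_apply, Pi.smul_apply, Pi.mul_apply, smul_eq_mul] at h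
  rw [h, ← mul_assoc]
  congr 1
  have h0 : τ ≠ 0 := by rintro rfl; simp at hτ
  have harg : 0 < arg τ ∧ arg τ < Real.pi := by
    refine ⟨?_, ?_⟩
    · rcases lt_or_eq_of_le (Complex.arg_nonneg_iff.2 hτ.le) with h | h
      · exact h
      · exact absurd (Complex.arg_eq_zero_iff.1 h.symm).2 hτ.ne'
    · rcases lt_or_eq_of_le (Complex.arg_le_pi τ) with h | h
      · exact h
      · exact absurd (Complex.arg_eq_pi_iff.1 h).2 hτ.ne'
  have hl : log (-I * τ) = log (-I) + log τ := by
    refine (Complex.log_mul_eq_add_log_iff (by simp) h0).2 ?_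
    rw [Complex.arg_neg_I]
    constructor <;> linarith [harg.1, harg.2, Real.pi_pos]
  unfold csq
  rw [Complex.cpow_def_of_ne_zero (by simp [h0]), hl, Complex.log_neg_I,
    sqrt_eq_exp h0, sqrt_eq_exp I_ne_zero, Complex.log_I, ← Complex.exp_neg,
    ← Complex.exp_add]
  congr 1
  ring

/-- The Euler product `∏ (1 - x^k)`, `k ≥ 1`. -/
def euler (x : ℂ) : ℂ := ∏' k : ℕ, (1 - x ^ (k + 1))

theorem euler_ne_zero {x : ℂ} (hx : ‖x‖ < 1) : euler x ≠ 0 := by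
  unfold euler
  simp_rw [sub_eq_add_neg]
  refine tprod_one_add_ne_zero_of_summable (fun i => ?_) ?_
  · rw [← sub_eq_add_neg, sub_ne_zero]
    intro h
    have := congrArg norm h
    rw [norm_pow, norm_one] at this
    exact absurd this.symm (pow_lt_one₀ (norm_nonneg _) hx (by omega)).ne
  · simpa using (summable_nat_add_iff 1).mpr (summable_geometric_of_lt_one (norm_nonneg _) hx)

theorem multipliable_one_sub_mul_pow {x : ℂ} (hx : ‖x‖ < 1) (c : ℂ) :
    Multipliable fun k : ℕ => 1 - c * x ^ k := by
  simp_rw [sub_eq_add_neg]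
  apply multipliable_one_add_of_summable
  simpa using (summable_geometric_of_lt_one (norm_nonneg _) hx).mul_left ‖c‖

theorem multipliable_one_add_mul_pow {x : ℂ} (hx : ‖x‖ < 1) (c : ℂ) :
    Multipliable fun k : ℕ => 1 + c * x ^ k := by
  simpa using multipliable_one_sub_mul_pow hx (-c)

theorem eta_eq_euler (τ : ℂ) :
    ModularForm.eta τ = exp (Real.pi * I * τ / 12) * euler (exp (2 * Real.pi * I * τ)) := by
  unfold ModularForm.eta euler ModularForm.eta_q Function.Periodic.qParam
  congr 1
  · congr 1
    push_cast
    ring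
  · simp

/-- `∏ (1 + c x^k)`, `k ≥ 0`. -/
def poch (c x : ℂ) : ℂ := ∏' k : ℕ, (1 + c * x ^ k)

theorem norm_sq_lt {x : ℂ} (hx : ‖x‖ < 1) : ‖x ^ 2‖ < 1 := by
  rw [norm_pow]; exact pow_lt_one₀ (norm_nonneg _) hx (by norm_num)

theorem euler_eq_poch (x : ℂ) : euler x = poch (-x) x := by
  unfold euler poch
  congr 1; ext k; ring

theorem poch_even_mul_odd {x : ℂ} (hx : ‖x‖ < 1) (c : ℂ) :
    poch c x = poch c (x ^ 2) * poch (c * x) (x ^ 2) := by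
  unfold poch
  rw [← tprod_even_mul_odd]
  · congr 1 <;> · congr 1; ext k; ring
  · exact (multipliable_one_add_mul_pow (norm_sq_lt hx) c).congr fun k => by ring
  · exact (multipliable_one_add_mul_pow (norm_sq_lt hx) (c * x)).congr fun k => by ring

theorem poch_mul_neg {x : ℂ} (hx : ‖x‖ < 1) (c : ℂ) :
    poch c x * poch (-c) x = poch (-c ^ 2) (x ^ 2) := by
  unfold poch
  rw [← (multipliable_one_add_mul_pow hx c).tprod_mul (multipliable_one_add_mul_pow hx (-c))]
  congr 1; ext k; ring

/-- `∏ (1 + x^{2k+1}) ∏ (1 - x^k) ∏ (1 - x^{4k}) = ∏ (1 - x^{2k})²`. -/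
theorem poch_mul_euler {x : ℂ} (hx : ‖x‖ < 1) :
    poch x (x ^ 2) * (euler x * euler (x ^ 4)) = euler (x ^ 2) ^ 2 := by
  have h2 := norm_sq_lt hx
  have h1 : euler x = poch (-x) (x ^ 2) * euler (x ^ 2) := by
    rw [euler_eq_poch, poch_even_mul_odd hx, euler_eq_poch (x ^ 2)]
    congr 2; ring
  have h3 := poch_mul_neg h2 x
  have h4 : euler (x ^ 2) = poch (-x ^ 2) ((x ^ 2) ^ 2) * euler (x ^ 4) := by
    rw [euler_eq_poch, poch_even_mul_odd h2, euler_eq_poch (x ^ 4)]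
    congr 2 <;> ring
  linear_combination poch x (x ^ 2) * euler (x ^ 4) * h1 + euler (x ^ 2) * euler (x ^ 4) * h3
    - euler (x ^ 2) * h4

theorem euler_eq_poch_neg_mul {x : ℂ} (hx : ‖x‖ < 1) :
    euler x = poch (-x) (x ^ 2) * euler (x ^ 2) := by
  rw [euler_eq_poch, poch_even_mul_odd hx, euler_eq_poch (x ^ 2)]
  congr 2; ring

/-- `∏ (1 + x^k) ∏ (1 - x^k) = ∏ (1 - x^{2k})`. -/
theorem poch_self_mul_euler {x : ℂ} (hx : ‖x‖ < 1) : poch x x * euler x = euler (x ^ 2) := by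
  rw [euler_eq_poch, poch_mul_neg hx, euler_eq_poch]

theorem norm_exp_two_pi {τ : ℂ} (hτ : 0 < τ.im) : ‖exp (2 * Real.pi * I * τ)‖ < 1 := by
  rw [Complex.norm_exp]
  simp only [mul_re, re_ofNat, ofReal_re, im_ofNat, ofReal_im, I_re, I_im, mul_im]
  rw [Real.exp_lt_one_iff]
  have := mul_pos Real.pi_pos hτ
  nlinarith

theorem norm_exp_pi {τ : ℂ} (hτ : 0 < τ.im) : ‖exp (Real.pi * I * τ)‖ < 1 := by
  rw [Complex.norm_exp]
  simp only [mul_re, ofReal_re, ofReal_im, I_re, I_im, mul_im]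
  rw [Real.exp_lt_one_iff]
  have := mul_pos Real.pi_pos hτ
  nlinarith

theorem eta_half_T {τ : ℂ} (hτ : 0 < τ.im) :
    ModularForm.eta ((τ + 1) / 2) * (ModularForm.eta (τ / 2) * ModularForm.eta (2 * τ)) =
      exp (Real.pi * I / 24) * ModularForm.eta τ ^ 3 := by
  set p := exp (Real.pi * I * τ) with hp
  have hp1 : ‖p‖ < 1 := norm_exp_pi hτ
  have e1 : exp (2 * Real.pi * I * ((τ + 1) / 2)) = -p := by
    rw [show 2 * Real.pi * I * ((τ + 1) / 2) = Real.pi * I * τ + Real.pi * I by ring,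
      Complex.exp_add, Complex.exp_pi_mul_I]
    ring
  have e2 : exp (2 * Real.pi * I * (τ / 2)) = p := by
    rw [hp]; congr 1; ring
  have e3 : exp (2 * Real.pi * I * τ) = p ^ 2 := by
    rw [hp, ← Complex.exp_nat_mul]; congr 1; push_cast; ring
  have e4 : exp (2 * Real.pi * I * (2 * τ)) = p ^ 4 := by
    rw [hp, ← Complex.exp_nat_mul]; congr 1; push_cast; ring
  simp only [eta_eq_euler, e1, e2, e3, e4]
  have hE : exp (Real.pi * I * ((τ + 1) / 2) / 12) * (exp (Real.pi * I * (τ / 2) / 12) *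
      exp (Real.pi * I * (2 * τ) / 12)) = exp (Real.pi * I / 24) * exp (Real.pi * I * τ / 12) ^ 3 := by
    rw [← Complex.exp_nat_mul]
    simp only [← Complex.exp_add]
    congr 1
    push_cast
    ring
  have hP : euler (-p) * (euler p * euler (p ^ 4)) = euler (p ^ 2) ^ 3 := by
    have h1 := euler_eq_poch_neg_mul (x := -p) (by simpa using hp1)
    have h2 := poch_mul_euler hp1
    simp only [neg_neg, even_two, Even.neg_pow] at h1
    rw [h1]
    linear_combination euler (p ^ 2) * h2
  linear_combination (euler (-p) * (euler p * euler (p ^ 4))) * hE +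
    (exp (Real.pi * I / 24) * exp (Real.pi * I * τ / 12) ^ 3) * hP

/-! ### Modular transformations -/

theorem slAct_S (p : Pt m n) : ((slAct ModularGroup.S p).1 : ℂ) = -1 / (p.1 : ℂ) ∧
    (slAct ModularGroup.S p).2 = (fun i => p.2.1 i / (p.1 : ℂ), fun j => p.2.2.1 j / (p.1 : ℂ),
      p.2.2.2 - (∑ i, p.2.1 i ^ 2 - ∑ j, p.2.2.1 j ^ 2) / (2 * (p.1 : ℂ))) := by
  constructor
  · simp only [slAct, UpperHalfPlane.modular_S_smul, UpperHalfPlane.coe_mk]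
    rw [inv_neg, neg_div, one_div]
  · simp [slAct, ModularGroup.S]

theorem slAct_T (p : Pt m n) : ((slAct ModularGroup.T p).1 : ℂ) = (p.1 : ℂ) + 1 ∧
    (slAct ModularGroup.T p).2 = p.2 := by
  constructor
  · simp only [slAct, UpperHalfPlane.modular_T_smul, UpperHalfPlane.coe_vadd]
    push_cast
    ring
  · simp [slAct, ModularGroup.T]

theorem prod_const_exp_mul {ι : Type*} [Fintype ι] (c r : ℂ) (x f : ι → ℂ) :
    ∏ i, (c * exp (Real.pi * I * x i ^ 2 / r) * f i) =
      c ^ Fintype.card ι * exp (Real.pi * I * (∑ i, x i ^ 2) / r) * ∏ i, f i := by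
  rw [Finset.prod_mul_distrib, Finset.prod_mul_distrib, ← Complex.exp_sum, Finset.prod_const,
    Finset.card_univ]
  congr 3
  rw [Finset.mul_sum, Finset.sum_div]

theorem thetaQuot_S {a b : ℕ} (ha : a ≤ 1) (p : Pt m n) :
    thetaQuot a b (slAct ModularGroup.S p) =
      exp (-(Real.pi * I * a * b / 2)) ^ ((m : ℤ) - n) * thetaQuot b a p := by
  obtain ⟨τ, x, y, t⟩ := p
  obtain ⟨h1, h2⟩ := slAct_S (τ, x, y, t)
  have hτ : 0 < (τ : ℂ).im := τ.2
  have h0 : (τ : ℂ) ≠ 0 := τ.ne_zero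
  have hc := csq_ne_zero hτ
  unfold thetaQuot
  rw [h1, h2]
  simp only [theta_S ha hτ, eta_S hτ]
  generalize hE : exp (-(Real.pi * I * a * b / 2)) = E
  have hE0 : E ≠ 0 := hE ▸ Complex.exp_ne_zero _
  have hη : ModularForm.eta (τ : ℂ) ≠ 0 := ModularForm.eta_ne_zero hτ
  rw [prod_const_exp_mul, prod_const_exp_mul, Fintype.card_fin, Fintype.card_fin]
  have hexp : exp (2 * Real.pi * I * (t - (∑ i, x i ^ 2 - ∑ j, y j ^ 2) / (2 * (τ : ℂ)))) *
      exp (Real.pi * I * (∑ i, x i ^ 2) / (τ : ℂ)) =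
      exp (2 * Real.pi * I * t) * exp (Real.pi * I * (∑ i, y i ^ 2) / (τ : ℂ)) := by
    rw [← Complex.exp_add, ← Complex.exp_add]
    congr 1
    field_simp
    ring
  generalize exp (2 * Real.pi * I * (t - (∑ i, x i ^ 2 - ∑ j, y j ^ 2) / (2 * (τ : ℂ)))) = e1 at *
  have hy0 := Complex.exp_ne_zero (Real.pi * I * (∑ i, y i ^ 2) / (τ : ℂ))
  generalize exp (Real.pi * I * (∑ i, y i ^ 2) / (τ : ℂ)) = e2 at *
  generalize exp (Real.pi * I * (∑ i, x i ^ 2) / (τ : ℂ)) = e3 at *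
  generalize exp (2 * Real.pi * I * t) = e4 at *
  generalize ∏ i, theta b a (τ : ℂ) (x i) = P
  generalize ∏ i, theta b a (τ : ℂ) (y i) = Q
  have key : (csq τ) ^ ((n : ℤ) - m) * ((E * csq τ) ^ m / (E * csq τ) ^ n) = E ^ ((m : ℤ) - n) := by
    rw [zpow_sub₀ hc, zpow_sub₀ hE0]
    simp only [zpow_natCast, mul_pow]
    field_simp
  calc _ = (csq τ) ^ ((n : ℤ) - m) * ((E * csq τ) ^ m / (E * csq τ) ^ n) * ((e1 * e3) / e2) *
        (ModularForm.eta (τ : ℂ)) ^ ((n : ℤ) - m) * (P / Q) := by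
        rw [mul_zpow, div_eq_mul_inv, div_eq_mul_inv, div_eq_mul_inv, div_eq_mul_inv, mul_inv,
          mul_inv]
        ring
    _ = _ := by
        rw [key, hexp, mul_div_assoc, div_self hy0]
        ring

theorem thetaQuot_zero_zero_T (p : Pt m n) :
    thetaQuot 0 0 (slAct ModularGroup.T p) =
      exp (Real.pi * I / 12) ^ ((n : ℤ) - m) * thetaQuot 0 1 p := by
  obtain ⟨h1, h2⟩ := slAct_T p
  unfold thetaQuot
  rw [h1, h2]
  simp only [theta_zero_zero_T, eta_T, mul_zpow]
  ring

theorem thetaQuot_zero_one_T (p : Pt m n) :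
    thetaQuot 0 1 (slAct ModularGroup.T p) =
      exp (Real.pi * I / 12) ^ ((n : ℤ) - m) * thetaQuot 0 0 p := by
  obtain ⟨h1, h2⟩ := slAct_T p
  unfold thetaQuot
  rw [h1, h2]
  simp only [theta_zero_one_T, eta_T, mul_zpow]
  ring

theorem thetaQuot_one_T (b : ℕ) (p : Pt m n) :
    thetaQuot 1 b (slAct ModularGroup.T p) =
      exp (-(Real.pi * I) / 6) ^ ((n : ℤ) - m) * thetaQuot 1 b p := by
  obtain ⟨h1, h2⟩ := slAct_T p
  unfold thetaQuot
  rw [h1, h2]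
  simp only [theta_one_T, eta_T, mul_zpow, Finset.prod_mul_distrib, Finset.prod_const,
    Finset.card_univ, Fintype.card_fin]
  have h3 : exp (Real.pi * I / 12) ^ ((n : ℤ) - m) * (exp (Real.pi * I / 4) ^ m /
      exp (Real.pi * I / 4) ^ n) = exp (-(Real.pi * I) / 6) ^ ((n : ℤ) - m) := by
    rw [← zpow_natCast, ← zpow_natCast, ← zpow_sub₀ (Complex.exp_ne_zero _),
      ← Complex.exp_int_mul, ← Complex.exp_int_mul, ← Complex.exp_int_mul, ← Complex.exp_add]
    congr 1
    push_cast
    ring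
  rw [← h3, div_eq_mul_inv, div_eq_mul_inv, div_eq_mul_inv, mul_inv]
  ring

theorem exp_zpow_mul (x y c : ℂ) (k : ℤ) (h : k * x + y = c) :
    exp x ^ k * exp y = exp c := by
  rw [← Complex.exp_int_mul, ← Complex.exp_add, h]

section OddPrefactors

variable {τ : ℂ}

theorem im_half_pos (hτ : 0 < τ.im) : 0 < (τ / 2).im := by
  rw [show τ / 2 = ((1 / 2 : ℝ) : ℂ) * τ by push_cast; ring, Complex.im_ofReal_mul]
  linarith

theorem im_two_mul_pos (hτ : 0 < τ.im) : 0 < (2 * τ).im := by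
  rw [show 2 * τ = ((2 : ℝ) : ℂ) * τ by push_cast; ring, Complex.im_ofReal_mul]
  linarith

theorem csq_two_mul (τ : ℂ) : csq (2 * τ) = (Real.sqrt 2 : ℂ) * csq τ := by
  simpa using csq_mul_ofReal (τ := τ) (r := 2) (by norm_num)

theorem sqrt_two_mul_self : (Real.sqrt 2 : ℂ) * (Real.sqrt 2 : ℂ) = 2 := by
  exact_mod_cast Real.mul_self_sqrt (by norm_num : (0 : ℝ) ≤ 2)

theorem sqrt_two_ne_zero : (Real.sqrt 2 : ℂ) ≠ 0 := fun h => by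
  simpa [h] using sqrt_two_mul_self

theorem csq_half (τ : ℂ) : csq (τ / 2) * (Real.sqrt 2 : ℂ) = csq τ := by
  rw [mul_comm, ← csq_two_mul]; congr 1; ring

theorem eta_half_S (hτ : 0 < τ.im) :
    ModularForm.eta (-1 / τ / 2) = (Real.sqrt 2 : ℂ) * csq τ * ModularForm.eta (2 * τ) := by
  rw [← csq_two_mul, ← eta_S (im_two_mul_pos hτ)]
  congr 1
  have h0 : τ ≠ 0 := by rintro rfl; simp at hτ
  field_simp

theorem eta_two_mul_S (hτ : 0 < τ.im) :
    ModularForm.eta (2 * (-1 / τ)) = csq (τ / 2) * ModularForm.eta (τ / 2) := by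
  rw [← eta_S (im_half_pos hτ)]
  congr 1
  have h0 : τ ≠ 0 := by rintro rfl; simp at hτ
  field_simp

end OddPrefactors

theorem oddPlus_S (p : Pt m n) : oddPlus (slAct ModularGroup.S p) = oddPlus p := by
  have hτ : 0 < (p.1 : ℂ).im := p.1.2
  have hc := csq_ne_zero hτ
  unfold oddPlus
  rw [thetaQuot_S (by norm_num), (slAct_S p).1, eta_half_S hτ, eta_two_mul_S hτ, eta_S hτ,
    ← csq_half (p.1 : ℂ)]
  rw [← csq_half (p.1 : ℂ)] at hc
  have h2 := sqrt_two_ne_zero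
  have h3 := sqrt_two_mul_self
  have h4 := ModularForm.eta_ne_zero (im_half_pos hτ)
  have h5 := ModularForm.eta_ne_zero (im_two_mul_pos hτ)
  have h6 : csq ((p.1 : ℂ) / 2) ≠ 0 := left_ne_zero_of_mul hc
  simp only [Nat.cast_zero, mul_zero, zero_div, neg_zero, Complex.exp_zero, one_zpow, one_mul]
  congr 1
  field_simp

theorem oddMinus_S (p : Pt m n) :
    oddMinus (slAct ModularGroup.S p) = (Real.sqrt 2 : ℂ) * oddTw p := by
  have hτ : 0 < (p.1 : ℂ).im := p.1.2
  have hc := csq_ne_zero hτ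
  unfold oddMinus oddTw
  rw [thetaQuot_S (by norm_num), (slAct_S p).1, eta_half_S hτ, eta_S hτ]
  simp only [Nat.cast_zero, mul_zero, zero_mul, zero_div, neg_zero, Complex.exp_zero, one_zpow,
    one_mul]
  have h4 := ModularForm.eta_ne_zero hτ
  field_simp

theorem oddTw_S (p : Pt m n) :
    oddTw (slAct ModularGroup.S p) = 1 / (Real.sqrt 2 : ℂ) * oddMinus p := by
  have hτ : 0 < (p.1 : ℂ).im := p.1.2
  have hc := csq_ne_zero hτ
  unfold oddMinus oddTw
  rw [thetaQuot_S (by norm_num), (slAct_S p).1, eta_two_mul_S hτ, eta_S hτ, ← csq_half (p.1 : ℂ)]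
  rw [← csq_half (p.1 : ℂ)] at hc
  simp only [Nat.cast_zero, mul_zero, zero_div, neg_zero, Complex.exp_zero, one_zpow,
    one_mul]
  have h4 := ModularForm.eta_ne_zero hτ
  have h2 := sqrt_two_ne_zero
  have h6 : csq ((p.1 : ℂ) / 2) ≠ 0 := left_ne_zero_of_mul hc
  field_simp

theorem eta_two_mul_T (τ : ℂ) :
    ModularForm.eta (2 * (τ + 1)) = exp (Real.pi * I / 6) * ModularForm.eta (2 * τ) := by
  rw [show 2 * (τ + 1) = 2 * τ + 1 + 1 by ring, eta_T, eta_T, ← mul_assoc, ← Complex.exp_add]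
  congr 2
  ring

theorem oddPlus_T (p : Pt m n) : oddPlus (slAct ModularGroup.T p) =
    exp (Real.pi * I / 12 * ((n : ℂ) - m - 1 / 2)) * oddMinus p := by
  have hτ : 0 < (p.1 : ℂ).im := p.1.2
  unfold oddPlus oddMinus
  rw [thetaQuot_zero_zero_T, (slAct_T p).1, eta_two_mul_T, eta_T,
    ← exp_zpow_mul (Real.pi * I / 12) (-(Real.pi * I / 24))
      (Real.pi * I / 12 * ((n : ℂ) - m - 1 / 2)) ((n : ℤ) - m) (by push_cast; ring)]
  have h1 := eta_half_T hτ
  have h3 := ModularForm.eta_ne_zero hτ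
  have h4 := ModularForm.eta_ne_zero (im_half_pos hτ)
  have h5 := ModularForm.eta_ne_zero (im_two_mul_pos hτ)
  have h6 : ModularForm.eta (((p.1 : ℂ) + 1) / 2) ≠ 0 := by
    intro h; rw [h, zero_mul] at h1
    exact mul_ne_zero (Complex.exp_ne_zero _) (pow_ne_zero 3 h3) h1.symm
  have e1 : exp (Real.pi * I / 12) ^ 2 = exp (Real.pi * I / 6) := by
    rw [← Complex.exp_nat_mul]; congr 1; push_cast; ring
  have e2 : exp (-(Real.pi * I / 24)) * exp (Real.pi * I / 24) = 1 := by
    rw [← Complex.exp_add]; simp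
  have key : (exp (Real.pi * I / 12) * ModularForm.eta (p.1 : ℂ)) ^ 2 /
      (ModularForm.eta (((p.1 : ℂ) + 1) / 2) *
        (exp (Real.pi * I / 6) * ModularForm.eta (2 * (p.1 : ℂ)))) =
      exp (-(Real.pi * I / 24)) * (ModularForm.eta ((p.1 : ℂ) / 2) / ModularForm.eta (p.1 : ℂ)) := by
    have := Complex.exp_ne_zero (Real.pi * I / 6)
    rw [mul_pow, e1]
    generalize ModularForm.eta (2 * (p.1 : ℂ)) = w at *
    field_simp
    linear_combination -exp (-(Real.pi * I / 24)) * h1 - ModularForm.eta (p.1 : ℂ) ^ 3 * e2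
  rw [key]
  ring

theorem oddMinus_T (p : Pt m n) : oddMinus (slAct ModularGroup.T p) =
    exp (Real.pi * I / 12 * ((n : ℂ) - m - 1 / 2)) * oddPlus p := by
  have hτ : 0 < (p.1 : ℂ).im := p.1.2
  unfold oddPlus oddMinus
  rw [thetaQuot_zero_one_T, (slAct_T p).1, eta_T,
    ← exp_zpow_mul (Real.pi * I / 12) (-(Real.pi * I / 24))
      (Real.pi * I / 12 * ((n : ℂ) - m - 1 / 2)) ((n : ℤ) - m) (by push_cast; ring)]
  have h1 := eta_half_T hτ
  have h3 := ModularForm.eta_ne_zero hτ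
  have h4 := ModularForm.eta_ne_zero (im_half_pos hτ)
  have h5 := ModularForm.eta_ne_zero (im_two_mul_pos hτ)
  have e2 : exp (-(Real.pi * I / 24)) * exp (Real.pi * I / 12) = exp (Real.pi * I / 24) := by
    rw [← Complex.exp_add]; congr 1; ring
  have key : ModularForm.eta (((p.1 : ℂ) + 1) / 2) /
      (exp (Real.pi * I / 12) * ModularForm.eta (p.1 : ℂ)) =
      exp (-(Real.pi * I / 24)) * (ModularForm.eta (p.1 : ℂ) ^ 2 /
        (ModularForm.eta ((p.1 : ℂ) / 2) * ModularForm.eta (2 * (p.1 : ℂ)))) := by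
    have := Complex.exp_ne_zero (Real.pi * I / 12)
    generalize ModularForm.eta (2 * (p.1 : ℂ)) = w at *
    field_simp
    linear_combination h1 - ModularForm.eta (p.1 : ℂ) ^ 3 * e2
  rw [key]
  ring

theorem oddTw_T (p : Pt m n) : oddTw (slAct ModularGroup.T p) =
    exp (Real.pi * I / 6 * ((m : ℂ) - n + 1 / 2)) * oddTw p := by
  have hτ : 0 < (p.1 : ℂ).im := p.1.2
  unfold oddTw
  rw [thetaQuot_one_T, (slAct_T p).1, eta_two_mul_T, eta_T,
    ← exp_zpow_mul (-(Real.pi * I) / 6) (Real.pi * I / 12)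
      (Real.pi * I / 6 * ((m : ℂ) - n + 1 / 2)) ((n : ℤ) - m) (by push_cast; ring)]
  have e1 : exp (Real.pi * I / 12) * exp (Real.pi * I / 12) = exp (Real.pi * I / 6) := by
    rw [← Complex.exp_add]; congr 1; ring
  have := Complex.exp_ne_zero (Real.pi * I / 12)
  rw [← e1]
  field_simp

/-! ### The action of `SL₂(ℤ)` -/

theorem slAct_one (p : Pt m n) : slAct 1 p = p := by
  simp [slAct]

theorem slAct_mul (g h : SL(2, ℤ)) (p : Pt m n) : slAct (g * h) p = slAct g (slAct h p) := by
  obtain ⟨τ, x, y, t⟩ := p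
  have hD : ∀ g : SL(2, ℤ), ∀ τ : UpperHalfPlane, (g 1 0 : ℂ) * τ + (g 1 1 : ℂ) ≠ 0 := by
    intro g τ
    have h := UpperHalfPlane.denom_ne_zero (g : GL (Fin 2) ℝ) τ
    simpa [UpperHalfPlane.denom] using h
  have hco : ((g 1 0 : ℂ) * (h • τ : UpperHalfPlane) + (g 1 1 : ℂ)) *
      ((h 1 0 : ℂ) * τ + (h 1 1 : ℂ)) =
      ((g * h) 1 0 : ℂ) * τ + ((g * h) 1 1 : ℂ) := by
    have h1 : ((h • τ : UpperHalfPlane) : ℂ) * ((h 1 0 : ℂ) * τ + (h 1 1 : ℂ)) =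
        (h 0 0 : ℂ) * τ + (h 0 1 : ℂ) := by
      have h2 := UpperHalfPlane.coe_specialLinearGroup_apply h τ
      simp only [algebraMap_int_eq, eq_intCast, ofReal_intCast] at h2
      rw [h2, div_mul_cancel₀ _ (hD h τ)]
    simp only [Matrix.SpecialLinearGroup.coe_mul, Matrix.mul_apply, Fin.sum_univ_two]
    push_cast
    linear_combination (g 1 0 : ℂ) * h1
  have d1 := hD g (h • τ)
  have d2 := hD h τ
  have hdet : (h 0 0 : ℂ) * (h 1 1 : ℂ) - (h 0 1 : ℂ) * (h 1 0 : ℂ) = 1 := by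
    have := h.det_coe
    rw [Matrix.det_fin_two] at this
    exact_mod_cast this
  have hgh : ((g * h) 1 0 : ℂ) = g 1 0 * h 0 0 + g 1 1 * h 1 0 := by
    simp [Matrix.mul_apply, Fin.sum_univ_two]
  simp only [slAct, ← hco]
  refine Prod.ext (mul_smul g h τ) (Prod.ext ?_ (Prod.ext ?_ ?_))
  · ext i; simp only; field_simp
  · ext i; simp only; field_simp
  · simp only [div_pow, ← Finset.sum_div, ← sub_div]
    have key : ((g * h) 1 0 : ℂ) * ((h 1 0 : ℂ) * τ + (h 1 1 : ℂ)) =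
        (h 1 0 : ℂ) * (((g 1 0 : ℂ) * (h • τ : UpperHalfPlane) + (g 1 1 : ℂ)) *
        ((h 1 0 : ℂ) * τ + (h 1 1 : ℂ))) + (g 1 0 : ℂ) := by
      rw [hco, hgh]
      have : ((g * h) 1 1 : ℂ) = g 1 0 * h 0 1 + g 1 1 * h 1 1 := by
        simp [Matrix.mul_apply, Fin.sum_univ_two]
      rw [this]
      linear_combination (g 1 0 : ℂ) * hdet
    generalize (g 1 0 : ℂ) * (h • τ : UpperHalfPlane) + (g 1 1 : ℂ) = D at *
    generalize (h 1 0 : ℂ) * τ + (h 1 1 : ℂ) = E at *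
    field_simp
    linear_combination -(∑ i, x i ^ 2 - ∑ j, y j ^ 2) * key

/-- A span is invariant if the generators `S` and `T` of `SL₂(ℤ)` preserve it. -/
theorem spanInvariant_of_S_of_T {ι : Type} [Finite ι] (f : ι → Pt m n → ℂ)
    (hS : ∀ i, (fun p => f i (slAct ModularGroup.S p)) ∈ Submodule.span ℂ (Set.range f))
    (hT : ∀ i, (fun p => f i (slAct ModularGroup.T p)) ∈ Submodule.span ℂ (Set.range f)) :
    SpanInvariant f := by
  let L : SL(2, ℤ) → (Pt m n → ℂ) →ₗ[ℂ] (Pt m n → ℂ) := fun g => LinearMap.funLeft ℂ ℂ (slAct g)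
  have hL : ∀ g h F, L (g * h) F = L h (L g F) := by
    intro g h F; ext p; simp [L, LinearMap.funLeft_apply, slAct_mul]
  have hL1 : ∀ F, L 1 F = F := by
    intro F; ext p; simp [L, LinearMap.funLeft_apply, slAct_one]
  set V := Submodule.span ℂ (Set.range f) with hV
  have : FiniteDimensional ℂ V := FiniteDimensional.span_of_finite ℂ (Set.finite_range f)
  intro g
  suffices hg : V.map (L g) ≤ V from fun F hF => hg ⟨F, hF, rfl⟩
  have hmem : g ∈ Subgroup.closure {ModularGroup.S, ModularGroup.T} := by
    rw [SpecialLinearGroup.SL2Z_generators]; exact Subgroup.mem_top _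
  induction hmem using Subgroup.closure_induction with
  | mem x hx =>
    rw [hV, Submodule.map_span_le]
    rintro _ ⟨i, rfl⟩
    rcases hx with rfl | rfl
    · exact hS i
    · exact hT i
  | one =>
    rintro _ ⟨F, hF, rfl⟩
    rw [hL1]; exact hF
  | mul x y _ _ hx hy =>
    rintro _ ⟨F, hF, rfl⟩
    rw [hL]; exact hy ⟨_, hx ⟨F, hF, rfl⟩, rfl⟩
  | inv x _ hx =>
    have hinj : Function.Injective (L x) := by
      intro F G h
      have := congrArg (L x⁻¹) h
      rwa [← hL, ← hL, mul_inv_cancel, hL1, hL1] at this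
    have heq : V.map (L x) = V := Submodule.eq_of_le_of_finrank_eq hx
      (LinearEquiv.finrank_eq (Submodule.equivMapOfInjective _ hinj V)).symm
    rintro _ ⟨F, hF, rfl⟩
    rw [← heq] at hF
    obtain ⟨G, hG, rfl⟩ := hF
    rwa [← hL, mul_inv_cancel, hL1]

/-! ### The Jacobi triple product -/

open Filter Topology in
/-- `∏ (1 - q^{j+1})`, `j < l`. -/
def finEuler (q : ℂ) (l : ℕ) : ℂ := ∏ j ∈ Finset.range l, (1 - q ^ (j + 1))

/-- The inverse of `finEuler q l`, extended by zero to negative `l`. -/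
def invEuler (q : ℂ) (l : ℤ) : ℂ := if 0 ≤ l then (finEuler q l.toNat)⁻¹ else 0

theorem one_sub_pow_ne_zero {q : ℂ} (hq : ‖q‖ < 1) (j : ℕ) : 1 - q ^ (j + 1) ≠ 0 := by
  rw [sub_ne_zero]
  intro h
  have := congrArg norm h
  rw [norm_pow, norm_one] at this
  exact absurd this.symm (pow_lt_one₀ (norm_nonneg _) hq (by omega)).ne

theorem finEuler_ne_zero {q : ℂ} (hq : ‖q‖ < 1) (l : ℕ) : finEuler q l ≠ 0 :=
  Finset.prod_ne_zero_iff.2 fun j _ => one_sub_pow_ne_zero hq j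

theorem invEuler_sub_one {q : ℂ} (hq : ‖q‖ < 1) (l : ℤ) :
    invEuler q (l - 1) = (1 - q ^ l) * invEuler q l := by
  rcases lt_trichotomy l 0 with h | rfl | h
  · simp [invEuler, not_le.2 h, show ¬ 1 ≤ l by omega]
  · simp [invEuler]
  · obtain ⟨k, rfl⟩ : ∃ k : ℕ, l = k + 1 := ⟨(l - 1).toNat, by omega⟩
    have h1 : ((k : ℤ) + 1).toNat = k + 1 := by omega
    have h2 := one_sub_pow_ne_zero hq k
    have h3 := finEuler_ne_zero hq k
    simp only [invEuler, add_sub_cancel_right, Int.natCast_nonneg, if_true, Int.toNat_natCast,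
      show (0 : ℤ) ≤ k + 1 by omega, h1]
    rw [finEuler, finEuler, Finset.prod_range_succ, ← finEuler,
      show q ^ ((k : ℤ) + 1) = q ^ (k + 1) by norm_cast]
    field_simp

/-- The `q`-binomial coefficient of `2N` over `N + k`. -/
def qbinom (q : ℂ) (N : ℕ) (k : ℤ) : ℂ :=
  finEuler q (2 * N) * (invEuler q (N + k) * invEuler q (N - k))

theorem qbinom_succ {q : ℂ} (hq : ‖q‖ < 1) (h0 : q ≠ 0) (N : ℕ) (k : ℤ) :
    qbinom q (N + 1) k = (1 + q ^ (2 * N + 1)) * qbinom q N k +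
      q ^ ((N : ℤ) + 1 - k) * qbinom q N (k - 1) + q ^ ((N : ℤ) + 1 + k) * qbinom q N (k + 1) := by
  have a1 := invEuler_sub_one hq (N + k + 1)
  have a2 := invEuler_sub_one hq (N + k)
  have b1 := invEuler_sub_one hq (N - k + 1)
  have b2 := invEuler_sub_one hq (N - k)
  have hE : finEuler q (2 * (N + 1)) =
      finEuler q (2 * N) * (1 - q ^ (2 * N + 1)) * (1 - q ^ (2 * N + 2)) := by
    rw [show 2 * (N + 1) = 2 * N + 1 + 1 by ring, finEuler, Finset.prod_range_succ,
      Finset.prod_range_succ, ← finEuler]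
  have hXY : q ^ ((N : ℤ) + k) * q ^ ((N : ℤ) - k) = q ^ (2 * N) := by
    rw [← zpow_add₀ h0, ← zpow_natCast]; congr 1; push_cast; ring
  rw [add_sub_cancel_right, zpow_add_one₀ h0] at a1 b1
  unfold qbinom
  rw [show (((N + 1 : ℕ) : ℤ) + k) = N + k + 1 by push_cast; ring,
    show (((N + 1 : ℕ) : ℤ) - k) = N - k + 1 by push_cast; ring,
    show (N : ℤ) + (k - 1) = N + k - 1 by ring, show (N : ℤ) - (k - 1) = N - k + 1 by ring,
    show (N : ℤ) + (k + 1) = N + k + 1 by ring, show (N : ℤ) - (k + 1) = N - k - 1 by ring,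
    show (N : ℤ) + 1 - k = N - k + 1 by ring, show (N : ℤ) + 1 + k = N + k + 1 by ring,
    a2, b2, a1, b1, hE, zpow_add_one₀ h0, zpow_add_one₀ h0, pow_add, pow_add, ← hXY]
  ring

theorem sq_zpow_ne {p : ℂ} (h0 : p ≠ 0) (k : ℤ) (c : ℤ) (N : ℕ) :
    (p ^ 2) ^ ((N : ℤ) + 1 + c) * p ^ (k ^ 2) = p ^ (2 * N + 1) * p ^ (k ^ 2 + 2 * c + 1) := by
  rw [← zpow_natCast p 2, ← zpow_mul, ← zpow_natCast p (2 * N + 1), ← zpow_add₀ h0, ← zpow_add₀ h0]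
  congr 1
  push_cast
  ring

theorem hasSum_qbinom {p w : ℂ} (hp : ‖p‖ < 1) (h0 : p ≠ 0) (hw : w ≠ 0) (N : ℕ) :
    HasSum (fun k : ℤ => qbinom (p ^ 2) N k * p ^ (k ^ 2) * w ^ k)
      (∏ j ∈ Finset.range N, ((1 + p * w * (p ^ 2) ^ j) * (1 + p * w⁻¹ * (p ^ 2) ^ j))) := by
  have hq := norm_sq_lt hp
  have hq0 : p ^ 2 ≠ 0 := pow_ne_zero 2 h0
  induction N with
  | zero =>
    have h : ∀ k : ℤ, k ≠ 0 → qbinom (p ^ 2) 0 k * p ^ (k ^ 2) * w ^ k = 0 := by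
      intro k hk
      rcases lt_or_gt_of_ne hk with h | h
      · simp [qbinom, invEuler, not_le.2 h]
      · simp [qbinom, invEuler, not_le.2 h]
    simpa [qbinom, invEuler, finEuler] using hasSum_single (0 : ℤ) h
  | succ N ih =>
    have h1 := ih.mul_left (1 + p ^ (4 * N + 2))
    have h2 := ((Equiv.addRight (-1 : ℤ)).hasSum_iff.2 ih).mul_left (p ^ (2 * N + 1) * w)
    have h3 := ((Equiv.addRight (1 : ℤ)).hasSum_iff.2 ih).mul_left (p ^ (2 * N + 1) * w⁻¹)
    convert! (h1.add h2).add h3 using 1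
    · funext k
      have e1 := sq_zpow_ne h0 k (-k) N
      have e2 := sq_zpow_ne h0 k k N
      have e3 : w * w ^ (k + -1) = w ^ k := by
        rw [← zpow_one_add₀ hw]; congr 1; ring
      have e4 : w⁻¹ * w ^ (k + 1) = w ^ k := by
        rw [zpow_add_one₀ hw]; field_simp
      rw [qbinom_succ hq hq0]
      simp only [Function.comp_apply, Equiv.coe_addRight]
      rw [show (k + -1) ^ 2 = k ^ 2 + 2 * -k + 1 by ring, show (k + 1) ^ 2 = k ^ 2 + 2 * k + 1 by ring,
        ← sub_eq_add_neg k 1] at *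
      rw [← sub_eq_add_neg ((N : ℤ) + 1) k] at e1
      linear_combination qbinom (p ^ 2) N (k - 1) * w ^ k * e1 +
        qbinom (p ^ 2) N (k + 1) * w ^ k * e2
        - p ^ (2 * N + 1) * p ^ (k ^ 2 + 2 * -k + 1) * qbinom (p ^ 2) N (k - 1) * e3
        - p ^ (2 * N + 1) * p ^ (k ^ 2 + 2 * k + 1) * qbinom (p ^ 2) N (k + 1) * e4
    · rw [Finset.prod_range_succ]
      have e5 : w * w⁻¹ = 1 := mul_inv_cancel₀ hw
      set P := ∏ j ∈ Finset.range N, ((1 + p * w * (p ^ 2) ^ j) * (1 + p * w⁻¹ * (p ^ 2) ^ j))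
      have e6 : (p ^ 2) ^ N = p ^ (2 * N) := by rw [pow_mul]
      rw [e6]
      linear_combination P * (p * p ^ (2 * N)) ^ 2 * e5

open Filter Topology in
theorem tendsto_finEuler {q : ℂ} (hq : ‖q‖ < 1) :
    Tendsto (finEuler q) atTop (𝓝 (euler q)) :=
  (ModularForm.multipliable_one_sub_pow hq).hasProd.tendsto_prod_nat

open Filter Topology in
theorem jacobi_triple_product (z : ℂ) {τ : ℂ} (hτ : 0 < τ.im) :
    jacobiTheta₂ z τ = euler (exp (2 * Real.pi * I * τ)) *
      (poch (exp (Real.pi * I * τ) * exp (2 * Real.pi * I * z)) (exp (2 * Real.pi * I * τ)) *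
      poch (exp (Real.pi * I * τ) * (exp (2 * Real.pi * I * z))⁻¹) (exp (2 * Real.pi * I * τ))) := by
  set p := exp (Real.pi * I * τ) with hp
  set w := exp (2 * Real.pi * I * z) with hw
  have hp1 : ‖p‖ < 1 := norm_exp_pi hτ
  have h0 : p ≠ 0 := Complex.exp_ne_zero _
  have hw0 : w ≠ 0 := Complex.exp_ne_zero _
  have e3 : exp (2 * Real.pi * I * τ) = p ^ 2 := by
    rw [hp, ← Complex.exp_nat_mul]; congr 1; push_cast; ring
  have hq := norm_sq_lt hp1
  rw [e3]
  have hterm : ∀ k : ℤ, jacobiTheta₂_term k z τ = p ^ (k ^ 2) * w ^ k := by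
    intro k
    rw [jacobiTheta₂_term, hp, hw, ← Complex.exp_int_mul, ← Complex.exp_int_mul, ← Complex.exp_add]
    congr 1
    push_cast
    ring
  have hsum : Summable fun k : ℤ => p ^ (k ^ 2) * w ^ k := by
    simpa only [hterm] using (summable_jacobiTheta₂_term_iff z τ).2 hτ
  have hE0 := euler_ne_zero hq
  have hlimE := tendsto_finEuler hq
  have hlimI : Tendsto (fun l => (finEuler (p ^ 2) l)⁻¹) atTop (𝓝 (euler (p ^ 2))⁻¹) :=
    hlimE.inv₀ hE0
  obtain ⟨C, hC⟩ := (Metric.isBounded_range_of_tendsto _ hlimE).exists_norm_le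
  obtain ⟨D, hD⟩ := (Metric.isBounded_range_of_tendsto _ hlimI).exists_norm_le
  have hC' : ∀ l, ‖finEuler (p ^ 2) l‖ ≤ C := fun l => hC _ ⟨l, rfl⟩
  have hD0 : 0 ≤ D := (norm_nonneg _).trans (hD _ ⟨0, rfl⟩)
  have hD' : ∀ l, ‖invEuler (p ^ 2) l‖ ≤ D := by
    intro l
    unfold invEuler
    split_ifs
    · exact hD _ ⟨_, rfl⟩
    · simpa using hD0
  have hlim1 : ∀ k : ℤ, Tendsto (fun N : ℕ => invEuler (p ^ 2) (N + k)) atTop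
      (𝓝 (euler (p ^ 2))⁻¹) := by
    intro k
    have ht : Tendsto (fun N : ℕ => ((N : ℤ) + k).toNat) atTop atTop := by
      refine tendsto_atTop.2 fun b => ?_
      filter_upwards [eventually_ge_atTop (b + k.natAbs)] with N hN
      omega
    refine (hlimI.comp ht).congr' ?_
    filter_upwards [eventually_ge_atTop k.natAbs] with N hN
    simp [invEuler, show 0 ≤ (N : ℤ) + k by omega]
  have hlimq : ∀ k : ℤ, Tendsto (fun N : ℕ => qbinom (p ^ 2) N k) atTop (𝓝 (euler (p ^ 2))⁻¹) := by
    intro k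
    have h2 : Tendsto (fun N : ℕ => finEuler (p ^ 2) (2 * N)) atTop (𝓝 (euler (p ^ 2))) :=
      hlimE.comp (tendsto_id.const_mul_atTop' (by norm_num))
    have h3 := h2.mul ((hlim1 k).mul (hlim1 (-k)))
    rw [← mul_assoc, mul_inv_cancel₀ hE0, one_mul] at h3
    exact h3.congr fun N => by rw [qbinom, sub_eq_add_neg]
  have hT := tendsto_tsum_of_dominated_convergence
    (f := fun (N : ℕ) (k : ℤ) => qbinom (p ^ 2) N k * p ^ (k ^ 2) * w ^ k)
    (g := fun k => (euler (p ^ 2))⁻¹ * p ^ (k ^ 2) * w ^ k) (𝓕 := atTop)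
    (bound := fun k => C * (D * D) * ‖p ^ (k ^ 2) * w ^ k‖) (hsum.norm.mul_left _)
    (fun k => ((hlimq k).mul_const _).mul_const _) (Eventually.of_forall fun N k => by
      rw [mul_assoc, norm_mul]
      refine mul_le_mul_of_nonneg_right ?_ (norm_nonneg _)
      rw [qbinom, norm_mul, norm_mul]
      have := hC' (2 * N)
      exact mul_le_mul this (mul_le_mul (hD' _) (hD' _) (norm_nonneg _) hD0)
        (by positivity) ((norm_nonneg _).trans this))
  simp only [fun N => (hasSum_qbinom hp1 h0 hw0 N).tsum_eq, Finset.prod_mul_distrib] at hT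
  have hT2 := ((multipliable_one_add_mul_pow hq (p * w)).hasProd.tendsto_prod_nat).mul
    ((multipliable_one_add_mul_pow hq (p * w⁻¹)).hasProd.tendsto_prod_nat)
  have heq := tendsto_nhds_unique hT hT2
  unfold poch
  rw [← heq, ← tsum_mul_left]
  unfold jacobiTheta₂
  refine tsum_congr fun k => ?_
  rw [hterm]
  field_simp

theorem poch_ne_zero {c x : ℂ} (hx : ‖x‖ < 1) (hc : ‖c‖ ≤ 1) (h1 : c ≠ -1) : poch c x ≠ 0 := by
  unfold poch
  refine tprod_one_add_ne_zero_of_summable (fun k h => ?_) ?_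
  · rcases Nat.eq_zero_or_pos k with rfl | hk
    · exact h1 (by simpa using eq_neg_of_add_eq_zero_right h)
    · have h2 := congrArg norm (eq_neg_of_add_eq_zero_right h)
      rw [norm_neg, norm_one, norm_mul, norm_pow] at h2
      have h3 := pow_lt_one₀ (norm_nonneg x) hx hk.ne'
      have h4 := mul_le_mul_of_nonneg_right hc (pow_nonneg (norm_nonneg x) k)
      linarith
  · simpa using (summable_geometric_of_lt_one (norm_nonneg _) hx).mul_left ‖c‖

theorem exp_pi_mul_natCast (b : ℕ) : exp (Real.pi * I * b) = (-1) ^ b := by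
  rw [← Complex.exp_pi_mul_I, ← Complex.exp_nat_mul]; congr 1; ring

theorem neg_one_pow_inv (b : ℕ) : ((-1 : ℂ) ^ b)⁻¹ = (-1) ^ b := by
  rw [← inv_pow]; norm_num

theorem theta_zero_eq_poch (b : ℕ) (z : ℂ) {τ : ℂ} (hτ : 0 < τ.im) :
    theta 0 b τ z = euler (exp (2 * Real.pi * I * τ)) *
      (poch ((-1) ^ b * (exp (Real.pi * I * τ) * exp (2 * Real.pi * I * z)))
        (exp (2 * Real.pi * I * τ)) *
      poch ((-1) ^ b * (exp (Real.pi * I * τ) * exp (-(2 * Real.pi * I * z))))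
        (exp (2 * Real.pi * I * τ))) := by
  rw [theta_eq_jacobiTheta₂, jacobi_triple_product _ hτ]
  have h1 : exp (2 * Real.pi * I * (z + b / 2 + (0 : ℕ) / 2 * τ)) =
      (-1) ^ b * exp (2 * Real.pi * I * z) := by
    rw [← exp_pi_mul_natCast, ← Complex.exp_add]; congr 1; push_cast; ring
  rw [h1, mul_inv, neg_one_pow_inv, Complex.exp_neg]
  simp only [Nat.cast_zero, zero_div, mul_zero, zero_mul, zero_add, Complex.exp_zero, one_mul, ne_eq,
    OfNat.ofNat_ne_zero, not_false_eq_true, zero_pow]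
  rw [mul_left_comm (exp (Real.pi * I * τ)) ((-1) ^ b),
    mul_left_comm (exp (Real.pi * I * τ)) ((-1) ^ b)]

theorem theta_one_eq_poch (b : ℕ) (z : ℂ) {τ : ℂ} (hτ : 0 < τ.im) :
    theta 1 b τ z = exp (Real.pi * I * τ / 4) * (-I) ^ b * euler (exp (2 * Real.pi * I * τ)) *
      (exp (-(Real.pi * I * z)) * (poch ((-1) ^ b * exp (2 * Real.pi * I * z))
        (exp (2 * Real.pi * I * τ)) *
      poch ((-1) ^ b * (exp (2 * Real.pi * I * τ) * exp (-(2 * Real.pi * I * z))))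
        (exp (2 * Real.pi * I * τ)))) := by
  have hs : theta 1 b τ z = exp (Real.pi * I * τ / 4 - Real.pi * I * (z + b / 2)) *
      jacobiTheta₂ (-(z + b / 2 + -1 / 2 * τ)) τ := by
    have hsh : theta 1 b τ z = ∑' k : ℤ, exp (Real.pi * I * ((k : ℂ) - 1 / 2) ^ 2 * τ +
        2 * Real.pi * I * ((k : ℂ) - 1 / 2) * (z + (b : ℂ) / 2)) := by
      unfold theta
      rw [← (Equiv.addRight (-1 : ℤ)).tsum_eq]
      refine tsum_congr fun k => ?_
      congr 1
      simp only [Equiv.coe_addRight]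
      push_cast
      ring
    rw [hsh, jacobiTheta₂_neg_left]
    unfold jacobiTheta₂ jacobiTheta₂_term
    rw [← tsum_mul_left]
    refine tsum_congr fun k => ?_
    rw [← Complex.exp_add]
    congr 1
    ring
  rw [hs, jacobiTheta₂_neg_left, jacobi_triple_product _ hτ]
  have h1 : exp (2 * Real.pi * I * (z + b / 2 + -1 / 2 * τ)) =
      (-1) ^ b * exp (2 * Real.pi * I * z) * (exp (Real.pi * I * τ))⁻¹ := by
    rw [← exp_pi_mul_natCast, ← Complex.exp_add, ← Complex.exp_neg, ← Complex.exp_add]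
    congr 1; ring
  have h2 : exp (2 * Real.pi * I * τ) = exp (Real.pi * I * τ) * exp (Real.pi * I * τ) := by
    rw [← Complex.exp_add]; congr 1; ring
  have h3 : exp (Real.pi * I * τ / 4 - Real.pi * I * (z + b / 2)) =
      exp (Real.pi * I * τ / 4) * (-I) ^ b * exp (-(Real.pi * I * z)) := by
    have : (-I) ^ b = exp (-(Real.pi * I * (b / 2))) := by
      rw [← Complex.exp_neg_pi_div_two_mul_I, ← Complex.exp_nat_mul]
      congr 1; ring
    rw [this, ← Complex.exp_add, ← Complex.exp_add]
    congr 1; ring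
  have h4 := Complex.exp_ne_zero (Real.pi * I * τ)
  have e1 : exp (Real.pi * I * τ) * ((-1) ^ b * exp (2 * Real.pi * I * z) *
      (exp (Real.pi * I * τ))⁻¹) = (-1) ^ b * exp (2 * Real.pi * I * z) := by
    field_simp
  have e2 : exp (Real.pi * I * τ) * ((-1) ^ b * exp (2 * Real.pi * I * z) *
      (exp (Real.pi * I * τ))⁻¹)⁻¹ = (-1) ^ b * (exp (2 * Real.pi * I * τ) *
        exp (-(2 * Real.pi * I * z))) := by
    rw [mul_inv, mul_inv, neg_one_pow_inv, inv_inv, h2, Complex.exp_neg]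
    ring
  rw [h1, e1, e2, h3]
  ring

theorem theta_I_ne_zero {a b : ℕ} (ha : a ≤ 1) (hb : b ≤ 1) : theta a b I (1 / 4) ≠ 0 := by
  have hτ : 0 < I.im := by simp
  have hq := norm_exp_two_pi hτ
  have hp := norm_exp_pi hτ
  have hw : exp (2 * Real.pi * I * (1 / 4)) = I := by
    rw [show 2 * Real.pi * I * (1 / 4) = Real.pi / 2 * I by ring, Complex.exp_pi_div_two_mul_I]
  have hI : ∀ c : ℂ, ‖c‖ < 1 → c ≠ -1 := by
    rintro c hc rfl; simp at hc
  have hs : ‖(-1 : ℂ) ^ b‖ = 1 := by simp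
  have hI1 : (-1 : ℂ) ^ b * I ≠ -1 := by
    intro h
    have := congrArg Complex.re h
    interval_cases b <;> simp at this
  interval_cases a
  · rw [theta_zero_eq_poch _ _ hτ, Complex.exp_neg, hw]
    have h1 : ‖(-1 : ℂ) ^ b * (exp (Real.pi * I * I) * I)‖ < 1 := by
      rw [norm_mul, norm_mul, hs]; simpa using hp
    have h2 : ‖(-1 : ℂ) ^ b * (exp (Real.pi * I * I) * I⁻¹)‖ < 1 := by
      rw [norm_mul, norm_mul, hs]; simpa using hp
    exact mul_ne_zero (euler_ne_zero hq) (mul_ne_zero (poch_ne_zero hq h1.le (hI _ h1))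
      (poch_ne_zero hq h2.le (hI _ h2)))
  · rw [theta_one_eq_poch _ _ hτ, Complex.exp_neg (2 * Real.pi * I * (1 / 4)), hw]
    have h2 : ‖(-1 : ℂ) ^ b * (exp (2 * Real.pi * I * I) * I⁻¹)‖ < 1 := by
      rw [norm_mul, norm_mul, hs]; simpa using hq
    refine mul_ne_zero (mul_ne_zero (mul_ne_zero (Complex.exp_ne_zero _) (by simp))
      (euler_ne_zero hq)) (mul_ne_zero (Complex.exp_ne_zero _)
      (mul_ne_zero (poch_ne_zero hq ?_ hI1) (poch_ne_zero hq h2.le (hI _ h2))))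
    rw [norm_mul, hs]; simp

/-! ### Meromorphy -/

theorem differentiableOn_theta_comp {E : Type*} [NormedAddCommGroup E] [NormedSpace ℂ E] (a b : ℕ)
    {s : Set E} {f g : E → ℂ} (hf : DifferentiableOn ℂ f s) (hg : DifferentiableOn ℂ g s)
    (h : ∀ x ∈ s, 0 < (f x).im) : DifferentiableOn ℂ (fun x => theta a b (f x) (g x)) s := by
  simp only [theta_eq_jacobiTheta₂]
  refine DifferentiableOn.mul (by fun_prop) ?_
  intro x hx
  have h1 : DifferentiableAt ℂ (fun p : ℂ × ℂ => jacobiTheta₂ p.1 p.2)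
      (g x + (b : ℂ) / 2 + (a : ℂ) / 2 * f x, f x) :=
    (hasFDerivAt_jacobiTheta₂ _ (h x hx)).differentiableAt
  have h2 : DifferentiableWithinAt ℂ (fun x => (g x + (b : ℂ) / 2 + (a : ℂ) / 2 * f x, f x)) s x := by
    have := hf x hx
    have := hg x hx
    fun_prop
  exact h1.comp_differentiableWithinAt x h2

theorem differentiableOn_eta_comp {E : Type*} [NormedAddCommGroup E] [NormedSpace ℂ E]
    {s : Set E} {f : E → ℂ} (hf : DifferentiableOn ℂ f s)
    (h : ∀ x ∈ s, 0 < (f x).im) : DifferentiableOn ℂ (fun x => ModularForm.eta (f x)) s :=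
  fun x hx => (ModularForm.differentiableAt_eta_of_mem_upperHalfPlaneSet
    (h x hx)).comp_differentiableWithinAt x (hf x hx)

theorem isMero_add_thetaQuot {A₁ A₂ : ℂ → ℂ} (h₁ : DifferentiableOn ℂ A₁ {τ | 0 < τ.im})
    (h₂ : DifferentiableOn ℂ A₂ {τ | 0 < τ.im}) {a₁ b₁ a₂ b₂ : ℕ} (ha₁ : a₁ ≤ 1) (hb₁ : b₁ ≤ 1)
    (ha₂ : a₂ ≤ 1) (hb₂ : b₂ ≤ 1) {F : Pt m n → ℂ}
    (hF : ∀ p, F p = A₁ p.1 * thetaQuot a₁ b₁ p + A₂ p.1 * thetaQuot a₂ b₂ p) : IsMero F := by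
  let den : ℕ → ℕ → ℂ × (Fin m → ℂ) × (Fin n → ℂ) × ℂ → ℂ :=
    fun a b z => ∏ j, theta a b z.1 (z.2.2.1 j)
  let num : ℕ → ℕ → ℂ × (Fin m → ℂ) × (Fin n → ℂ) × ℂ → ℂ :=
    fun a b z => exp (2 * Real.pi * I * z.2.2.2) * ModularForm.eta z.1 ^ ((n : ℤ) - m) *
      ∏ i, theta a b z.1 (z.2.1 i)
  have hprod : ∀ (k : ℕ) (f : Fin k → ℂ × (Fin m → ℂ) × (Fin n → ℂ) × ℂ → ℂ),
      (∀ j, DifferentiableOn ℂ (f j) {z | 0 < z.1.im}) →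
      DifferentiableOn ℂ (fun z => ∏ j, f j z) {z | 0 < z.1.im} := fun k f h =>
    fun z hz => (HasFDerivWithinAt.finsetProd fun j _ =>
      (h j z hz).hasFDerivWithinAt).differentiableWithinAt
  have hden : ∀ a b, DifferentiableOn ℂ (den a b) {z | 0 < z.1.im} := fun a b => by
    simp only [den]
    exact hprod _ _ fun j => differentiableOn_theta_comp a b
      (f := fun z : ℂ × (Fin m → ℂ) × (Fin n → ℂ) × ℂ => z.1) (g := fun z => z.2.2.1 j)
      (by fun_prop) (by fun_prop) fun x hx => hx
  have hnum : ∀ a b, DifferentiableOn ℂ (num a b) {z | 0 < z.1.im} := fun a b => by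
    refine DifferentiableOn.mul (DifferentiableOn.mul (by fun_prop) ?_) ?_
    · exact DifferentiableOn.zpow (differentiableOn_eta_comp (by fun_prop) fun x hx => hx)
        (Or.inl fun x hx => ModularForm.eta_ne_zero hx)
    · exact hprod _ _ fun j => differentiableOn_theta_comp a b
        (f := fun z : ℂ × (Fin m → ℂ) × (Fin n → ℂ) × ℂ => z.1) (g := fun z => z.2.1 j)
        (by fun_prop) (by fun_prop) fun x hx => hx
  have hA : ∀ A : ℂ → ℂ, DifferentiableOn ℂ A {τ | 0 < τ.im} → DifferentiableOn ℂ
      (fun z : ℂ × (Fin m → ℂ) × (Fin n → ℂ) × ℂ => A z.1) {z | 0 < z.1.im} := fun A h =>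
    h.comp (by fun_prop) fun z hz => hz
  refine ⟨fun z => A₁ z.1 * num a₁ b₁ z * den a₂ b₂ z + A₂ z.1 * num a₂ b₂ z * den a₁ b₁ z,
    fun z => den a₁ b₁ z * den a₂ b₂ z,
    (((hA _ h₁).mul (hnum _ _)).mul (hden _ _)).add (((hA _ h₂).mul (hnum _ _)).mul (hden _ _)),
    (hden _ _).mul (hden _ _), ⟨(I, 0, fun _ => 1 / 4, 0), by simp, ?_⟩, fun p hp => ?_⟩
  · exact mul_ne_zero (Finset.prod_ne_zero_iff.2 fun j _ => theta_I_ne_zero ha₁ hb₁)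
      (Finset.prod_ne_zero_iff.2 fun j _ => theta_I_ne_zero ha₂ hb₂)
  · obtain ⟨hp1, hp2⟩ := mul_ne_zero_iff.1 hp
    rw [hF]
    have e : ∀ a b, thetaQuot a b p = num a b (↑p.1, p.2) / den a b (↑p.1, p.2) := fun a b => by
      simp only [thetaQuot, num, den]
      ring
    rw [e, e]
    field_simp

theorem differentiableOn_oddPrefactors :
    DifferentiableOn ℂ (fun τ => ModularForm.eta τ ^ 2 /
      (ModularForm.eta (τ / 2) * ModularForm.eta (2 * τ))) {τ | 0 < τ.im} ∧
    DifferentiableOn ℂ (fun τ => ModularForm.eta (τ / 2) / ModularForm.eta τ) {τ | 0 < τ.im} ∧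
    DifferentiableOn ℂ (fun τ => ModularForm.eta (2 * τ) / ModularForm.eta τ) {τ | 0 < τ.im} := by
  have h1 : DifferentiableOn ℂ (fun τ : ℂ => ModularForm.eta τ) {τ | 0 < τ.im} :=
    differentiableOn_eta_comp differentiableOn_id fun x hx => hx
  have h2 : DifferentiableOn ℂ (fun τ : ℂ => ModularForm.eta (2 * τ)) {τ | 0 < τ.im} :=
    differentiableOn_eta_comp (by fun_prop) fun x hx => im_two_mul_pos hx
  have h3 : DifferentiableOn ℂ (fun τ : ℂ => ModularForm.eta (τ / 2)) {τ | 0 < τ.im} :=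
    differentiableOn_eta_comp (by fun_prop) fun x hx => im_half_pos hx
  have n1 : ∀ τ ∈ {τ : ℂ | 0 < τ.im}, ModularForm.eta τ ≠ 0 := fun τ hτ =>
    ModularForm.eta_ne_zero hτ
  exact ⟨(h1.pow 2).div (h3.mul h2) fun τ hτ => mul_ne_zero
    (ModularForm.eta_ne_zero (im_half_pos hτ)) (ModularForm.eta_ne_zero (im_two_mul_pos hτ)),
    h3.div h1 n1, h2.div h1 n1⟩

theorem chOdd_isMero (m n : ℕ) (i : Fin 3) : IsMero (chOdd m n i) := by
  obtain ⟨h1, h2, h3⟩ := differentiableOn_oddPrefactors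
  fin_cases i
  · exact isMero_add_thetaQuot (h1.div_const 2) (h2.div_const 2) (a₁ := 0) (b₁ := 0) (a₂ := 0)
      (b₂ := 1) (by norm_num) (by norm_num) (by norm_num) (by norm_num) fun p => by
        simp [chOdd, oddPlus, oddMinus]; ring
  · exact isMero_add_thetaQuot (h1.div_const 2) (h2.neg.div_const 2) (a₁ := 0) (b₁ := 0) (a₂ := 0)
      (b₂ := 1) (by norm_num) (by norm_num) (by norm_num) (by norm_num) fun p => by
        simp [chOdd, oddPlus, oddMinus]; ring
  · exact isMero_add_thetaQuot h3 (A₂ := fun _ => 0) (by fun_prop) (a₁ := 1) (b₁ := 0) (a₂ := 0)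
      (b₂ := 1) (by norm_num) (by norm_num) (by norm_num) (by norm_num) fun p => by
        simp [chOdd, oddTw]

theorem chEven_isMero (m n : ℕ) (i : Fin 4) : IsMero (chEven m n i) := by
  have hc : ∀ c : ℂ, DifferentiableOn ℂ (fun _ : ℂ => c) {τ | 0 < τ.im} := fun c => by fun_prop
  fin_cases i
  · exact isMero_add_thetaQuot (hc (1 / 2)) (hc (1 / 2)) (a₁ := 0) (b₁ := 0) (a₂ := 0)
      (b₂ := 1) (by norm_num) (by norm_num) (by norm_num) (by norm_num) fun p => by
        simp [chEven]; ring
  · exact isMero_add_thetaQuot (hc (1 / 2)) (hc (-1 / 2)) (a₁ := 0) (b₁ := 0) (a₂ := 0)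
      (b₂ := 1) (by norm_num) (by norm_num) (by norm_num) (by norm_num) fun p => by
        simp [chEven]; ring
  · exact isMero_add_thetaQuot (hc (1 / 2)) (hc (I ^ ((m : ℤ) - n) / 2)) (a₁ := 1) (b₁ := 0)
      (a₂ := 1) (b₂ := 1) (by norm_num) (by norm_num) (by norm_num) (by norm_num) fun p => by
        simp [chEven, evenTwMinus]; ring
  · exact isMero_add_thetaQuot (hc (1 / 2)) (hc (-I ^ ((m : ℤ) - n) / 2)) (a₁ := 1) (b₁ := 0)
      (a₂ := 1) (b₂ := 1) (by norm_num) (by norm_num) (by norm_num) (by norm_num) fun p => by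
        simp [chEven, evenTwMinus]; ring

theorem spanInvariant_chOdd (m n : ℕ) : SpanInvariant (chOdd m n) := by
  have hm : ∀ i, chOdd m n i ∈ Submodule.span ℂ (Set.range (chOdd m n)) := fun i =>
    Submodule.subset_span ⟨i, rfl⟩
  have h0 : chOdd m n 0 = fun p => (oddPlus p + oddMinus p) / 2 := rfl
  have h1 : chOdd m n 1 = fun p => (oddPlus p - oddMinus p) / 2 := rfl
  have h2 : chOdd m n 2 = oddTw := rfl
  have hp : oddPlus ∈ Submodule.span ℂ (Set.range (chOdd m n)) := by
    convert! add_mem (hm 0) (hm 1) using 1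
    rw [h0, h1]; funext p; simp only [Pi.add_apply]; ring
  have hmi : oddMinus ∈ Submodule.span ℂ (Set.range (chOdd m n)) := by
    convert! sub_mem (hm 0) (hm 1) using 1
    rw [h0, h1]; funext p; simp only [Pi.sub_apply]; ring
  have ht : oddTw ∈ Submodule.span ℂ (Set.range (chOdd m n)) := hm 2
  have comb : ∀ (F G : Pt m n → ℂ) (x y : ℂ), F ∈ Submodule.span ℂ (Set.range (chOdd m n)) →
      G ∈ Submodule.span ℂ (Set.range (chOdd m n)) →
      (fun p => x * F p + y * G p) ∈ Submodule.span ℂ (Set.range (chOdd m n)) :=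
    fun F G x y hF hG => add_mem (Submodule.smul_mem _ x hF) (Submodule.smul_mem _ y hG)
  refine spanInvariant_of_S_of_T _ (fun i => ?_) (fun i => ?_) <;> fin_cases i
  · convert! comb _ _ (1 / 2) ((Real.sqrt 2 : ℂ) / 2) hp ht using 2
    simp [h0, oddPlus_S, oddMinus_S]; ring
  · convert! comb _ _ (1 / 2) (-(Real.sqrt 2 : ℂ) / 2) hp ht using 2
    simp [h1, oddPlus_S, oddMinus_S]; ring
  · convert! comb _ _ (1 / (Real.sqrt 2 : ℂ)) 0 hmi ht using 2
    simp [h2, oddTw_S]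
  · convert! comb _ _ (exp (Real.pi * I / 12 * ((n : ℂ) - m - 1 / 2)) / 2)
      (exp (Real.pi * I / 12 * ((n : ℂ) - m - 1 / 2)) / 2) hp hmi using 2
    simp [h0, oddPlus_T, oddMinus_T]; ring
  · convert! comb _ _ (-exp (Real.pi * I / 12 * ((n : ℂ) - m - 1 / 2)) / 2)
      (exp (Real.pi * I / 12 * ((n : ℂ) - m - 1 / 2)) / 2) hp hmi using 2
    simp [h1, oddPlus_T, oddMinus_T]; ring
  · convert! comb _ _ (exp (Real.pi * I / 6 * ((m : ℂ) - n + 1 / 2))) 0 ht ht using 2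
    simp [h2, oddTw_T]

theorem evenTwMinus_S (p : Pt m n) :
    evenTwMinus (slAct ModularGroup.S p) = (-I) ^ ((m : ℤ) - n) * evenTwMinus p := by
  unfold evenTwMinus
  rw [thetaQuot_S le_rfl, show exp (-(Real.pi * I * (1 : ℕ) * (1 : ℕ) / 2)) = -I by
    rw [← Complex.exp_neg_pi_div_two_mul_I]; congr 1; push_cast; ring]
  ring

theorem thetaQuot_S_zero_left (b : ℕ) (p : Pt m n) :
    thetaQuot 0 b (slAct ModularGroup.S p) = thetaQuot b 0 p := by
  rw [thetaQuot_S (by norm_num)]; simp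

theorem thetaQuot_S_zero_right (p : Pt m n) :
    thetaQuot 1 0 (slAct ModularGroup.S p) = thetaQuot 0 1 p := by
  rw [thetaQuot_S (by norm_num)]; simp

theorem exp_zpow_eq (x : ℂ) : exp x ^ ((n : ℤ) - m) = exp (x * ((n : ℂ) - m)) := by
  rw [← Complex.exp_int_mul]; congr 1; push_cast; ring

theorem evenTwMinus_T (p : Pt m n) : evenTwMinus (slAct ModularGroup.T p) =
    exp (-(Real.pi * I) / 6 * ((n : ℂ) - m)) * evenTwMinus p := by
  unfold evenTwMinus
  rw [thetaQuot_one_T, exp_zpow_eq]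
  ring

theorem spanInvariant_chEven (m n : ℕ) : SpanInvariant (chEven m n) := by
  have hm : ∀ i, chEven m n i ∈ Submodule.span ℂ (Set.range (chEven m n)) := fun i =>
    Submodule.subset_span ⟨i, rfl⟩
  have h0 : chEven m n 0 = fun p => (thetaQuot 0 0 p + thetaQuot 0 1 p) / 2 := rfl
  have h1 : chEven m n 1 = fun p => (thetaQuot 0 0 p - thetaQuot 0 1 p) / 2 := rfl
  have h2 : chEven m n 2 = fun p => (thetaQuot 1 0 p + evenTwMinus p) / 2 := rfl
  have h3 : chEven m n 3 = fun p => (thetaQuot 1 0 p - evenTwMinus p) / 2 := rfl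
  have hp : thetaQuot 0 0 ∈ Submodule.span ℂ (Set.range (chEven m n)) := by
    convert! add_mem (hm 0) (hm 1) using 1
    rw [h0, h1]; funext p; simp only [Pi.add_apply]; ring
  have hq : thetaQuot 0 1 ∈ Submodule.span ℂ (Set.range (chEven m n)) := by
    convert! sub_mem (hm 0) (hm 1) using 1
    rw [h0, h1]; funext p; simp only [Pi.sub_apply]; ring
  have hr : thetaQuot 1 0 ∈ Submodule.span ℂ (Set.range (chEven m n)) := by
    convert! add_mem (hm 2) (hm 3) using 1
    rw [h2, h3]; funext p; simp only [Pi.add_apply]; ring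
  have hs : evenTwMinus ∈ Submodule.span ℂ (Set.range (chEven m n)) := by
    convert! sub_mem (hm 2) (hm 3) using 1
    rw [h2, h3]; funext p; simp only [Pi.sub_apply]; ring
  have comb : ∀ (F G : Pt m n → ℂ) (x y : ℂ), F ∈ Submodule.span ℂ (Set.range (chEven m n)) →
      G ∈ Submodule.span ℂ (Set.range (chEven m n)) →
      (fun p => x * F p + y * G p) ∈ Submodule.span ℂ (Set.range (chEven m n)) :=
    fun F G x y hF hG => add_mem (Submodule.smul_mem _ x hF) (Submodule.smul_mem _ y hG)
  refine spanInvariant_of_S_of_T _ (fun i => ?_) (fun i => ?_) <;> fin_cases i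
  · convert! comb _ _ (1 / 2) (1 / 2) hp hr using 2
    simp [h0, thetaQuot_S_zero_left]; ring
  · convert! comb _ _ (1 / 2) (-1 / 2) hp hr using 2
    simp [h1, thetaQuot_S_zero_left]; ring
  · convert! comb _ _ (1 / 2) ((-I) ^ ((m : ℤ) - n) / 2) hq hs using 2
    simp [h2, thetaQuot_S_zero_right, evenTwMinus_S]; ring
  · convert! comb _ _ (1 / 2) (-(-I) ^ ((m : ℤ) - n) / 2) hq hs using 2
    simp [h3, thetaQuot_S_zero_right, evenTwMinus_S]; ring
  · convert! comb _ _ (exp (Real.pi * I / 12) ^ ((n : ℤ) - m) / 2)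
      (exp (Real.pi * I / 12) ^ ((n : ℤ) - m) / 2) hp hq using 2
    simp [h0, thetaQuot_zero_zero_T, thetaQuot_zero_one_T]; ring
  · convert! comb _ _ (-exp (Real.pi * I / 12) ^ ((n : ℤ) - m) / 2)
      (exp (Real.pi * I / 12) ^ ((n : ℤ) - m) / 2) hp hq using 2
    simp [h1, thetaQuot_zero_zero_T, thetaQuot_zero_one_T]; ring
  · convert! comb _ _ (exp (-(Real.pi * I) / 6 * ((n : ℂ) - m)) / 2)
      (exp (-(Real.pi * I) / 6 * ((n : ℂ) - m)) / 2) hr hs using 2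
    simp [h2, thetaQuot_one_T, evenTwMinus_T, exp_zpow_eq]; ring
  · convert! comb _ _ (exp (-(Real.pi * I) / 6 * ((n : ℂ) - m)) / 2)
      (-exp (-(Real.pi * I) / 6 * ((n : ℂ) - m)) / 2) hr hs using 2
    simp [h3, thetaQuot_one_T, evenTwMinus_T, exp_zpow_eq]; ring

theorem chOdd_modular (m n : ℕ) :
    (∀ i, IsMero (chOdd m n i)) ∧
    (∀ p, chOdd m n 0 (slAct ModularGroup.S p) +
        chOdd m n 1 (slAct ModularGroup.S p) =
      chOdd m n 0 p + chOdd m n 1 p) ∧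
    (∀ p, chOdd m n 0 (slAct ModularGroup.S p) -
        chOdd m n 1 (slAct ModularGroup.S p) =
      (Real.sqrt 2 : ℂ) * chOdd m n 2 p) ∧
    (∀ p, chOdd m n 2 (slAct ModularGroup.S p) =
      1 / (Real.sqrt 2 : ℂ) * (chOdd m n 0 p - chOdd m n 1 p)) ∧
    (∀ p, chOdd m n 0 (slAct ModularGroup.T p) =
      exp (Real.pi * I / 12 * ((n : ℂ) - m - 1 / 2)) * chOdd m n 0 p) ∧
    (∀ p, chOdd m n 1 (slAct ModularGroup.T p) =
      -exp (Real.pi * I / 12 * ((n : ℂ) - m - 1 / 2)) * chOdd m n 1 p) ∧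
    (∀ p, chOdd m n 2 (slAct ModularGroup.T p) =
      exp (Real.pi * I / 6 * ((m : ℂ) - n + 1 / 2)) * chOdd m n 2 p) ∧
    SpanInvariant (chOdd m n) := by
  have h0 : chOdd m n 0 = fun p => (oddPlus p + oddMinus p) / 2 := rfl
  have h1 : chOdd m n 1 = fun p => (oddPlus p - oddMinus p) / 2 := rfl
  have h2 : chOdd m n 2 = oddTw := rfl
  refine ⟨chOdd_isMero m n, fun p => ?_, fun p => ?_, fun p => ?_, fun p => ?_, fun p => ?_,
    fun p => ?_, spanInvariant_chOdd m n⟩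
  · simp only [h0, h1, oddPlus_S, oddMinus_S]; ring
  · simp only [h0, h1, h2, oddPlus_S, oddMinus_S]; ring
  · simp only [h0, h1, h2, oddTw_S]; ring
  · simp only [h0, oddPlus_T, oddMinus_T]; ring
  · simp only [h1, oddPlus_T, oddMinus_T]; ring
  · simp only [h2, oddTw_T]

theorem chEven_modular (m n : ℕ) :
    (∀ i, IsMero (chEven m n i)) ∧
    (∀ p, chEven m n 0 (slAct ModularGroup.S p) +
        chEven m n 1 (slAct ModularGroup.S p) =
      chEven m n 0 p + chEven m n 1 p) ∧
    (∀ p, chEven m n 0 (slAct ModularGroup.S p) -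
        chEven m n 1 (slAct ModularGroup.S p) =
      chEven m n 2 p + chEven m n 3 p) ∧
    (∀ p, chEven m n 2 (slAct ModularGroup.S p) +
        chEven m n 3 (slAct ModularGroup.S p) =
      chEven m n 0 p - chEven m n 1 p) ∧
    (∀ p, chEven m n 2 (slAct ModularGroup.S p) -
        chEven m n 3 (slAct ModularGroup.S p) =
      (-I) ^ ((m : ℤ) - n) * (chEven m n 2 p - chEven m n 3 p)) ∧
    (∀ p, chEven m n 0 (slAct ModularGroup.T p) =
      exp (Real.pi * I / 12 * ((n : ℂ) - m)) * chEven m n 0 p) ∧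
    (∀ p, chEven m n 1 (slAct ModularGroup.T p) =
      -exp (Real.pi * I / 12 * ((n : ℂ) - m)) * chEven m n 1 p) ∧
    (∀ p, chEven m n 2 (slAct ModularGroup.T p) =
      exp (-(Real.pi * I) / 6 * ((n : ℂ) - m)) * chEven m n 2 p) ∧
    (∀ p, chEven m n 3 (slAct ModularGroup.T p) =
      exp (-(Real.pi * I) / 6 * ((n : ℂ) - m)) * chEven m n 3 p) ∧
    SpanInvariant (chEven m n) := by
  have h0 : chEven m n 0 = fun p => (thetaQuot 0 0 p + thetaQuot 0 1 p) / 2 := rfl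
  have h1 : chEven m n 1 = fun p => (thetaQuot 0 0 p - thetaQuot 0 1 p) / 2 := rfl
  have h2 : chEven m n 2 = fun p => (thetaQuot 1 0 p + evenTwMinus p) / 2 := rfl
  have h3 : chEven m n 3 = fun p => (thetaQuot 1 0 p - evenTwMinus p) / 2 := rfl
  refine ⟨chEven_isMero m n, fun p => ?_, fun p => ?_, fun p => ?_, fun p => ?_, fun p => ?_,
    fun p => ?_, fun p => ?_, fun p => ?_, spanInvariant_chEven m n⟩
  · simp only [h0, h1, thetaQuot_S_zero_left]; ring
  · simp only [h0, h1, h2, h3, thetaQuot_S_zero_left]; ring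
  · simp only [h0, h1, h2, h3, thetaQuot_S_zero_right]; ring
  · simp only [h2, h3, evenTwMinus_S, thetaQuot_S_zero_right]; ring
  · simp only [h0, thetaQuot_zero_zero_T, thetaQuot_zero_one_T, exp_zpow_eq]; ring
  · simp only [h1, thetaQuot_zero_zero_T, thetaQuot_zero_one_T, exp_zpow_eq]; ring
  · simp only [h2, thetaQuot_one_T, evenTwMinus_T, exp_zpow_eq]; ring
  · simp only [h3, thetaQuot_one_T, evenTwMinus_T, exp_zpow_eq]; ring

/-! ### A monomial basis of an exterior algebra -/

section ExteriorBasis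

variable {I : Type}

/-- The generator of the exterior algebra attached to an index. -/
def extGen (p : I) : ExteriorAlgebra ℂ (I →₀ ℂ) := ExteriorAlgebra.ι ℂ (Finsupp.single p 1)

/-- Contraction with the coordinate function of an index. -/
def extCon (p : I) : Module.End ℂ (ExteriorAlgebra ℂ (I →₀ ℂ)) :=
  CliffordAlgebra.contractLeft (Finsupp.lapply (R := ℂ) p)

/-- The basis of the exterior algebra given by the ordered products of generators, for some
order of the indices. -/
def extBasis (I : Type) : Module.Basis (Finset I) ℂ (ExteriorAlgebra ℂ (I →₀ ℂ)) :=
  letI : LinearOrder I := IsWellOrder.linearOrder (WellOrderingRel : I → I → Prop)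
  (Finsupp.basisSingleOne (R := ℂ) (ι := I)).ExteriorAlgebra

theorem extBasis_empty : extBasis I ∅ = 1 := by
  let _ : LinearOrder I := IsWellOrder.linearOrder (WellOrderingRel : I → I → Prop)
  have h : (Finsupp.basisSingleOne (R := ℂ) (ι := I)).ExteriorAlgebra ∅ = 1 := by
    rw [ExteriorAlgebra.basis_apply_ofCard (n := 0) _ rfl]
    simp [ExteriorAlgebra.ιMulti_apply]
  exact h

theorem extBasis_singleton (p : I) : extBasis I {p} = extGen p := by
  let _ : LinearOrder I := IsWellOrder.linearOrder (WellOrderingRel : I → I → Prop)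
  have h : (Finsupp.basisSingleOne (R := ℂ) (ι := I)).ExteriorAlgebra {p} = extGen p := by
    rw [ExteriorAlgebra.basis_apply_ofCard (n := 1) _ (Finset.card_singleton p)]
    obtain ⟨j, hj⟩ := (Set.powersetCard.mem_range_ofFinEmbEquiv_symm_iff_mem
      (Set.powersetCard.ofCard (Finset.card_singleton p)) p).mpr
      (Finset.mem_singleton_self p)
    have h0 : j = 0 := Subsingleton.elim _ _
    subst h0
    simp [ExteriorAlgebra.ιMulti_apply, hj, extGen]
  exact h

theorem extGen_mul_basis_of_mem {p : I} {T : Finset I} (h : p ∈ T) :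
    extGen p * extBasis I T = 0 := by
  rw [← extBasis_singleton]
  let _ : LinearOrder I := IsWellOrder.linearOrder (WellOrderingRel : I → I → Prop)
  exact ExteriorAlgebra.basis_mul_of_not_disjoint (Finsupp.basisSingleOne (R := ℂ) (ι := I))
    (Set.powersetCard.ofCard (Finset.card_singleton p)) (Set.powersetCard.ofCard (s := T) rfl)
    (by simpa using h)

theorem extGen_mul_basis_aux {p : I} {T U : Finset I} (h : p ∉ T)
    (hU : ∀ x, x ∈ U ↔ x = p ∨ x ∈ T) :
    ∃ ε : ℂ, ε * ε = 1 ∧ extGen p * extBasis I T = ε • extBasis I U := by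
  rw [← extBasis_singleton]
  let _ : LinearOrder I := IsWellOrder.linearOrder (WellOrderingRel : I → I → Prop)
  have hd : Disjoint (Set.powersetCard.ofCard (Finset.card_singleton p)).val
    (Set.powersetCard.ofCard (s := T) rfl).val := by simpa using h
  have h1 := ExteriorAlgebra.basis_mul_of_disjoint (Finsupp.basisSingleOne (R := ℂ) (ι := I))
    (Set.powersetCard.ofCard (Finset.card_singleton p)) (Set.powersetCard.ofCard (s := T) rfl) hd
  have h2 : ((Set.powersetCard.disjUnion hd : Set.powersetCard I _) : Finset I) = U := by
    ext x
    simp [Set.powersetCard.disjUnion, hU]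
  rw [h2] at h1
  rcases Int.units_eq_one_or (Set.powersetCard.permOfDisjoint hd).sign with hs | hs
  · refine ⟨1, by norm_num, ?_⟩
    rw [hs, one_smul] at h1
    rw [one_smul]
    exact h1
  · refine ⟨-1, by norm_num, ?_⟩
    rw [hs, Units.neg_smul, one_smul] at h1
    rw [neg_smul, one_smul]
    exact h1

theorem extCon_one (p : I) : extCon p (1 : ExteriorAlgebra ℂ (I →₀ ℂ)) = 0 :=
  CliffordAlgebra.contractLeft_one (Q := (0 : QuadraticForm ℂ (I →₀ ℂ))) _

theorem extCon_comm (p q : I) (x : ExteriorAlgebra ℂ (I →₀ ℂ)) :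
    extCon p (extCon q x) = -extCon q (extCon p x) :=
  CliffordAlgebra.contractLeft_comm (Q := (0 : QuadraticForm ℂ (I →₀ ℂ))) _
    (Finsupp.lapply (R := ℂ) q) x

theorem extGen_mul_comm (p q : I) : extGen p * extGen q = -(extGen q * extGen p) := by
  have h := ExteriorAlgebra.ι_add_mul_swap (R := ℂ) (M := I →₀ ℂ) (Finsupp.single p 1) (Finsupp.single q 1)
  exact eq_neg_of_add_eq_zero_left h

variable [DecidableEq I]

theorem extGen_mul_basis_of_notMem {p : I} {T : Finset I} (h : p ∉ T) :
    ∃ ε : ℂ, ε * ε = 1 ∧ extGen p * extBasis I T = ε • extBasis I (insert p T) :=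
  extGen_mul_basis_aux h fun _ => Finset.mem_insert

theorem extCon_gen_mul (p q : I) (x : ExteriorAlgebra ℂ (I →₀ ℂ)) :
    extCon p (extGen q * x) = (if q = p then (1 : ℂ) else 0) • x - extGen q * extCon p x := by
  have h := CliffordAlgebra.contractLeft_ι_mul (Q := (0 : QuadraticForm ℂ (I →₀ ℂ)))
    (d := Finsupp.lapply (R := ℂ) p) (Finsupp.single q 1) x
  rw [Finsupp.lapply_apply, Finsupp.single_apply] at h
  exact h

theorem extCon_basis_of_notMem {p : I} {T : Finset I} (h : p ∉ T) :
    extCon p (extBasis I T) = 0 := by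
  induction T using Finset.induction_on with
  | empty => rw [extBasis_empty, extCon_one]
  | insert q T hq ih =>
    obtain ⟨ε, hε, h1⟩ := extGen_mul_basis_of_notMem hq
    have h2 : extBasis I (insert q T) = ε • (extGen q * extBasis I T) := by
      rw [h1, smul_smul, hε, one_smul]
    rw [Finset.mem_insert, not_or] at h
    rw [h2, map_smul, extCon_gen_mul, if_neg (Ne.symm h.1), ih h.2]
    simp

theorem exists_sign {p : I} {T : Finset I} (h : p ∉ T) :
    ∃ ε : ℂ, ε * ε = 1 ∧ extGen p * extBasis I T = ε • extBasis I (insert p T) ∧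
      extCon p (extBasis I (insert p T)) = ε • extBasis I T := by
  obtain ⟨ε, hε, h1⟩ := extGen_mul_basis_of_notMem h
  refine ⟨ε, hε, h1, ?_⟩
  have h2 : extBasis I (insert p T) = ε • (extGen p * extBasis I T) := by
    rw [h1, smul_smul, hε, one_smul]
  rw [h2, map_smul, extCon_gen_mul, if_pos rfl, extCon_basis_of_notMem h]
  simp

end ExteriorBasis

/-! ### Labels of modes -/

theorem J.conj_conj (a : J m n e) : a.conj.conj = a := by cases a <;> rfl

theorem J.conj_injective : Function.Injective (J.conj : J m n e → J m n e) :=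
  fun a b h => by rw [← J.conj_conj a, h, J.conj_conj]

theorem J.sgn_mul_self (a : J m n e) : a.sgn * a.sgn = 1 := by cases a <;> simp [J.sgn]

theorem J.sgn_ne_zero (a : J m n e) : a.sgn ≠ 0 := by cases a <;> simp [J.sgn]

theorem J.sgn_conj_of_even {a : J m n e} (h : a.par = 0) : a.conj.sgn = -a.sgn := by
  cases a <;> simp_all [J.sgn, J.conj, J.par]

theorem J.sgn_of_odd {a : J m n e} (h : a.par = 1) : a.sgn = 1 := by
  cases a <;> simp_all [J.sgn, J.par]

theorem J.conj_ne_of_even {a : J m n e} (h : a.par = 0) : a.conj ≠ a := by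
  cases a <;> simp_all [J.conj, J.par]

theorem par_cases (a : J m n e) : a.par = 0 ∨ a.par = 1 := by cases a <;> simp [J.par]

theorem zmod_two_cases (s : ZMod 2) : s = 0 ∨ s = 1 := by revert s; decide

theorem dualMode_dualMode (tw : Bool) (p : J m n e × ℤ) : dualMode tw (dualMode tw p) = p := by
  simp [dualMode, J.conj_conj]

theorem dualMode_inj {tw : Bool} {p q : J m n e × ℤ} : dualMode tw p = dualMode tw q ↔ p = q :=
  ⟨fun h => by rw [← dualMode_dualMode tw p, h, dualMode_dualMode], fun h => by rw [h]⟩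

theorem dualMode_par (tw : Bool) (p : J m n e × ℤ) : (dualMode tw p).1.par = p.1.par :=
  par_conj p.1

theorem cr_dualMode_of_not {tw : Bool} {p : J m n e × ℤ} (h : ¬ Cr tw p) :
    Cr tw (dualMode tw p) := by
  obtain ⟨a, k⟩ := p
  cases tw <;> cases a <;> simp_all [Cr, dualMode, shift, J.conj, J.low] <;> omega

theorem not_cr_dualMode {tw : Bool} {p : J m n e × ℤ} (h : Cr tw p) (hp : dualMode tw p ≠ p) :
    ¬ Cr tw (dualMode tw p) := by
  obtain ⟨a, k⟩ := p
  cases tw <;> cases a <;> simp_all [Cr, dualMode, shift, J.conj, J.low] <;> omega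

theorem dualMode_ne_of_even {tw : Bool} {p : J m n e × ℤ} (h : p.1.par = 0) :
    dualMode tw p ≠ p := fun h' => J.conj_ne_of_even h (congrArg Prod.fst h')

/-- A label is that of a creation operator, or dual to one. -/
theorem label_cases (tw : Bool) {u : ZMod 2} (p : J m n e × ℤ) (hp : p.1.par = u) :
    (∃ c : CrMode m n e tw u, p = c.1) ∨
      ∃ c : CrMode m n e tw u, dualMode tw c.1 ≠ c.1 ∧ p = dualMode tw c.1 := by
  by_cases h : Cr tw p
  · exact Or.inl ⟨⟨p, hp, h⟩, rfl⟩
  · refine Or.inr ⟨⟨dualMode tw p, (dualMode_par tw p).trans hp, cr_dualMode_of_not h⟩, ?_, ?_⟩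
    · intro h'
      rw [dualMode_dualMode] at h'
      apply h
      change p = dualMode tw p at h'
      rw [h']
      exact cr_dualMode_of_not h
    · exact (dualMode_dualMode tw p).symm

/-- The value of the supercommutator of two modes. -/
def pairing (tw : Bool) (p q : J m n e × ℤ) : ℂ := if q = dualMode tw p then p.1.sgn else 0

theorem pairing_eq (tw : Bool) (a b : J m n e) (k l : ℤ) :
    pairing tw (a, k) (b, l) = if k + l + shift tw = 0 then B a b else 0 := by
  unfold pairing B dualMode
  by_cases h : b = a.conj
  · by_cases h' : k + l + shift tw = 0
    · rw [if_pos h', if_pos h, if_pos (by rw [h]; congr 1; omega)]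
    · rw [if_neg h', if_neg]
      intro h2
      have := congrArg Prod.snd h2
      simp only at this
      omega
  · rw [if_neg (fun h2 => h (congrArg Prod.fst h2)), if_neg h]
    simp

/-! ### The modes as operators -/

section Operators

variable {tw : Bool}

theorem mode_boson_cr (c : CrMode m n e tw 0) :
    mode tw c.1.1 c.1.2 = LinearMap.rTensor _ (LinearMap.mulLeft ℂ (MvPolynomial.X c)) := by
  obtain ⟨⟨a, k⟩, h0, hc⟩ := c
  have h0' : a.par = 0 := h0
  have hd : ¬ Cr tw (dualMode tw (a, k)) := not_cr_dualMode hc (dualMode_ne_of_even h0)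
  rw [mode, dif_pos h0', bosonOp, dif_pos hc, dif_neg hd, add_zero]

theorem mode_boson_an (c : CrMode m n e tw 0) :
    mode tw (dualMode tw c.1).1 (dualMode tw c.1).2 =
      c.1.1.conj.sgn • LinearMap.rTensor _ (MvPolynomial.pderiv (R := ℂ) c).toLinearMap := by
  have h0 : (dualMode tw c.1).1.par = 0 := (dualMode_par tw c.1).trans c.2.1
  have hd : ¬ Cr tw (dualMode tw c.1) := not_cr_dualMode c.2.2 (dualMode_ne_of_even c.2.1)
  have hdd : Cr tw (dualMode tw (dualMode tw c.1)) := by rw [dualMode_dualMode]; exact c.2.2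
  have hc : ∀ h, (⟨dualMode tw (dualMode tw c.1), h⟩ : CrMode m n e tw 0) = c :=
    fun h => Subtype.ext (dualMode_dualMode tw c.1)
  rw [mode, dif_pos h0, bosonOp, dif_neg hd, dif_pos hdd, zero_add, LinearMap.rTensor_smul, hc]
  rfl

theorem mode_fermion_cr (c : CrMode m n e tw 1) (hs : dualMode tw c.1 ≠ c.1) :
    mode tw c.1.1 c.1.2 = LinearMap.lTensor _ (LinearMap.mulLeft ℂ (extGen c)) := by
  obtain ⟨⟨a, k⟩, h0, hc⟩ := c
  have h0' : ¬ a.par = 0 := by rw [h0]; decide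
  have hd : ¬ Cr tw (dualMode tw (a, k)) := not_cr_dualMode hc hs
  rw [mode, dif_neg h0', fermionOp, dif_pos hc, dif_neg hd, add_zero]
  rfl

theorem mode_fermion_an (c : CrMode m n e tw 1) (hs : dualMode tw c.1 ≠ c.1) :
    mode tw (dualMode tw c.1).1 (dualMode tw c.1).2 = LinearMap.lTensor _ (extCon c) := by
  have h0 : ¬ (dualMode tw c.1).1.par = 0 := by rw [dualMode_par, c.2.1]; decide
  have hd : ¬ Cr tw (dualMode tw c.1) := not_cr_dualMode c.2.2 hs
  have hdd : Cr tw (dualMode tw (dualMode tw c.1)) := by rw [dualMode_dualMode]; exact c.2.2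
  have hc : ∀ h, (⟨dualMode tw (dualMode tw c.1), h⟩ : CrMode m n e tw 1) = c :=
    fun h => Subtype.ext (dualMode_dualMode tw c.1)
  have hne : ¬ dualMode tw (dualMode tw c.1) = dualMode tw c.1 := by
    rw [dualMode_inj]; exact hs
  rw [mode, dif_neg h0, fermionOp, dif_neg hd, dif_pos hdd, zero_add, if_neg hne, one_smul, hc]
  rfl

theorem mode_fermion_self (c : CrMode m n e tw 1) (hs : dualMode tw c.1 = c.1) :
    mode tw c.1.1 c.1.2 =
      LinearMap.lTensor _ (LinearMap.mulLeft ℂ (extGen c) + (1 / 2 : ℂ) • extCon c) := by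
  obtain ⟨⟨a, k⟩, h0, hc⟩ := c
  have h0' : ¬ a.par = 0 := by rw [h0]; decide
  have hs' : dualMode tw (a, k) = (a, k) := hs
  have hd : Cr tw (dualMode tw (a, k)) := by rw [hs']; exact hc
  have he : ∀ h, (⟨dualMode tw (a, k), h⟩ : CrMode m n e tw 1) = ⟨(a, k), h0, hc⟩ :=
    fun h => Subtype.ext hs'
  rw [mode, dif_neg h0', fermionOp, dif_pos hc, dif_pos hd, if_pos hs', he]
  rfl

theorem rTensor_comp_lTensor (f : Module.End ℂ (MvPolynomial (CrMode m n e tw 0) ℂ))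
    (g : Module.End ℂ (ExteriorAlgebra ℂ (CrMode m n e tw 1 →₀ ℂ))) :
    (LinearMap.rTensor _ f * LinearMap.lTensor _ g : Module.End ℂ (Fock m n e tw)) =
      LinearMap.lTensor _ g * LinearMap.rTensor _ f := by
  rw [Module.End.mul_eq_comp, Module.End.mul_eq_comp, LinearMap.rTensor_comp_lTensor,
    LinearMap.lTensor_comp_rTensor]

theorem pderiv_X_mul (c d : CrMode m n e tw 0) :
    (MvPolynomial.pderiv (R := ℂ) c).toLinearMap * LinearMap.mulLeft ℂ (MvPolynomial.X d) =
      LinearMap.mulLeft ℂ (MvPolynomial.X d) * (MvPolynomial.pderiv (R := ℂ) c).toLinearMap +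
      (if d = c then (1 : ℂ) else 0) • (1 : Module.End ℂ _) := by
  refine LinearMap.ext fun x => ?_
  simp only [LinearMap.add_apply, Module.End.mul_apply, LinearMap.mulLeft_apply,
    Derivation.coeFn_coe, Derivation.leibniz,
    MvPolynomial.pderiv_X, smul_eq_mul, LinearMap.smul_apply, Module.End.one_apply]
  by_cases h : d = c
  · subst h; simp
  · simp [h]

theorem pderiv_comm (c d : CrMode m n e tw 0) :
    (MvPolynomial.pderiv (R := ℂ) c).toLinearMap * (MvPolynomial.pderiv (R := ℂ) d).toLinearMap =
      (MvPolynomial.pderiv (R := ℂ) d).toLinearMap *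
        (MvPolynomial.pderiv (R := ℂ) c).toLinearMap := by
  have h : ⁅MvPolynomial.pderiv (R := ℂ) c, MvPolynomial.pderiv (R := ℂ) d⁆ = 0 := by
    refine MvPolynomial.derivation_ext fun i => ?_
    simp only [Derivation.commutator_apply, MvPolynomial.pderiv_X, Derivation.coe_zero,
      Pi.zero_apply]
    simp only [Pi.single_apply]
    split_ifs <;> simp
  refine LinearMap.ext fun x => ?_
  have h2 := congrArg (fun D => D x) h
  simp only [Derivation.commutator_apply, Derivation.coe_zero, Pi.zero_apply] at h2
  exact sub_eq_zero.mp h2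

theorem mode_mode_boson (p q : J m n e × ℤ) (hp : p.1.par = 0) (hq : q.1.par = 0) :
    mode tw p.1 p.2 * mode tw q.1 q.2 = mode tw q.1 q.2 * mode tw p.1 p.2 +
      pairing tw p q • 1 := by
  have key : ∀ c d : CrMode m n e tw 0,
      mode tw (dualMode tw d.1).1 (dualMode tw d.1).2 * mode tw c.1.1 c.1.2 =
        mode tw c.1.1 c.1.2 * mode tw (dualMode tw d.1).1 (dualMode tw d.1).2 +
        (if c = d then d.1.1.conj.sgn else 0) • 1 := by
    intro c d
    have h1 : LinearMap.rTensor (ExteriorAlgebra ℂ (CrMode m n e tw 1 →₀ ℂ))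
      (1 : Module.End ℂ (MvPolynomial (CrMode m n e tw 0) ℂ)) = 1 := LinearMap.rTensor_id _ _
    rw [mode_boson_cr, mode_boson_an, mul_smul_comm, smul_mul_assoc,
      ← LinearMap.rTensor_mul, ← LinearMap.rTensor_mul, pderiv_X_mul, LinearMap.rTensor_add,
      LinearMap.rTensor_smul, h1, smul_add, smul_smul]
    by_cases h : c = d
    · subst h; simp
    · simp [h]
  rcases label_cases tw p hp with ⟨c, rfl⟩ | ⟨c, hc, rfl⟩ <;>
    rcases label_cases tw q hq with ⟨d, rfl⟩ | ⟨d, hd, rfl⟩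
  · have hpair : pairing tw c.1 d.1 = 0 := by
      rw [pairing, if_neg]
      intro h
      exact not_cr_dualMode c.2.2 (dualMode_ne_of_even hp) (h ▸ d.2.2)
    rw [mode_boson_cr, mode_boson_cr, ← LinearMap.rTensor_mul, ← LinearMap.rTensor_mul, hpair,
      zero_smul, add_zero]
    congr 1
    refine LinearMap.ext fun x => ?_
    simp only [Module.End.mul_apply, LinearMap.mulLeft_apply]
    ring
  · rw [key, pairing, add_assoc, ← add_smul]
    by_cases h : c = d
    · subst h
      simp [J.sgn_conj_of_even hp]
    · have h' : dualMode tw d.1 ≠ dualMode tw c.1 := by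
        rw [ne_eq, dualMode_inj]
        exact fun h2 => h (Subtype.ext h2.symm)
      simp [h, h']
  · rw [key, pairing, dualMode_dualMode]
    simp only [← Subtype.ext_iff]
    by_cases h : d = c
    · subst h
      simp [dualMode]
    · simp [h]
  · have hpair : pairing tw (dualMode tw c.1) (dualMode tw d.1) = 0 := by
      rw [pairing, if_neg]
      rw [dualMode_inj]
      intro h
      exact not_cr_dualMode c.2.2 hc (h ▸ d.2.2)
    rw [mode_boson_an, mode_boson_an, smul_mul_smul_comm, smul_mul_smul_comm,
      ← LinearMap.rTensor_mul, ← LinearMap.rTensor_mul, pderiv_comm, mul_comm, hpair,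
      zero_smul, add_zero]

theorem extGen_anticomm (c d : CrMode m n e tw 1) :
    LinearMap.mulLeft ℂ (extGen c) * LinearMap.mulLeft ℂ (extGen d) +
      LinearMap.mulLeft ℂ (extGen d) * LinearMap.mulLeft ℂ (extGen c) = 0 := by
  refine LinearMap.ext fun x => ?_
  simp only [LinearMap.add_apply, Module.End.mul_apply, LinearMap.mulLeft_apply, ← mul_assoc]
  rw [extGen_mul_comm c d]
  simp

theorem extCon_anticomm (c d : CrMode m n e tw 1) :
    extCon c * extCon d + extCon d * extCon c = 0 := by
  refine LinearMap.ext fun x => ?_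
  simp only [LinearMap.add_apply, Module.End.mul_apply]
  rw [extCon_comm c d]
  simp

theorem extCon_extGen (c d : CrMode m n e tw 1) :
    extCon c * LinearMap.mulLeft ℂ (extGen d) + LinearMap.mulLeft ℂ (extGen d) * extCon c =
      (if d = c then (1 : ℂ) else 0) • 1 := by
  refine LinearMap.ext fun x => ?_
  simp only [LinearMap.add_apply, Module.End.mul_apply, LinearMap.mulLeft_apply, extCon_gen_mul,
    sub_add_cancel, LinearMap.smul_apply, Module.End.one_apply]

set_option maxHeartbeats 400000 in
theorem mode_mode_fermion (p q : J m n e × ℤ) (hp : p.1.par = 1) (hq : q.1.par = 1) :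
    mode tw p.1 p.2 * mode tw q.1 q.2 + mode tw q.1 q.2 * mode tw p.1 p.2 =
      pairing tw p q • 1 := by
  have h1 : LinearMap.lTensor (MvPolynomial (CrMode m n e tw 0) ℂ)
    (1 : Module.End ℂ (ExteriorAlgebra ℂ (CrMode m n e tw 1 →₀ ℂ))) = 1 := LinearMap.lTensor_id _ _
  have fin : ∀ (X Y : Module.End ℂ (ExteriorAlgebra ℂ (CrMode m n e tw 1 →₀ ℂ))) (x : ℂ),
      X * Y + Y * X = x • 1 →
      (LinearMap.lTensor _ X * LinearMap.lTensor _ Y + LinearMap.lTensor _ Y *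
        LinearMap.lTensor _ X : Module.End ℂ (Fock m n e tw)) = x • 1 := by
    intro X Y x h
    rw [← LinearMap.lTensor_mul, ← LinearMap.lTensor_mul, ← LinearMap.lTensor_add, h,
      LinearMap.lTensor_smul, h1]
  have gen : ∀ p : J m n e × ℤ, p.1.par = 1 → ∃ (c : CrMode m n e tw 1) (x y : ℂ),
      mode tw p.1 p.2 = LinearMap.lTensor _ (x • LinearMap.mulLeft ℂ (extGen c) + y • extCon c) ∧
      ((p = c.1 ∧ dualMode tw c.1 ≠ c.1 ∧ x = 1 ∧ y = 0) ∨
       (p = dualMode tw c.1 ∧ dualMode tw c.1 ≠ c.1 ∧ x = 0 ∧ y = 1) ∨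
       (p = c.1 ∧ dualMode tw c.1 = c.1 ∧ x = 1 ∧ y = 1 / 2)) := by
    intro p hp
    rcases label_cases tw p hp with ⟨c, rfl⟩ | ⟨c, hc, rfl⟩
    · by_cases hs : dualMode tw c.1 = c.1
      · exact ⟨c, 1, 1 / 2, by rw [mode_fermion_self c hs, one_smul], Or.inr (Or.inr
          ⟨rfl, hs, rfl, rfl⟩)⟩
      · exact ⟨c, 1, 0, by rw [mode_fermion_cr c hs, one_smul, zero_smul, add_zero],
          Or.inl ⟨rfl, hs, rfl, rfl⟩⟩
    · exact ⟨c, 0, 1, by rw [mode_fermion_an c hc, one_smul, zero_smul, zero_add],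
        Or.inr (Or.inl ⟨rfl, hc, rfl, rfl⟩)⟩
  obtain ⟨c, x, y, hc, hcc⟩ := gen p hp
  obtain ⟨d, z, w, hd, hdd⟩ := gen q hq
  rw [hc, hd]
  have ev : pairing tw p q = if d = c then x * w + y * z else 0 := by
    rw [pairing, J.sgn_of_odd hp]
    have n1 : ∀ c d : CrMode m n e tw 1, dualMode tw c.1 ≠ c.1 → d.1 ≠ dualMode tw c.1 :=
      fun c d hs h => not_cr_dualMode c.2.2 hs (h ▸ d.2.2)
    rcases hcc with ⟨rfl, hs, rfl, rfl⟩ | ⟨rfl, hs, rfl, rfl⟩ | ⟨rfl, hs, rfl, rfl⟩ <;>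
      rcases hdd with ⟨rfl, ht, rfl, rfl⟩ | ⟨rfl, ht, rfl, rfl⟩ | ⟨rfl, ht, rfl, rfl⟩
    · simp [n1 c d hs]
    · simp [dualMode_inj, Subtype.ext_iff]
    · rw [if_neg (n1 c d hs), if_neg]
      rintro rfl; exact hs ht
    · simp [dualMode_dualMode, Subtype.ext_iff]
    · rw [if_neg]
      · simp
      · rw [dualMode_inj]
        exact fun h => n1 c d hs (h ▸ rfl)
    · have hcd : d ≠ c := by rintro rfl; exact hs ht
      simp [dualMode_dualMode, hcd, ← Subtype.ext_iff]
    · have hcd : d ≠ c := by rintro rfl; exact ht hs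
      simp [hs, hcd, ← Subtype.ext_iff]
    · have hcd : d ≠ c := by rintro rfl; exact ht hs
      simp [dualMode_inj, hcd, ← Subtype.ext_iff]
    · by_cases hcd : d = c
      · subst hcd
        simp [hs]
        norm_num
      · simp [hs, hcd, ← Subtype.ext_iff]
  refine fin _ _ _ ?_
  rw [ev]
  have e1 := extGen_anticomm c d
  have e2 := extCon_anticomm c d
  have e3 := extCon_extGen c d
  have e4 := extCon_extGen d c
  have e5 : (if c = d then (1 : ℂ) else 0) = if d = c then 1 else 0 := by simp [eq_comm]
  rw [e5] at e4
  have e6 : (if d = c then x * w + y * z else 0) = (x * w + y * z) * if d = c then 1 else 0 := by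
    split_ifs <;> simp
  rw [e6]
  generalize (if d = c then (1 : ℂ) else 0) = t at *
  generalize LinearMap.mulLeft ℂ (extGen c) = Gc at *
  generalize LinearMap.mulLeft ℂ (extGen d) = Gd at *
  generalize extCon c = Cc at *
  generalize extCon d = Cd at *
  have : (x • Gc + y • Cc) * (z • Gd + w • Cd) + (z • Gd + w • Cd) * (x • Gc + y • Cc) =
      (x * z) • (Gc * Gd + Gd * Gc) + (y * w) • (Cc * Cd + Cd * Cc) +
      (y * z) • (Cc * Gd + Gd * Cc) + (x * w) • (Cd * Gc + Gc * Cd) := by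
    simp only [add_mul, mul_add, smul_mul_smul_comm, smul_add]
    rw [mul_comm z x, mul_comm w x, mul_comm z y, mul_comm w y]
    abel
  rw [this, e1, e2, e3, e4]
  simp only [smul_zero, zero_add, smul_smul, ← add_smul]
  congr 1
  ring

/-- The canonical commutation relations. -/
theorem mode_mode (a b : J m n e) (k l : ℤ) (v : Fock m n e tw) :
    mode tw a k (mode tw b l v) = kz a.par b.par • mode tw b l (mode tw a k v) +
      (if k + l + shift tw = 0 then B a b else 0) • v := by
  rw [← pairing_eq]
  have mixed : ∀ (a b : J m n e) (k l : ℤ), a.par = 0 → b.par = 1 →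
      mode tw a k (mode tw b l v) = mode tw b l (mode tw a k v) := by
    intro a b k l ha hb
    have hb' : ¬ b.par = 0 := by rw [hb]; decide
    rw [mode, mode, dif_pos ha, dif_neg hb']
    exact congrArg (fun f => f v) (rTensor_comp_lTensor _ _)
  have pz : a.par ≠ b.par → pairing tw (a, k) (b, l) = 0 := by
    intro h
    rw [pairing, if_neg]
    intro h2
    apply h
    have h3 : b = a.conj := congrArg Prod.fst h2
    rw [h3, par_conj]
  rcases par_cases a with ha | ha <;> rcases par_cases b with hb | hb
  · rw [kz, ha, if_neg (by simp), one_smul]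
    exact congrArg (fun f => f v) (mode_mode_boson (tw := tw) (a, k) (b, l) ha hb)
  · rw [pz (by rw [ha, hb]; decide), mixed a b k l ha hb, kz, ha, if_neg (by simp), one_smul,
      zero_smul, add_zero]
  · rw [pz (by rw [ha, hb]; decide), mixed b a l k hb ha, kz, hb, if_neg (by simp), one_smul,
      zero_smul, add_zero]
  · have h := congrArg (fun f => f v) (mode_mode_fermion (tw := tw) (a, k) (b, l) ha hb)
    have h' : mode tw a k (mode tw b l v) + mode tw b l (mode tw a k v) =
      pairing tw (a, k) (b, l) • v := h
    rw [kz, ha, hb, if_pos ⟨rfl, rfl⟩, ← h']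
    module

/-! ### The action of the modes on the monomial basis -/

/-- The set of indices of the monomial basis. -/
abbrev Idx (m n e : ℕ) (tw : Bool) : Type := (CrMode m n e tw 0 →₀ ℕ) × Finset (CrMode m n e tw 1)

/-- The monomial basis of the Fock space. -/
def fockBasis (m n e : ℕ) (tw : Bool) : Module.Basis (Idx m n e tw) ℂ (Fock m n e tw) :=
  (MvPolynomial.basisMonomials (CrMode m n e tw 0) ℂ).tensorProduct
    (extBasis (CrMode m n e tw 1))

theorem fockBasis_apply (f : CrMode m n e tw 0 →₀ ℕ) (S : Finset (CrMode m n e tw 1)) :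
    fockBasis m n e tw (f, S) =
      MvPolynomial.monomial f (1 : ℂ) ⊗ₜ[ℂ] extBasis (CrMode m n e tw 1) S := by
  rw [fockBasis, Module.Basis.tensorProduct_apply, MvPolynomial.coe_basisMonomials]

theorem vac_eq : vac m n e tw = fockBasis m n e tw (0, ∅) := by
  rw [fockBasis_apply, extBasis_empty]
  rfl

theorem mode_boson_cr_basis (c : CrMode m n e tw 0) (f : CrMode m n e tw 0 →₀ ℕ)
    (S : Finset (CrMode m n e tw 1)) :
    mode tw c.1.1 c.1.2 (fockBasis m n e tw (f, S)) =
      fockBasis m n e tw (f + Finsupp.single c 1, S) := by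
  rw [mode_boson_cr, fockBasis_apply, fockBasis_apply, LinearMap.rTensor_tmul,
    LinearMap.mulLeft_apply, MvPolynomial.X, MvPolynomial.monomial_mul, one_mul, add_comm]

theorem mode_boson_an_basis (c : CrMode m n e tw 0) (f : CrMode m n e tw 0 →₀ ℕ)
    (S : Finset (CrMode m n e tw 1)) :
    mode tw (dualMode tw c.1).1 (dualMode tw c.1).2 (fockBasis m n e tw (f, S)) =
      (c.1.1.conj.sgn * f c) • fockBasis m n e tw (f - Finsupp.single c 1, S) := by
  have h : MvPolynomial.monomial (f - Finsupp.single c 1) (1 * (f c : ℂ)) =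
      (f c : ℂ) • MvPolynomial.monomial (f - Finsupp.single c 1) (1 : ℂ) := by
    rw [MvPolynomial.smul_monomial]; simp
  rw [mode_boson_an, fockBasis_apply, fockBasis_apply, LinearMap.smul_apply,
    LinearMap.rTensor_tmul, Derivation.coeFn_coe, MvPolynomial.pderiv_monomial, h,
    TensorProduct.smul_tmul', smul_smul]
  exact (TensorProduct.smul_tmul' _ _ _).symm

theorem mode_fermion_cr_of_mem (c : CrMode m n e tw 1) (hc : dualMode tw c.1 ≠ c.1)
    (f : CrMode m n e tw 0 →₀ ℕ) (S : Finset (CrMode m n e tw 1)) (h : c ∈ S) :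
    mode tw c.1.1 c.1.2 (fockBasis m n e tw (f, S)) = 0 := by
  rw [mode_fermion_cr c hc, fockBasis_apply, LinearMap.lTensor_tmul, LinearMap.mulLeft_apply,
    extGen_mul_basis_of_mem h, TensorProduct.tmul_zero]

theorem mode_fermion_an_of_notMem (c : CrMode m n e tw 1) (hc : dualMode tw c.1 ≠ c.1)
    (f : CrMode m n e tw 0 →₀ ℕ) (S : Finset (CrMode m n e tw 1)) (h : c ∉ S) :
    mode tw (dualMode tw c.1).1 (dualMode tw c.1).2 (fockBasis m n e tw (f, S)) = 0 := by
  rw [mode_fermion_an c hc, fockBasis_apply, LinearMap.lTensor_tmul,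
    extCon_basis_of_notMem h, TensorProduct.tmul_zero]

theorem mode_fermion_basis (c : CrMode m n e tw 1) (S : Finset (CrMode m n e tw 1)) (h : c ∉ S) :
    ∃ ε : ℂ, ε * ε = 1 ∧ ∀ f : CrMode m n e tw 0 →₀ ℕ,
      mode tw c.1.1 c.1.2 (fockBasis m n e tw (f, S)) =
        ε • fockBasis m n e tw (f, insert c S) ∧
      mode tw (dualMode tw c.1).1 (dualMode tw c.1).2 (fockBasis m n e tw (f, insert c S)) =
        ((if dualMode tw c.1 = c.1 then 1 / 2 else 1) * ε) • fockBasis m n e tw (f, S) := by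
  obtain ⟨ε, hε, h1, h2⟩ := exists_sign h
  refine ⟨ε, hε, fun f => ?_⟩
  by_cases hc : dualMode tw c.1 = c.1
  · rw [if_pos hc, hc, mode_fermion_self c hc]
    simp only [fockBasis_apply, LinearMap.lTensor_tmul, LinearMap.add_apply,
      LinearMap.mulLeft_apply, LinearMap.smul_apply, h1, h2, extCon_basis_of_notMem h,
      extGen_mul_basis_of_mem (Finset.mem_insert_self c S), smul_zero, add_zero, zero_add,
      TensorProduct.tmul_smul, smul_smul, and_self]
  · rw [if_neg hc, one_mul, mode_fermion_cr c hc, mode_fermion_an c hc]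
    simp only [fockBasis_apply, LinearMap.lTensor_tmul, LinearMap.mulLeft_apply, h1, h2,
      TensorProduct.tmul_smul, and_self]

end Operators

/-! ### Fock modules with a monomial basis -/

/-- The sum of the values of `ω` at the labels of a basis monomial. -/
def tot {tw : Bool} {A : Type} [AddCommMonoid A] (ω : J m n e × ℤ → A) (i : Idx m n e tw) : A :=
  (i.1.sum fun c k => k • ω c.1) + ∑ c ∈ i.2, ω c.1

/-- A module over the modes, with a monomial basis. -/
structure SuperFock (m n e : ℕ) (tw : Bool) (W : Type) [AddCommGroup W] [Module ℂ W] where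
  A : J m n e → ℤ → Module.End ℂ W
  vac : W
  bas : Module.Basis (Idx m n e tw) ℂ W
  vac_eq : vac = bas (0, ∅)
  ccr : ∀ a b k l v, A a k (A b l v) = kz a.par b.par • A b l (A a k v) +
    (if k + l + shift tw = 0 then B a b else 0) • v
  boson_cr : ∀ (c : CrMode m n e tw 0) f S,
    A c.1.1 c.1.2 (bas (f, S)) = bas (f + Finsupp.single c 1, S)
  boson_an : ∀ (c : CrMode m n e tw 0) f S,
    A (dualMode tw c.1).1 (dualMode tw c.1).2 (bas (f, S)) =
      (c.1.1.conj.sgn * f c) • bas (f - Finsupp.single c 1, S)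
  fermion_cr : ∀ (c : CrMode m n e tw 1), dualMode tw c.1 ≠ c.1 → ∀ f S, c ∈ S →
    A c.1.1 c.1.2 (bas (f, S)) = 0
  fermion_an : ∀ (c : CrMode m n e tw 1), dualMode tw c.1 ≠ c.1 → ∀ f S, c ∉ S →
    A (dualMode tw c.1).1 (dualMode tw c.1).2 (bas (f, S)) = 0
  fermion : ∀ (c : CrMode m n e tw 1) S, c ∉ S → ∃ ε : ℂ, ε * ε = 1 ∧ ∀ f,
    A c.1.1 c.1.2 (bas (f, S)) = ε • bas (f, insert c S) ∧
    A (dualMode tw c.1).1 (dualMode tw c.1).2 (bas (f, insert c S)) =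
      ((if dualMode tw c.1 = c.1 then 1 / 2 else 1) * ε) • bas (f, S)

/-- The Fock space as a module with a monomial basis. -/
def superFock (m n e : ℕ) (tw : Bool) : SuperFock m n e tw (Fock m n e tw) where
  A := mode tw
  vac := vac m n e tw
  bas := fockBasis m n e tw
  vac_eq := vac_eq
  ccr := mode_mode
  boson_cr := mode_boson_cr_basis
  boson_an := mode_boson_an_basis
  fermion_cr := mode_fermion_cr_of_mem
  fermion_an := mode_fermion_an_of_notMem
  fermion := mode_fermion_basis

section Tot

variable {tw : Bool} {A : Type} [AddCommMonoid A] (ω : J m n e × ℤ → A)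

theorem tot_zero : tot (tw := tw) ω (0, ∅) = 0 := by simp [tot]

theorem tot_add_single (f : CrMode m n e tw 0 →₀ ℕ) (S : Finset (CrMode m n e tw 1))
    (c : CrMode m n e tw 0) :
    tot ω (f + Finsupp.single c 1, S) = tot ω (f, S) + ω c.1 := by
  unfold tot
  rw [Finsupp.sum_add_index' (h := fun (c : CrMode m n e tw 0) k => k • ω c.1)
    (fun _ => zero_nsmul _) (fun _ _ _ => add_nsmul _ _ _),
    Finsupp.sum_single_index (h := fun (c : CrMode m n e tw 0) k => k • ω c.1) (zero_nsmul _),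
    one_nsmul, add_right_comm]

theorem tot_insert (f : CrMode m n e tw 0 →₀ ℕ) {S : Finset (CrMode m n e tw 1)}
    {c : CrMode m n e tw 1} (h : c ∉ S) :
    tot ω (f, insert c S) = tot ω (f, S) + ω c.1 := by
  unfold tot
  rw [Finset.sum_insert h, add_comm (ω c.1), add_assoc]

theorem tot_nonneg {ω : J m n e × ℤ → ℤ} (h : ∀ p, Cr tw p → 0 ≤ ω p) (i : Idx m n e tw) :
    0 ≤ tot ω i := by
  refine add_nonneg (Finset.sum_nonneg fun c _ => ?_) (Finset.sum_nonneg fun c _ => h _ c.2.2)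
  exact nsmul_nonneg (h _ c.2.2) _

end Tot

theorem finsupp_nat_induction {ι : Type} {P : (ι →₀ ℕ) → Prop} (h0 : P 0)
    (hs : ∀ f c, P f → P (f + Finsupp.single c 1)) (f : ι →₀ ℕ) : P f := by
  classical
  obtain ⟨s, rfl⟩ := Multiset.toFinsupp.surjective f
  induction s using Multiset.induction with
  | empty => simpa using h0
  | cons a s ih =>
    rw [← Multiset.singleton_add, map_add, Multiset.toFinsupp_singleton, add_comm]
    exact hs _ _ ih

namespace SuperFock

variable {tw : Bool} {W : Type} [AddCommGroup W] [Module ℂ W] (F : SuperFock m n e tw W)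

/-- The mode with a given label. -/
def op (p : J m n e × ℤ) : Module.End ℂ W := F.A p.1 p.2

/-- The monomial in the modes with the given labels, applied to the vacuum. -/
def word (l : List (J m n e × ℤ)) : W := (l.map fun p => F.A p.1 p.2).prod F.vac

theorem word_nil : F.word [] = F.vac := rfl

theorem word_cons (p : J m n e × ℤ) (l : List (J m n e × ℤ)) :
    F.word (p :: l) = F.op p (F.word l) := by
  rw [word, List.map_cons, List.prod_cons]; rfl

/-- The span of the basis monomials of degree `x`. -/
def gr {A : Type} [AddCommMonoid A] (ω : J m n e × ℤ → A) (x : A) : Submodule ℂ W :=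
  Submodule.span ℂ (F.bas '' {i | tot ω i = x})

/-- The span of the basis monomials of degree at most `N`. -/
def low (ω : J m n e × ℤ → ℤ) (N : ℤ) : Submodule ℂ W :=
  Submodule.span ℂ (F.bas '' {i | tot ω i ≤ N})

theorem bas_mem_gr {A : Type} [AddCommMonoid A] (ω : J m n e × ℤ → A) (i : Idx m n e tw) :
    F.bas i ∈ F.gr ω (tot ω i) := Submodule.subset_span ⟨i, rfl, rfl⟩

/-- The action of a mode on a basis vector. -/
theorem op_bas_cases (p : J m n e × ℤ) (i : Idx m n e tw) :
    ∃ (x : ℂ) (j : Idx m n e tw), F.op p (F.bas i) = x • F.bas j ∧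
      (x = 0 ∨ ∀ {A : Type} [AddCommGroup A] (ω : J m n e × ℤ → A),
        (∀ p, ω (dualMode tw p) = -ω p) → tot ω j = tot ω i + ω p) := by
  obtain ⟨f, S⟩ := i
  rcases zmod_two_cases p.1.par with hp | hp
  · rcases label_cases tw p hp with ⟨c, rfl⟩ | ⟨c, hc, rfl⟩
    · refine ⟨1, _, by rw [op, F.boson_cr, one_smul], Or.inr fun ω _ => ?_⟩
      exact tot_add_single ω f S c
    · refine ⟨_, _, F.boson_an c f S, ?_⟩
      by_cases h0 : f c = 0
      · left; simp [h0]
      · right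
        intro A _ ω hω
        have h1 : f - Finsupp.single c 1 + Finsupp.single c 1 = f := by
          refine tsub_add_cancel_of_le fun d => ?_
          by_cases hd : d = c
          · subst hd; simp; omega
          · simp [Ne.symm hd]
        rw [hω]
        conv_rhs => rw [← h1]
        rw [tot_add_single, add_neg_cancel_right]
  · rcases label_cases tw p hp with ⟨c, rfl⟩ | ⟨c, hc, rfl⟩
    · by_cases hS : c ∈ S
      · by_cases hs : dualMode tw c.1 = c.1
        · obtain ⟨ε, -, h⟩ := F.fermion c (S.erase c) (Finset.notMem_erase c S)
          rw [Finset.insert_erase hS] at h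
          have h2 := (h f).2
          rw [hs] at h2
          refine ⟨_, _, h2, Or.inr fun ω hω => ?_⟩
          have h3 := tot_insert ω f (Finset.notMem_erase c S)
          rw [Finset.insert_erase hS] at h3
          have h4 := hω c.1
          rw [hs] at h4
          have h5 : ω c.1 + ω c.1 = 0 := by
            nth_rewrite 1 [h4]
            rw [neg_add_cancel]
          rw [h3, add_assoc, h5, add_zero]
        · exact ⟨0, (f, S), by rw [op, F.fermion_cr c hs f S hS, zero_smul], Or.inl rfl⟩
      · obtain ⟨ε, -, h⟩ := F.fermion c S hS
        exact ⟨_, _, (h f).1, Or.inr fun ω _ => tot_insert ω f hS⟩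
    · by_cases hS : c ∈ S
      · obtain ⟨ε, -, h⟩ := F.fermion c (S.erase c) (Finset.notMem_erase c S)
        rw [Finset.insert_erase hS] at h
        refine ⟨_, _, (h f).2, Or.inr fun ω hω => ?_⟩
        have h3 := tot_insert ω f (Finset.notMem_erase c S)
        rw [Finset.insert_erase hS] at h3
        rw [h3, hω, add_neg_cancel_right]
      · exact ⟨0, (f, S), by rw [op, F.fermion_an c hc f S hS, zero_smul], Or.inl rfl⟩

theorem op_mem_gr {A : Type} [AddCommGroup A] {ω : J m n e × ℤ → A}
    (hω : ∀ p, ω (dualMode tw p) = -ω p) (p : J m n e × ℤ) {x : A} {v : W} (hv : v ∈ F.gr ω x) :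
    F.op p v ∈ F.gr ω (x + ω p) := by
  induction hv using Submodule.span_induction with
  | mem v hv =>
    obtain ⟨i, rfl, rfl⟩ := hv
    obtain ⟨y, j, h1, h2⟩ := F.op_bas_cases p i
    rw [h1]
    rcases h2 with rfl | h2
    · rw [zero_smul]; exact zero_mem _
    · refine Submodule.smul_mem _ _ ?_
      rw [← h2 ω hω]
      exact F.bas_mem_gr ω j
  | zero => rw [map_zero]; exact zero_mem _
  | add v w _ _ h1 h2 => rw [map_add]; exact add_mem h1 h2
  | smul c v _ h => rw [map_smul]; exact Submodule.smul_mem _ _ h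

theorem op_mem_low {ω : J m n e × ℤ → ℤ} (hω : ∀ p, ω (dualMode tw p) = -ω p) (p : J m n e × ℤ)
    {N : ℤ} {v : W} (hv : v ∈ F.low ω N) : F.op p v ∈ F.low ω (N + ω p) := by
  induction hv using Submodule.span_induction with
  | mem v hv =>
    obtain ⟨i, hi, rfl⟩ := hv
    obtain ⟨y, j, h1, h2⟩ := F.op_bas_cases p i
    rw [h1]
    rcases h2 with rfl | h2
    · rw [zero_smul]; exact zero_mem _
    · refine Submodule.smul_mem _ _ (Submodule.subset_span ⟨j, ?_, rfl⟩)
      have hi' : tot ω i ≤ N := hi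
      have := h2 ω hω
      change tot ω j ≤ N + ω p
      omega
  | zero => rw [map_zero]; exact zero_mem _
  | add v w _ _ h1 h2 => rw [map_add]; exact add_mem h1 h2
  | smul c v _ h => rw [map_smul]; exact Submodule.smul_mem _ _ h

theorem low_mono (ω : J m n e × ℤ → ℤ) {N N' : ℤ} (h : N ≤ N') : F.low ω N ≤ F.low ω N' :=
  Submodule.span_mono (Set.image_mono fun _ hi => le_trans hi h)

theorem low_eq_bot {ω : J m n e × ℤ → ℤ} (hω : ∀ p, Cr tw p → 0 ≤ ω p) {N : ℤ} (hN : N < 0) :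
    F.low ω N = ⊥ := by
  rw [low, Submodule.span_eq_bot]
  rintro _ ⟨i, hi, rfl⟩
  have h1 : tot ω i ≤ N := hi
  have h2 := tot_nonneg hω i
  omega

theorem exists_mem_low (ω : J m n e × ℤ → ℤ) (v : W) : ∃ N : ℕ, v ∈ F.low ω N := by
  induction F.bas.mem_span v using Submodule.span_induction with
  | mem v hv =>
    obtain ⟨i, rfl⟩ := hv
    exact ⟨(tot ω i).toNat, Submodule.subset_span ⟨i, Int.self_le_toNat _, rfl⟩⟩
  | zero => exact ⟨0, zero_mem _⟩
  | add v w _ _ h1 h2 =>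
    obtain ⟨N1, h1⟩ := h1
    obtain ⟨N2, h2⟩ := h2
    exact ⟨max N1 N2, add_mem (F.low_mono ω (by simp) h1) (F.low_mono ω (by simp) h2)⟩
  | smul c v _ h =>
    obtain ⟨N, h⟩ := h
    exact ⟨N, Submodule.smul_mem _ _ h⟩

/-- A non-zero subspace has a non-zero vector of minimal degree. -/
theorem exists_min_low {ω : J m n e × ℤ → ℤ} (hω : ∀ p, Cr tw p → 0 ≤ ω p) {U : Submodule ℂ W}
    (hU : U ≠ ⊥) :
    ∃ (N : ℤ) (v : W), v ∈ U ∧ v ≠ 0 ∧ v ∈ F.low ω N ∧ ∀ M < N, ∀ w ∈ U, w ∈ F.low ω M → w = 0 := by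
  classical
  have h : ∃ N : ℕ, ∃ v ∈ U, v ≠ 0 ∧ v ∈ F.low ω N := by
    obtain ⟨v, hv, hv0⟩ := Submodule.exists_mem_ne_zero_of_ne_bot hU
    obtain ⟨N, hN⟩ := F.exists_mem_low ω v
    exact ⟨N, v, hv, hv0, hN⟩
  obtain ⟨v, hv, hv0, hvN⟩ := Nat.find_spec h
  refine ⟨Nat.find h, v, hv, hv0, hvN, fun M hM w hw hwM => ?_⟩
  by_contra hw0
  by_cases hM0 : M < 0
  · rw [F.low_eq_bot hω hM0, Submodule.mem_bot] at hwM
    exact hw0 hwM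
  · have := Nat.find_min (m := M.toNat) h (by omega)
    exact this ⟨w, hw, hw0, by rwa [Int.toNat_of_nonneg (by omega)]⟩

/-! ### Words and gradings -/

theorem bas_eq_word (i : Idx m n e tw) :
    ∃ (x : ℂ) (l : List (J m n e × ℤ)), F.bas i = x • F.word l ∧ (∀ p ∈ l, Cr tw p) ∧
      ∀ {A : Type} [AddCommMonoid A] (ω : J m n e × ℤ → A), (l.map ω).sum = tot ω i := by
  obtain ⟨f, S⟩ := i
  induction f using finsupp_nat_induction with
  | h0 =>
    induction S using Finset.induction_on with
    | empty =>
      exact ⟨1, [], by rw [one_smul, word_nil, F.vac_eq], by simp, fun ω => by simp [tot_zero]⟩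
    | insert c S hc ih =>
      obtain ⟨x, l, h1, h2, h3⟩ := ih
      obtain ⟨ε, hε, h⟩ := F.fermion c S hc
      refine ⟨ε * x, c.1 :: l, ?_, by simpa using ⟨c.2.2, fun a b => h2 (a, b)⟩, fun ω => ?_⟩
      · rw [word_cons, mul_smul, ← map_smul, ← h1, op, (h 0).1, smul_smul, hε, one_smul]
      · rw [List.map_cons, List.sum_cons, h3, tot_insert ω 0 hc, add_comm]
  | hs f c ih =>
    obtain ⟨x, l, h1, h2, h3⟩ := ih
    refine ⟨x, c.1 :: l, ?_, by simpa using ⟨c.2.2, fun a b => h2 (a, b)⟩, fun ω => ?_⟩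
    · rw [word_cons, ← map_smul, ← h1, op, F.boson_cr]
    · rw [List.map_cons, List.sum_cons, h3, tot_add_single, add_comm]

theorem word_mem_gr {A : Type} [AddCommGroup A] {ω : J m n e × ℤ → A}
    (hω : ∀ p, ω (dualMode tw p) = -ω p) (l : List (J m n e × ℤ)) :
    F.word l ∈ F.gr ω (l.map ω).sum := by
  induction l with
  | nil =>
    rw [word_nil, F.vac_eq, List.map_nil, List.sum_nil, ← tot_zero (tw := tw) ω]
    exact F.bas_mem_gr ω _
  | cons p l ih =>
    rw [word_cons, List.map_cons, List.sum_cons, add_comm]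
    exact F.op_mem_gr hω p ih

theorem gr_eq_span_word {A : Type} [AddCommGroup A] {ω : J m n e × ℤ → A}
    (hω : ∀ p, ω (dualMode tw p) = -ω p) (x : A) :
    F.gr ω x = Submodule.span ℂ {v | ∃ l : List (J m n e × ℤ), (l.map ω).sum = x ∧
      F.word l = v} := by
  apply le_antisymm
  · refine Submodule.span_le.mpr ?_
    rintro _ ⟨i, hi, rfl⟩
    obtain ⟨y, l, h1, -, h3⟩ := F.bas_eq_word i
    rw [h1]
    exact Submodule.smul_mem _ _ (Submodule.subset_span ⟨l, (h3 ω).trans hi, rfl⟩)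
  · refine Submodule.span_le.mpr ?_
    rintro _ ⟨l, rfl, rfl⟩
    exact F.word_mem_gr hω l

theorem mem_of_word {S : Submodule ℂ W} (h : ∀ l, F.word l ∈ S) (v : W) : v ∈ S := by
  induction F.bas.mem_span v using Submodule.span_induction with
  | mem v hv =>
    obtain ⟨i, rfl⟩ := hv
    obtain ⟨x, l, h1, -⟩ := F.bas_eq_word i
    rw [h1]
    exact S.smul_mem _ (h l)
  | zero => exact S.zero_mem
  | add v w _ _ h1 h2 => exact S.add_mem h1 h2
  | smul c v _ h => exact S.smul_mem _ h

theorem gr_disjoint {A : Type} [AddCommMonoid A] (ω : J m n e × ℤ → A) {x y : A} (h : x ≠ y) :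
    Disjoint (F.gr ω x) (F.gr ω y) :=
  F.bas.linearIndependent.disjoint_span_image
    (Set.disjoint_left.mpr fun _ hi hj => h (Eq.trans (Eq.symm hi) hj))

theorem gr_isCompl (ω : J m n e × ℤ → ZMod 2) : IsCompl (F.gr ω 0) (F.gr ω 1) := by
  refine ⟨F.gr_disjoint ω (by decide), codisjoint_iff.mpr ?_⟩
  rw [gr, gr, ← Submodule.span_union, ← Set.image_union, eq_top_iff, ← F.bas.span_eq]
  refine Submodule.span_mono ?_
  rintro _ ⟨i, rfl⟩
  exact ⟨i, zmod_two_cases (tot ω i), rfl⟩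

/-- The span of the words of parity `s`. -/
def parSub (s : ZMod 2) : Submodule ℂ W :=
  Submodule.span ℂ {v | ∃ l : List (J m n e × ℤ), (l.map fun p => p.1.par).sum = s ∧
    F.word l = v}

/-- The span of the words of degree `s` modulo two. -/
def degSub (s : ZMod 2) : Submodule ℂ W :=
  Submodule.span ℂ {v | ∃ l : List (J m n e × ℤ), (l.length : ZMod 2) = s ∧ F.word l = v}

/-- Parity of labels. -/
def parW (p : J m n e × ℤ) : ZMod 2 := p.1.par

/-- The degree of labels. -/
def degW (_ : J m n e × ℤ) : ZMod 2 := 1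

theorem zmod_two_neg (x : ZMod 2) : -x = x := by revert x; decide

theorem parW_dual (p : J m n e × ℤ) : parW (dualMode tw p) = -parW p := by
  rw [zmod_two_neg]; exact dualMode_par tw p

theorem degW_dual (p : J m n e × ℤ) : degW (dualMode tw p) = -degW p := (zmod_two_neg _).symm

theorem parSub_eq (s : ZMod 2) : F.parSub s = F.gr parW s := (F.gr_eq_span_word parW_dual s).symm

theorem degSub_eq (s : ZMod 2) : F.degSub s = F.gr degW s := by
  rw [F.gr_eq_span_word degW_dual s, degSub]
  congr 1
  ext v
  refine exists_congr fun l => and_congr_left fun _ => ?_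
  have : (l.map degW).sum = (l.length : ZMod 2) := by
    clear * -
    induction l with
    | nil => simp
    | cons a l ih => rw [List.map_cons, List.sum_cons, ih, List.length_cons, degW]; push_cast; ring
  rw [this]

/-- Twice the negated mode number. -/
def enW (tw : Bool) (p : J m n e × ℤ) : ℤ := -(2 * p.2 + shift tw)

theorem enW_dual (p : J m n e × ℤ) : enW tw (dualMode tw p) = -enW tw p := by
  simp only [enW, dualMode]; ring

theorem enW_nonneg (p : J m n e × ℤ) (h : Cr tw p) : 0 ≤ enW tw p := by
  rcases h with h | ⟨h1, h2, -⟩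
  · cases tw <;> simp [enW, shift] <;> omega
  · subst h1; simp [enW, shift, h2]

/-- The number of modes, not counting self-dual ones. -/
def redW (tw : Bool) (p : J m n e × ℤ) : ℤ :=
  if dualMode tw p = p then 0 else if Cr tw p then 1 else -1

theorem redW_dual (p : J m n e × ℤ) : redW tw (dualMode tw p) = -redW tw p := by
  unfold redW
  rw [dualMode_dualMode]
  by_cases h : dualMode tw p = p
  · simp [h]
  · rw [if_neg (Ne.symm h), if_neg h]
    by_cases hc : Cr tw p
    · rw [if_neg (not_cr_dualMode hc h), if_pos hc]
    · rw [if_pos (cr_dualMode_of_not hc), if_neg hc]; norm_num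

theorem redW_nonneg (p : J m n e × ℤ) (h : Cr tw p) : 0 ≤ redW tw p := by
  unfold redW
  split_ifs <;> norm_num

/-- Every vector is killed by all modes of sufficiently large mode number. -/
theorem exists_bound (v : W) : ∃ P : ℤ, ∀ (a : J m n e) (k : ℤ), P ≤ k → F.A a k v = 0 := by
  obtain ⟨N, hN⟩ := F.exists_mem_low (enW tw) v
  refine ⟨N + 1, fun a k hk => ?_⟩
  have h := F.op_mem_low enW_dual (a, k) hN
  rwa [F.low_eq_bot enW_nonneg, Submodule.mem_bot] at h
  cases tw <;> simp [enW, shift] <;> omega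

/-! ### Diagonal operators -/

/-- The operator whose eigenvectors are the basis monomials. -/
def diag (d : Idx m n e tw → ℂ) : Module.End ℂ W := F.bas.constr ℂ fun i => d i • F.bas i

theorem diag_bas (d : Idx m n e tw → ℂ) (i : Idx m n e tw) :
    F.diag d (F.bas i) = d i • F.bas i := F.bas.constr_basis ℂ _ i

theorem diag_tot_op {ω : J m n e × ℤ → ℂ} (hω : ∀ p, ω (dualMode tw p) = -ω p) (p : J m n e × ℤ)
    (v : W) : F.diag (tot ω) (F.op p v) = F.op p (F.diag (tot ω) v) + ω p • F.op p v := by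
  have h : F.diag (tot ω) ∘ₗ F.op p = F.op p ∘ₗ F.diag (tot ω) + ω p • F.op p := by
    refine F.bas.ext fun i => ?_
    rw [LinearMap.comp_apply, LinearMap.add_apply, LinearMap.comp_apply, LinearMap.smul_apply,
      diag_bas, map_smul]
    obtain ⟨y, j, h1, h2⟩ := F.op_bas_cases p i
    rw [h1]
    rcases h2 with rfl | h2
    · simp
    · rw [map_smul, diag_bas, h2 ω hω]
      module
  exact congrArg (fun T => T v) h

/-- An operator commuting with all modes is determined by its value at the vacuum. -/
theorem ext_of_commute {S T : Module.End ℂ W} (h0 : S F.vac = T F.vac)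
    (h : ∀ p v, S v = T v → S (F.op p v) = T (F.op p v)) : S = T := by
  refine LinearMap.ext fun v => ?_
  refine F.mem_of_word (S := LinearMap.eqLocus S T) (fun l => ?_) v
  induction l with
  | nil => exact h0
  | cons p l ih =>
    rw [word_cons]
    exact h p _ ih

/-! ### The contravariant form -/

/-- The norm of a basis monomial. -/
def nu (i : Idx m n e tw) : ℂ :=
  (i.1.prod fun c k => (k.factorial : ℂ) * c.1.1.sgn ^ k) *
    ∏ c ∈ i.2, if dualMode tw c.1 = c.1 then 1 / 2 else 1

theorem nu_ne_zero (i : Idx m n e tw) : nu i ≠ 0 := by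
  refine mul_ne_zero (Finset.prod_ne_zero_iff.mpr fun c _ => ?_)
    (Finset.prod_ne_zero_iff.mpr fun c _ => by split_ifs <;> norm_num)
  exact mul_ne_zero (by exact_mod_cast Nat.factorial_ne_zero _) (pow_ne_zero _ (J.sgn_ne_zero _))

theorem nu_add_single (f : CrMode m n e tw 0 →₀ ℕ) (S : Finset (CrMode m n e tw 1))
    (c : CrMode m n e tw 0) :
    nu (f + Finsupp.single c 1, S) = c.1.1.sgn * (f c + 1) * nu (f, S) := by
  unfold nu
  have h : ((f + Finsupp.single c 1).prod fun c k => (k.factorial : ℂ) * c.1.1.sgn ^ k) =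
      c.1.1.sgn * (f c + 1) * f.prod fun c k => (k.factorial : ℂ) * c.1.1.sgn ^ k := by
    have h1 : (f + Finsupp.single c 1).support ⊆ insert c f.support := by
      intro d hd
      by_cases hdc : d = c
      · simp [hdc]
      · have : f d ≠ 0 := by simpa [Finsupp.single_apply, Ne.symm hdc] using hd
        simp [this]
    rw [Finsupp.prod_of_support_subset _ h1 _ (by simp),
      Finsupp.prod_of_support_subset f (Finset.subset_insert c f.support) _ (by simp),
      ← Finset.mul_prod_erase _ _ (Finset.mem_insert_self c f.support),
      ← Finset.mul_prod_erase _ _ (Finset.mem_insert_self c f.support)]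
    have h2 : ∀ d ∈ (insert c f.support).erase c,
        (f + Finsupp.single c 1 : CrMode m n e tw 0 →₀ ℕ) d = f d := by
      intro d hd
      simp [(Finset.ne_of_mem_erase hd).symm]
    rw [Finset.prod_congr rfl fun d hd => by rw [h2 d hd]]
    simp only [Finsupp.add_apply, Finsupp.single_eq_same, pow_succ, Nat.factorial_succ]
    push_cast
    ring
  rw [h, mul_assoc]

theorem nu_insert (f : CrMode m n e tw 0 →₀ ℕ) {S : Finset (CrMode m n e tw 1)}
    {c : CrMode m n e tw 1} (h : c ∉ S) :
    nu (f, insert c S) = (if dualMode tw c.1 = c.1 then 1 / 2 else 1) * nu (f, S) := by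
  unfold nu
  rw [Finset.prod_insert h]
  ring

/-- The symmetric bilinear form for which the basis monomials are orthogonal with norms `nu`. -/
def bform : W →ₗ[ℂ] W →ₗ[ℂ] ℂ := F.bas.constr ℂ fun i => nu i • F.bas.coord i

theorem bform_bas_left (i : Idx m n e tw) (v : W) :
    F.bform (F.bas i) v = nu i * F.bas.repr v i := by
  rw [bform, F.bas.constr_basis]
  rfl

theorem bform_bas (i j : Idx m n e tw) :
    F.bform (F.bas i) (F.bas j) = if i = j then nu i else 0 := by
  rw [bform_bas_left, F.bas.repr_self, Finsupp.single_apply]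
  simp [eq_comm]

theorem bform_symm (v w : W) : F.bform v w = F.bform w v := by
  have h : F.bform = F.bform.flip := by
    refine F.bas.ext fun i => F.bas.ext fun j => ?_
    rw [LinearMap.flip_apply, bform_bas, bform_bas]
    by_cases h : i = j
    · subst h; simp
    · simp [h, Ne.symm h]
  exact congrArg (fun T => T v w) h

/-- The sign in the adjunction of modes. -/
def kap (a : J m n e) : ℂ := if a.par = 0 then -1 else 1

theorem kap_mul_self (a : J m n e) : kap a * kap a = 1 := by unfold kap; split_ifs <;> norm_num

theorem kap_conj (a : J m n e) : kap a.conj = kap a := by rw [kap, par_conj, kap]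

theorem bform_op_cr (p : J m n e × ℤ) (hp : Cr tw p) (v w : W) :
    F.bform (F.op p v) w = kap p.1 * F.bform v (F.op (dualMode tw p) w) := by
  have h : F.bform.comp (F.op p) = kap p.1 • F.bform.compl₂ (F.op (dualMode tw p)) := by
    refine F.bas.ext fun i => F.bas.ext fun j => ?_
    rw [LinearMap.comp_apply, LinearMap.smul_apply, LinearMap.smul_apply, LinearMap.compl₂_apply,
      smul_eq_mul]
    obtain ⟨f, S⟩ := i
    obtain ⟨g, T⟩ := j
    rcases zmod_two_cases p.1.par with h0 | h0
    · obtain ⟨c, rfl⟩ : ∃ c : CrMode m n e tw 0, c.1 = p := ⟨⟨p, h0, hp⟩, rfl⟩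
      rw [op, op, F.boson_cr, F.boson_an, map_smul, bform_bas, bform_bas, kap, if_pos h0,
        J.sgn_conj_of_even h0, nu_add_single]
      by_cases hg : g c = 0
      · have : f + Finsupp.single c 1 ≠ g := by
          rintro rfl
          simp at hg
        simp [hg, this]
      · have h1 : (f + Finsupp.single c 1 = g) ↔ f = g - Finsupp.single c 1 := by
          have h2 : g - Finsupp.single c 1 + Finsupp.single c 1 = g := by
            refine tsub_add_cancel_of_le fun d => ?_
            by_cases hd : d = c
            · subst hd; simp; omega
            · simp [Ne.symm hd]
          constructor
          · rintro rfl; simp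
          · intro h; rw [h, h2]
        simp only [Prod.mk.injEq, h1]
        by_cases h3 : f = g - Finsupp.single c 1 ∧ S = T
        · rw [if_pos h3, if_pos h3]
          have h4 : g = f + Finsupp.single c 1 := (h1.mpr h3.1).symm
          rw [h4]
          simp
        · rw [if_neg h3, if_neg h3]; simp
    · obtain ⟨c, rfl⟩ : ∃ c : CrMode m n e tw 1, c.1 = p := ⟨⟨p, h0, hp⟩, rfl⟩
      have hk : kap c.1.1 = 1 := by rw [kap, h0]; simp
      rw [hk, one_mul]
      have key : ∀ S T : Finset (CrMode m n e tw 1), c ∉ S → c ∈ T → ∀ f g,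
          F.bform (F.op c.1 (F.bas (f, S))) (F.bas (g, T)) =
          F.bform (F.bas (f, S)) (F.op (dualMode tw c.1) (F.bas (g, T))) := by
        intro S T hS hT f g
        obtain ⟨ε, -, h1⟩ := F.fermion c S hS
        obtain ⟨δ, -, h2⟩ := F.fermion c (T.erase c) (Finset.notMem_erase c T)
        rw [op, op, (h1 f).1]
        by_cases hST : S = T.erase c
        · subst hST
          have h3 := (h1 g).2
          rw [Finset.insert_erase hT] at h3 ⊢
          rw [h3, map_smul, map_smul, LinearMap.smul_apply, bform_bas, bform_bas]
          by_cases hfg : f = g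
          · subst hfg
            have h4 := nu_insert f (Finset.notMem_erase c T)
            rw [Finset.insert_erase hT] at h4
            rw [if_pos rfl, if_pos rfl, h4, smul_eq_mul, smul_eq_mul]
            ring
          · simp [hfg]
        · have h3 := (h2 g).2
          rw [Finset.insert_erase hT] at h3
          have h4 : insert c S ≠ T := by
            rintro rfl
            exact hST (Finset.erase_insert hS).symm
          rw [h3, map_smul, map_smul, LinearMap.smul_apply, bform_bas, bform_bas]
          simp [hST, h4]
      have bz : ∀ S T : Finset (CrMode m n e tw 1), c ∉ S → c ∈ T → ∀ f g,
          F.bform (F.bas (f, S)) (F.bas (g, T)) = 0 := by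
        intro S T hS hT f g
        rw [bform_bas, if_neg]
        intro h
        simp only [Prod.mk.injEq] at h
        exact hS (h.2 ▸ hT)
      by_cases hS : c ∈ S
      · by_cases hT : c ∈ T
        · obtain ⟨ε, -, h1⟩ := F.fermion c (S.erase c) (Finset.notMem_erase c S)
          obtain ⟨δ, -, h2⟩ := F.fermion c (T.erase c) (Finset.notMem_erase c T)
          have h3 := (h2 g).2
          rw [Finset.insert_erase hT] at h3
          have h5 : F.bform (F.op c.1 (F.bas (f, S))) (F.bas (g, T)) = 0 := by
            by_cases hs : dualMode tw c.1 = c.1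
            · have h4 := (h1 f).2
              rw [Finset.insert_erase hS, hs] at h4
              rw [op, h4, map_smul, LinearMap.smul_apply, bz _ _ (Finset.notMem_erase c S) hT,
                smul_zero]
            · rw [op, F.fermion_cr c hs f S hS, map_zero, LinearMap.zero_apply]
          rw [h5, op, h3, map_smul, F.bform_symm, bz _ _ (Finset.notMem_erase c T) hS, smul_zero]
        · by_cases hs : dualMode tw c.1 = c.1
          · have := key T S hT hS g f
            rw [hs] at this ⊢
            rw [F.bform_symm, ← this, F.bform_symm]
          · rw [op, op, F.fermion_cr c hs f S hS, F.fermion_an c hs g T hT]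
            simp
      · by_cases hT : c ∈ T
        · exact key S T hS hT f g
        · obtain ⟨ε, -, h1⟩ := F.fermion c S hS
          obtain ⟨δ, -, h2⟩ := F.fermion c T hT
          have h5 : F.bform (F.bas (f, S)) (F.op (dualMode tw c.1) (F.bas (g, T))) = 0 := by
            by_cases hs : dualMode tw c.1 = c.1
            · rw [op, hs, (h2 g).1, map_smul, bz _ _ hS (Finset.mem_insert_self c T), smul_zero]
            · rw [op, F.fermion_an c hs g T hT, map_zero]
          rw [h5, op, (h1 f).1, map_smul, LinearMap.smul_apply, F.bform_symm,
            bz _ _ hT (Finset.mem_insert_self c S), smul_zero]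
  exact congrArg (fun T => T v w) h

theorem bform_op (p : J m n e × ℤ) (v w : W) :
    F.bform (F.op p v) w = kap p.1 * F.bform v (F.op (dualMode tw p) w) := by
  by_cases hp : Cr tw p
  · exact F.bform_op_cr p hp v w
  · have h := F.bform_op_cr (dualMode tw p) (cr_dualMode_of_not hp) w v
    have hk : kap (dualMode tw p).1 = kap p.1 := kap_conj p.1
    rw [dualMode_dualMode, hk] at h
    rw [F.bform_symm v, h, ← mul_assoc, kap_mul_self, one_mul, F.bform_symm]

/-! ### Irreducibility under the modes -/

theorem op_vac_of_not (p : J m n e × ℤ) (hp : ¬ Cr tw p) : F.op p F.vac = 0 := by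
  rw [F.vac_eq]
  rcases zmod_two_cases p.1.par with h0 | h0
  · rcases label_cases tw p h0 with ⟨c, rfl⟩ | ⟨c, hc, rfl⟩
    · exact (hp c.2.2).elim
    · rw [op, F.boson_an]; simp
  · rcases label_cases tw p h0 with ⟨c, rfl⟩ | ⟨c, hc, rfl⟩
    · exact (hp c.2.2).elim
    · rw [op, F.fermion_an c hc 0 ∅ (Finset.notMem_empty c)]

theorem op_vac_ne_zero (p : J m n e × ℤ) (hp : Cr tw p) : F.op p F.vac ≠ 0 := by
  rw [F.vac_eq]
  rcases zmod_two_cases p.1.par with h0 | h0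
  · obtain ⟨c, rfl⟩ : ∃ c : CrMode m n e tw 0, c.1 = p := ⟨⟨p, h0, hp⟩, rfl⟩
    rw [op, F.boson_cr]
    exact F.bas.ne_zero _
  · obtain ⟨c, rfl⟩ : ∃ c : CrMode m n e tw 1, c.1 = p := ⟨⟨p, h0, hp⟩, rfl⟩
    obtain ⟨ε, hε, h1⟩ := F.fermion c ∅ (Finset.notMem_empty c)
    rw [op, (h1 0).1]
    refine smul_ne_zero ?_ (F.bas.ne_zero _)
    rintro rfl
    norm_num at hε

theorem op_vac_eq_zero_iff (p : J m n e × ℤ) : F.op p F.vac = 0 ↔ ¬ Cr tw p :=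
  ⟨fun h hp => F.op_vac_ne_zero p hp h, F.op_vac_of_not p⟩

/-- A vector killed by `p` has no component along monomials containing the dual mode of `p`. -/
theorem repr_eq_zero_of_op {p : J m n e × ℤ} {v w : W} (hv : F.op (dualMode tw p) v = 0)
    {x : ℂ} (hx : x ≠ 0) {i : Idx m n e tw} (hw : F.op p w = x • F.bas i) : F.bas.repr v i = 0 := by
  have h := F.bform_op p w v
  rw [hv, map_zero, mul_zero, hw, map_smul, LinearMap.smul_apply, bform_bas_left, smul_eq_mul] at h
  simpa [hx, nu_ne_zero] using h

/-- A vector killed by all annihilation operators is a combination of monomials in self-dual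
modes. -/
theorem repr_eq_zero_of_killed {v : W} (hv : ∀ p, ¬ Cr tw p → F.op p v = 0) {i : Idx m n e tw}
    (hi : i.1 ≠ 0 ∨ ∃ c ∈ i.2, dualMode tw c.1 ≠ c.1) : F.bas.repr v i = 0 := by
  obtain ⟨f, S⟩ := i
  rcases hi with hf | ⟨c, hc, hcs⟩
  · obtain ⟨c, hc⟩ := Finsupp.ne_iff.mp hf
    have h2 : f - Finsupp.single c 1 + Finsupp.single c 1 = f := by
      refine tsub_add_cancel_of_le fun d => ?_
      by_cases hd : d = c
      · subst hd
        simp only [Finsupp.coe_zero, Pi.zero_apply] at hc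
        simp; omega
      · simp [Ne.symm hd]
    refine F.repr_eq_zero_of_op (p := c.1) (w := F.bas (f - Finsupp.single c 1, S))
      (hv _ (not_cr_dualMode c.2.2 (dualMode_ne_of_even c.2.1))) one_ne_zero ?_
    rw [op, F.boson_cr, h2, one_smul]
  · obtain ⟨ε, hε, h1⟩ := F.fermion c (S.erase c) (Finset.notMem_erase c S)
    rw [Finset.insert_erase hc] at h1
    refine F.repr_eq_zero_of_op (p := c.1) (w := F.bas (f, S.erase c))
      (hv _ (not_cr_dualMode c.2.2 hcs)) ?_ (h1 f).1
    rintro rfl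
    norm_num at hε

theorem exists_of_dualMode_eq {p : J m n e × ℤ} (h : dualMode tw p = p) :
    ∃ i, p = (J.z i, 0) ∧ tw = true := by
  obtain ⟨a, k⟩ := p
  cases a <;> cases tw <;> simp [dualMode, J.conj, shift] at h ⊢ <;> omega

/-- A vector killed by all annihilation operators is a combination of the vacuum and, in the
twisted sector for odd `M`, the vector `ψ_0 |0⟩`. -/
theorem mem_span_of_killed (he : e ≤ 1) {v : W} (hv : ∀ p, ¬ Cr tw p → F.op p v = 0) :
    ∃ (x y : ℂ) (w : W), v = x • F.vac + y • w ∧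
      (y = 0 ∨ tw = true ∧ ∃ i : Fin e, w = F.op (J.z i, 0) F.vac) := by
  have hz : ∀ i, (i.1 ≠ 0 ∨ ∃ c ∈ i.2, dualMode tw c.1 ≠ c.1) → F.bas.repr v i = 0 :=
    fun i hi => F.repr_eq_zero_of_killed hv hi
  by_cases hs : ∃ c : CrMode m n e tw 1, dualMode tw c.1 = c.1
  · obtain ⟨c, hc⟩ := hs
    obtain ⟨i, hi, htw⟩ := exists_of_dualMode_eq hc
    have huniq : ∀ d : CrMode m n e tw 1, dualMode tw d.1 = d.1 → d = c := by
      intro d hd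
      obtain ⟨j, hj, -⟩ := exists_of_dualMode_eq hd
      apply Subtype.ext
      rw [hi, hj]
      congr 2
      ext
      omega
    obtain ⟨ε, hε, h1⟩ := F.fermion c ∅ (Finset.notMem_empty c)
    refine ⟨F.bas.repr v (0, ∅), ε * F.bas.repr v (0, insert c ∅), F.op (J.z i, 0) F.vac, ?_,
      Or.inr ⟨htw, i, rfl⟩⟩
    rw [← hi, op, F.vac_eq, (h1 0).1, smul_smul, mul_right_comm, hε, one_mul]
    apply F.bas.repr.injective
    ext j
    simp only [map_add, map_smul, F.bas.repr_self, Finsupp.add_apply, Finsupp.smul_apply,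
      Finsupp.single_apply, smul_eq_mul]
    by_cases hj1 : ((0, ∅) : Idx m n e tw) = j
    · subst hj1
      simp
    · by_cases hj2 : ((0, insert c ∅) : Idx m n e tw) = j
      · subst hj2
        simp
      · rw [if_neg hj1, if_neg hj2, hz j]
        · simp
        · by_contra hcon
          push Not at hcon
          obtain ⟨hf, hS⟩ := hcon
          have hS' : j.2 ⊆ {c} := fun d hd => Finset.mem_singleton.mpr (huniq d (hS d hd))
          rcases Finset.subset_singleton_iff.mp hS' with h | h
          · exact hj1 (Prod.ext hf.symm h.symm)
          · exact hj2 (Prod.ext hf.symm (by rw [h]; rfl))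
  · refine ⟨F.bas.repr v (0, ∅), 0, 0, ?_, Or.inl rfl⟩
    rw [F.vac_eq, smul_zero, add_zero]
    apply F.bas.repr.injective
    ext j
    simp only [map_smul, F.bas.repr_self, Finsupp.smul_apply, Finsupp.single_apply, smul_eq_mul]
    by_cases hj1 : ((0, ∅) : Idx m n e tw) = j
    · subst hj1
      simp
    · rw [if_neg hj1, hz j]
      · simp
      · by_contra hcon
        push Not at hcon hs
        obtain ⟨hf, hS⟩ := hcon
        refine hj1 (Prod.ext hf.symm ?_)
        symm
        rw [Finset.eq_empty_iff_forall_notMem]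
        exact fun d hd => hs d (hS d hd)

theorem redW_of_not {p : J m n e × ℤ} (hp : ¬ Cr tw p) : redW tw p = -1 := by
  unfold redW
  rw [if_neg, if_neg hp]
  intro h
  exact hp (h ▸ cr_dualMode_of_not hp)

theorem vac_mem_gr {A : Type} [AddCommGroup A] (ω : J m n e × ℤ → A) : F.vac ∈ F.gr ω 0 := by
  rw [F.vac_eq, ← tot_zero (tw := tw) ω]
  exact F.bas_mem_gr ω _

theorem zmode_zmode (i : Fin e) (v : W) (htw : tw = true) :
    F.op (J.z i, 0) (F.op (J.z i, 0) v) = (1 / 2 : ℂ) • v := by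
  have h := F.ccr (J.z i) (J.z i) 0 0 v
  subst htw
  simp only [J.par, kz, shift, B, J.conj, J.sgn, and_self, if_true, add_zero, one_smul] at h
  change F.A _ _ (F.A _ _ v) = _
  have h2 : (2 : ℂ) • F.A (J.z i) 0 (F.A (J.z i) 0 v) = v := by
    rw [two_smul]
    nth_rewrite 1 [h]
    module
  have h3 := congrArg (fun x => (1 / 2 : ℂ) • x) h2
  simp only [smul_smul] at h3
  norm_num at h3 ⊢
  exact h3

theorem eq_bot_or_eq_top (he : e ≤ 1) {S : Submodule ℂ W} (hg : IsGraded F.parSub S)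
    (hS : ∀ a k, ∀ v ∈ S, F.A a k v ∈ S) : S = ⊥ ∨ S = ⊤ := by
  by_cases hbot : S = ⊥
  · exact Or.inl hbot
  right
  suffices hvac : F.vac ∈ S by
    refine eq_top_iff.mpr fun v _ => F.mem_of_word (fun l => ?_) v
    induction l with
    | nil => exact hvac
    | cons p l ih => rw [word_cons]; exact hS _ _ _ ih
  obtain ⟨N, v, hv, hv0, hvN, hmin⟩ := F.exists_min_low redW_nonneg hbot
  have hkill : ∀ p, ¬ Cr tw p → F.op p v = 0 := fun p hp =>
    hmin (N + redW tw p) (by rw [redW_of_not hp]; omega) _ (hS _ _ _ hv)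
      (F.op_mem_low redW_dual p hvN)
  obtain ⟨x, y, w, hvw, hy⟩ := F.mem_span_of_killed he hkill
  have hvac0 : F.vac ∈ F.parSub 0 := by
    rw [parSub_eq]
    exact F.vac_mem_gr _
  rcases hy with rfl | ⟨htw, i, rfl⟩
  · have hx : x ≠ 0 := by
      rintro rfl
      simp at hvw
      exact hv0 hvw
    rw [zero_smul, add_zero] at hvw
    exact (S.smul_mem_iff hx).mp (hvw ▸ hv)
  · have hw1 : F.op (J.z i, 0) F.vac ∈ F.parSub 1 := by
      rw [parSub_eq] at hvac0 ⊢
      have := F.op_mem_gr parW_dual (J.z i, 0) hvac0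
      rwa [zero_add] at this
    have hv' := hv
    rw [hg] at hv'
    obtain ⟨v0, hv0', v1, hv1', hsum⟩ := Submodule.mem_sup.mp hv'
    have hdisj : Disjoint (F.parSub 0) (F.parSub 1) := by
      rw [parSub_eq, parSub_eq]
      exact F.gr_disjoint _ (by decide)
    have e1 : v0 - x • F.vac = y • F.op (J.z i, 0) F.vac - v1 := by
      rw [sub_eq_sub_iff_add_eq_add, hsum, hvw]
      abel
    have e2 : v0 - x • F.vac = 0 := by
      refine Submodule.disjoint_def.mp hdisj _ (sub_mem hv0'.2 (Submodule.smul_mem _ _ hvac0)) ?_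
      rw [e1]
      exact sub_mem (Submodule.smul_mem _ _ hw1) hv1'.2
    by_cases hx : x = 0
    · have hy0 : y ≠ 0 := by
        rintro rfl
        rw [hx] at hvw
        simp at hvw
        exact hv0 hvw
      rw [e2] at e1
      have e3 : y • F.op (J.z i, 0) F.vac ∈ S := by
        rw [sub_eq_zero.mp e1.symm]
        exact hv1'.1
      have e4 := hS (J.z i) 0 _ ((S.smul_mem_iff hy0).mp e3)
      have e5 := F.zmode_zmode i F.vac htw
      change F.A _ _ _ = _ at e5
      rw [e5] at e4
      exact (S.smul_mem_iff (by norm_num)).mp e4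
    · exact (S.smul_mem_iff hx).mp (sub_eq_zero.mp e2 ▸ hv0'.1)

end SuperFock

/-! ### The form on `V` and the relations of `osp(M|N)` in coordinates -/

theorem B_conj (a : J m n e) : B a a.conj = a.sgn := if_pos rfl

theorem B_conj_left (a : J m n e) : B a.conj a = a.conj.sgn := if_pos (J.conj_conj a).symm

theorem B_eq_zero {a b : J m n e} (h : b ≠ a.conj) : B a b = 0 := if_neg h

theorem B_eq_ite (a b : J m n e) : B a b = if a = b.conj then b.conj.sgn else 0 := by
  unfold B
  by_cases h : a = b.conj
  · rw [if_pos (by rw [h, J.conj_conj]), if_pos h, h]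
  · rw [if_neg (fun h' => h (by rw [h', J.conj_conj])), if_neg h]

theorem sgn_conj_eq (a : J m n e) : a.conj.sgn = -kz a.par a.par * a.sgn := by
  cases a <;> simp [J.sgn, J.conj, J.par, kz]

theorem kz_B_left (s : ZMod 2) (a b : J m n e) : kz s a.par * B a b = kz s b.par * B a b := by
  by_cases h : b = a.conj
  · rw [h, par_conj]
  · rw [B_eq_zero h]; simp

theorem osp_apply {s : ZMod 2} (X : osp m n e s) (a b : J m n e) :
    X.1 a b = -kz s b.par * b.sgn * a.sgn * X.1 b.conj a.conj := by
  have h := X.2.2 b a.conj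
  have h1 : ∑ c, X.1 c b * B c a.conj = X.1 a b * a.sgn := by
    rw [Finset.sum_eq_single a, B_conj]
    · intro c _ hc
      rw [B_eq_zero fun h => hc (J.conj_injective h).symm, mul_zero]
    · simp
  have h2 : ∑ c, B b c * X.1 c a.conj = b.sgn * X.1 b.conj a.conj := by
    rw [Finset.sum_eq_single b.conj, B_conj]
    · intro c _ hc
      rw [B_eq_zero hc, zero_mul]
    · simp
  rw [h1, h2] at h
  linear_combination a.sgn * h - X.1 a b * J.sgn_mul_self a

theorem osp_par {s : ZMod 2} (X : osp m n e s) {a b : J m n e} (h : X.1 a b ≠ 0) :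
    a.par + b.par = s := by
  by_contra h'
  exact h (X.2.1 a b h')

theorem kz_osp {s : ZMod 2} (X : osp m n e s) (t : ZMod 2) (a b : J m n e) :
    kz a.par t * kz b.par t * X.1 a b = kz s t * X.1 a b := by
  by_cases h : X.1 a b = 0
  · simp [h]
  · rw [← kz_mul, osp_par X h]

theorem sum_conj {M : Type*} [AddCommMonoid M] (f : J m n e → M) :
    ∑ a : J m n e, f a.conj = ∑ a, f a :=
  Function.Bijective.sum_comp
    ⟨J.conj_injective, fun a => ⟨a.conj, J.conj_conj a⟩⟩ f

namespace SuperFock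

variable {tw : Bool} {W : Type} [AddCommGroup W] [Module ℂ W] (F : SuperFock m n e tw W)

/-! ### Normally ordered products -/

/-- The `k`-th term of the product of two fields, ordered by mode numbers with cut-off `K`. -/
def term (K : ℤ) (a b : J m n e) (r : ℤ) (v : W) (k : ℤ) : W :=
  if k < K then F.A a k (F.A b (r - shift tw - k) v)
  else kz a.par b.par • F.A b (r - shift tw - k) (F.A a k v)

theorem term_support (K : ℤ) (a b : J m n e) (r : ℤ) (v : W) :
    (Function.support (F.term K a b r v)).Finite := by
  obtain ⟨P, hP⟩ := F.exists_bound v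
  refine (Set.finite_Ico (min (r - shift tw - P) K) (max P K)).subset fun k hk => ?_
  by_contra hk'
  apply hk
  simp only [Set.mem_Ico, not_and_or, not_le, not_lt] at hk'
  rw [term]
  split_ifs with h
  · rw [hP b (r - shift tw - k) (by omega), map_zero]
  · rw [hP a k (by omega), map_zero, smul_zero]

/-- The product of two fields, ordered by mode numbers with cut-off `K`. -/
def nord (K : ℤ) (a b : J m n e) (r : ℤ) : Module.End ℂ W where
  toFun v := ∑ᶠ k, F.term K a b r v k
  map_add' v w := by
    rw [← finsum_add_distrib (F.term_support K a b r v) (F.term_support K a b r w)]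
    refine finsum_congr fun k => ?_
    unfold term
    split_ifs <;> simp
  map_smul' x v := by
    rw [RingHom.id_apply, smul_finsum' x (F.term_support K a b r v)]
    refine finsum_congr fun k => ?_
    unfold term
    split_ifs
    · simp
    · simp only [map_smul, smul_comm x]

theorem nord_apply (K : ℤ) (a b : J m n e) (r : ℤ) (v : W) :
    F.nord K a b r v = ∑ᶠ k, F.term K a b r v k := rfl

theorem nord_succ (K : ℤ) (a b : J m n e) (r : ℤ) (v : W) :
    F.nord (K + 1) a b r v = F.nord K a b r v + (if r = 0 then B a b else 0) • v := by
  have h : ∀ k, F.term (K + 1) a b r v k =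
      F.term K a b r v k + if k = K then (if r = 0 then B a b else 0) • v else 0 := by
    intro k
    unfold term
    by_cases hk : k = K
    · subst hk
      rw [if_pos (by omega), if_neg (by omega), if_pos rfl, F.ccr]
      congr 2
      simp
    · rw [if_neg hk, add_zero]
      by_cases h : k < K
      · rw [if_pos (by omega), if_pos h]
      · rw [if_neg (by omega), if_neg h]
  rw [nord_apply, finsum_congr h, finsum_add_distrib (F.term_support K a b r v), nord_apply,
    finsum_eq_single _ K fun k hk => if_neg hk, if_pos rfl]
  exact (Set.finite_singleton K).subset fun k hk => by
    by_contra h'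
    exact hk (if_neg h')

theorem nord_eq (K : ℤ) (a b : J m n e) (r : ℤ) (v : W) :
    F.nord K a b r v = F.nord 0 a b r v + ((K : ℂ) * if r = 0 then B a b else 0) • v := by
  induction K using Int.induction_on with
  | zero => simp
  | succ K ih =>
    rw [nord_succ, ih, add_assoc, ← add_smul]
    congr 2
    push_cast
    ring
  | pred K ih =>
    have h := F.nord_succ (-(K : ℤ) - 1) a b r v
    rw [sub_add_cancel] at h
    rw [h] at ih
    rw [eq_sub_of_add_eq ih, add_sub_assoc, ← sub_smul]
    congr 2
    push_cast
    ring

/-- The normally ordered product of two fields. -/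
def normOrd (a b : J m n e) (r : ℤ) (v : W) : W :=
  (∑ᶠ k : ℤ, if Cr tw (a, k) then F.A a k (F.A b (r - shift tw - k) v)
    else kz a.par b.par • F.A b (r - shift tw - k) (F.A a k v)) -
  (if r = 0 then sConst tw a * B a b else 0) • v

/-- Half of the twist. -/
def twc (tw : Bool) : ℂ := if tw then 1 / 2 else 0

/-- The normally ordered product of two fields, as an operator. -/
def bil (a b : J m n e) (r : ℤ) : Module.End ℂ W :=
  F.nord 0 a b r + (twc tw * if r = 0 then B a b else 0) • 1

theorem bil_apply (a b : J m n e) (r : ℤ) (v : W) :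
    F.bil a b r v = F.nord 0 a b r v + (twc tw * if r = 0 then B a b else 0) • v := rfl

theorem normOrd_eq (a b : J m n e) (r : ℤ) (v : W) : F.normOrd a b r v = F.bil a b r v := by
  obtain ⟨K, hK, hs⟩ : ∃ K : ℤ, (∀ k, Cr tw (a, k) ↔ k < K) ∧ (K : ℂ) - sConst tw a = twc tw := by
    cases tw with
    | false => exact ⟨0, fun k => by simp [Cr], by simp [sConst, twc]⟩
    | true =>
      by_cases ha : a.low = true
      · refine ⟨1, fun k => ?_, by simp [sConst, twc, ha]; norm_num⟩
        simp only [Cr, ha, and_true, true_and]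
        omega
      · refine ⟨0, fun k => by simp [Cr, ha], by simp [sConst, twc, ha]; norm_num⟩
  have h : F.normOrd a b r v = F.nord K a b r v -
      (if r = 0 then sConst tw a * B a b else 0) • v := by
    unfold normOrd
    rw [nord_apply]
    congr 1
    refine finsum_congr fun k => ?_
    unfold term
    simp only [hK]
  rw [h, nord_eq, bil_apply, add_sub_assoc, ← sub_smul, ← hs]
  congr 2
  split_ifs <;> ring

theorem nord_mem {S : Submodule ℂ W} {K : ℤ} {a b : J m n e} {r : ℤ} {v : W}
    (h : ∀ k, F.term K a b r v k ∈ S) : F.nord K a b r v ∈ S := by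
  rw [nord_apply]
  exact finsum_induction (· ∈ S) S.zero_mem (fun _ _ h1 h2 => S.add_mem h1 h2) h

theorem op_op_op (a b c : J m n e) (k j l : ℤ) (v : W) :
    F.A a k (F.A b j (F.A c l v)) =
      (kz a.par c.par * kz b.par c.par) • F.A c l (F.A a k (F.A b j v)) +
      ((if j + l + shift tw = 0 then B b c else 0) • F.A a k v +
        (kz b.par c.par * if k + l + shift tw = 0 then B a c else 0) • F.A b j v) := by
  rw [F.ccr b c, map_add, map_smul, map_smul, F.ccr a c]
  module

/-- Commutator of a normally ordered product with a mode. -/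
theorem nord_comm (a b c : J m n e) (r l : ℤ) (v : W) :
    F.nord 0 a b r (F.A c l v) = (kz a.par c.par * kz b.par c.par) • F.A c l (F.nord 0 a b r v) +
      (B b c • F.A a (r + l) v + (kz b.par c.par * B a c) • F.A b (r + l) v) := by
  have h : ∀ k, F.term 0 a b r (F.A c l v) k =
      (kz a.par c.par * kz b.par c.par) • F.A c l (F.term 0 a b r v k) +
      ((if k = r + l then B b c • F.A a (r + l) v else 0) +
        if k = -l - shift tw then (kz b.par c.par * B a c) • F.A b (r + l) v else 0) := by
    intro k
    have e1 : (if k = r + l then B b c • F.A a (r + l) v else 0) =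
        (if r - shift tw - k + l + shift tw = 0 then B b c else 0) • F.A a k v := by
      by_cases hk : k = r + l
      · rw [if_pos hk, if_pos (by omega), hk]
      · rw [if_neg hk, if_neg (by omega), zero_smul]
    have e2 : (if k = -l - shift tw then (kz b.par c.par * B a c) • F.A b (r + l) v else 0) =
        (kz b.par c.par * if k + l + shift tw = 0 then B a c else 0) •
          F.A b (r - shift tw - k) v := by
      by_cases hk : k = -l - shift tw
      · have hk' : r + l = r - shift tw - k := by omega
        rw [if_pos hk, if_pos (by omega), hk']
      · rw [if_neg hk, if_neg (by omega), mul_zero, zero_smul]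
    rw [e1, e2]
    unfold term
    by_cases h1 : k < 0
    · rw [if_pos h1, if_pos h1]
      exact F.op_op_op a b c _ _ _ v
    · rw [if_neg h1, if_neg h1, F.op_op_op b a c, map_smul]
      have f1 : kz a.par b.par * B a c = kz b.par c.par * B a c := by
        rw [kz_comm a.par, kz_B_left b.par a c, kz_comm]
      have f2 : kz a.par b.par * (kz a.par c.par * B b c) = B b c := by
        rw [← kz_B_left a.par b c, ← mul_assoc, kz_sq, one_mul]
      have f1' : kz a.par b.par * (if k + l + shift tw = 0 then B a c else 0) =
          kz b.par c.par * if k + l + shift tw = 0 then B a c else 0 := by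
        split_ifs
        · exact f1
        · simp
      have f2' : kz a.par b.par * (kz a.par c.par *
          if r - shift tw - k + l + shift tw = 0 then B b c else 0) =
          if r - shift tw - k + l + shift tw = 0 then B b c else 0 := by
        split_ifs
        · exact f2
        · simp
      rw [← f1']
      nth_rewrite 2 [← f2']
      module
  rw [nord_apply, finsum_congr h, finsum_add_distrib, finsum_add_distrib,
    finsum_eq_single _ (r + l) fun k hk => if_neg hk, if_pos rfl,
    finsum_eq_single _ (-l - shift tw) fun k hk => if_neg hk, if_pos rfl, nord_apply,
    ← smul_finsum', ← map_finsum]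
  · exact F.term_support 0 a b r v
  · refine (F.term_support 0 a b r v).subset fun k hk hk' => hk ?_
    beta_reduce
    rw [hk', map_zero]
  · exact (Set.finite_singleton (r + l)).subset fun k hk => by
      by_contra h'
      exact hk (if_neg h')
  · exact (Set.finite_singleton (-l - shift tw)).subset fun k hk => by
      by_contra h'
      exact hk (if_neg h')
  · refine (F.term_support 0 a b r v).subset fun k hk hk' => hk ?_
    beta_reduce
    rw [hk', map_zero, smul_zero]
  · refine ((Set.finite_singleton (r + l)).union (Set.finite_singleton (-l - shift tw))).subset
      fun k hk => ?_
    by_contra h'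
    simp only [Set.mem_union, Set.mem_singleton_iff, not_or] at h'
    apply hk
    beta_reduce
    rw [if_neg h'.1, if_neg h'.2, add_zero]

/-- Commutator of a normally ordered product with a mode. -/
theorem bil_comm (a b c : J m n e) (r l : ℤ) (v : W) :
    F.bil a b r (F.A c l v) = (kz a.par c.par * kz b.par c.par) • F.A c l (F.bil a b r v) +
      (B b c • F.A a (r + l) v + (kz b.par c.par * B a c) • F.A b (r + l) v) := by
  rw [bil_apply, nord_comm, bil_apply, map_add, map_smul]
  have h : (twc tw * if r = 0 then B a b else 0) =
      (kz a.par c.par * kz b.par c.par) * (twc tw * if r = 0 then B a b else 0) := by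
    have h2 : B a b = (kz a.par c.par * kz b.par c.par) * B a b := by
      rw [mul_assoc, kz_comm b.par c.par, ← kz_B_left c.par a b, kz_comm c.par, ← mul_assoc, kz_sq,
        one_mul]
    split_ifs
    · rw [mul_left_comm, ← h2]
    · simp
  nth_rewrite 1 [h]
  module

/-- An operator derivation: `D` has weight `ω p` with respect to the mode `p`. -/
theorem bil_of_weight {D : Module.End ℂ W} {ω : J m n e × ℤ → ℂ}
    (hD : ∀ p v, D (F.op p v) = F.op p (D v) + ω p • F.op p v) (a b : J m n e) (r : ℤ) (x : ℂ)
    (hx : ∀ k, ω (a, k) + ω (b, r - shift tw - k) = x)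
    (hx0 : r = 0 → b = a.conj → x = 0) (v : W) :
    D (F.bil a b r v) = F.bil a b r (D v) + x • F.bil a b r v := by
  have h : ∀ k, D (F.term 0 a b r v k) = F.term 0 a b r (D v) k + x • F.term 0 a b r v k := by
    intro k
    have h1 := hD (a, k)
    have h2 := hD (b, r - shift tw - k)
    simp only [op] at h1 h2
    unfold term
    rw [← hx k]
    split_ifs
    · rw [h1, h2, map_add, map_smul]
      module
    · rw [map_smul, h2, h1, map_add, map_smul]
      module
  have h2 : D (F.nord 0 a b r v) = F.nord 0 a b r (D v) + x • F.nord 0 a b r v := by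
    rw [nord_apply, map_finsum D (F.term_support 0 a b r v), finsum_congr h, finsum_add_distrib,
      nord_apply, smul_finsum']
    · exact F.term_support 0 a b r v
    · exact F.term_support 0 a b r (D v)
    · refine (F.term_support 0 a b r v).subset fun k hk hk' => hk ?_
      beta_reduce
      rw [hk', smul_zero]
  rw [bil_apply, map_add, h2, map_smul, bil_apply]
  have h3 : x * (twc tw * if r = 0 then B a b else 0) = 0 := by
    by_cases hr : r = 0
    · by_cases hb : b = a.conj
      · rw [hx0 hr hb, zero_mul]
      · rw [B_eq_zero hb]; simp
    · simp [hr]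
  rw [smul_add, smul_smul, h3]
  module

/-! ### The currents of `osp(M|N)` -/

/-- The mode of the current of a matrix. -/
def cur (X : Matrix (J m n e) (J m n e) ℂ) (r : ℤ) : Module.End ℂ W :=
  (1 / 2 : ℂ) • ∑ a, ∑ c, (X c a * B a.conj a) • F.bil c a.conj r

theorem cur_apply (X : Matrix (J m n e) (J m n e) ℂ) (r : ℤ) (v : W) :
    F.cur X r v = (1 / 2 : ℂ) • ∑ a, ∑ c, (X c a * B a.conj a) • F.bil c a.conj r v := by
  simp [cur, LinearMap.sum_apply]

/-- Currents act on the modes by the action of `osp(M|N)` on `V`. -/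
theorem cur_comm {s : ZMod 2} (X : osp m n e s) (b : J m n e) (r l : ℤ) (v : W) :
    F.cur X.1 r (F.A b l v) = kz s b.par • F.A b l (F.cur X.1 r v) +
      ∑ c, X.1 c b • F.A c (r + l) v := by
  have h : ∀ a c, (X.1 c a * B a.conj a) • F.bil c a.conj r (F.A b l v) =
      kz s b.par • F.A b l ((X.1 c a * B a.conj a) • F.bil c a.conj r v) +
      ((X.1 c a * B a.conj a * B a.conj b) • F.A c (r + l) v +
        (X.1 c a * B a.conj a * (kz a.par b.par * B c b)) • F.A a.conj (r + l) v) := by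
    intro a c
    rw [bil_comm, par_conj, map_smul]
    have := kz_osp X b.par c a
    have h2 : (X.1 c a * B a.conj a) * (kz c.par b.par * kz a.par b.par) =
      kz s b.par * (X.1 c a * B a.conj a) := by linear_combination B a.conj a * this
    rw [smul_add, smul_smul, h2]
    module
  rw [cur_apply, Finset.sum_congr rfl fun a _ => Finset.sum_congr rfl fun c _ => h a c]
  simp only [Finset.sum_add_distrib]
  have s1 : ∑ a, ∑ c, (X.1 c a * B a.conj a * B a.conj b) • F.A c (r + l) v =
      ∑ c, X.1 c b • F.A c (r + l) v := by
    rw [Finset.sum_eq_single b]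
    · refine Finset.sum_congr rfl fun c _ => ?_
      rw [B_conj_left, mul_assoc, J.sgn_mul_self, mul_one]
    · intro a _ hab
      refine Finset.sum_eq_zero fun c _ => ?_
      rw [B_eq_zero (b := b), mul_zero, zero_smul]
      rw [J.conj_conj]
      exact Ne.symm hab
    · simp
  have s2 : ∑ a, ∑ c, (X.1 c a * B a.conj a * (kz a.par b.par * B c b)) • F.A a.conj (r + l) v =
      ∑ c, X.1 c b • F.A c (r + l) v := by
    rw [← sum_conj (fun c => X.1 c b • F.A c (r + l) v)]
    refine Finset.sum_congr rfl fun a _ => ?_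
    rw [Finset.sum_eq_single b.conj]
    · congr 1
      rw [B_conj_left, B_conj_left, osp_apply X a.conj b, J.conj_conj, sgn_conj_eq b]
      have h3 := kz_osp X b.par b.conj a
      rw [par_conj] at h3
      linear_combination (-a.conj.sgn * b.sgn) * h3
    · intro c _ hc
      rw [B_eq_ite c b, if_neg hc]
      simp
    · simp
  rw [s1, s2, cur_apply, map_smul, map_sum]
  simp only [map_sum]
  simp only [← Finset.smul_sum]
  module

theorem nord_par {u : ZMod 2} {v : W} (hv : v ∈ F.gr parW u) (K : ℤ) (a b : J m n e) (r : ℤ) :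
    F.nord K a b r v ∈ F.gr parW (u + (a.par + b.par)) := by
  refine F.nord_mem fun k => ?_
  unfold term
  split_ifs
  · have := F.op_mem_gr parW_dual (a, k) (F.op_mem_gr parW_dual (b, r - shift tw - k) hv)
    rwa [add_assoc, add_comm (parW _)] at this
  · have := F.op_mem_gr parW_dual (b, r - shift tw - k) (F.op_mem_gr parW_dual (a, k) hv)
    rw [add_assoc] at this
    exact Submodule.smul_mem _ _ this

theorem bil_par {u : ZMod 2} {v : W} (hv : v ∈ F.gr parW u) (a b : J m n e) (r : ℤ) :
    F.bil a b r v ∈ F.gr parW (u + (a.par + b.par)) := by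
  rw [bil_apply]
  refine add_mem (F.nord_par hv _ _ _ _) ?_
  by_cases h : b = a.conj
  · have h2 : ∀ x y : ZMod 2, x + (y + y) = x := by decide
    rw [h, par_conj, h2]
    exact Submodule.smul_mem _ _ hv
  · rw [B_eq_zero h]
    simp

theorem cur_par {s u : ZMod 2} (X : osp m n e s) (r : ℤ) {v : W} (hv : v ∈ F.gr parW u) :
    F.cur X.1 r v ∈ F.gr parW (s + u) := by
  rw [cur_apply]
  refine Submodule.smul_mem _ _ (Submodule.sum_mem _ fun a _ => Submodule.sum_mem _ fun c _ => ?_)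
  by_cases h : X.1 c a = 0
  · rw [h, zero_mul, zero_smul]; exact zero_mem _
  · refine Submodule.smul_mem _ _ ?_
    have := F.bil_par hv c a.conj r
    rwa [par_conj, add_comm u, osp_par X h] at this

end SuperFock

namespace SuperFock

variable {tw : Bool} {W : Type} [AddCommGroup W] [Module ℂ W] (F : SuperFock m n e tw W)

/-! ### The commutation relations of the currents -/

theorem cur_op_op {s : ZMod 2} (X : osp m n e s) (c d : J m n e) (r k j : ℤ) (v : W) :
    F.cur X.1 r (F.A c k (F.A d j v)) =
      (kz s c.par * kz s d.par) • F.A c k (F.A d j (F.cur X.1 r v)) +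
      (∑ x, X.1 x c • F.A x (r + k) (F.A d j v) +
        kz s c.par • ∑ x, X.1 x d • F.A c k (F.A x (r + j) v)) := by
  rw [cur_comm, cur_comm, map_add, map_smul, map_sum]
  simp only [map_smul]
  module

theorem cur_term {s : ZMod 2} (X : osp m n e s) (c d : J m n e) (r l : ℤ) (v : W) (k : ℤ) :
    F.cur X.1 r (F.term 0 c d l v k) =
      (kz s c.par * kz s d.par) • F.term 0 c d l (F.cur X.1 r v) k +
      (∑ x, X.1 x c • F.term r x d (l + r) v (k + r) +
        kz s c.par • ∑ x, X.1 x d • F.term 0 c x (l + r) v k) := by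
  have e1 : l + r - shift tw - (k + r) = l - shift tw - k := by ring
  have e2 : l + r - shift tw - k = r + (l - shift tw - k) := by ring
  unfold term
  by_cases h : k < 0
  · have h' : k + r < r := by omega
    simp only [if_pos h, if_pos h', e1, e2]
    rw [cur_op_op, add_comm k r]
  · have h' : ¬ k + r < r := by omega
    simp only [if_neg h, if_neg h', e1, e2]
    rw [map_smul, cur_op_op, add_comm k r]
    have f1 : ∀ x, (kz c.par d.par * kz s d.par) • X.1 x c • F.A d (l - shift tw - k)
        (F.A x (r + k) v) = X.1 x c • kz x.par d.par • F.A d (l - shift tw - k)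
        (F.A x (r + k) v) := by
      intro x
      have := kz_osp X d.par x c
      rw [smul_smul, smul_smul]
      congr 1
      have h2 := kz_sq c.par d.par
      linear_combination -kz c.par d.par * this + (kz x.par d.par * X.1 x c) * h2
    have f2 : ∀ x, kz c.par d.par • X.1 x d • F.A x (r + (l - shift tw - k)) (F.A c k v) =
        kz s c.par • X.1 x d • kz c.par x.par • F.A x (r + (l - shift tw - k)) (F.A c k v) := by
      intro x
      have := kz_osp X c.par x d
      rw [smul_smul, smul_smul, smul_smul]
      congr 1
      rw [kz_comm c.par d.par, kz_comm c.par x.par]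
      have h2 := kz_sq d.par c.par
      have h3 := kz_sq s c.par
      have h4 := kz_sq x.par c.par
      linear_combination kz x.par c.par * this - (kz d.par c.par * X.1 x d) * h4
    have g1 : kz c.par d.par • kz s d.par • ∑ x, X.1 x c • F.A d (l - shift tw - k)
        (F.A x (r + k) v) = ∑ x, X.1 x c • kz x.par d.par • F.A d (l - shift tw - k)
        (F.A x (r + k) v) := by
      rw [smul_smul, Finset.smul_sum]
      exact Finset.sum_congr rfl fun x _ => f1 x
    have g2 : kz c.par d.par • ∑ x, X.1 x d • F.A x (r + (l - shift tw - k)) (F.A c k v) =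
        kz s c.par • ∑ x, X.1 x d • kz c.par x.par • F.A x (r + (l - shift tw - k))
          (F.A c k v) := by
      rw [Finset.smul_sum, Finset.smul_sum]
      exact Finset.sum_congr rfl fun x _ => f2 x
    rw [smul_add, smul_add, g1, g2]
    module

theorem cur_nord {s : ZMod 2} (X : osp m n e s) (c d : J m n e) (r l : ℤ) (v : W) :
    F.cur X.1 r (F.nord 0 c d l v) =
      (kz s c.par * kz s d.par) • F.nord 0 c d l (F.cur X.1 r v) +
      (∑ x, X.1 x c • F.nord r x d (l + r) v +
        kz s c.par • ∑ x, X.1 x d • F.nord 0 c x (l + r) v) := by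
  have t0 := F.term_support 0 c d l (F.cur X.1 r v)
  have t1 : ∀ x, (Function.support fun k => F.term r x d (l + r) v (k + r)).Finite := fun x =>
    (F.term_support r x d (l + r) v).preimage (f := fun k => k + r)
      (add_left_injective r).injOn
  have t2 : ∀ x, (Function.support fun k => X.1 x c • F.term r x d (l + r) v (k + r)).Finite :=
    fun x => (t1 x).subset fun k hk hk' =>
      hk ((congrArg (X.1 x c • ·) hk').trans (smul_zero _))
  have t3 : ∀ x, (Function.support fun k => X.1 x d • F.term 0 c x (l + r) v k).Finite :=
    fun x => (F.term_support 0 c x (l + r) v).subset fun k hk hk' =>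
      hk (by beta_reduce; rw [hk', smul_zero])
  have t4 : (Function.support fun k => ∑ x, X.1 x c • F.term r x d (l + r) v (k + r)).Finite :=
    (Set.finite_iUnion t2).subset fun k hk => by
      by_contra h
      simp only [Set.mem_iUnion, not_exists, Function.mem_support, not_not] at h
      exact hk (Finset.sum_eq_zero fun x _ => h x)
  have t5 : (Function.support fun k => ∑ x, X.1 x d • F.term 0 c x (l + r) v k).Finite :=
    (Set.finite_iUnion t3).subset fun k hk => by
      by_contra h
      simp only [Set.mem_iUnion, not_exists, Function.mem_support, not_not] at h
      exact hk (Finset.sum_eq_zero fun x _ => h x)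
  have t6 : (Function.support fun k =>
      kz s c.par • ∑ x, X.1 x d • F.term 0 c x (l + r) v k).Finite :=
    t5.subset fun k hk hk' => hk ((congrArg (kz s c.par • ·) hk').trans (smul_zero _))
  have t7 : (Function.support fun k =>
      (kz s c.par * kz s d.par) • F.term 0 c d l (F.cur X.1 r v) k).Finite :=
    t0.subset fun k hk hk' => hk (by beta_reduce; rw [hk', smul_zero])
  have t8 : (Function.support fun k => ∑ x, X.1 x c • F.term r x d (l + r) v (k + r) +
      kz s c.par • ∑ x, X.1 x d • F.term 0 c x (l + r) v k).Finite :=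
    (t4.union t6).subset fun k hk => by
      by_contra h
      simp only [Set.mem_union, Function.mem_support, not_or, not_not] at h
      exact hk (by beta_reduce; rw [h.1, h.2, add_zero])
  rw [nord_apply, map_finsum _ (F.term_support 0 c d l v),
    finsum_congr (F.cur_term X c d r l v), finsum_add_distrib t7 t8, finsum_add_distrib t4 t6,
    ← smul_finsum' _ t0, ← smul_finsum' _ t5, finsum_sum_comm _ _ fun x _ => t2 x,
    finsum_sum_comm _ _ fun x _ => t3 x, nord_apply]
  congr 2
  · refine Finset.sum_congr rfl fun x _ => ?_
    rw [← smul_finsum' _ (t1 x), nord_apply]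
    congr 1
    exact finsum_comp_equiv (Equiv.addRight r) (f := F.term r x d (l + r) v)
  · congr 1
    refine Finset.sum_congr rfl fun x _ => ?_
    rw [← smul_finsum' _ (F.term_support 0 c x (l + r) v), nord_apply]

theorem osp_B {s : ZMod 2} (X : osp m n e s) (c d : J m n e) :
    ∑ x, X.1 x c * B x d + kz s c.par * ∑ x, X.1 x d * B c x = 0 := by
  have h := X.2.2 c d
  rw [Finset.sum_congr (g := fun x => X.1 x d * B c x) (s₁ := Finset.univ)
    (f := fun x => B c x * X.1 x d) rfl fun x _ => mul_comm _ _] at h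
  exact h

/-- Commutator of a current with a normally ordered product. -/
theorem cur_bil {s : ZMod 2} (X : osp m n e s) (c d : J m n e) (r l : ℤ) (v : W) :
    F.cur X.1 r (F.bil c d l v) =
      (kz s c.par * kz s d.par) • F.bil c d l (F.cur X.1 r v) +
      (∑ x, X.1 x c • F.bil x d (l + r) v + kz s c.par • ∑ x, X.1 x d • F.bil c x (l + r) v) +
      (if r + l = 0 then r * ∑ x, X.1 x c * B x d else 0) • v := by
  have hk : (twc tw * if l = 0 then B c d else 0) =
      (kz s c.par * kz s d.par) * (twc tw * if l = 0 then B c d else 0) := by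
    have h2 : B c d = (kz s c.par * kz s d.par) * B c d := by
      rw [mul_assoc, ← kz_B_left s c d, ← mul_assoc, kz_sq, one_mul]
    split_ifs
    · rw [mul_left_comm, ← h2]
    · simp
  have e1 : ∑ x, X.1 x c • F.bil x d (l + r) v = ∑ x, X.1 x c • F.nord 0 x d (l + r) v +
      (twc tw * if l + r = 0 then ∑ x, X.1 x c * B x d else 0) • v := by
    simp only [bil_apply, smul_add, Finset.sum_add_distrib]
    congr 1
    rw [Finset.sum_congr rfl fun x _ => smul_smul _ _ v, ← Finset.sum_smul]
    congr 1
    split_ifs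
    · rw [Finset.mul_sum]
      exact Finset.sum_congr rfl fun x _ => by ring
    · simp
  have e2 : ∑ x, X.1 x d • F.bil c x (l + r) v = ∑ x, X.1 x d • F.nord 0 c x (l + r) v +
      (twc tw * if l + r = 0 then ∑ x, X.1 x d * B c x else 0) • v := by
    simp only [bil_apply, smul_add, Finset.sum_add_distrib]
    congr 1
    rw [Finset.sum_congr rfl fun x _ => smul_smul _ _ v, ← Finset.sum_smul]
    congr 1
    split_ifs
    · rw [Finset.mul_sum]
      exact Finset.sum_congr rfl fun x _ => by ring
    · simp
  have e3 : ∑ x, X.1 x c • F.nord r x d (l + r) v = ∑ x, X.1 x c • F.nord 0 x d (l + r) v +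
      (if r + l = 0 then r * ∑ x, X.1 x c * B x d else 0) • v := by
    simp only [F.nord_eq r, smul_add, Finset.sum_add_distrib]
    congr 1
    rw [Finset.sum_congr rfl fun x _ => smul_smul _ _ v, ← Finset.sum_smul, add_comm r l]
    congr 1
    split_ifs
    · rw [Finset.mul_sum]
      exact Finset.sum_congr rfl fun x _ => by ring
    · simp
  have hB := osp_B X c d
  have hB' : (if l + r = 0 then ∑ x, X.1 x c * B x d else 0) =
      -(kz s c.par * if l + r = 0 then ∑ x, X.1 x d * B c x else 0) := by
    split_ifs
    · linear_combination hB
    · simp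
  rw [bil_apply, map_add, map_smul, cur_nord, e1, e2, e3, bil_apply, hB']
  nth_rewrite 1 [hk]
  module

/-- The commutation relations of the affine Lie superalgebra. -/
theorem cur_cur {s u : ZMod 2} (X : osp m n e s) (Y : osp m n e u) (r l : ℤ) (v : W) :
    F.cur X.1 r (F.cur Y.1 l v) = kz s u • F.cur Y.1 l (F.cur X.1 r v) +
      F.cur (superBr X Y).1 (r + l) v +
      (if r + l = 0 then (r : ℂ) * form X.1 Y.1 else 0) • v := by
  have h : ∀ a c, F.cur X.1 r ((Y.1 c a * B a.conj a) • F.bil c a.conj l v) =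
      kz s u • (Y.1 c a * B a.conj a) • F.bil c a.conj l (F.cur X.1 r v) +
      (∑ x, (X.1 x c * Y.1 c a * B a.conj a) • F.bil x a.conj (r + l) v -
      kz s u • ∑ x, (Y.1 c a * X.1 a x * B x.conj x) • F.bil c x.conj (r + l) v) +
      (if r + l = 0 then r * (X.1 a c * Y.1 c a * (B a.conj a * B a a.conj)) else 0) • v := by
    intro a c
    rw [map_smul, cur_bil, par_conj, add_comm l r]
    have k1 : Y.1 c a * (kz s c.par * kz s a.par) = kz s u * Y.1 c a := by
      have := kz_osp Y s c a
      rw [kz_comm s c.par, kz_comm s a.par, kz_comm s u]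
      linear_combination this
    have s1 : ∑ x, X.1 x c * B x a.conj = X.1 a c * B a a.conj := by
      rw [Finset.sum_eq_single a]
      · intro x _ hx
        rw [B_eq_zero fun h => hx (J.conj_injective h).symm, mul_zero]
      · simp
    have s2 : (Y.1 c a * B a.conj a) • ∑ x, X.1 x c • F.bil x a.conj (r + l) v =
        ∑ x, (X.1 x c * Y.1 c a * B a.conj a) • F.bil x a.conj (r + l) v := by
      rw [Finset.smul_sum]
      refine Finset.sum_congr rfl fun x _ => ?_
      rw [smul_smul]
      congr 1
      ring
    have s3 : (Y.1 c a * B a.conj a) • kz s c.par • ∑ x, X.1 x a.conj • F.bil c x (r + l) v =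
        -(kz s u • ∑ x, (Y.1 c a * X.1 a x * B x.conj x) • F.bil c x.conj (r + l) v) := by
      rw [← sum_conj fun x => X.1 x a.conj • F.bil c x (r + l) v, Finset.smul_sum,
        Finset.smul_sum, Finset.smul_sum, ← Finset.sum_neg_distrib]
      refine Finset.sum_congr rfl fun x _ => ?_
      rw [smul_smul, smul_smul, smul_smul, ← neg_smul]
      congr 1
      rw [osp_apply X x.conj a.conj, J.conj_conj, J.conj_conj, par_conj, B_conj_left, B_conj_left]
      have := J.sgn_mul_self a.conj
      linear_combination (-x.conj.sgn * X.1 a x) * k1 -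
        (Y.1 c a * kz s c.par * kz s a.par * x.conj.sgn * X.1 a x) * this
    have s4 : (Y.1 c a * B a.conj a) • (if r + l = 0 then r * ∑ x, X.1 x c * B x a.conj else 0) • v
        = (if r + l = 0 then r * (X.1 a c * Y.1 c a * (B a.conj a * B a a.conj)) else 0) • v := by
      rw [s1, smul_smul]
      congr 1
      split_ifs
      · ring
      · simp
    rw [smul_add, smul_add, smul_add, s2, s3, s4]
    have s5 : (Y.1 c a * B a.conj a) • (kz s c.par * kz s a.par) •
        F.bil c a.conj l (F.cur X.1 r v) =
        kz s u • (Y.1 c a * B a.conj a) • F.bil c a.conj l (F.cur X.1 r v) := by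
      rw [smul_smul, smul_smul]
      congr 1
      linear_combination B a.conj a * k1
    rw [s5]
    abel
  have f1 : ∑ a, ∑ c, ∑ x, (X.1 x c * Y.1 c a * B a.conj a) • F.bil x a.conj (r + l) v =
      ∑ a, ∑ x, ((X.1 * Y.1) x a * B a.conj a) • F.bil x a.conj (r + l) v := by
    refine Finset.sum_congr rfl fun a _ => ?_
    rw [Finset.sum_comm]
    refine Finset.sum_congr rfl fun x _ => ?_
    rw [Matrix.mul_apply, Finset.sum_mul, Finset.sum_smul]
  have f2 : ∑ a, ∑ c, ∑ x, (Y.1 c a * X.1 a x * B x.conj x) • F.bil c x.conj (r + l) v =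
      ∑ x, ∑ c, ((Y.1 * X.1) c x * B x.conj x) • F.bil c x.conj (r + l) v := by
    rw [Finset.sum_comm]
    have : ∀ c, ∑ a, ∑ x, (Y.1 c a * X.1 a x * B x.conj x) • F.bil c x.conj (r + l) v =
        ∑ x, ((Y.1 * X.1) c x * B x.conj x) • F.bil c x.conj (r + l) v := by
      intro c
      rw [Finset.sum_comm]
      refine Finset.sum_congr rfl fun x _ => ?_
      rw [Matrix.mul_apply, Finset.sum_mul, Finset.sum_smul]
    rw [Finset.sum_congr rfl fun c _ => this c, Finset.sum_comm]
  have f3 : ∑ a, ∑ c, (if r + l = 0 then r * (X.1 a c * Y.1 c a * (B a.conj a * B a a.conj)) else 0)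
      = (if r + l = 0 then 2 * ((r : ℂ) * form X.1 Y.1) else 0) := by
    split_ifs with h0
    · have hs : ∀ a : J m n e, B a.conj a * B a a.conj = if a.par = 0 then -1 else 1 := by
        intro a
        rw [B_conj_left, B_conj]
        cases a <;> simp [J.sgn, J.conj, J.par]
      simp only [hs]
      rw [form, Finset.mul_sum, Finset.mul_sum, Finset.mul_sum]
      refine Finset.sum_congr rfl fun a _ => ?_
      rw [Matrix.mul_apply, ← Finset.mul_sum, ← Finset.sum_mul]
      split_ifs <;> ring
    · simp
  rw [F.cur_apply Y.1 l v, map_smul, map_sum]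
  rw [Finset.sum_congr rfl fun a _ => (map_sum (F.cur X.1 r) _ _).trans
    (Finset.sum_congr rfl fun c _ => h a c)]
  simp only [Finset.sum_add_distrib, Finset.sum_sub_distrib, ← Finset.smul_sum, ← Finset.sum_smul]
  rw [f1, f2, f3, F.cur_apply Y.1 l, F.cur_apply (superBr X Y).1]
  have f4 : ∑ a, ∑ c, ((superBr X Y).1 c a * B a.conj a) • F.bil c a.conj (r + l) v =
      ∑ a, ∑ x, ((X.1 * Y.1) x a * B a.conj a) • F.bil x a.conj (r + l) v -
      kz s u • ∑ x, ∑ c, ((Y.1 * X.1) c x * B x.conj x) • F.bil c x.conj (r + l) v := by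
    simp only [Finset.smul_sum, ← Finset.sum_sub_distrib]
    refine Finset.sum_congr rfl fun a _ => Finset.sum_congr rfl fun c _ => ?_
    rw [smul_smul, ← sub_smul]
    congr 1
    simp only [superBr, Matrix.sub_apply, Matrix.smul_apply, smul_eq_mul]
    ring
  rw [f4]
  have f5 : (if r + l = 0 then 2 * ((r : ℂ) * form X.1 Y.1) else 0) =
      2 * (if r + l = 0 then (r : ℂ) * form X.1 Y.1 else 0) := by split_ifs <;> simp
  rw [f5]
  module

/-! ### The fermionic representation -/

/-- The mode number of a label. -/
def modeNum (tw : Bool) (p : J m n e × ℤ) : ℂ := (p.2 : ℂ) + (shift tw : ℂ) / 2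

theorem modeNum_dual (p : J m n e × ℤ) : modeNum tw (dualMode tw p) = -modeNum tw p := by
  simp only [modeNum, dualMode]
  push_cast
  ring

/-- The energy operator. -/
def dOp : Module.End ℂ W := F.diag (tot (modeNum tw))

theorem dOp_op (p : J m n e × ℤ) (v : W) :
    F.dOp (F.op p v) = F.op p (F.dOp v) + modeNum tw p • F.op p v :=
  F.diag_tot_op modeNum_dual p v

theorem dOp_vac : F.dOp F.vac = 0 := by
  rw [dOp, F.vac_eq, diag_bas, tot_zero, zero_smul]

theorem dOp_cur (X : Matrix (J m n e) (J m n e) ℂ) (r : ℤ) (v : W) :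
    F.dOp (F.cur X r v) = F.cur X r (F.dOp v) + (r : ℂ) • F.cur X r v := by
  have h : ∀ a c, F.dOp (F.bil c a r v) = F.bil c a r (F.dOp v) + (r : ℂ) • F.bil c a r v := by
    intro a c
    refine F.bil_of_weight F.dOp_op c a r r (fun k => ?_) (fun h _ => by simp [h]) v
    simp only [modeNum]
    push_cast
    ring
  rw [cur_apply, cur_apply, map_smul, map_sum]
  simp only [map_sum, map_smul, h, smul_add, Finset.sum_add_distrib]
  congr 1
  simp only [Finset.smul_sum, smul_smul]
  refine Finset.sum_congr rfl fun a _ => Finset.sum_congr rfl fun c _ => ?_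
  congr 1
  ring

theorem dOp_gr {A : Type} [AddCommMonoid A] (ω : J m n e × ℤ → A) (x : A) {v : W}
    (hv : v ∈ F.gr ω x) : F.dOp v ∈ F.gr ω x := by
  induction hv using Submodule.span_induction with
  | mem v hv =>
    obtain ⟨i, hi, rfl⟩ := hv
    rw [dOp, diag_bas]
    exact Submodule.smul_mem _ _ (Submodule.subset_span ⟨i, hi, rfl⟩)
  | zero => rw [map_zero]; exact zero_mem _
  | add v w _ _ h1 h2 => rw [map_add]; exact add_mem h1 h2
  | smul c v _ h => rw [map_smul]; exact Submodule.smul_mem _ _ h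

/-- `R` is the fermionic representation. -/
def IsFermionic (R : AffRep m n e W) : Prop :=
  R.par = F.parSub ∧ R.K = 1 ∧ R.d F.vac = 0 ∧
  (∀ a k, R.d * F.A a k - F.A a k * R.d = ((k : ℂ) + (shift tw : ℂ) / 2) • F.A a k) ∧
  ∀ s r (X : osp m n e s) v, R.loop s r X v =
    (1 / 2 : ℂ) • ∑ a, ∑ c, (X.1 c a * B a.conj a) • F.normOrd c a.conj r v

/-- The fermionic representation. -/
def rep : AffRep m n e W where
  par := F.parSub
  loop s r :=
    { toFun := fun X => F.cur X.1 r
      map_add' := fun X Y => by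
        refine LinearMap.ext fun v => ?_
        simp only [LinearMap.add_apply, cur_apply, ← smul_add, ← Finset.sum_add_distrib, ← add_smul,
          Submodule.coe_add, Matrix.add_apply, add_mul]
      map_smul' := fun x X => by
        refine LinearMap.ext fun v => ?_
        simp only [LinearMap.smul_apply, cur_apply, RingHom.id_apply]
        rw [smul_comm]
        congr 1
        simp only [Finset.smul_sum, smul_smul, SetLike.val_smul, Matrix.smul_apply, smul_eq_mul,
          mul_assoc] }
  K := 1
  d := F.dOp
  par_isCompl := by
    rw [parSub_eq, parSub_eq]
    exact F.gr_isCompl _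
  loop_par s u k X v hv := by
    rw [parSub_eq] at hv ⊢
    exact F.cur_par X k hv
  K_par u v hv := hv
  d_par u v hv := by
    rw [parSub_eq] at hv ⊢
    exact F.dOp_gr _ _ hv
  loop_loop s u k l X Y := by
    refine LinearMap.ext fun v => ?_
    have h := F.cur_cur X Y k l v
    simp only [LinearMap.sub_apply, LinearMap.add_apply, LinearMap.smul_apply,
      Module.End.mul_apply, LinearMap.coe_mk, AddHom.coe_mk, Module.End.one_apply]
    rw [h]
    abel
  K_loop s k X := by rw [one_mul, mul_one]
  K_d := by rw [one_mul, mul_one]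
  d_loop s k X := by
    refine LinearMap.ext fun v => ?_
    have h := F.dOp_cur X.1 k v
    simp only [LinearMap.sub_apply, LinearMap.smul_apply,
      Module.End.mul_apply, LinearMap.coe_mk, AddHom.coe_mk]
    rw [h]
    abel

theorem rep_isFermionic : F.IsFermionic F.rep := by
  refine ⟨rfl, rfl, F.dOp_vac, fun a k => ?_, fun s r X v => ?_⟩
  · refine LinearMap.ext fun v => ?_
    have h := F.dOp_op (a, k) v
    simp only [op, modeNum] at h
    simp only [LinearMap.sub_apply, LinearMap.smul_apply, Module.End.mul_apply]
    change F.dOp _ - F.A a k (F.dOp v) = _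
    rw [h]
    abel
  · simp only [normOrd_eq]
    exact F.cur_apply X.1 r v

theorem IsFermionic.eq_rep {R : AffRep m n e W} (h : F.IsFermionic R) : R = F.rep := by
  obtain ⟨hpar, hK, hd0, hd, hloop⟩ := h
  have hd' : R.d = F.dOp := by
    refine F.ext_of_commute (by rw [hd0, dOp_vac]) fun p v hv => ?_
    have h1 := congrArg (fun T => T v) (hd p.1 p.2)
    simp only [LinearMap.sub_apply, LinearMap.smul_apply, Module.End.mul_apply] at h1
    rw [dOp_op, ← hv]
    exact (sub_eq_iff_eq_add.mp h1).trans (add_comm _ _)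
  have hl : R.loop = F.rep.loop := by
    funext s r
    refine LinearMap.ext fun X => LinearMap.ext fun v => ?_
    rw [hloop]
    exact (F.rep_isFermionic.2.2.2.2 s r X v).symm
  obtain ⟨par, loop, K, d, _, _, _, _, _, _, _, _⟩ := R
  simp only at hpar hK hd' hl
  subst hpar hK hd' hl
  rfl

theorem existsUnique_isFermionic : ∃! R : AffRep m n e W, F.IsFermionic R :=
  ⟨F.rep, F.rep_isFermionic, fun _ h => h.eq_rep⟩

end SuperFock

/-! ### The Fock space of the superfermions -/

variable {tw : Bool}

theorem existsUnique_fermionic (m n e : ℕ) (tw : Bool) :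
    ∃! R : AffRep m n e (Fock m n e tw), IsFermionic R :=
  (superFock m n e tw).existsUnique_isFermionic

theorem degSub_isCompl (m n e : ℕ) (tw : Bool) :
    IsCompl (degSub m n e tw 0) (degSub m n e tw 1) := by
  have h := (superFock m n e tw).gr_isCompl SuperFock.degW
  rw [← SuperFock.degSub_eq, ← SuperFock.degSub_eq] at h
  exact h

theorem isFreeFieldModule (m n e : ℕ) (tw : Bool) (he : e ≤ 1) : IsFreeFieldModule m n e tw := by
  let F := superFock m n e tw
  refine ⟨fun a b k l => LinearMap.ext fun v => ?_, ?_, fun a k => F.op_vac_eq_zero_iff (a, k), ?_,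
    fun S hg hS => F.eq_bot_or_eq_top he hg hS⟩
  · have h := F.ccr a b k l v
    exact sub_eq_of_eq_add' h
  · have h := F.bas.ne_zero (0, ∅)
    rw [← F.vac_eq] at h
    exact h
  · have h := F.gr_isCompl SuperFock.parW
    rw [← SuperFock.parSub_eq, ← SuperFock.parSub_eq] at h
    exact h

/-! ### Normally ordered products of basis vectors as elements of `osp(M|N)` -/

theorem B_swap (a b : J m n e) : B b a = -kz a.par b.par * B a b := by
  by_cases h : b = a.conj
  · subst h
    rw [B_conj_left, B_conj, par_conj, sgn_conj_eq]
  · rw [B_eq_zero h, B_eq_ite, if_neg h, mul_zero]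

/-- The element `v ↦ ⟨b|v⟩ a + (-1)^{p(a)p(b)} ⟨a|v⟩ b` of `osp(M|N)`. -/
def ospPair (a b : J m n e) : osp m n e (a.par + b.par) :=
  ⟨Matrix.of fun x v => (if x = a then B b v else 0) +
    kz a.par b.par * (if x = b then B a v else 0), by
    have hpar : ∀ a b : J m n e, B a b ≠ 0 → a.par = b.par := by
      intro a b h
      by_contra h'
      apply h
      refine B_eq_zero fun h2 => h' ?_
      rw [h2, par_conj]
    have h2 : ∀ x y z w : ZMod 2, w = y → x + z ≠ z + w → x ≠ y := by decide
    refine ⟨fun x v hx => ?_, fun u v => ?_⟩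
    · have e1 : (if x = a then B b v else 0) = 0 := by
        split_ifs with h
        · subst h
          by_contra hb
          exact hx (by rw [hpar _ _ hb])
        · rfl
      have e2 : (if x = b then B a v else 0) = 0 := by
        split_ifs with h
        · subst h
          by_contra hb
          exact hx (by rw [hpar _ _ hb, add_comm])
        · rfl
      rw [Matrix.of_apply, e1, e2, mul_zero, add_zero]
    · simp only [Matrix.of_apply, add_mul, mul_add, Finset.sum_add_distrib, ite_mul, zero_mul,
        mul_ite, mul_zero, Finset.sum_ite_eq', Finset.mem_univ, if_true]
      have k1 : kz (a.par + b.par) u.par = kz a.par u.par * kz b.par u.par := kz_mul _ _ _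
      rw [k1, B_swap a u, B_swap b u]
      have k2 := kz_sq a.par u.par
      have k3 := kz_sq b.par u.par
      have k4 : kz b.par u.par * B a u = kz b.par a.par * B a u := (kz_B_left b.par a u).symm
      have k5 : kz a.par u.par * B b u = kz a.par b.par * B b u := (kz_B_left a.par b u).symm
      have k6 := kz_sq a.par b.par
      have k7 := kz_comm b.par a.par
      rw [k7] at k4
      linear_combination (-kz b.par u.par * B a u * B b v) * k2 - B b v * k4 -
        (kz a.par b.par * kz a.par u.par * B b u * B a v) * k3 -
        (kz a.par b.par * B a v) * k5 - (B b u * B a v) * k6⟩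

theorem ospPair_apply (a b x v : J m n e) :
    (ospPair a b).1 x v = (if x = a then B b v else 0) +
      kz a.par b.par * (if x = b then B a v else 0) := rfl

namespace SuperFock

variable {W : Type} [AddCommGroup W] [Module ℂ W] (F : SuperFock m n e tw W)

theorem nord_swap (a b : J m n e) (r : ℤ) (v : W) :
    F.nord 0 b a r v = kz a.par b.par • F.nord (r - shift tw + 1) a b r v := by
  rw [nord_apply, nord_apply, smul_finsum' _ (F.term_support _ a b r v),
    ← finsum_comp_equiv (Equiv.subLeft (r - shift tw))
      (f := fun k => kz a.par b.par • F.term (r - shift tw + 1) a b r v k)]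
  refine finsum_congr fun k => ?_
  simp only [Equiv.subLeft_apply]
  unfold term
  have e1 : r - shift tw - (r - shift tw - k) = k := by ring
  rw [e1]
  by_cases h : k < 0
  · rw [if_pos h, if_neg (by omega), smul_smul, kz_sq, one_smul]
  · rw [if_neg h, if_pos (by omega), kz_comm]

theorem bil_swap (a b : J m n e) (r : ℤ) (v : W) :
    F.bil b a r v = kz a.par b.par • F.bil a b r v := by
  rw [bil_apply, bil_apply, nord_swap, nord_eq, B_swap a b, smul_add, smul_add, smul_smul,
    smul_smul, add_assoc, ← add_smul]
  congr 2
  by_cases hr : r = 0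
  · simp only [hr, if_true]
    cases tw <;> simp [twc, shift] <;> ring
  · simp [hr]

theorem cur_ospPair (a b : J m n e) (r : ℤ) (v : W) :
    F.cur (ospPair a b).1 r v = F.bil a b r v := by
  rw [cur_apply]
  simp only [ospPair_apply, add_mul, add_smul, Finset.sum_add_distrib, ite_mul, zero_mul, mul_ite,
    mul_zero, ite_smul, zero_smul, Finset.sum_ite_eq', Finset.mem_univ, if_true]
  have key : ∀ a b : J m n e, ∑ x, (B b x * B x.conj x) • F.bil a x.conj r v = F.bil a b r v := by
    intro a b
    rw [Finset.sum_eq_single b.conj]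
    · rw [J.conj_conj, B_conj, J.sgn_mul_self, one_smul]
    · intro x _ hx
      rw [B_eq_zero hx, zero_mul, zero_smul]
    · simp
  have key2 : ∑ x, (kz a.par b.par * B a x * B x.conj x) • F.bil b x.conj r v =
      F.bil a b r v := by
    simp only [mul_assoc, mul_smul]
    rw [← Finset.smul_sum]
    simp only [← mul_smul]
    rw [key b a, F.bil_swap a b, smul_smul, kz_sq, one_smul]
  rw [key a b, key2]
  module

/-! ### Stability -/

/-- Stability under all normally ordered products. -/
def Stable (U : Submodule ℂ W) : Prop := ∀ a b r, ∀ v ∈ U, F.bil a b r v ∈ U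

theorem bil_bil_eq_zero (a b c d : J m n e) (r l : ℤ) (hr : r + l ≠ 0) {v : W}
    (h1 : F.bil a b r v = 0) (h2 : ∀ x y, F.bil x y (l + r) v = 0) :
    F.bil a b r (F.bil c d l v) = 0 := by
  rw [← cur_ospPair, cur_bil, cur_ospPair, h1, if_neg hr]
  simp [h2]

theorem bil_low {E : ℤ} {v : W} (hv : v ∈ F.low (enW tw) E) (a b : J m n e) (r : ℤ) :
    F.bil a b r v ∈ F.low (enW tw) (E - 2 * r) := by
  rw [bil_apply]
  refine add_mem (F.nord_mem fun k => ?_) ?_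
  · have e1 : E + enW tw (b, r - shift tw - k) + enW tw (a, k) = E - 2 * r := by
      simp only [enW]; ring
    have e2 : E + enW tw (a, k) + enW tw (b, r - shift tw - k) = E - 2 * r := by
      simp only [enW]; ring
    unfold term
    split_ifs
    · rw [← e1]
      exact F.op_mem_low enW_dual (a, k) (F.op_mem_low enW_dual (b, r - shift tw - k) hv)
    · rw [← e2]
      exact Submodule.smul_mem _ _
        (F.op_mem_low enW_dual (b, r - shift tw - k) (F.op_mem_low enW_dual (a, k) hv))
  · by_cases h : r = 0
    · subst h
      rw [mul_zero, sub_zero]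
      exact Submodule.smul_mem _ _ hv
    · simp [h]

/-- A normally ordered product as a finite sum. -/
theorem bil_window {a b : J m n e} {k0 lo r : ℤ} {v : W} (ha : ∀ k, k0 < k → F.A a k v = 0)
    (hb : ∀ k, k0 < k → F.A b k v = 0) (h1 : lo ≤ r - shift tw - k0) (_ : lo ≤ k0) :
    F.bil a b r v = ∑ k ∈ Finset.Ico lo k0, F.A a k (F.A b (r - shift tw - k) v) +
      F.A a k0 (F.A b (r - shift tw - k0) v) +
      ((twc tw - (k0 + 1)) * if r = 0 then B a b else 0) • v := by
  have h : F.nord (k0 + 1) a b r v = ∑ k ∈ Finset.Ico lo k0, F.A a k (F.A b (r - shift tw - k) v) +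
      F.A a k0 (F.A b (r - shift tw - k0) v) := by
    rw [nord_apply, finsum_eq_sum_of_support_subset (s := insert k0 (Finset.Ico lo k0)),
      Finset.sum_insert (by simp), add_comm]
    · congr 1
      · refine Finset.sum_congr rfl fun k hk => ?_
        rw [term, if_pos (by have := Finset.mem_Ico.mp hk; omega)]
      · rw [term, if_pos (by omega)]
    · intro k hk
      by_contra h'
      apply hk
      simp only [Finset.coe_insert, Finset.coe_Ico, Set.mem_insert_iff, Set.mem_Ico, not_or,
        not_and, not_lt] at h'
      unfold term
      split_ifs with h3
      · rw [hb _ (by omega), map_zero]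
      · rw [ha _ (by omega), map_zero, smul_zero]
  have h' := F.nord_eq (k0 + 1) a b r v
  rw [h] at h'
  rw [bil_apply, h', add_assoc, ← add_smul]
  congr 2
  push_cast
  ring

end SuperFock

/-! ### Singular vectors for a pair of bosonic fields -/

section Bosons

variable {G : Type} [AddCommGroup G] [Module ℂ G] {A C : ℤ → Module.End ℂ G} {s : ℂ} {sh : ℤ}

theorem boson_relation (hAC : ∀ k l v, A k (C l v) = C l (A k v) +
      (if k + l + sh = 0 then s else 0) • v)
    (hsh : sh = 0 ∨ sh = 1) {k0 : ℤ} (hk0 : 1 ≤ k0) {u : G}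
    (h1 : ∀ r, 1 ≤ r → ∑ k ∈ Finset.Ico (-k0 - 1) k0, A k (A (r - sh - k) u) +
      A k0 (A (r - sh - k0) u) = 0)
    (h2 : ∀ r, 1 ≤ r → ∑ k ∈ Finset.Ico (-k0 - 1) k0, C k (A (r - sh - k) u) +
      C k0 (A (r - sh - k0) u) = 0)
    (hAA : ∀ k l v, A k (A l v) = A l (A k v)) :
    ∑ k ∈ Finset.Ico (-k0 - 1) k0, C k (A (-sh - k) (A k0 u)) -
      ∑ k ∈ Finset.Ico (-k0 - 1) k0, A k (A (-sh - k) (C k0 u)) =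
      (s * (2 * k0 - 1 + sh)) • A k0 u := by
  have e1 : ∑ l ∈ Finset.Ico (-k0 - 1) k0, C l (∑ k ∈ Finset.Ico (-k0 - 1) k0,
      A k (A (k0 - l - sh - k) u) + A k0 (A (k0 - l - sh - k0) u)) = 0 :=
    Finset.sum_eq_zero fun l hl => by
      rw [h1 (k0 - l) (by have := Finset.mem_Ico.mp hl; omega), map_zero]
  have e2 : ∑ l ∈ Finset.Ico (-k0 - 1) k0, A l (∑ k ∈ Finset.Ico (-k0 - 1) k0,
      C k (A (k0 - l - sh - k) u) + C k0 (A (k0 - l - sh - k0) u)) = 0 :=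
    Finset.sum_eq_zero fun l hl => by
      rw [h2 (k0 - l) (by have := Finset.mem_Ico.mp hl; omega), map_zero]
  simp only [map_add, map_sum, Finset.sum_add_distrib] at e1 e2
  rw [Finset.sum_comm] at e2
  have e3 : ∀ l ∈ Finset.Ico (-k0 - 1) k0, ∀ k ∈ Finset.Ico (-k0 - 1) k0,
      A k (C l (A (k0 - k - sh - l) u)) = C l (A k (A (k0 - l - sh - k) u)) +
        (if k = -sh - l then s else 0) • A k0 u := by
    intro l _ k _
    have e : k0 - k - sh - l = k0 - l - sh - k := by ring
    rw [hAC, e]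
    by_cases h : k = -sh - l
    · rw [if_pos h, if_pos (by omega)]
      congr 3
      congr 1
      omega
    · rw [if_neg h, if_neg (by omega), zero_smul, zero_smul]
  rw [Finset.sum_congr rfl fun l hl => Finset.sum_congr rfl fun k hk => e3 l hl k hk] at e2
  simp only [Finset.sum_add_distrib, ← Finset.sum_smul, Finset.sum_ite_eq', Finset.mem_Ico] at e2
  have e4 : ∑ l ∈ Finset.Ico (-k0 - 1) k0, (if -k0 - 1 ≤ -sh - l ∧ -sh - l < k0 then s else 0) =
      s * (2 * k0 - 1 + sh) := by
    rw [← Finset.sum_filter, Finset.sum_const]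
    have : Finset.filter (fun l => -k0 - 1 ≤ -sh - l ∧ -sh - l < k0) (Finset.Ico (-k0 - 1) k0) =
        Finset.Ico (-sh - k0 + 1) k0 := by
      ext l
      simp only [Finset.mem_filter, Finset.mem_Ico]
      omega
    rw [this, Int.card_Ico, nsmul_eq_mul, mul_comm]
    congr 1
    have : ((k0 - (-sh - k0 + 1)).toNat : ℤ) = 2 * k0 - 1 + sh := by omega
    exact_mod_cast congrArg (Int.cast : ℤ → ℂ) this
  rw [e4] at e2
  have e5 : ∑ l ∈ Finset.Ico (-k0 - 1) k0, C l (A (-sh - l) (A k0 u)) =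
      ∑ l ∈ Finset.Ico (-k0 - 1) k0, C l (A k0 (A (k0 - l - sh - k0) u)) := by
    refine Finset.sum_congr rfl fun l _ => ?_
    rw [hAA]
    congr 4
    ring
  have e6 : ∑ l ∈ Finset.Ico (-k0 - 1) k0, A l (A (-sh - l) (C k0 u)) =
      ∑ l ∈ Finset.Ico (-k0 - 1) k0, A l (C k0 (A (k0 - l - sh - k0) u)) := by
    refine Finset.sum_congr rfl fun l hl => ?_
    have := Finset.mem_Ico.mp hl
    have e : k0 - l - sh - k0 = -sh - l := by ring
    rw [hAC, if_neg (by omega), zero_smul, add_zero, e]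
  rw [e5, e6]
  rw [eq_comm, ← sub_eq_zero, ← e2]
  have e7 := e1
  generalize ∑ l ∈ Finset.Ico (-k0 - 1) k0, C l (A k0 (A (k0 - l - sh - k0) u)) = X1 at *
  generalize ∑ l ∈ Finset.Ico (-k0 - 1) k0, A l (C k0 (A (k0 - l - sh - k0) u)) = X2 at *
  rw [eq_neg_of_add_eq_zero_left e7]
  abel

/-- Vanishing in the twisted sector. -/
theorem eq_zero_of_zero_modes {a c : Module.End ℂ G} {x y : G} {s t : ℂ} (hs : s ≠ 0)
    (hac : ∀ v, a (c v) = c (a v) + s • v) (ht1 : t + 1 ≠ 0) (ht2 : t + 2 ≠ 0)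
    (h1 : c (a x) - a (a y) = (s * t) • x) (h2 : a (c y) - c (c x) = (-s * t) • y) :
    x = 0 ∧ y = 0 := by
  have e1 : a (a y - c x) = (-s * (t + 1)) • x := by
    rw [map_sub, hac x, sub_add_eq_sub_sub, ← neg_sub (c (a x)), h1]
    module
  have e2 : c (a y - c x) = (-s * (t + 1)) • y := by
    rw [map_sub, eq_sub_of_add_eq (hac y).symm, sub_right_comm, h2]
    module
  have e3 := hac (a y - c x)
  rw [e1, e2, map_smul, map_smul] at e3
  have e4 : (s * (t + 2)) • (a y - c x) = 0 := by
    have : (-s * (t + 1)) • (a y - c x) = s • (a y - c x) := by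
      rw [smul_sub, e3]
      module
    have h5 : (s * (t + 2)) • (a y - c x) =
      s • (a y - c x) - (-s * (t + 1)) • (a y - c x) := by module
    rw [h5, this, sub_self]
  have e5 : a y - c x = 0 := (smul_eq_zero.mp e4).resolve_left (mul_ne_zero hs ht2)
  rw [e5, map_zero] at e1 e2
  have hne : -s * (t + 1) ≠ 0 := mul_ne_zero (neg_ne_zero.mpr hs) ht1
  exact ⟨(smul_eq_zero.mp e1.symm).resolve_left hne, (smul_eq_zero.mp e2.symm).resolve_left hne⟩

/-- Vanishing in the untwisted sector. -/
theorem eq_zero_of_half_modes {a c a' c' : Module.End ℂ G} {x y : G} {s t : ℂ} (hs : s ≠ 0)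
    (hac' : ∀ v, a (c' v) = c' (a v) + s • v) (hca' : ∀ v, c (a' v) = a' (c v) - s • v)
    (haa' : ∀ v, a (a' v) = a' (a v)) (hcc' : ∀ v, c (c' v) = c' (c v))
    (hac : ∀ v, a (c v) = c (a v))
    (haax : a (a x) = 0) (hacx : a (c x) = 0) (hccx : c (c x) = 0)
    (haay : a (a y) = 0) (hacy : a (c y) = 0) (hccy : c (c y) = 0)
    (ht0 : t ≠ 0) (ht1 : t ≠ 1) (ht3 : t + 3 ≠ 0)
    (h1 : c' (a x) + a' (c x) - (2 : ℂ) • a' (a y) = (s * t) • x)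
    (h2 : a' (c y) + c' (a y) - (2 : ℂ) • c' (c x) = (-s * t) • y) :
    x = 0 ∧ y = 0 := by
  have hcax : c (a x) = 0 := by rw [← hac, hacx]
  have hcay : c (a y) = 0 := by rw [← hac, hacy]
  have f1 := congrArg a h1
  have f2 := congrArg c h1
  have f3 := congrArg a h2
  have f4 := congrArg c h2
  simp only [map_add, map_sub, map_smul, hac', hca', haa', hcc', haax, hacx, hccx, haay, hacy,
    hccy, hcax, hcay, map_zero, zero_add, add_zero, sub_zero, smul_zero, zero_sub] at f1 f2 f3 f4
  have ax : a x = 0 := by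
    have : (s * (1 - t)) • a x = 0 := by
      rw [mul_sub, sub_smul, ← f1, mul_one, sub_self]
    exact (smul_eq_zero.mp this).resolve_left (mul_ne_zero hs (sub_ne_zero.mpr ht1.symm))
  have cy : c y = 0 := by
    have : (s * (1 - t)) • c y = 0 := by
      have e : (s * (1 - t)) • c y = (-s * t) • c y - (-(s • c y)) := by module
      rw [e, ← f4, sub_self]
    exact (smul_eq_zero.mp this).resolve_left (mul_ne_zero hs (sub_ne_zero.mpr ht1.symm))
  have g1 : (2 * s) • a y = (s * (t + 1)) • c x := by
    have e : (s * (t + 1)) • c x = (s * t) • c x + s • c x := by module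
    rw [e, ← f2]
    module
  have g2 : (2 * s) • c x = (s * (t + 1)) • a y := by
    have e : (s * (t + 1)) • a y = s • a y - (-s * t) • a y := by module
    rw [e, ← f3]
    module
  have g3 : (s * s * ((t - 1) * (t + 3))) • c x = 0 := by
    have e : (s * s * ((t - 1) * (t + 3))) • c x =
      (s * (t + 1)) • (s * (t + 1)) • c x - (2 * s) • (2 * s) • c x := by module
    rw [e, ← g1, g2, smul_comm, sub_self]
  have cx : c x = 0 := (smul_eq_zero.mp g3).resolve_left
    (mul_ne_zero (mul_ne_zero hs hs) (mul_ne_zero (sub_ne_zero.mpr ht1) ht3))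
  have ay : a y = 0 := by
    rw [cx, smul_zero] at g1
    exact (smul_eq_zero.mp g1).resolve_left (mul_ne_zero two_ne_zero hs)
  rw [ax, cx, ay] at h1
  rw [cy, cx, ay] at h2
  simp only [map_zero, smul_zero, add_zero, sub_zero] at h1 h2
  exact ⟨(smul_eq_zero.mp h1.symm).resolve_left (mul_ne_zero hs ht0),
    (smul_eq_zero.mp h2.symm).resolve_left (mul_ne_zero (neg_ne_zero.mpr hs) ht0)⟩

/-- Sums of products of modes on vectors killed by modes of large mode number, twisted sector. -/
theorem sum_modes_twisted (hAC : ∀ k l v, A k (C l v) = C l (A k v) +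
      (if k + l + 0 = 0 then s else 0) • v) {k0 : ℤ} (hk0 : 1 ≤ k0) {x : G}
    (hA : ∀ k, 1 ≤ k → A k x = 0) (hC : ∀ k, 1 ≤ k → C k x = 0) :
    ∑ k ∈ Finset.Ico (-k0 - 1) k0, C k (A (-0 - k) x) = C 0 (A 0 x) - (s * (k0 - 1)) • x := by
  have h : ∀ k ∈ Finset.Ico (-k0 - 1) k0, C k (A (-0 - k) x) =
      (if k = 0 then C 0 (A 0 x) else 0) - (if 1 ≤ k then s else 0) • x := by
    intro k _
    rcases lt_trichotomy k 0 with h | h | h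
    · rw [hA _ (by omega), map_zero, if_neg (by omega), if_neg (by omega)]; simp
    · subst h; simp
    · have := hAC (-0 - k) k x
      rw [hC k (by omega), map_zero, if_pos (by omega)] at this
      rw [if_neg (by omega), if_pos (by omega), zero_sub]
      exact eq_neg_of_add_eq_zero_left this.symm
  rw [Finset.sum_congr rfl h, Finset.sum_sub_distrib, ← Finset.sum_smul, Finset.sum_ite_eq',
    if_pos (by simp; omega), ← Finset.sum_filter, Finset.sum_const]
  have : Finset.filter (fun k => 1 ≤ k) (Finset.Ico (-k0 - 1) k0) = Finset.Ico 1 k0 := by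
    ext l
    simp only [Finset.mem_filter, Finset.mem_Ico]
    omega
  rw [this, Int.card_Ico, nsmul_eq_mul, mul_comm]
  congr 3
  have : ((k0 - 1).toNat : ℤ) = k0 - 1 := by omega
  exact_mod_cast congrArg (Int.cast : ℤ → ℂ) this

theorem sum_modes_twisted_self (hAA : ∀ k l v, A k (A l v) = A l (A k v)) {k0 : ℤ}
    (hk0 : 1 ≤ k0) {x : G} (hA : ∀ k, 1 ≤ k → A k x = 0) :
    ∑ k ∈ Finset.Ico (-k0 - 1) k0, A k (A (-0 - k) x) = A 0 (A 0 x) := by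
  rw [Finset.sum_eq_single 0]
  · simp
  · intro k _ hk
    rcases lt_or_gt_of_ne hk with h | h
    · rw [hA _ (by omega), map_zero]
    · rw [hAA, hA _ (by omega), map_zero]
  · intro h
    simp at h
    omega

/-- Sums of products of modes on vectors killed by modes of large mode number, untwisted sector. -/
theorem sum_modes_untwisted (hAC : ∀ k l v, A k (C l v) = C l (A k v) +
      (if k + l + 1 = 0 then s else 0) • v) {k0 : ℤ} (hk0 : 1 ≤ k0) {x : G}
    (hA : ∀ k, 1 ≤ k → A k x = 0) (hC : ∀ k, 1 ≤ k → C k x = 0) :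
    ∑ k ∈ Finset.Ico (-k0 - 1) k0, C k (A (-1 - k) x) =
      C (-1) (A 0 x) + A (-1) (C 0 x) - (s * k0) • x := by
  have h : ∀ k ∈ Finset.Ico (-k0 - 1) k0, C k (A (-1 - k) x) =
      (if k = -1 then C (-1) (A 0 x) else 0) + (if k = 0 then A (-1) (C 0 x) else 0) -
        (if 0 ≤ k then s else 0) • x := by
    intro k _
    rcases lt_trichotomy k (-1) with h | h | h
    · rw [hA _ (by omega), map_zero, if_neg (by omega), if_neg (by omega), if_neg (by omega)]; simp
    · subst h; simp
    · have h3 := hAC (-1 - k) k x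
      rw [if_pos (by omega)] at h3
      rw [if_neg (by omega), if_pos (by omega : 0 ≤ k), zero_add]
      by_cases h0 : k = 0
      · subst h0
        rw [if_pos rfl]
        simp only [sub_zero] at h3 ⊢
        exact eq_sub_of_add_eq h3.symm
      · rw [hC k (by omega), map_zero] at h3
        rw [if_neg h0, zero_sub]
        exact eq_neg_of_add_eq_zero_left h3.symm
  rw [Finset.sum_congr rfl h, Finset.sum_sub_distrib, Finset.sum_add_distrib, ← Finset.sum_smul,
    Finset.sum_ite_eq', Finset.sum_ite_eq', if_pos (by simp; omega), if_pos (by simp; omega),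
    ← Finset.sum_filter, Finset.sum_const]
  have : Finset.filter (fun k => 0 ≤ k) (Finset.Ico (-k0 - 1) k0) = Finset.Ico 0 k0 := by
    ext l
    simp only [Finset.mem_filter, Finset.mem_Ico]
    omega
  rw [this, Int.card_Ico, nsmul_eq_mul, mul_comm]
  congr 3
  have : ((k0 - 0).toNat : ℤ) = k0 := by omega
  exact_mod_cast congrArg (Int.cast : ℤ → ℂ) this

theorem sum_modes_untwisted_self (hAA : ∀ k l v, A k (A l v) = A l (A k v)) {k0 : ℤ}
    (hk0 : 1 ≤ k0) {x : G} (hA : ∀ k, 1 ≤ k → A k x = 0) :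
    ∑ k ∈ Finset.Ico (-k0 - 1) k0, A k (A (-1 - k) x) = (2 : ℂ) • A (-1) (A 0 x) := by
  have h : ∀ k ∈ Finset.Ico (-k0 - 1) k0, A k (A (-1 - k) x) =
      (if k = -1 then A (-1) (A 0 x) else 0) + (if k = 0 then A (-1) (A 0 x) else 0) := by
    intro k _
    rcases lt_trichotomy k (-1) with h | h | h
    · rw [hA _ (by omega), map_zero, if_neg (by omega), if_neg (by omega)]; simp
    · subst h; simp
    · rw [if_neg (by omega), zero_add]
      by_cases h0 : k = 0
      · subst h0
        rw [if_pos rfl, hAA, sub_zero]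
      · rw [if_neg h0, hAA, hA k (by omega), map_zero]
  rw [Finset.sum_congr rfl h, Finset.sum_add_distrib,
    Finset.sum_ite_eq', Finset.sum_ite_eq', if_pos (by simp; omega), if_pos (by simp; omega),
    two_smul]

end Bosons

section Bosons

variable {G : Type} [AddCommGroup G] [Module ℂ G] {A C : ℤ → Module.End ℂ G} {s : ℂ}

theorem bosons_eq_zero {sh : ℤ} (hsh : sh = 0 ∨ sh = 1) (hs : s ≠ 0)
    (hAC : ∀ k l v, A k (C l v) = C l (A k v) + (if k + l + sh = 0 then s else 0) • v)
    (hAA : ∀ k l v, A k (A l v) = A l (A k v)) (hCC : ∀ k l v, C k (C l v) = C l (C k v))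
    {k0 : ℤ} (hk0 : 1 ≤ k0) {u : G}
    (h1 : ∀ r, 1 ≤ r → ∑ k ∈ Finset.Ico (-k0 - 1) k0, A k (A (r - sh - k) u) +
      A k0 (A (r - sh - k0) u) = 0)
    (h2 : ∀ r, 1 ≤ r → ∑ k ∈ Finset.Ico (-k0 - 1) k0, C k (A (r - sh - k) u) +
      C k0 (A (r - sh - k0) u) = 0)
    (h3 : ∀ r, 1 ≤ r → ∑ k ∈ Finset.Ico (-k0 - 1) k0, C k (C (r - sh - k) u) +
      C k0 (C (r - sh - k0) u) = 0)
    (h4 : ∀ r, 1 ≤ r → ∑ k ∈ Finset.Ico (-k0 - 1) k0, A k (C (r - sh - k) u) +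
      A k0 (C (r - sh - k0) u) = 0)
    (hAx : ∀ k, 1 ≤ k → A k (A k0 u) = 0) (hCx : ∀ k, 1 ≤ k → C k (A k0 u) = 0)
    (hAy : ∀ k, 1 ≤ k → A k (C k0 u) = 0) (hCy : ∀ k, 1 ≤ k → C k (C k0 u) = 0)
    (hx : sh = 1 → A 0 (A 0 (A k0 u)) = 0 ∧ A 0 (C 0 (A k0 u)) = 0 ∧ C 0 (C 0 (A k0 u)) = 0)
    (hy : sh = 1 → A 0 (A 0 (C k0 u)) = 0 ∧ A 0 (C 0 (C k0 u)) = 0 ∧ C 0 (C 0 (C k0 u)) = 0) :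
    A k0 u = 0 ∧ C k0 u = 0 := by
  have hCA : ∀ k l v, C k (A l v) = A l (C k v) + (if k + l + sh = 0 then -s else 0) • v := by
    intro k l v
    rw [hAC l k v, add_comm l k]
    split_ifs <;> module
  have r1 := boson_relation hAC hsh hk0 h1 h2 hAA
  have r2 := boson_relation hCA hsh hk0 h3 h4 hCC
  have hk : (1 : ℝ) ≤ k0 := by exact_mod_cast hk0
  have hne : ∀ x y : ℝ, x * k0 + y ≠ 0 → (x * k0 + y : ℂ) ≠ 0 := fun x y h => by
    exact_mod_cast h
  rcases hsh with rfl | rfl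
  · rw [sum_modes_twisted hAC hk0 hAx hCx, sum_modes_twisted_self hAA hk0 hAy] at r1
    rw [sum_modes_twisted hCA hk0 hCy hAy, sum_modes_twisted_self hCC hk0 hCx] at r2
    refine eq_zero_of_zero_modes (a := A 0) (c := C 0) (t := 3 * k0 - 2) hs
      (fun v => by simpa using hAC 0 0 v) ?_ ?_ ?_ ?_
    · have := hne 3 (-1) (by nlinarith)
      push_cast at this
      convert this using 1; ring
    · have := hne 3 0 (by nlinarith)
      push_cast at this
      convert this using 1; ring
    · have e : (s * (3 * k0 - 2)) • A k0 u =
        (s * (2 * k0 - 1 + ((0 : ℤ) : ℂ))) • A k0 u + (s * (k0 - 1)) • A k0 u := by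
        push_cast; module
      rw [e, ← r1]; abel
    · have e : (-s * (3 * k0 - 2)) • C k0 u =
        (-s * (2 * k0 - 1 + ((0 : ℤ) : ℂ))) • C k0 u + (-s * (k0 - 1)) • C k0 u := by
        push_cast; module
      rw [e, ← r2]; abel
  · rw [sum_modes_untwisted hAC hk0 hAx hCx, sum_modes_untwisted_self hAA hk0 hAy] at r1
    rw [sum_modes_untwisted hCA hk0 hCy hAy, sum_modes_untwisted_self hCC hk0 hCx] at r2
    obtain ⟨x1, x2, x3⟩ := hx rfl
    obtain ⟨y1, y2, y3⟩ := hy rfl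
    refine eq_zero_of_half_modes (a := A 0) (c := C 0) (a' := A (-1)) (c' := C (-1))
      (t := 3 * k0) hs (fun v => by simpa using hAC 0 (-1) v)
      (fun v => ?_) (fun v => hAA _ _ v) (fun v => hCC _ _ v)
      (fun v => by simpa using hAC 0 0 v) x1 x2 x3 y1 y2 y3 ?_ ?_ ?_ ?_ ?_
    · have := hCA 0 (-1) v
      simp only [zero_add, neg_add_cancel, if_true] at this
      rw [this]; module
    · have := hne 3 0 (by nlinarith)
      push_cast at this
      convert this using 1; ring
    · have := hne 3 (-1) (by nlinarith)
      push_cast at this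
      intro h
      apply this
      rw [h]; norm_num
    · have := hne 3 3 (by nlinarith)
      push_cast at this
      exact this
    · have e : (s * (3 * k0)) • A k0 u =
        (s * (2 * k0 - 1 + ((1 : ℤ) : ℂ))) • A k0 u + (s * k0) • A k0 u := by
        push_cast; module
      rw [e, ← r1]; abel
    · have e : (-s * (3 * k0)) • C k0 u =
        (-s * (2 * k0 - 1 + ((1 : ℤ) : ℂ))) • C k0 u + (-s * k0) • C k0 u := by
        push_cast; module
      rw [e, ← r2]; abel

end Bosons

namespace SuperFock

variable {tw : Bool} {W : Type} [AddCommGroup W] [Module ℂ W] (F : SuperFock m n e tw W)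

/-- Vectors killed by all positive modes of the currents. -/
def IsSing (v : W) : Prop := ∀ a b r, 1 ≤ r → F.bil a b r v = 0

theorem shift_cases (tw : Bool) : shift tw = 0 ∨ shift tw = 1 := by cases tw <;> simp [shift]

variable {F}

theorem IsSing.mode {v : W} (hv : F.IsSing v) {k0 : ℤ} (h : ∀ a k, k0 < k → F.A a k v = 0)
    (c : J m n e) : F.IsSing (F.A c k0 v) := by
  intro a b r hr
  rw [bil_comm, hv a b r hr, h a _ (by omega), h b _ (by omega)]
  simp

theorem IsSing.bil {v : W} (hv : F.IsSing v) (c d : J m n e) : F.IsSing (F.bil c d 0 v) :=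
  fun a b r hr => F.bil_bil_eq_zero a b c d r 0 (by omega) (hv a b r hr)
    fun x y => hv x y _ (by omega)

theorem IsSing.zero_zero {v : W} (hv : F.IsSing v) (htw : shift tw = 1)
    (h : ∀ a k, 1 ≤ k → F.A a k v = 0) (a b : J m n e) : F.A a 0 (F.A b 0 v) = 0 := by
  have h1 := F.bil_window (a := a) (b := b) (k0 := 0) (lo := 0) (r := 1) (v := v)
    (fun k hk => h a k (by omega)) (fun k hk => h b k (by omega)) (by omega) le_rfl
  rw [hv a b 1 le_rfl, htw] at h1
  simpa using h1.symm

/-- Vectors killed by all positive modes of the currents are killed by all modes `a_k`, except for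
those of smallest positive and of zero mode number. -/
theorem IsSing.top (i0 : Fin n) {v : W} (hv : F.IsSing v) (a : J m n e) {k : ℤ} (hk : 1 ≤ k) :
    F.A a k v = 0 := by
  suffices H : ∀ (N : ℕ) (E : ℤ), E < N → ∀ v ∈ F.low (enW tw) E, F.IsSing v →
      ∀ a k, 1 ≤ k → F.A a k v = 0 by
    obtain ⟨N, hN⟩ := F.exists_mem_low (enW tw) v
    exact H (N + 1) N (by push_cast; omega) v hN hv a k hk
  clear hv hk
  intro N
  induction N with
  | zero =>
    intro E hE v hvE _ a k _
    rw [F.low_eq_bot enW_nonneg (by simpa using hE), Submodule.mem_bot] at hvE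
    rw [hvE, map_zero]
  | succ N ih =>
    intro E hE
    suffices H : ∀ (j : ℕ) (v : W), v ∈ F.low (enW tw) E → F.IsSing v →
        ∀ a k, 1 ≤ k → (N : ℤ) - j < k → F.A a k v = 0 by
      intro v hvE hv a k hk
      exact H N v hvE hv a k hk (by omega)
    intro j
    induction j with
    | zero =>
      intro v hvE hv a k hk hN
      have h := F.op_mem_low enW_dual (a, k) hvE
      rw [F.low_eq_bot enW_nonneg, Submodule.mem_bot] at h
      · exact h
      · have := shift_cases tw
        simp only [enW]
        push_cast at hE hN
        omega
    | succ j ihj =>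
      intro v hvE hv a k hk hN
      by_cases hk' : (N : ℤ) - j < k
      · exact ihj v hvE hv a k hk hk'
      obtain rfl : k = N - j := by push_cast at hN; omega
      generalize hk0 : (N : ℤ) - j = k at *
      have hen : ∀ (v : W), v ∈ F.low (enW tw) E → ∀ c, F.A c k v ∈ F.low (enW tw) (E - 2) := by
        intro v hvE c
        refine F.low_mono _ ?_ (F.op_mem_low enW_dual (c, k) hvE)
        have := shift_cases tw
        simp only [enW]
        omega
      have hgt : ∀ (v : W), v ∈ F.low (enW tw) E → F.IsSing v → ∀ a k', k < k' → F.A a k' v = 0 :=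
        fun v hvE hv a k' hk' => ihj v hvE hv a k' (by omega) hk'
      have hBAC : B (J.ph i0 : J m n e) (J.phs i0) = -1 := by simp [B, J.conj, J.sgn]
      have hBCA : B (J.phs i0 : J m n e) (J.ph i0) = 1 := by simp [B, J.conj, J.sgn]
      have main : ∀ (v : W), v ∈ F.low (enW tw) E → F.IsSing v →
          F.A (J.ph i0) k v = 0 ∧ F.A (J.phs i0) k v = 0 := by
        intro v hvE hv
        have hg := hgt v hvE hv
        have hS := fun c => hv.mode hg c
        have hK : ∀ c a k', 1 ≤ k' → F.A a k' (F.A c k v) = 0 := fun c a k' hk' =>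
          ih (E - 2) (by push_cast at hE; omega) _ (hen v hvE c) (hS c) a k' hk'
        have hwin : ∀ (a b : J m n e) (r : ℤ), 1 ≤ r →
            ∑ l ∈ Finset.Ico (-k - 1) k, F.A a l (F.A b (r - shift tw - l) v) +
              F.A a k (F.A b (r - shift tw - k) v) = 0 := by
          intro a b r hr
          have h1 := F.bil_window (a := a) (b := b) (k0 := k) (lo := -k - 1) (r := r) (v := v)
            (hg a) (hg b) (by have := shift_cases tw; omega) (by omega)
          rw [hv a b r hr, if_neg (by omega), mul_zero, zero_smul, add_zero] at h1
          exact h1.symm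
        have hkz : ∀ a b : J m n e, a.par = 0 → kz a.par b.par = 1 := fun a b h => by
          simp [h, kz]
        refine bosons_eq_zero (A := F.A (J.ph i0)) (C := F.A (J.phs i0)) (s := -1)
          (shift_cases tw) (by norm_num) (fun k l v => ?_) (fun k l v => ?_) (fun k l v => ?_) hk
          (hwin _ _) (hwin _ _) (hwin _ _) (hwin _ _) (hK _ _) (hK _ _) (hK _ _) (hK _ _)
          (fun h => ⟨(hS _).zero_zero h (hK _) _ _, (hS _).zero_zero h (hK _) _ _,
            (hS _).zero_zero h (hK _) _ _⟩)
          (fun h => ⟨(hS _).zero_zero h (hK _) _ _, (hS _).zero_zero h (hK _) _ _,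
            (hS _).zero_zero h (hK _) _ _⟩)
        · rw [F.ccr, hBAC, hkz _ _ rfl, one_smul]
        · rw [F.ccr, hkz _ _ rfl, one_smul]
          simp [B, J.conj]
        · rw [F.ccr, hkz _ _ rfl, one_smul]
          simp [B, J.conj]
      have hw : F.bil a (J.phs i0) 0 v ∈ F.low (enW tw) E := by
        have := F.bil_low hvE a (J.phs i0) 0
        rwa [mul_zero, sub_zero] at this
      have h := F.bil_comm a (J.phs i0) (J.ph i0) 0 k v
      rw [(main v hvE hv).1, (main _ hw (hv.bil _ _)).1, zero_add, (main v hvE hv).2, hBCA] at h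
      simpa using h.symm

end SuperFock

namespace SuperFock

section General

variable {tw : Bool} {W : Type} [AddCommGroup W] [Module ℂ W] {F : SuperFock m n e tw W}

theorem Stable.exists_isSing {U : Submodule ℂ W} (hU : F.Stable U) (hne : U ≠ ⊥) :
    ∃ v ∈ U, v ≠ 0 ∧ F.IsSing v := by
  obtain ⟨N, v, hv, hv0, hN, hmin⟩ := F.exists_min_low (ω := enW tw) enW_nonneg hne
  exact ⟨v, hv, hv0, fun a b r hr =>
    hmin (N - 2 * r) (by omega) _ (hU a b r v hv) (F.bil_low hN a b r)⟩

theorem op_mem_degSub (p : J m n e × ℤ) {s : ZMod 2} {v : W} (hv : v ∈ F.degSub s) :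
    F.op p v ∈ F.degSub (s + 1) := by
  rw [degSub_eq] at *
  exact F.op_mem_gr degW_dual p hv

theorem vac_mem_degSub : F.vac ∈ F.degSub 0 := by
  rw [degSub_eq]
  exact F.vac_mem_gr _

theorem op_vac_mem_degSub (p : J m n e × ℤ) : F.op p F.vac ∈ F.degSub 1 := by
  simpa using op_mem_degSub p F.vac_mem_degSub

theorem eq_zero_of_mem_degSub {v : W} (h0 : v ∈ F.degSub 0) (h1 : v ∈ F.degSub 1) : v = 0 := by
  rw [degSub_eq] at h0 h1
  exact Submodule.disjoint_def.mp (F.gr_disjoint degW (by decide)) v h0 h1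

theorem exists_op_vac (p : J m n e × ℤ) (hp : Cr tw p) :
    ∃ (x : ℂ) (i : Idx m n e tw), x ≠ 0 ∧ F.op p F.vac = x • F.bas i := by
  obtain ⟨x, i, h, -⟩ := F.op_bas_cases p (0, ∅)
  rw [← F.vac_eq] at h
  refine ⟨x, i, fun hx => F.op_vac_ne_zero p hp ?_, h⟩
  rw [h, hx, zero_smul]

theorem bform_op_vac_ne_zero (p : J m n e × ℤ) (hp : Cr tw p) :
    F.bform (F.op p F.vac) (F.op p F.vac) ≠ 0 := by
  obtain ⟨x, i, hx, h⟩ := exists_op_vac (F := F) p hp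
  rw [h, map_smul, map_smul, LinearMap.smul_apply, bform_bas, if_pos rfl, smul_eq_mul, smul_eq_mul]
  exact mul_ne_zero hx (mul_ne_zero hx (nu_ne_zero i))

theorem bform_vac_ne_zero : F.bform F.vac F.vac ≠ 0 := by
  rw [F.vac_eq, bform_bas, if_pos rfl]
  exact nu_ne_zero _

end General

section Untwisted

variable {W : Type} [AddCommGroup W] [Module ℂ W] {F : SuperFock m n e false W}

theorem not_cr_untwisted {p : J m n e × ℤ} (hp : ¬ Cr false p) : 0 ≤ p.2 := by
  simpa [Cr] using hp

theorem Stable.mem_untwisted (he : e ≤ 1) (i0 : Fin n) {U : Submodule ℂ W} (hU : F.Stable U)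
    (hne : U ≠ ⊥) : F.vac ∈ U ∨ F.op (J.ph i0, -1) F.vac ∈ U := by
  obtain ⟨v, hv, hv0, hs⟩ := hU.exists_isSing hne
  have htop : ∀ a k, 1 ≤ k → F.A a k v = 0 := fun a k hk => hs.top i0 a hk
  have hkill : ∀ b p, ¬ Cr false p → F.op p (F.A b 0 v) = 0 := by
    intro b p hp
    rcases (not_cr_untwisted hp).eq_or_lt with h | h
    · rw [op, ← h, hs.zero_zero rfl htop]
    · rw [op, F.ccr, htop _ _ (by omega), if_neg (by simp [shift]; omega)]
      simp
  have hx : ∀ b, ∃ x : ℂ, F.A b 0 v = x • F.vac := by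
    intro b
    obtain ⟨x, y, w, h1, h2⟩ := F.mem_span_of_killed he (hkill b)
    rcases h2 with rfl | ⟨h, -⟩
    · exact ⟨x, by rw [h1, zero_smul, add_zero]⟩
    · cases h
  choose x hx using hx
  have key : ∀ a b, x b • F.op (a, -1) F.vac + (kz a.par b.par * x a) • F.op (b, -1) F.vac ∈ U := by
    intro a b
    have h := F.bil_window (a := a) (b := b) (k0 := 0) (lo := -1) (r := 0) (v := v)
      (fun k hk => htop a k (by omega)) (fun k hk => htop b k (by omega)) (by simp [shift])
      (by omega)
    have h2 : (Finset.Ico (-1 : ℤ) 0) = {-1} := by decide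
    rw [h2, Finset.sum_singleton] at h
    have e1 : (0 : ℤ) - shift false - -1 = 0 := by simp [shift]
    have e2 : (0 : ℤ) - shift false - 0 = -1 := by simp [shift]
    rw [e1, e2, hx b, F.ccr a b 0 (-1) v, hx a] at h
    have h3 : F.bil a b 0 v = x b • F.op (a, -1) F.vac +
        (kz a.par b.par * x a) • F.op (b, -1) F.vac := by
      rw [h]
      simp only [map_smul, twc, shift, op]
      simp
      module
    rw [← h3]
    exact hU a b 0 v hv
  by_cases h0 : ∀ b, x b = 0
  · left
    obtain ⟨y, z, w, h1, h2⟩ := F.mem_span_of_killed (v := v) he fun p hp => by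
      rcases (not_cr_untwisted hp).eq_or_lt with h | h
      · rw [op, ← h, hx, h0, zero_smul]
      · exact htop _ _ (by omega)
    rcases h2 with rfl | ⟨h, -⟩
    · rw [zero_smul, add_zero] at h1
      have hy : y ≠ 0 := by
        rintro rfl
        exact hv0 (by rw [h1, zero_smul])
      rw [h1] at hv
      exact (U.smul_mem_iff hy).mp hv
    · cases h
  · right
    push Not at h0
    by_cases hph : x (J.ph i0) = 0
    · obtain ⟨b, hb⟩ := h0
      have h := key (J.ph i0) b
      rw [hph, mul_zero, zero_smul, add_zero] at h
      exact (U.smul_mem_iff hb).mp h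
    · have h := key (J.ph i0) (J.ph i0)
      have h1 : kz (J.ph i0 : J m n e).par (J.ph i0 : J m n e).par = 1 := by simp [kz, J.par]
      rw [h1, one_mul, ← add_smul, ← two_mul] at h
      exact (U.smul_mem_iff (mul_ne_zero two_ne_zero hph)).mp h

end Untwisted

section Twisted

variable {W : Type} [AddCommGroup W] [Module ℂ W] {F : SuperFock m n e true W}

theorem not_cr_twisted {p : J m n e × ℤ} (hp : ¬ Cr true p) :
    1 ≤ p.2 ∨ p.2 = 0 ∧ p.1.low = false := by
  simp only [Cr, true_and, not_or, not_lt, not_and, Bool.not_eq_true] at hp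
  rcases hp.1.eq_or_lt with h | h
  · exact Or.inr ⟨h.symm, hp.2 h.symm⟩
  · exact Or.inl h

theorem Stable.exists_red {U : Submodule ℂ W} (hU : F.Stable U) (hne : U ≠ ⊥) (i0 : Fin n) :
    ∃ v ∈ U, v ≠ 0 ∧ (∀ a k, 1 ≤ k → F.A a k v = 0) ∧ (∀ x y, F.A x 0 (F.A y 0 v) ∈ U) ∧
      ∀ x y, redW true (x, 0) + redW true (y, 0) < 0 → F.A x 0 (F.A y 0 v) = 0 := by
  have hpair : ∀ v ∈ U, (∀ a k, 1 ≤ k → F.A a k v = 0) → ∀ x y, F.A x 0 (F.A y 0 v) ∈ U := by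
    intro v hv hk x y
    have h := F.bil_window (a := x) (b := y) (k0 := 0) (lo := 0) (r := 0) (v := v)
      (fun k h => hk x k (by omega)) (fun k h => hk y k (by omega)) (by simp [shift]) le_rfl
    have e1 : (0 : ℤ) - shift true - 0 = 0 := by simp [shift]
    rw [Finset.Ico_self, Finset.sum_empty, zero_add, e1] at h
    rw [eq_sub_of_add_eq h.symm]
    exact U.sub_mem (hU x y 0 v hv) (U.smul_mem _ hv)
  have hpos : ∀ v, (∀ a k, 1 ≤ k → F.A a k v = 0) → ∀ y a k, 1 ≤ k → F.A a k (F.A y 0 v) = 0 := by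
    intro v hv y a k hk
    rw [F.ccr, hv a k hk, if_neg (by simp [shift]; omega)]
    simp
  let Z : Submodule ℂ W := U ⊓ ⨅ p : J m n e × {k : ℤ // 1 ≤ k}, (F.A p.1 p.2.1).ker
  have hZ : ∀ v, v ∈ Z ↔ v ∈ U ∧ ∀ a k, 1 ≤ k → F.A a k v = 0 := by
    intro v
    simp only [Z, Submodule.mem_inf, Submodule.mem_iInf, LinearMap.mem_ker, Prod.forall,
      Subtype.forall]
  have hZne : Z ≠ ⊥ := by
    obtain ⟨v, hv, hv0, hs⟩ := hU.exists_isSing hne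
    intro h
    have : v ∈ Z := (hZ v).mpr ⟨hv, fun a k hk => hs.top i0 a hk⟩
    rw [h] at this
    exact hv0 this
  obtain ⟨N, v, hv, hv0, hN, hmin⟩ := F.exists_min_low (ω := redW true) redW_nonneg hZne
  obtain ⟨hvU, hvk⟩ := (hZ v).mp hv
  refine ⟨v, hvU, hv0, hvk, hpair v hvU hvk, fun x y hxy => ?_⟩
  refine hmin (N + redW true (y, 0) + redW true (x, 0)) (by omega) _
    ((hZ _).mpr ⟨hpair v hvU hvk x y, hpos _ (hpos v hvk y) x⟩) ?_
  exact F.op_mem_low redW_dual (x, 0) (F.op_mem_low redW_dual (y, 0) hN)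

theorem Stable.mem_twisted_odd (he : e ≤ 1) (i0 : Fin n) (z0 : Fin e) {U : Submodule ℂ W}
    (hU : F.Stable U) (hne : U ≠ ⊥) {s : ZMod 2} (hs : U ≤ F.degSub s) :
    F.vac ∈ U ∨ F.op (J.z z0, 0) F.vac ∈ U := by
  obtain ⟨v, hv, hv0, hk, -, hred⟩ := hU.exists_red hne i0
  have hz : redW true ((J.z z0, 0) : J m n e × ℤ) = 0 := if_pos (by simp [dualMode, shift, J.conj])
  obtain ⟨x, y, w, h1, h2⟩ := F.mem_span_of_killed (v := v) he fun p hp => by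
    rcases not_cr_twisted hp with h | ⟨h, -⟩
    · exact hk _ _ h
    · have hr := redW_of_not hp
      obtain ⟨a, k⟩ := p
      obtain rfl : k = 0 := h
      have h3 := hred (J.z z0) a (by rw [hz, hr]; norm_num)
      have h4 := F.zmode_zmode z0 (F.A a 0 v) rfl
      rw [op, h3, map_zero] at h4
      exact (smul_eq_zero.mp h4.symm).resolve_left (by norm_num)
  have hw : y • w ∈ F.degSub 1 ∧ (y = 0 ∨ w = F.op (J.z z0, 0) F.vac) := by
    rcases h2 with rfl | ⟨-, i, rfl⟩
    · rw [zero_smul]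
      exact ⟨zero_mem _, Or.inl rfl⟩
    · refine ⟨Submodule.smul_mem _ _ (op_vac_mem_degSub _), Or.inr ?_⟩
      rw [show i = z0 from Fin.ext (by omega)]
  have hvs := hs hv
  have hx : x • F.vac ∈ F.degSub 0 := Submodule.smul_mem _ _ vac_mem_degSub
  rcases zmod_two_cases s with rfl | rfl
  · left
    have : y • w = 0 := eq_zero_of_mem_degSub (by
      rw [← sub_eq_of_eq_add' h1]; exact sub_mem hvs hx) hw.1
    rw [this, add_zero] at h1
    have hx0 : x ≠ 0 := by
      rintro rfl
      exact hv0 (by rw [h1, zero_smul])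
    rw [h1] at hv
    exact (U.smul_mem_iff hx0).mp hv
  · right
    have : x • F.vac = 0 := eq_zero_of_mem_degSub hx (by
      rw [← sub_eq_of_eq_add h1]; exact sub_mem hvs hw.1)
    rw [this, zero_add] at h1
    have hy0 : y ≠ 0 := by
      rintro rfl
      exact hv0 (by rw [h1, zero_smul])
    rw [h1, hw.2.resolve_left hy0] at hv
    exact (U.smul_mem_iff hy0).mp hv

theorem Stable.mem_twisted_even {F : SuperFock m n 0 true W} (i0 : Fin n) {U : Submodule ℂ W}
    (hU : F.Stable U) (hne : U ≠ ⊥) : F.vac ∈ U ∨ F.op (J.phs i0, 0) F.vac ∈ U := by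
  obtain ⟨v, hv, hv0, hk, hpair, hred⟩ := hU.exists_red hne i0
  have hspan : ∀ u : W, (∀ p, ¬ Cr true p → F.op p u = 0) → ∃ x : ℂ, u = x • F.vac := by
    intro u hu
    obtain ⟨x, y, w, h1, h2⟩ := F.mem_span_of_killed (by norm_num) hu
    rcases h2 with rfl | ⟨-, i, -⟩
    · exact ⟨x, by rw [h1, zero_smul, add_zero]⟩
    · exact i.elim0
  by_cases h : ∀ p, ¬ Cr true p → F.op p v = 0
  · left
    obtain ⟨x, hx⟩ := hspan v h
    have hx0 : x ≠ 0 := by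
      rintro rfl
      exact hv0 (by rw [hx, zero_smul])
    rw [hx] at hv
    exact (U.smul_mem_iff hx0).mp hv
  · right
    push Not at h
    obtain ⟨⟨a, k⟩, hp, hpv⟩ := h
    have hk0 : k = 0 := by
      rcases not_cr_twisted hp with h | ⟨h, -⟩
      · exact (hpv (hk _ _ h)).elim
      · exact h
    subst hk0
    obtain ⟨x, hx⟩ := hspan (F.A a 0 v) fun q hq => by
      rcases not_cr_twisted hq with h | ⟨h, -⟩
      · rw [op, F.ccr, hk _ _ h, if_neg (by simp [shift]; omega)]
        simp
      · obtain ⟨b, l⟩ := q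
        obtain rfl : l = 0 := h
        exact hred b a (by rw [redW_of_not hq, redW_of_not hp]; norm_num)
    have hx0 : x ≠ 0 := by
      rintro rfl
      exact hpv (by rw [op, hx, zero_smul])
    have h1 := hpair (J.phs i0) a
    rw [hx, map_smul] at h1
    exact (U.smul_mem_iff hx0).mp h1

end Twisted

/-- There is a non-isotropic vector of odd degree such that every stable subspace contains it or the
vacuum. -/
theorem exists_common {tw : Bool} {W : Type} [AddCommGroup W] [Module ℂ W]
    (F : SuperFock m n e tw W) (he : e ≤ 1) (i0 : Fin n) :
    ∃ p : J m n e × ℤ, Cr tw p ∧ ∀ s, ∀ U : Submodule ℂ W, F.Stable U → U ≠ ⊥ → U ≤ F.degSub s →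
      F.vac ∈ U ∨ F.op p F.vac ∈ U := by
  cases tw with
  | false => exact ⟨(J.ph i0, -1), Or.inl (by norm_num), fun s U h1 h2 _ => h1.mem_untwisted he i0 h2⟩
  | true =>
    rcases Nat.le_one_iff_eq_zero_or_eq_one.mp he with rfl | rfl
    · exact ⟨(J.phs i0, 0), Or.inr ⟨rfl, rfl, rfl⟩, fun s U h1 h2 _ => h1.mem_twisted_even i0 h2⟩
    · exact ⟨(J.z 0, 0), Or.inr ⟨rfl, rfl, rfl⟩,
        fun s U h1 h2 h3 => h1.mem_twisted_odd he i0 0 h2 h3⟩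

end SuperFock

/-- The weight `±1` on the modes of a vector and of its dual. -/
def chi (x : J m n e) (p : J m n e × ℤ) : ℤ :=
  (if p.1 = x then 1 else 0) - (if p.1 = x.conj then 1 else 0)

theorem chi_dual (tw : Bool) (x : J m n e) (p : J m n e × ℤ) :
    chi x (dualMode tw p) = -chi x p := by
  have h1 : (p.1.conj = x) ↔ p.1 = x.conj :=
    ⟨fun h => by rw [← h, J.conj_conj], fun h => by rw [h, J.conj_conj]⟩
  have h2 : (p.1.conj = x.conj) ↔ p.1 = x := J.conj_injective.eq_iff
  simp only [chi, dualMode, h1, h2]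
  ring

namespace SuperFock

variable {tw : Bool} {W : Type} [AddCommGroup W] [Module ℂ W] (F : SuperFock m n e tw W)

/-! ### The contravariant form -/

theorem bform_nord (K : ℤ) (a b : J m n e) (r : ℤ) (v w : W) :
    F.bform (F.nord K a b r v) w =
      kap a * kap b * F.bform v (F.nord (K - r) b.conj a.conj (-r) w) := by
  have h1 : F.bform (F.nord K a b r v) w = ∑ᶠ k, F.bform (F.term K a b r v k) w := by
    rw [nord_apply]
    exact map_finsum (F.bform.flip w) (F.term_support K a b r v)
  have h2 : F.bform v (F.nord (K - r) b.conj a.conj (-r) w) =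
      ∑ᶠ k, F.bform v (F.term (K - r) b.conj a.conj (-r) w k) := by
    rw [nord_apply]
    exact map_finsum (F.bform v) (F.term_support (K - r) b.conj a.conj (-r) w)
  rw [h1, h2, ← finsum_comp_equiv (Equiv.subRight r)
    (f := fun k => F.bform v (F.term (K - r) b.conj a.conj (-r) w k)), ← smul_eq_mul, smul_finsum]
  refine finsum_congr fun k => ?_
  simp only [Equiv.subRight_apply]
  have hop : ∀ (a b : J m n e) (k l : ℤ), F.bform (F.A a k (F.A b l v)) w =
      kap a * kap b * F.bform v (F.A b.conj (-l - shift tw) (F.A a.conj (-k - shift tw) w)) := by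
    intro a b k l
    have e1 := F.bform_op (a, k) (F.A b l v) w
    have e2 := F.bform_op (b, l) v (F.op (dualMode tw (a, k)) w)
    simp only [op, dualMode] at e1 e2
    rw [e1, e2, mul_assoc]
  have e1 : -(r - shift tw - k) - shift tw = k - r := by ring
  have e2 : -r - shift tw - (k - r) = -k - shift tw := by ring
  unfold term
  rw [e2]
  by_cases hk : k < K
  · rw [if_pos hk, if_pos (by omega), hop, e1, smul_eq_mul]
  · rw [if_neg hk, if_neg (by omega), map_smul, LinearMap.smul_apply, hop, e1, map_smul,
      par_conj, par_conj, kz_comm b.par a.par, smul_eq_mul, smul_eq_mul, smul_eq_mul]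
    ring

theorem bform_bil (a b : J m n e) (r : ℤ) (v w : W) :
    F.bform (F.bil a b r v) w = kap a * kap b * F.bform v (F.bil b.conj a.conj (-r) w) := by
  rw [bil_apply, bil_apply, map_add, LinearMap.add_apply, bform_nord, nord_eq, map_add, map_add]
  by_cases hr : r = 0
  · subst hr
    have hB : B a b = kap a * kap b * B b.conj a.conj := by
      by_cases h : b = a.conj
      · subst h
        rw [kap_conj, kap_mul_self, one_mul, J.conj_conj]
      · rw [B_eq_zero h, B_eq_zero, mul_zero]
        rw [J.conj_conj]
        rintro rfl
        exact h rfl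
    simp only [if_true, neg_zero, map_smul, LinearMap.smul_apply, smul_eq_mul]
    rw [hB]
    push_cast
    ring
  · simp [hr]

theorem degSub_stable (s : ZMod 2) : F.Stable (F.degSub s) := by
  intro a b r v h
  rw [degSub_eq] at h ⊢
  rw [bil_apply]
  refine add_mem (F.nord_mem fun k => ?_) (Submodule.smul_mem _ _ h)
  have h2 : ∀ p q : J m n e × ℤ, F.op p (F.op q v) ∈ F.gr degW s := by
    intro p q
    have := F.op_mem_gr degW_dual p (F.op_mem_gr degW_dual q h)
    rw [add_assoc] at this
    have e : degW q + degW p = 0 := CharTwo.add_self_eq_zero 1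
    rwa [e, add_zero] at this
  unfold term
  split_ifs
  · exact h2 (a, k) (b, _)
  · exact Submodule.smul_mem _ _ (h2 (b, _) (a, k))

variable {F} in
/-- The orthogonal complement of a stable subspace in one of the two parts of the Fock space. -/
theorem Stable.orthogonal {U : Submodule ℂ W} (hU : F.Stable U) (s : ZMod 2) :
    F.Stable (F.degSub s ⊓ ⨅ u : U, (F.bform u.1).ker) := by
  intro a b r v hv
  simp only [Submodule.mem_inf, Submodule.mem_iInf, LinearMap.mem_ker, Subtype.forall] at hv ⊢
  refine ⟨F.degSub_stable s a b r v hv.1, fun u hu => ?_⟩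
  rw [bform_symm, bform_bil, bform_symm, hv.2 _ (hU _ _ _ u hu), mul_zero]

/-! ### Cartan subalgebra -/

/-- The Cartan subalgebra acts diagonally. -/
theorem bil_cartan {x : J m n e} (hx : x.low = false) (v : W) :
    F.bil x x.conj 0 v = F.diag (tot fun p => (chi x p : ℂ)) v + (twc tw * x.sgn) • v := by
  suffices h : F.bil x x.conj 0 =
      F.diag (tot fun p => (chi x p : ℂ)) + (twc tw * x.sgn) • (1 : Module.End ℂ W) from
    LinearMap.congr_fun h v
  have hne : x ≠ x.conj := by cases x <;> simp [J.conj, J.low] at hx ⊢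
  refine F.ext_of_commute ?_ fun p v h => ?_
  · have hk : ∀ a : J m n e, (a = x ∨ a = x.conj) → ∀ k, (-shift tw) < k → F.A a k F.vac = 0 := by
      intro a _ k hk
      refine F.op_vac_of_not (a, k) fun h => ?_
      rcases h with h | ⟨h1, h2, -⟩
      · have := shift_cases tw
        simp only at h
        omega
      · subst h1
        simp only [shift] at h2 hk
        simp at hk
        omega
    have h0 : F.A x.conj 0 F.vac = 0 ∨ tw = true := by
      cases tw with
      | false => exact Or.inl (F.op_vac_of_not (x.conj, 0) (by simp [Cr]))
      | true => exact Or.inr rfl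
    have hw := F.bil_window (k0 := -shift tw) (lo := -shift tw) (r := 0) (hk x (Or.inl rfl))
      (hk x.conj (Or.inr rfl)) (by have := shift_cases tw; omega) le_rfl
    rw [Finset.Ico_self, Finset.sum_empty, zero_add, if_pos rfl, B_conj] at hw
    rw [hw, LinearMap.add_apply, F.vac_eq, diag_bas, tot_zero, zero_smul, zero_add, ← F.vac_eq,
      LinearMap.smul_apply, Module.End.one_apply]
    have e : (0 : ℤ) - shift tw - -shift tw = 0 := by ring
    rw [e]
    cases tw with
    | false =>
      rw [h0.resolve_right (by simp), map_zero, zero_add]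
      simp [shift, twc]
    | true =>
      have h1 : F.A x 0 F.vac = 0 := F.op_vac_of_not (x, 0) (by simp [Cr, hx])
      have h2 := F.ccr x x.conj 0 0 F.vac
      rw [h1, map_zero, smul_zero, zero_add, if_pos (by simp [shift]), B_conj] at h2
      have h3 : (-shift true : ℤ) = 0 := by simp [shift]
      rw [h3, h2, ← add_smul]
      congr 1
      simp [twc]
      ring
  · simp only [LinearMap.add_apply, LinearMap.smul_apply, Module.End.one_apply] at h ⊢
    have h1 := F.bil_comm x x.conj p.1 0 p.2 v
    rw [h, zero_add] at h1
    have h2 := F.diag_tot_op (ω := fun p => (chi x p : ℂ))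
      (fun q => by rw [chi_dual]; push_cast; rfl) p v
    have hB1 : B x.conj p.1 • F.A x p.2 v = (if p.1 = x then (1 : ℂ) else 0) • F.op p v := by
      by_cases h3 : p.1 = x
      · rw [h3, B_conj_left, if_pos rfl, op, h3]
        cases x <;> simp [J.conj, J.sgn, J.low] at hx ⊢
      · rw [B_eq_zero (by rwa [J.conj_conj]), if_neg h3, zero_smul, zero_smul]
    have hB2 : (kz x.conj.par p.1.par * B x p.1) • F.A x.conj p.2 v =
        (-(if p.1 = x.conj then (1 : ℂ) else 0)) • F.op p v := by
      by_cases h3 : p.1 = x.conj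
      · rw [h3, B_conj, if_pos rfl, op, h3]
        congr 1
        cases x <;> simp [J.conj, J.sgn, J.low, J.par, kz] at hx ⊢
      · rw [B_eq_zero h3, if_neg h3, mul_zero, zero_smul, neg_zero, zero_smul]
    have hB3 : kz x.par p.1.par * kz x.conj.par p.1.par = 1 := by rw [par_conj, kz_sq]
    have h4 : F.op p v = F.A p.1 p.2 v := rfl
    rw [h4] at h2 ⊢
    rw [hB1, hB2, hB3, one_smul] at h1
    have h5 : (chi x p : ℂ) = (if p.1 = x then 1 else 0) - (if p.1 = x.conj then 1 else 0) := by
      simp only [chi]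
      push_cast
      rfl
    rw [h1, h2, h4, map_add, map_smul, h5, op]
    module

/-! ### Irreducibility -/

/-- Minus twice the mode numbers, corrected by the charge with respect to `φ` and `φ*`; the
operator with these weights has finite-dimensional eigenspaces. -/
def finW (tw : Bool) (p : J m n e × ℤ) : ℤ := 2 * enW tw p - ∑ j : Fin n, chi (J.ph j) p

theorem sum_chi (p : J m n e × ℤ) : ∑ j : Fin n, chi (J.ph j) p =
    match p.1 with
    | .ph _ => 1
    | .phs _ => -1
    | _ => 0 := by
  obtain ⟨a, k⟩ := p
  cases a <;> simp [chi, J.conj]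

theorem le_finW {p : J m n e × ℤ} (hp : Cr tw p) : -4 * p.2 - 3 ≤ finW tw p ∧ 0 ≤ finW tw p ∧
    (p.1.par = 0 → 1 ≤ finW tw p) := by
  obtain ⟨a, k⟩ := p
  have hs := shift_cases tw
  simp only [finW, sum_chi, enW]
  rcases hp with h | ⟨rfl, h2, h3⟩
  · simp only at h
    cases a <;> simp [J.par] <;> omega
  · simp only at h2 h3
    subst h2
    cases a <;> simp [J.low] at h3 <;> simp [shift, J.par]

theorem finite_tot_le (tw : Bool) (N : ℤ) :
    {i : Idx m n e tw | tot (finW tw) i ≤ N}.Finite := by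
  classical
  have hbox : {p : J m n e × ℤ | Cr tw p ∧ finW tw p ≤ N}.Finite := by
    refine ((Set.finite_univ (α := J m n e)).prod (Set.finite_Icc (-(N + 3)) 0)).subset ?_
    rintro p ⟨h1, h2⟩
    have h3 := (le_finW h1).1
    refine ⟨Set.mem_univ _, Set.mem_Icc.mpr ⟨?_, ?_⟩⟩
    · by_cases h : p.2 < 0
      · linarith
      · have : finW tw p ≥ 0 := (le_finW h1).2.1
        omega
    · rcases h1 with h | ⟨-, h, -⟩ <;> omega
  have hfin : ∀ u, {c : CrMode m n e tw u | finW tw c.1 ≤ N}.Finite := fun u =>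
    (hbox.preimage (f := Subtype.val) Subtype.val_injective.injOn).subset
      fun c hc => ⟨c.2.2, hc⟩
  let T0 := (hfin 0).toFinset
  let T1 := (hfin 1).toFinset
  let g : CrMode m n e tw 0 →₀ ℕ := ∑ c ∈ T0, Finsupp.single c N.toNat
  refine ((Set.finite_Iic g).prod (T1.powerset.finite_toSet)).subset ?_
  rintro ⟨f, S⟩ hi
  have hi' : (f.sum fun c k => k • finW tw c.1) + ∑ c ∈ S, finW tw c.1 ≤ N := hi
  have h0 : ∀ c ∈ f.support, 0 ≤ f c • finW tw c.1 :=
    fun c _ => nsmul_nonneg (le_finW c.2.2).2.1 _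
  have h1 : ∀ c ∈ S, 0 ≤ finW tw c.1 := fun c _ => (le_finW c.2.2).2.1
  refine ⟨fun c => ?_, Finset.mem_coe.mpr (Finset.mem_powerset.mpr fun c hc => ?_)⟩
  · by_cases hc : f c = 0
    · rw [hc]; exact Nat.zero_le _
    · have h2 := Finset.single_le_sum h0 (Finsupp.mem_support_iff.mpr hc)
      have h3 : f c • finW tw c.1 ≤ N :=
        h2.trans ((le_add_of_nonneg_right (Finset.sum_nonneg h1)).trans hi')
      have h4 := (le_finW c.2.2).2.2 c.2.1
      have h5 : (1 : ℤ) ≤ f c := by exact_mod_cast Nat.one_le_iff_ne_zero.mpr hc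
      rw [nsmul_eq_mul] at h3
      have h6 : c ∈ T0 := by
        simp only [T0, Set.Finite.mem_toFinset, Set.mem_ofPred_eq]
        nlinarith
      have h7 : (f c : ℤ) ≤ N := by nlinarith
      have h8 : g c = N.toNat := by
        simp only [g, Finsupp.finsetSum_apply, Finsupp.single_apply, Finset.sum_ite_eq', h6, if_true]
      change f c ≤ g c
      rw [h8]
      omega
  · have h2 := Finset.single_le_sum h1 hc
    simp only [T1, Set.Finite.mem_toFinset, Set.mem_ofPred_eq]
    exact h2.trans ((le_add_of_nonneg_left (Finset.sum_nonneg h0)).trans hi')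

theorem aeval_diag (d : Idx m n e tw → ℂ) (p : Polynomial ℂ) :
    Polynomial.aeval (F.diag d) p = F.diag fun i => p.eval (d i) := by
  refine F.bas.ext fun i => ?_
  rw [diag_bas, Module.End.aeval_apply_of_hasEigenvector]
  exact ⟨Module.End.mem_eigenspace_iff.mpr (F.diag_bas d i), F.bas.ne_zero i⟩

theorem aeval_mem {T : Module.End ℂ W} {U : Submodule ℂ W} (hU : ∀ v ∈ U, T v ∈ U)
    (p : Polynomial ℂ) {u : W} (hu : u ∈ U) : Polynomial.aeval T p u ∈ U := by
  induction p using Polynomial.induction_on' with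
  | add p q hp hq => rw [map_add]; exact U.add_mem hp hq
  | monomial k c =>
    rw [Polynomial.aeval_monomial, Module.End.mul_apply, Module.algebraMap_end_apply]
    refine U.smul_mem c ?_
    induction k with
    | zero => exact hu
    | succ k ih => rw [pow_succ', Module.End.mul_apply]; exact hU _ ih

/-- Eigenprojections preserve subspaces that are stable under a diagonal operator. -/
theorem proj_mem {d : Idx m n e tw → ℂ} {U : Submodule ℂ W} (hU : ∀ v ∈ U, F.diag d v ∈ U) (x : ℂ)
    {u : W} (hu : u ∈ U) : F.diag (fun i => if d i = x then 1 else 0) u ∈ U := by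
  classical
  let E : Finset ℂ := ((F.bas.repr u).support.image d).erase x
  let p : Polynomial ℂ := ∏ y ∈ E, (Polynomial.C (x - y)⁻¹ * (Polynomial.X - Polynomial.C y))
  have hp : F.diag (fun i => if d i = x then 1 else 0) u = Polynomial.aeval (F.diag d) p u := by
    rw [aeval_diag]
    rw [← F.bas.linearCombination_repr u, Finsupp.linearCombination_apply, Finsupp.sum, map_sum,
      map_sum]
    refine Finset.sum_congr rfl fun i hi => ?_
    rw [map_smul, map_smul, diag_bas, diag_bas]
    congr 2
    simp only [p, Polynomial.eval_prod, Polynomial.eval_mul, Polynomial.eval_C, Polynomial.eval_sub,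
      Polynomial.eval_X]
    by_cases h : d i = x
    · rw [if_pos h, Finset.prod_eq_one]
      intro y hy
      rw [h]
      exact inv_mul_cancel₀ (sub_ne_zero.mpr (Finset.ne_of_mem_erase hy).symm)
    · rw [if_neg h, Finset.prod_eq_zero (i := d i)]
      · exact Finset.mem_erase.mpr ⟨h, Finset.mem_image_of_mem d hi⟩
      · rw [sub_self, mul_zero]
  rw [hp]
  exact aeval_mem hU p hu

theorem diag_apply_repr (d : Idx m n e tw → ℂ) (v : W) (i : Idx m n e tw) :
    F.bas.repr (F.diag d v) i = d i * F.bas.repr v i := by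
  have h : F.bas.coord i ∘ₗ F.diag d = d i • F.bas.coord i := by
    refine F.bas.ext fun j => ?_
    rw [LinearMap.comp_apply, LinearMap.smul_apply, diag_bas, map_smul, F.bas.coord_apply,
      F.bas.repr_self, smul_eq_mul, smul_eq_mul, Finsupp.single_apply]
    split_ifs with h
    · rw [h]
    · simp
  exact LinearMap.congr_fun h v

/-- The two parts of the Fock space are irreducible. -/
theorem eq_degSub_of_stable (he : e ≤ 1) (i0 : Fin n) {U : Submodule ℂ W} (hU : F.Stable U)
    (hd : ∀ v ∈ U, F.dOp v ∈ U) {s : ZMod 2} (hs : U ≤ F.degSub s) (hne : U ≠ ⊥) :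
    U = F.degSub s := by
  classical
  have hperp : F.degSub s ⊓ ⨅ u : U, (F.bform u.1).ker = ⊥ := by
    by_contra h
    have hin : ∀ w : W, F.bform w w ≠ 0 → w ∈ U →
        w ∉ F.degSub s ⊓ ⨅ u : U, (F.bform u.1).ker := by
      intro w hw hwU hwP
      simp only [Submodule.mem_inf, Submodule.mem_iInf, LinearMap.mem_ker, Subtype.forall] at hwP
      exact hw (hwP.2 w hwU)
    obtain ⟨p, hp, hc⟩ := F.exists_common he i0
    have h1 := hc s U hU hne hs
    have h2 := hc s _ (hU.orthogonal s) h inf_le_left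
    have hvac : F.vac ≠ 0 := by rw [F.vac_eq]; exact F.bas.ne_zero _
    rcases h1 with h1 | h1 <;> rcases h2 with h2 | h2
    · exact hin _ bform_vac_ne_zero h1 h2
    · rcases zmod_two_cases s with rfl | rfl
      · exact F.op_vac_ne_zero p hp (eq_zero_of_mem_degSub h2.1 (op_vac_mem_degSub p))
      · exact hvac (eq_zero_of_mem_degSub vac_mem_degSub (hs h1))
    · rcases zmod_two_cases s with rfl | rfl
      · exact F.op_vac_ne_zero p hp (eq_zero_of_mem_degSub (hs h1) (op_vac_mem_degSub p))
      · exact hvac (eq_zero_of_mem_degSub vac_mem_degSub h2.1)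
    · exact hin _ (bform_op_vac_ne_zero p hp) h1 h2
  have hH : ∀ v ∈ U, F.diag (fun i => ((tot (finW tw) i : ℤ) : ℂ)) v ∈ U := by
    intro v hv
    have h1 : F.diag (fun i => ((tot (finW tw) i : ℤ) : ℂ)) v = (-4 : ℂ) • F.dOp v -
        ∑ j : Fin n, F.diag (tot fun p => (chi (J.ph j) p : ℂ)) v := by
      have : F.diag (fun i => ((tot (finW tw) i : ℤ) : ℂ)) = (-4 : ℂ) • F.dOp -
          ∑ j : Fin n, F.diag (tot fun p => (chi (J.ph j) p : ℂ)) := by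
        refine F.bas.ext fun i => ?_
        rw [LinearMap.sub_apply, LinearMap.smul_apply, LinearMap.sum_apply, dOp]
        simp only [diag_bas]
        rw [← Finset.sum_smul, smul_smul, ← sub_smul]
        congr 1
        have hp : ∀ p : J m n e × ℤ, (finW tw p : ℂ) = -4 * modeNum tw p -
            ∑ j : Fin n, (chi (J.ph j) p : ℂ) := by
          intro p
          simp only [finW, enW, modeNum]
          push_cast
          ring
        simp only [tot, Finsupp.sum]
        push_cast
        simp only [nsmul_eq_mul, Int.cast_mul, Int.cast_natCast, hp, mul_add, mul_sub,
          Finset.sum_sub_distrib, Finset.sum_add_distrib, Finset.mul_sum]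
        rw [Finset.sum_comm (s := i.1.support), Finset.sum_comm (s := i.2)]
        simp only [mul_left_comm]
        ring
      rw [this, LinearMap.sub_apply, LinearMap.smul_apply, LinearMap.sum_apply]
    rw [h1]
    refine U.sub_mem (U.smul_mem _ (hd v hv)) (U.sum_mem fun j _ => ?_)
    have h2 := F.bil_cartan (x := J.ph j) rfl v
    rw [eq_sub_of_add_eq h2.symm]
    exact U.sub_mem (hU _ _ _ v hv) (U.smul_mem _ hv)
  refine le_antisymm hs ?_
  rw [degSub_eq]
  refine Submodule.span_le.mpr ?_
  rintro _ ⟨i, hi, rfl⟩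
  by_contra hiU
  obtain ⟨l, hl, hlU⟩ := Submodule.exists_le_ker_of_notMem (show F.bas i ∉ U from hiU)
  let T : Finset (Idx m n e tw) := ((finite_tot_le tw (tot (finW tw) i)).toFinset).filter
    fun j => tot (finW tw) j = tot (finW tw) i ∧ tot degW j = s
  have hT : ∀ j, j ∈ T ↔ tot (finW tw) j = tot (finW tw) i ∧ tot degW j = s := by
    intro j
    simp only [T, Finset.mem_filter, Set.Finite.mem_toFinset, Set.mem_ofPred_eq, and_iff_right_iff_imp]
    exact fun h => h.1.le
  have hw : ∑ j ∈ T, (l (F.bas j) / nu j) • F.bas j ∈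
      F.degSub s ⊓ ⨅ u : U, (F.bform u.1).ker := by
    simp only [Submodule.mem_inf, Submodule.mem_iInf, LinearMap.mem_ker, Subtype.forall]
    constructor
    · refine Submodule.sum_mem _ fun j hj => Submodule.smul_mem _ _ ?_
      rw [degSub_eq, ← ((hT j).mp hj).2]
      exact F.bas_mem_gr _ j
    · intro u hu
      have h1 := F.proj_mem hH ((tot (finW tw) i : ℤ) : ℂ) hu
      have h2 : F.diag (fun j => if ((tot (finW tw) j : ℤ) : ℂ) = ((tot (finW tw) i : ℤ) : ℂ) then 1 else 0) u =
          ∑ j ∈ T, F.bas.repr u j • F.bas j := by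
        refine F.bas.ext_elem fun j => ?_
        have hrs : F.bas.repr (∑ j ∈ T, F.bas.repr u j • F.bas j) j =
            if j ∈ T then F.bas.repr u j else 0 := by
          rw [map_sum, Finsupp.finsetSum_apply]
          simp only [map_smul, F.bas.repr_self, Finsupp.smul_apply, Finsupp.single_apply,
            smul_eq_mul, mul_ite, mul_one, mul_zero, Finset.sum_ite_eq']
        rw [diag_apply_repr, hrs]
        by_cases hj : tot (finW tw) j = tot (finW tw) i
        · rw [if_pos (by rw [hj]), one_mul]
          by_cases hs' : tot degW j = s
          · rw [if_pos ((hT j).mpr ⟨hj, hs'⟩)]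
          · rw [if_neg fun h => hs' ((hT j).mp h).2]
            have hu' := hs hu
            rw [degSub_eq, gr, F.bas.mem_span_image] at hu'
            by_contra h0
            exact hs' (hu' (Finsupp.mem_support_iff.mpr h0))
        · rw [if_neg (by exact_mod_cast hj), zero_mul, if_neg fun h => hj ((hT j).mp h).1]
      rw [h2] at h1
      have h3 := hlU h1
      rw [LinearMap.mem_ker, map_sum] at h3
      rw [bform_symm, map_sum, LinearMap.sum_apply, ← h3]
      refine Finset.sum_congr rfl fun j _ => ?_
      rw [map_smul, LinearMap.smul_apply, bform_bas_left, map_smul, smul_eq_mul, smul_eq_mul,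
        ← mul_assoc, div_mul_cancel₀ _ (nu_ne_zero j), mul_comm]
  rw [hperp, Submodule.mem_bot] at hw
  have h5 := linearIndependent_iff'.mp F.bas.linearIndependent T _ hw i ((hT i).mpr ⟨rfl, hi⟩)
  exact hl ((div_eq_zero_iff.mp h5).resolve_right (nu_ne_zero i))

end SuperFock

open SuperFock

section Tot

variable {tw : Bool}

theorem tot_sum {ι A : Type} [AddCommMonoid A] (T : Finset ι) (ω : ι → J m n e × ℤ → A)
    (i : Idx m n e tw) : tot (fun p => ∑ a ∈ T, ω a p) i = ∑ a ∈ T, tot (ω a) i := by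
  simp only [tot, Finsupp.sum, Finset.smul_sum, Finset.sum_add_distrib]
  rw [Finset.sum_comm, Finset.sum_comm (s := i.2)]

theorem tot_add {A : Type} [AddCommMonoid A] (ω ω' : J m n e × ℤ → A) (i : Idx m n e tw) :
    tot (fun p => ω p + ω' p) i = tot ω i + tot ω' i := by
  simp only [tot, Finsupp.sum, smul_add, Finset.sum_add_distrib]
  abel

theorem tot_mul_left {A : Type} [CommRing A] (x : A) (ω : J m n e × ℤ → A) (i : Idx m n e tw) :
    tot (fun p => x * ω p) i = x * tot ω i := by
  simp only [tot, Finsupp.sum, mul_add, Finset.mul_sum, nsmul_eq_mul, mul_left_comm]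

theorem tot_intCast (ω : J m n e × ℤ → ℤ) (i : Idx m n e tw) :
    tot (fun p => (ω p : ℂ)) i = (tot ω i : ℤ) := by
  simp only [tot, Finsupp.sum, nsmul_eq_mul]
  push_cast
  rfl

theorem tot_modeNum (i : Idx m n e tw) : tot (enW tw) i = -2 * tot (modeNum tw) i := by
  rw [← tot_mul_left, ← tot_intCast]
  congr 1
  funext p
  simp only [enW, modeNum]
  push_cast
  ring

end Tot

/-! ### Weights -/

theorem AffRep.loop_congr {W : Type} [AddCommGroup W] [Module ℂ W] (R : AffRep m n e W)
    {s s' : ZMod 2} {k k' : ℤ} {X : osp m n e s} {X' : osp m n e s'} (hs : s = s') (hk : k = k')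
    (hX : X.1 = X'.1) : R.loop s k X = R.loop s' k' X' := by
  subst hs hk
  rw [Subtype.ext hX]

/-- Root vectors shift weights. -/
theorem AffRep.loop_mem_wtSpace {W : Type} [AddCommGroup W] [Module ℂ W] (R : AffRep m n e W)
    {s : ZMod 2} {X : osp m n e s} {α μ : Wt m n} (hX : IsRootVec X α) (k : ℤ) {v : W}
    (hv : v ∈ R.wtSpace μ) :
    R.loop s k X v ∈ R.wtSpace ⟨μ.e + α.e, μ.f + α.f, μ.k, μ.u + k⟩ := by
  obtain ⟨h1, h2, h3, h4⟩ := hv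
  have key : ∀ (H : osp m n e 0) (x y : ℂ), H.1 * X.1 - X.1 * H.1 = x • X.1 →
      R.loop 0 0 H v = y • v → R.loop 0 0 H (R.loop s k X v) = (y + x) • R.loop s k X v := by
    intro H x y hH hy
    have h5 := LinearMap.congr_fun (R.loop_loop 0 s 0 k H X) v
    have h6 : R.loop (0 + s) (0 + k) (superBr H X) = x • R.loop s k X := by
      rw [← map_smul]
      refine R.loop_congr (zero_add s) (zero_add k) ?_
      change H.1 * X.1 - kz 0 s • (X.1 * H.1) = x • X.1
      rw [← hH]
      simp [kz]
    rw [h6] at h5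
    simp only [LinearMap.sub_apply, LinearMap.smul_apply, Module.End.mul_apply, hy, map_smul, Int.cast_zero, zero_mul, ite_self, zero_smul,
      add_zero] at h5
    rw [add_smul, ← h5]
    simp [kz]
  refine ⟨fun i => key _ _ _ (hX.1 i) (h1 i), fun j => key _ _ _ (hX.2 j) (h2 j), ?_, ?_⟩
  · have := LinearMap.congr_fun (R.K_loop s k X) v
    simp only [Module.End.mul_apply, h3, map_smul] at this
    exact this
  · have := LinearMap.congr_fun (R.d_loop s k X) v
    simp only [LinearMap.sub_apply, LinearMap.smul_apply, Module.End.mul_apply, h4, map_smul] at this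
    rw [eq_add_of_sub_eq this, add_smul, add_comm]

theorem chi_cast (x : J m n e) (p : J m n e × ℤ) :
    (chi x p : ℂ) = (if p.1 = x then 1 else 0) - (if p.1 = x.conj then 1 else 0) := by
  simp only [chi]
  push_cast
  rfl

theorem IsRootVec.e_eq {s : ZMod 2} {X : osp m n e s} {α : Wt m n} (hX : IsRootVec X α)
    {a b : J m n e} (h : X.1 a b ≠ 0) (i : Fin m) :
    α.e i = ((chi (.ps i) (a, 0) - chi (.ps i) (b, 0) : ℤ) : ℂ) := by
  have h1 := congrFun (congrFun (hX.1 i) a) b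
  simp only [hE, Matrix.sub_apply, Matrix.diagonal_mul, Matrix.mul_diagonal, Matrix.smul_apply,
    smul_eq_mul] at h1
  refine mul_right_cancel₀ h ?_
  have e1 : (J.ps i : J m n e).conj = .pss i := rfl
  rw [← h1, Int.cast_sub, chi_cast, chi_cast, e1]
  ring

/-- The weight of a basis vector of the Fock space. -/
def bwt (tw : Bool) (i : Idx m n e tw) : Wt m n :=
  ⟨fun a => tot (chi (.ps a)) i + twc tw, fun j => tot (chi (.ph j)) i - twc tw,
    1, tot (modeNum tw) i⟩

namespace SuperFock

variable {tw : Bool} {W : Type} [AddCommGroup W] [Module ℂ W] (F : SuperFock m n e tw W)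

theorem diag_eq_smul_iff (d : Idx m n e tw → ℂ) (x : ℂ) (v : W) :
    F.diag d v = x • v ↔ ∀ i, F.bas.repr v i ≠ 0 → d i = x := by
  refine ⟨fun h i hi => ?_, fun h => F.bas.ext_elem fun i => ?_⟩
  · have := F.diag_apply_repr d v i
    rw [h, map_smul, Finsupp.smul_apply, smul_eq_mul] at this
    exact (mul_right_cancel₀ hi this).symm
  · rw [diag_apply_repr, map_smul, Finsupp.smul_apply, smul_eq_mul]
    by_cases hi : F.bas.repr v i = 0
    · rw [hi, mul_zero, mul_zero]
    · rw [h i hi]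

theorem mem_gr_iff {A : Type} [AddCommMonoid A] (ω : J m n e × ℤ → A) (x : A) (v : W) :
    v ∈ F.gr ω x ↔ ∀ i, F.bas.repr v i ≠ 0 → tot ω i = x := by
  rw [gr, F.bas.mem_span_image]
  exact ⟨fun h i hi => h (Finsupp.mem_support_iff.mpr hi),
    fun h i hi => h i (Finsupp.mem_support_iff.mp hi)⟩

theorem loop_hE (i : Fin m) (v : W) : F.rep.loop 0 0 (hE i) v =
    F.diag (tot fun p => (chi (.ps i) p : ℂ)) v + twc tw • v := by
  have h := F.bil_cartan (x := .ps i) rfl v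
  rw [← cur_ospPair] at h
  have h2 : (hE i : osp m n e 0).1 = (ospPair (.ps i) (J.ps i).conj : osp m n e _).1 := by
    ext a b
    rw [ospPair_apply]
    cases a <;> cases b <;> simp [hE, Matrix.diagonal_apply, B, J.conj, J.sgn, J.par, kz] <;> split_ifs <;> simp_all
  change F.cur (hE i).1 0 v = _
  rw [h2, h]
  simp [J.sgn]

theorem loop_hD (j : Fin n) (v : W) : F.rep.loop 0 0 (hD j) v =
    F.diag (tot fun p => (chi (.ph j) p : ℂ)) v + (-twc tw) • v := by
  have h := F.bil_cartan (x := .ph j) rfl v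
  rw [← cur_ospPair] at h
  have h2 : (hD j : osp m n e 0).1 = (ospPair (.ph j) (J.ph j).conj : osp m n e _).1 := by
    ext a b
    rw [ospPair_apply]
    cases a <;> cases b <;> simp [hD, Matrix.diagonal_apply, B, J.conj, J.sgn, J.par, kz] <;> split_ifs <;> simp_all
  change F.cur (hD j).1 0 v = _
  rw [h2, h]
  simp [J.sgn]

theorem mem_wtSpace (μ : Wt m n) (v : W) :
    v ∈ F.rep.wtSpace μ ↔ ∀ i, F.bas.repr v i ≠ 0 → bwt tw i = μ := by
  have h0 : v ∈ F.rep.wtSpace μ ↔ (∀ i, F.rep.loop 0 0 (hE i) v = μ.e i • v) ∧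
    (∀ j, F.rep.loop 0 0 (hD j) v = μ.f j • v) ∧ v = μ.k • v ∧ F.dOp v = μ.u • v := Iff.rfl
  have hk : v = μ.k • v ↔ ∀ i, F.bas.repr v i ≠ 0 → 1 = μ.k := by
    rw [← F.diag_eq_smul_iff (fun _ => 1)]
    have : F.diag (fun _ => 1) = 1 := F.bas.ext fun i => by rw [diag_bas, one_smul]; rfl
    rw [this]; rfl
  rw [h0, hk, dOp, diag_eq_smul_iff]
  simp only [loop_hE, loop_hD, ← eq_sub_iff_add_eq, ← sub_smul, diag_eq_smul_iff]
  refine ⟨fun ⟨h1, h2, h3, h4⟩ i hi => ?_, fun h => ⟨fun a i hi => ?_, fun j i hi => ?_,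
    fun i hi => ?_, fun i hi => ?_⟩⟩
  · ext a
    · simp only [bwt]
      rw [← tot_intCast, h1 a i hi]; ring
    · simp only [bwt]
      rw [← tot_intCast, h2 a i hi]; ring
    · exact h3 i hi
    · exact h4 i hi
  · rw [← h i hi, tot_intCast]; simp [bwt]
  · rw [← h i hi, tot_intCast]; simp [bwt]
  · rw [← h i hi]; rfl
  · rw [← h i hi]; rfl

/-! ### Highest weight vectors -/

theorem inv_degSub (s : ZMod 2) : F.rep.Inv (F.degSub s) := by
  refine ⟨fun u k X v hv => ?_, fun v hv => hv, fun v hv => ?_⟩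
  · change F.cur X.1 k v ∈ _
    rw [cur_apply]
    exact Submodule.smul_mem _ _ (Submodule.sum_mem _ fun a _ => Submodule.sum_mem _ fun b _ =>
      Submodule.smul_mem _ _ (F.degSub_stable s _ _ _ v hv))
  · rw [degSub_eq] at hv ⊢
    exact F.dOp_gr _ _ hv

theorem isGraded_degSub (s : ZMod 2) : IsGraded F.parSub (F.degSub s) := by
  refine le_antisymm ?_ (sup_le inf_le_left inf_le_left)
  rw [degSub_eq, gr]
  refine Submodule.span_le.mpr ?_
  rintro _ ⟨i, hi, rfl⟩
  have h1 : F.bas i ∈ F.gr degW s := hi ▸ F.bas_mem_gr degW i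
  have h2 := F.bas_mem_gr parW i
  rw [parSub_eq, parSub_eq]
  rcases zmod_two_cases (tot parW i) with h | h <;> rw [h] at h2
  · exact Submodule.mem_sup_left ⟨h1, h2⟩
  · exact Submodule.mem_sup_right ⟨h1, h2⟩

theorem eq_bot_or_eq_degSub (he : e ≤ 1) (i0 : Fin n) {U : Submodule ℂ W} {s : ZMod 2}
    (hs : U ≤ F.degSub s) (hU : F.rep.Inv U) : U = ⊥ ∨ U = F.degSub s := by
  by_cases h : U = ⊥
  · exact Or.inl h
  · refine Or.inr (F.eq_degSub_of_stable he i0 (fun a b r v hv => ?_) hU.2.2 hs h)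
    rw [← cur_ospPair]
    exact hU.1 _ r (ospPair a b) v hv

end SuperFock

/-- A linear functional on weights. -/
def Wt.hgt (cE : Fin m → ℕ) (cD : Fin n → ℕ) (μ : Wt m n) : ℂ :=
  ∑ i, (cE i : ℂ) * μ.e i + ∑ j, (cD j : ℂ) * μ.f j

/-- The values of a linear functional on the weights of the modes. -/
def hgtW (cE : Fin m → ℕ) (cD : Fin n → ℕ) (p : J m n e × ℤ) : ℤ :=
  ∑ i, (cE i : ℤ) * chi (.ps i) p + ∑ j, (cD j : ℤ) * chi (.ph j) p

theorem hgtW_eq (cE : Fin m → ℕ) (cD : Fin n → ℕ) (p : J m n e × ℤ) : hgtW cE cD p =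
    match p.1 with
    | .ph j => (cD j : ℤ)
    | .phs j => -(cD j : ℤ)
    | .ps i => (cE i : ℤ)
    | .pss i => -(cE i : ℤ)
    | .z _ => 0 := by
  obtain ⟨a, k⟩ := p
  cases a <;> simp [hgtW, chi, J.conj]

theorem hgtW_le {tw : Bool} {cE : Fin m → ℕ} {cD : Fin n → ℕ} {H : ℕ} (hE : ∀ i, cE i ≤ H)
    (hD : ∀ j, cD j ≤ H) (i : Idx m n e tw) : tot (hgtW cE cD) i ≤ H * tot (enW tw) i := by
  have h : ∀ p : J m n e × ℤ, Cr tw p → 0 ≤ H * enW tw p + (-1) * hgtW cE cD p := by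
    rintro ⟨a, k⟩ hp
    have hs := shift_cases tw
    rw [hgtW_eq]
    rcases hp with h | ⟨rfl, h2, h3⟩
    · simp only at h
      have h4 : (H : ℤ) * 1 ≤ H * enW tw (a, k) :=
        mul_le_mul_of_nonneg_left (by simp only [enW]; omega) (by positivity)
      cases a with
      | ph j => have := hD j; simp only; omega
      | phs j => simp only; omega
      | ps i => have := hE i; simp only; omega
      | pss i => simp only; omega
      | z i => simp only; omega
    · simp only at h2 h3
      subst h2
      cases a <;> simp [J.low] at h3 <;> simp [enW, shift]
  have h1 := tot_nonneg h i
  rw [tot_add, tot_mul_left, tot_mul_left] at h1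
  linarith

theorem hgt_bwt {tw : Bool} (cE : Fin m → ℕ) (cD : Fin n → ℕ) (i : Idx m n e tw) :
    (bwt tw i).hgt cE cD = (tot (hgtW cE cD) i : ℤ) +
      twc tw * (∑ i, (cE i : ℂ) - ∑ j, (cD j : ℂ)) := by
  have h : tot (hgtW cE cD) i =
      ∑ a, (cE a : ℤ) * tot (chi (.ps a)) i + ∑ j, (cD j : ℤ) * tot (chi (.ph j)) i := by
    unfold hgtW
    rw [tot_add, tot_sum, tot_sum]
    simp only [tot_mul_left]
  rw [h]
  push_cast
  simp only [Wt.hgt, bwt, mul_add, mul_sub, Finset.sum_add_distrib, Finset.sum_sub_distrib]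
  rw [← Finset.sum_mul, ← Finset.sum_mul]
  ring

/-- The weight of the vector obtained by applying a mode to the vacuum. -/
def opWt (tw : Bool) (p : J m n e × ℤ) : Wt m n :=
  ⟨fun a => chi (.ps a) p + twc tw, fun j => chi (.ph j) p - twc tw, 1, modeNum tw p⟩

/-- The weight of the vacuum. -/
def vacWt (m n : ℕ) (tw : Bool) : Wt m n := ⟨fun _ => twc tw, fun _ => -twc tw, 1, 0⟩

namespace SuperFock

variable {tw : Bool} {W : Type} [AddCommGroup W] [Module ℂ W] (F : SuperFock m n e tw W)

/-- The simple roots have value one for a linear functional, except for `α₀ = δ - θ`. -/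
def HasHgt (α : Fin (m + n + 1) → Wt m n) (cE : Fin m → ℕ) (cD : Fin n → ℕ) : Prop :=
  ∀ j, (α j).u = 1 ∨ (α j).u = 0 ∧ (α j).hgt cE cD = 1

theorem loop_eq_zero {α : Fin (m + n + 1) → Wt m n} {cE : Fin m → ℕ} {cD : Fin n → ℕ} {H : ℕ}
    (hα : HasHgt α cE cD) (hE : ∀ i, cE i ≤ H) (hD : ∀ j, cD j ≤ H) {i0 : Idx m n e tw}
    (h1 : tot (hgtW cE cD) i0 = H * tot (enW tw) i0) (h2 : tot (enW tw) i0 ≤ 1) {v : W}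
    (hv : v ∈ F.rep.wtSpace (bwt tw i0)) {j : Fin (m + n + 1)} {s : ZMod 2} {k : ℤ}
    {X : osp m n e s} (hX : IsRootVec X (α j)) (hk : (k : ℂ) = (α j).u) :
    F.rep.loop s k X v = 0 := by
  have h := (F.mem_wtSpace _ _).mp (F.rep.loop_mem_wtSpace hX k hv)
  refine F.bas.ext_elem fun i => ?_
  rw [map_zero, Finsupp.zero_apply]
  by_contra hi
  have hw := h i hi
  have hle := hgtW_le hE hD i
  have hu : tot (enW tw) i = tot (enW tw) i0 - 2 * k := by
    have h3 : tot (modeNum tw) i = tot (modeNum tw) i0 + k := congrArg Wt.u hw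
    have h4 := tot_modeNum i
    have h5 := tot_modeNum i0
    have h6 : ((tot (enW tw) i : ℤ) : ℂ) = ((tot (enW tw) i0 - 2 * k : ℤ) : ℂ) := by
      push_cast
      rw [h4, h5, h3]
      ring
    exact_mod_cast h6
  have h0 := tot_nonneg enW_nonneg i
  rcases hα j with hj | ⟨hj, hj'⟩
  · have hk1 : k = 1 := by
      rw [hj] at hk
      exact_mod_cast hk
    omega
  · have hk0 : k = 0 := by
      rw [hj] at hk
      exact_mod_cast hk
    subst hk0
    have h3 := congrArg (Wt.hgt cE cD) hw
    have h4 : Wt.hgt cE cD (⟨(bwt tw i0).e + (α j).e, (bwt tw i0).f + (α j).f, (bwt tw i0).k,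
        (bwt tw i0).u + ((0 : ℤ) : ℂ)⟩ : Wt m n) = (bwt tw i0).hgt cE cD + (α j).hgt cE cD := by
      simp only [Wt.hgt, Pi.add_apply, mul_add, Finset.sum_add_distrib]
      ring
    rw [h4, hj', hgt_bwt, hgt_bwt] at h3
    have h5 : ((tot (hgtW cE cD) i : ℤ) : ℂ) = ((tot (hgtW cE cD) i0 + 1 : ℤ) : ℂ) := by
      push_cast
      linear_combination h3
    have h6 : tot (hgtW cE cD) i = tot (hgtW cE cD) i0 + 1 := by exact_mod_cast h5
    rw [hu, h6, h1] at hle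
    linarith

theorem isHW {α : Fin (m + n + 1) → Wt m n} {cE : Fin m → ℕ} {cD : Fin n → ℕ} {H : ℕ}
    (he : e ≤ 1) (hn : Fin n) (hα : HasHgt α cE cD) (hE : ∀ i, cE i ≤ H) (hD : ∀ j, cD j ≤ H)
    {i0 : Idx m n e tw} (h1 : tot (hgtW cE cD) i0 = H * tot (enW tw) i0)
    (h2 : tot (enW tw) i0 ≤ 1) {x : ℂ} (hx : x ≠ 0) :
    F.rep.IsHW (F.degSub (tot degW i0)) (tot parW i0) α (bwt tw i0) (x • F.bas i0) := by
  have hw : x • F.bas i0 ∈ F.rep.wtSpace (bwt tw i0) := by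
    refine Submodule.smul_mem _ _ ((F.mem_wtSpace _ _).mpr fun i hi => ?_)
    rw [F.bas.repr_self, Finsupp.single_apply] at hi
    rw [of_not_not fun h => hi (if_neg h)]
  refine ⟨F.inv_degSub _, F.isGraded_degSub _,
    fun U hU hI _ => F.eq_bot_or_eq_degSub he hn hU hI, Submodule.smul_mem _ _ ?_, ?_,
    smul_ne_zero hx (F.bas.ne_zero _), hw, fun j s k X hX hk => F.loop_eq_zero hα hE hD h1 h2 hw hX hk⟩
  · rw [degSub_eq]
    exact F.bas_mem_gr _ _
  · change _ ∈ F.parSub _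
    rw [parSub_eq]
    exact Submodule.smul_mem _ _ (F.bas_mem_gr _ _)

theorem isHW_vac {α : Fin (m + n + 1) → Wt m n} {cE : Fin m → ℕ} {cD : Fin n → ℕ}
    (he : e ≤ 1) (hn : Fin n) (hα : HasHgt α cE cD) :
    F.rep.IsHW (F.degSub 0) 0 α (vacWt m n tw) F.vac := by
  have h := F.isHW (i0 := (0, ∅)) (H := ∑ i, cE i + ∑ j, cD j) (x := 1) he hn hα
    (fun i => le_add_right (Finset.single_le_sum (fun _ _ => Nat.zero_le _) (Finset.mem_univ i)))
    (fun j => le_add_left (Finset.single_le_sum (fun _ _ => Nat.zero_le _) (Finset.mem_univ j)))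
    (by rw [tot_zero, tot_zero, mul_zero]) (by rw [tot_zero]; norm_num) one_ne_zero
  rw [tot_zero, tot_zero, one_smul, ← F.vac_eq] at h
  convert h using 1
  ext <;> simp [vacWt, bwt, tot_zero]

theorem isHW_op {α : Fin (m + n + 1) → Wt m n} {cE : Fin m → ℕ} {cD : Fin n → ℕ} {H : ℕ}
    (he : e ≤ 1) (hn : Fin n) (hα : HasHgt α cE cD) (hE : ∀ i, cE i ≤ H) (hD : ∀ j, cD j ≤ H)
    {p : J m n e × ℤ} (hp : Cr tw p) (h1 : hgtW cE cD p = H * enW tw p) (h2 : enW tw p ≤ 1) :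
    F.rep.IsHW (F.degSub 1) p.1.par α (opWt tw p) (F.op p F.vac) := by
  obtain ⟨x, i, h, h'⟩ := F.op_bas_cases p (0, ∅)
  rw [← F.vac_eq] at h
  have hx : x ≠ 0 := by
    rintro rfl
    exact F.op_vac_ne_zero p hp (by rw [h, zero_smul])
  have hω : ∀ {A : Type} [AddCommGroup A] (ω : J m n e × ℤ → A),
      (∀ p, ω (dualMode tw p) = -ω p) → tot ω i = ω p := fun ω hω => by
    rw [h'.resolve_left hx ω hω, tot_zero, zero_add]
  have hH : ∀ q : J m n e × ℤ, hgtW cE cD (dualMode tw q) = -hgtW cE cD q := fun q => by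
    simp only [hgtW, chi_dual, mul_neg, Finset.sum_neg_distrib]
    ring
  have h3 := F.isHW (i0 := i) he hn hα hE hD (by rw [hω _ hH, hω _ enW_dual, h1])
    (by rw [hω _ enW_dual]; exact h2) hx
  rw [hω _ degW_dual, hω _ parW_dual, ← h] at h3
  have h4 : opWt tw p = bwt tw i := by
    refine Wt.ext (funext fun a => ?_) (funext fun j => ?_) rfl ?_
    · simp only [opWt, bwt, hω _ (chi_dual tw _)]
    · simp only [opWt, bwt, hω _ (chi_dual tw _)]
    · simp only [opWt, bwt, hω _ modeNum_dual]
  rw [h4]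
  exact h3

/-! ### Integrability -/

/-- The energy grows faster than any multiple of the charge with respect to `ψ^a`. -/
theorem exists_charge_le (tw : Bool) (a : Fin m) (K : ℕ) : ∃ C : ℤ, ∀ i : Idx m n e tw,
    K * |tot (chi (.ps a)) i| - C ≤ tot (enW tw) i := by
  classical
  have hfin : {c : CrMode m n e tw 1 | enW tw c.1 < K}.Finite := by
    refine (((Set.finite_univ (α := J m n e)).prod (Set.finite_Icc (-(K + 1) : ℤ) 0)).preimage
      (f := Subtype.val) Subtype.val_injective.injOn).subset fun c hc => ⟨Set.mem_univ _, ?_⟩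
    have h1 : enW tw c.1 < K := hc
    have h2 := shift_cases tw
    have h3 := c.2.2
    simp only [enW] at h1
    refine Set.mem_Icc.mpr ⟨by omega, ?_⟩
    rcases h3 with h | ⟨-, h, -⟩ <;> omega
  refine ⟨K * hfin.toFinset.card, fun ⟨f, S⟩ => ?_⟩
  have h0 : ∀ c : CrMode m n e tw 0, chi (.ps a) c.1 = 0 := by
    rintro ⟨⟨b, k⟩, h, -⟩
    cases b <;> simp [chi, J.conj, J.par] at h ⊢
  have h1 : |tot (chi (.ps a)) (f, S)| ≤ S.card := by
    simp only [tot, Finsupp.sum, h0, smul_zero, Finset.sum_const_zero, zero_add]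
    refine (Finset.abs_sum_le_sum_abs _ _).trans ?_
    rw [Finset.card_eq_sum_ones]
    push_cast
    refine Finset.sum_le_sum fun c _ => ?_
    simp only [chi]
    split_ifs <;> simp
  have h2 : ∑ c ∈ S \ hfin.toFinset, (K : ℤ) ≤ tot (enW tw) (f, S) := by
    have h3 : ∑ c ∈ S \ hfin.toFinset, (K : ℤ) ≤ ∑ c ∈ S, enW tw c.1 := by
      refine (Finset.sum_le_sum fun c hc => ?_).trans
        (Finset.sum_le_sum_of_subset_of_nonneg Finset.sdiff_subset
          fun c _ _ => enW_nonneg _ c.2.2)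
      have := (Finset.mem_sdiff.mp hc).2
      rw [Set.Finite.mem_toFinset] at this
      exact not_lt.mp this
    exact h3.trans (le_add_of_nonneg_left (Finset.sum_nonneg fun c _ =>
      nsmul_nonneg (enW_nonneg _ c.2.2) _))
  rw [Finset.sum_const, nsmul_eq_mul] at h2
  have h3 : S.card ≤ (S \ hfin.toFinset).card + hfin.toFinset.card := by
    have := Finset.le_card_sdiff hfin.toFinset S
    omega
  have h4 : (S.card : ℤ) ≤ (S \ hfin.toFinset).card + hfin.toFinset.card := by exact_mod_cast h3
  nlinarith

theorem soIntegrable : F.rep.SoIntegrable := by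
  classical
  intro X α hXp hX hα k v
  by_cases hX0 : X = 0
  · refine ⟨1, ?_⟩
    rw [hX0, map_zero, pow_one, LinearMap.zero_apply]
  obtain ⟨a, b, hab⟩ : ∃ a b, X.1 a b ≠ 0 := by
    by_contra h
    push Not at h
    exact hX0 (Subtype.ext (by ext a b; exact h a b))
  obtain ⟨i1, hi1⟩ := Function.ne_iff.mp hα
  have hc := hX.e_eq hab i1
  generalize chi (.ps i1) (a, 0) - chi (.ps i1) (b, 0) = c at hc
  have hc0 : c ≠ 0 := by
    rintro rfl
    exact hi1 (by rw [hc]; simp)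
  obtain ⟨C, hC⟩ := exists_charge_le (m := m) (n := n) (e := e) tw i1 (2 * k.natAbs + 1)
  have hpow : ∀ (N : ℕ) (μ : Wt m n) (v : W), v ∈ F.rep.wtSpace μ →
      ∃ μ' : Wt m n, (F.rep.loop 0 k X ^ N) v ∈ F.rep.wtSpace μ' ∧
        μ'.e i1 = μ.e i1 + N * c ∧ μ'.u = μ.u + N * k := by
    intro N μ v hv
    induction N with
    | zero => exact ⟨μ, by simpa using hv, by simp, by simp⟩
    | succ N ih =>
      obtain ⟨μ', h1, h2, h3⟩ := ih
      rw [pow_succ', Module.End.mul_apply]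
      refine ⟨_, F.rep.loop_mem_wtSpace hX k h1, ?_, ?_⟩
      · simp only [Pi.add_apply, h2, hc]; push_cast; ring
      · simp only [h3]; push_cast; ring
  have hbas : ∀ i : Idx m n e tw, ∃ N : ℕ, (F.rep.loop 0 k X ^ N) (F.bas i) = 0 := by
    intro i
    let N : ℕ := (tot (enW tw) i + (2 * k.natAbs + 1) * |tot (chi (.ps i1)) i| + C).natAbs + 1
    refine ⟨N, ?_⟩
    obtain ⟨μ', h1, h2, h3⟩ := hpow N (bwt tw i) (F.bas i)
      ((F.mem_wtSpace _ _).mpr fun j hj => by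
        rw [F.bas.repr_self, Finsupp.single_apply] at hj
        rw [of_not_not fun h => hj (if_neg h)])
    refine F.bas.ext_elem fun j => ?_
    rw [map_zero, Finsupp.zero_apply]
    by_contra hj
    have hw := (F.mem_wtSpace _ _).mp h1 j hj
    rw [← hw] at h2 h3
    simp only [bwt] at h2 h3
    have h4 : tot (chi (.ps i1)) j = tot (chi (.ps i1)) i + N * c := by
      have : ((tot (chi (.ps i1)) j : ℤ) : ℂ) = ((tot (chi (.ps i1)) i + N * c : ℤ) : ℂ) := by
        push_cast
        linear_combination h2
      exact_mod_cast this
    have h5 : tot (enW tw) j = tot (enW tw) i - 2 * (N * k) := by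
      have h6 := tot_modeNum j
      have h7 := tot_modeNum i
      have : ((tot (enW tw) j : ℤ) : ℂ) = ((tot (enW tw) i - 2 * (N * k) : ℤ) : ℂ) := by
        push_cast
        rw [h6, h7, h3]
        ring
      exact_mod_cast this
    have h6 := hC j
    rw [h4, h5] at h6
    have h7 : (N : ℤ) - |tot (chi (.ps i1)) i| ≤ |tot (chi (.ps i1)) i + N * c| := by
      have h8 : (N : ℤ) ≤ |(N : ℤ) * c| := by
        rw [abs_mul, Nat.abs_cast]
        exact le_mul_of_one_le_right (by positivity) (Int.one_le_abs hc0)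
      have h9 := abs_sub_abs_le_abs_sub ((N : ℤ) * c) (-tot (chi (.ps i1)) i)
      rw [abs_neg, sub_neg_eq_add, add_comm] at h9
      rw [add_comm] at h9
      rw [add_comm (tot _ _)]
      omega
    have h10 : ((2 * k.natAbs + 1 : ℕ) : ℤ) * ((N : ℤ) - |tot (chi (.ps i1)) i|) ≤
        ((2 * k.natAbs + 1 : ℕ) : ℤ) * |tot (chi (.ps i1)) i + N * c| :=
      mul_le_mul_of_nonneg_left h7 (by positivity)
    have h11 : -(N * k) ≤ (N : ℤ) * k.natAbs := by
      have : -k ≤ k.natAbs := by omega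
      nlinarith
    have h12 : tot (enW tw) i + (2 * k.natAbs + 1) * |tot (chi (.ps i1)) i| + C < N := by
      simp only [N]
      push_cast
      exact lt_of_le_of_lt (le_abs_self _) (lt_add_one _)
    push_cast at h10 h6 h11 h12
    nlinarith
  induction F.bas.mem_span v using Submodule.span_induction with
  | mem v hv =>
    obtain ⟨i, rfl⟩ := hv
    exact hbas i
  | zero => exact ⟨0, map_zero _⟩
  | add v w _ _ h1 h2 =>
    obtain ⟨N1, h1⟩ := h1
    obtain ⟨N2, h2⟩ := h2
    refine ⟨N1 + N2, ?_⟩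
    rw [map_add, add_comm N1, pow_add, Module.End.mul_apply, h1, map_zero, zero_add, ← pow_add,
      add_comm N2, pow_add, Module.End.mul_apply, h2, map_zero]
  | smul x v _ h =>
    obtain ⟨N, h⟩ := h
    exact ⟨N, by rw [map_smul, h, smul_zero]⟩

end SuperFock

/-! ### Systems of simple roots -/

namespace Wt

theorem ip_add_right (a b c : Wt m n) : a.ip (b + c) = a.ip b + a.ip c := by
  have h1 : (b + c).e = b.e + c.e := rfl
  have h2 : (b + c).f = b.f + c.f := rfl
  have h3 : (b + c).k = b.k + c.k := rfl
  have h4 : (b + c).u = b.u + c.u := rfl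
  simp only [ip, h1, h2, h3, h4, Pi.add_apply, mul_add, Finset.sum_add_distrib]
  ring

theorem ip_sub_right (a b c : Wt m n) : a.ip (b - c) = a.ip b - a.ip c := by
  have h1 : (b - c).e = b.e - c.e := rfl
  have h2 : (b - c).f = b.f - c.f := rfl
  have h3 : (b - c).k = b.k - c.k := rfl
  have h4 : (b - c).u = b.u - c.u := rfl
  simp only [ip, h1, h2, h3, h4, Pi.sub_apply, mul_sub, Finset.sum_sub_distrib]
  ring

theorem ip_comm (a b : Wt m n) : a.ip b = b.ip a := by
  simp only [ip, mul_comm]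
  ring

theorem ip_imag (a : Wt m n) : a.ip imag = a.k := by simp [ip, imag]

theorem ip_eps (a : Wt m n) (i : Fin m) : a.ip (eps i) = a.e i := by simp [ip, eps, Fin.val_inj]

theorem ip_del (a : Wt m n) (j : Fin n) : a.ip (del j) = -a.f j := by simp [ip, del, Fin.val_inj]

theorem coroot_eq_zero {a α : Wt m n} (h : a.ip α = 0) : a.coroot α = 0 := by
  simp [coroot, h]

theorem coroot_eq_one {a α : Wt m n} (h : a.ip α = 1) (hα : α.ip α = 0 ∨ α.ip α = 2) :
    a.coroot α = 1 := by
  rcases hα with hα | hα <;> simp [coroot, h, hα]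

theorem hgt_sub (cE : Fin m → ℕ) (cD : Fin n → ℕ) (a b : Wt m n) :
    (a - b).hgt cE cD = a.hgt cE cD - b.hgt cE cD := by
  have h1 : (a - b).e = a.e - b.e := rfl
  have h2 : (a - b).f = a.f - b.f := rfl
  simp only [hgt, h1, h2, Pi.sub_apply, mul_sub, Finset.sum_sub_distrib]
  ring

theorem hgt_add (cE : Fin m → ℕ) (cD : Fin n → ℕ) (a b : Wt m n) :
    (a + b).hgt cE cD = a.hgt cE cD + b.hgt cE cD := by
  have h1 : (a + b).e = a.e + b.e := rfl
  have h2 : (a + b).f = a.f + b.f := rfl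
  simp only [hgt, h1, h2, Pi.add_apply, mul_add, Finset.sum_add_distrib]
  ring

end Wt

/-- The positions `pE`, `pD` define an order of the weights `ε_i`, `δ_j`. -/
structure IsOrd (pE : Fin m → ℕ) (pD : Fin n → ℕ) : Prop where
  injE : Function.Injective pE
  injD : Function.Injective pD
  ne : ∀ i j, pE i ≠ pD j
  ltE : ∀ i, pE i < m + n
  ltD : ∀ j, pD j < m + n

namespace IsOrd

variable {pE : Fin m → ℕ} {pD : Fin n → ℕ}

theorem exists_pos (h : IsOrd pE pD) {p : ℕ} (hp : p < m + n) : (∃ i, pE i = p) ∨ ∃ j, pD j = p := by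
  let g : Fin m ⊕ Fin n → Fin (m + n) :=
    Sum.elim (fun i => ⟨pE i, h.ltE i⟩) (fun j => ⟨pD j, h.ltD j⟩)
  have hg : Function.Injective g := by
    rintro (i | i) (j | j) hij <;> simp only [g, Sum.elim_inl, Sum.elim_inr, Fin.mk.injEq] at hij
    · rw [h.injE hij]
    · exact (h.ne _ _ hij).elim
    · exact (h.ne _ _ hij.symm).elim
    · rw [h.injD hij]
  have hs := (hg.bijective_of_nat_card_le (by simp)).2 ⟨p, hp⟩
  obtain ⟨i | j, hx⟩ := hs
  · exact Or.inl ⟨i, congrArg Fin.val hx⟩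
  · exact Or.inr ⟨j, congrArg Fin.val hx⟩

theorem ip_E (h : IsOrd pE pD) (a : Wt m n) (i : Fin m) : a.ip (ordWt pE pD (pE i)) = a.e i := by
  simp [Wt.ip, ordWt, h.injE.eq_iff, (h.ne _ _).symm]

theorem ip_D (h : IsOrd pE pD) (a : Wt m n) (j : Fin n) : a.ip (ordWt pE pD (pD j)) = -a.f j := by
  simp [Wt.ip, ordWt, h.injD.eq_iff, h.ne]

/-- The values of a weight on the ordered basis. -/
theorem ip_eq (h : IsOrd pE pD) {a : Wt m n} {L : ℕ → ℂ} (hE : ∀ i, a.e i = L (pE i))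
    (hD : ∀ j, -a.f j = L (pD j)) {p : ℕ} (hp : p < m + n) : a.ip (ordWt pE pD p) = L p := by
  rcases h.exists_pos hp with ⟨i, rfl⟩ | ⟨j, rfl⟩
  · rw [h.ip_E, hE]
  · rw [h.ip_D, hD]

theorem ip_self_E (h : IsOrd pE pD) (i : Fin m) :
    (ordWt pE pD (pE i)).ip (ordWt pE pD (pE i)) = 1 := by
  rw [h.ip_E]; simp [ordWt]

theorem ip_self_D (h : IsOrd pE pD) (j : Fin n) :
    (ordWt pE pD (pD j)).ip (ordWt pE pD (pD j)) = -1 := by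
  rw [h.ip_D]; simp [ordWt]

theorem ip_of_ne (h : IsOrd pE pD) {p q : ℕ} (hpq : p ≠ q) (hq : q < m + n) :
    (ordWt pE pD p).ip (ordWt pE pD q) = 0 := by
  rcases h.exists_pos hq with ⟨i, rfl⟩ | ⟨j, rfl⟩
  · rw [h.ip_E]; simp [ordWt, hpq.symm]
  · rw [h.ip_D]; simp [ordWt, hpq.symm]

theorem norm_sub (h : IsOrd pE pD) {p q : ℕ} (hpq : p ≠ q) (hp : p < m + n) (hq : q < m + n) :
    (ordWt pE pD p - ordWt pE pD q).ip (ordWt pE pD p - ordWt pE pD q) =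
      (ordWt pE pD p).ip (ordWt pE pD p) + (ordWt pE pD q).ip (ordWt pE pD q) := by
  rw [Wt.ip_sub_right, Wt.ip_comm, Wt.ip_sub_right, Wt.ip_comm (_ - _), Wt.ip_sub_right,
    h.ip_of_ne hpq hq, h.ip_of_ne hpq.symm hp]
  ring

theorem norm_add (h : IsOrd pE pD) {p q : ℕ} (hpq : p ≠ q) (hp : p < m + n) (hq : q < m + n) :
    (ordWt pE pD p + ordWt pE pD q).ip (ordWt pE pD p + ordWt pE pD q) =
      (ordWt pE pD p).ip (ordWt pE pD p) + (ordWt pE pD q).ip (ordWt pE pD q) := by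
  rw [Wt.ip_add_right, Wt.ip_comm, Wt.ip_add_right, Wt.ip_comm (_ + _), Wt.ip_add_right,
    h.ip_of_ne hpq hq, h.ip_of_ne hpq.symm hp]
  ring

theorem norm_imag_sub (θ : Wt m n) (hk : θ.k = 0) :
    (Wt.imag - θ).ip (Wt.imag - θ) = θ.ip θ := by
  have h1 : (Wt.imag - θ : Wt m n).k = 0 := by
    change (0 : ℂ) - θ.k = 0
    rw [hk, sub_zero]
  rw [Wt.ip_sub_right, Wt.ip_imag, h1, Wt.ip_comm, Wt.ip_sub_right, Wt.ip_imag, hk]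
  ring

theorem hgt_eq (h : IsOrd pE pD) (c : ℕ → ℕ) {p : ℕ} (hp : p < m + n) :
    (ordWt pE pD p).hgt (fun i => c (pE i)) (fun j => c (pD j)) = c p := by
  rcases h.exists_pos hp with ⟨i, rfl⟩ | ⟨j, rfl⟩
  · simp [Wt.hgt, ordWt, h.injE.eq_iff, (h.ne _ _).symm]
  · simp [Wt.hgt, ordWt, h.injD.eq_iff, h.ne]

/-- Heights with respect to the finite simple roots. -/
theorem hasHgt (h : IsOrd pE pD) (he : e ≤ 1) (hmn : 2 ≤ m + n + e) {θ : Wt m n} (hθ : θ.u = 0) :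
    HasHgt (affRoots e (ordWt pE pD) θ) (fun i => m + n - 1 + e - pE i)
      (fun j => m + n - 1 + e - pD j) := by
  intro j
  have hg := fun p hp => h.hgt_eq (p := p) (fun p => m + n - 1 + e - p) hp
  have hj := j.2
  unfold affRoots
  split_ifs with h1 h2 h3
  · left
    change (1 : ℂ) - θ.u = 1
    rw [hθ, sub_zero]
  · refine Or.inr ⟨sub_zero _, ?_⟩
    rw [Wt.hgt_sub, hg _ (by omega), hg _ h2,
      show m + n - 1 + e - (j.val - 1) = m + n - 1 + e - j.val + 1 by omega]
    push_cast
    ring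
  · refine Or.inr ⟨rfl, ?_⟩
    rw [hg _ (by omega), show m + n - 1 + e - (j.val - 1) = 1 by omega, Nat.cast_one]
  · refine Or.inr ⟨add_zero _, ?_⟩
    rw [Wt.hgt_add, hg _ (by omega), hg _ (by omega),
      show m + n - 1 + e - (j.val - 2) = 1 by omega, show m + n - 1 + e - (j.val - 1) = 0 by omega]
    norm_num

end IsOrd

/-- The positions in the order that defines the distinguished simple roots. -/
theorem isOrd_dist (m n : ℕ) : IsOrd (fun i : Fin m => n + i.val) (fun j : Fin n => j.val) where
  injE i j hij := Fin.ext (by simpa using hij)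
  injD i j hij := Fin.ext hij
  ne i j := by have := j.2; omega
  ltE i := by have := i.2; omega
  ltD j := by have := j.2; omega

/-- The position of `ε_{i+1}` in the order adapted to integrable modules. -/
def intE (m n e : ℕ) (i : Fin m) : ℕ :=
  if n ≤ i.val then m - 1 - i.val else (m - n) + 2 * (n - 1 - i.val) + (1 - e)

/-- The position of `δ_{j+1}` in the order adapted to integrable modules. -/
def intD (m n e : ℕ) (j : Fin n) : ℕ := (m - n) + 2 * (n - 1 - j.val) + e

theorem isOrd_int (he : e ≤ 1) (hmn : n ≤ m) : IsOrd (intE m n e) (intD m n e) where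
  injE i j hij := by
    have := i.2
    have := j.2
    simp only [intE] at hij
    refine Fin.ext ?_
    split_ifs at hij <;> omega
  injD i j hij := by
    have := i.2
    have := j.2
    simp only [intD] at hij
    exact Fin.ext (by omega)
  ne i j := by
    have := i.2
    have := j.2
    simp only [intE, intD]
    split_ifs <;> omega
  ltE i := by
    have := i.2
    simp only [intE]
    split_ifs <;> omega
  ltD j := by
    have := j.2
    simp only [intD]
    omega

theorem intRoots_eq (m n e : ℕ) : intRoots m n e = affRoots e (ordWt (intE m n e) (intD m n e))
    (ordWt (intE m n e) (intD m n e) 0 + ordWt (intE m n e) (intD m n e) 1) := rfl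

theorem isFund_affRoots {w : ℕ → Wt m n} {θ Λ : Wt m n} {i : ℕ}
    (h0 : Λ.coroot (Wt.imag - θ) = if 0 = i then 1 else 0)
    (hmid : ∀ p, p + 1 < m + n → Λ.coroot (w p - w (p + 1)) = if p + 1 = i then 1 else 0)
    (hlast : Λ.coroot (if e = 1 then w (m + n - 1) else w (m + n - 2) + w (m + n - 1)) =
      if m + n = i then 1 else 0) : IsFund (affRoots e w θ) i Λ := by
  intro j
  have hj := j.2
  unfold affRoots
  by_cases h1 : j.val = 0
  · rw [if_pos h1, h0, h1]
  · rw [if_neg h1]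
    by_cases h2 : j.val < m + n
    · have := hmid (j.val - 1) (by omega)
      rw [Nat.sub_add_cancel (by omega)] at this
      rw [if_pos h2, this]
    · have h3 : j.val = m + n := by omega
      rw [if_neg h2, h3, hlast]

/-- The norms of the ordered weights in the order adapted to integrable modules. -/
def intSg (m n e p : ℕ) : ℂ := if p < m - n ∨ (p - (m - n)) % 2 = 1 - e then 1 else -1

theorem norm_int (he : e ≤ 1) (hmn : n ≤ m) {p : ℕ} (hp : p < m + n) :
    (ordWt (intE m n e) (intD m n e) p).ip (ordWt (intE m n e) (intD m n e) p) =
      intSg m n e p := by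
  have h := isOrd_int he hmn
  rcases h.exists_pos hp with ⟨i, hi⟩ | ⟨j, hj⟩
  · rw [← hi, h.ip_self_E, intSg, if_pos]
    have := i.2
    simp only [intE]
    split_ifs <;> omega
  · rw [← hj, h.ip_self_D, intSg, if_neg]
    have := j.2
    simp only [intD]
    omega

theorem intSg_or (m n e p : ℕ) : intSg m n e p = 1 ∨ intSg m n e p = -1 := by
  unfold intSg
  split_ifs <;> simp

theorem one_add_intSg (m n e p : ℕ) : 1 + intSg m n e p = 0 ∨ 1 + intSg m n e p = 2 := by
  rcases intSg_or m n e p with h | h <;> rw [h] <;> norm_num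

/-! ### Fundamental weights -/

theorem IsOrd.norm_or {pE : Fin m → ℕ} {pD : Fin n → ℕ} (h : IsOrd pE pD) {p : ℕ}
    (hp : p < m + n) : (ordWt pE pD p).ip (ordWt pE pD p) = 1 ∨
      (ordWt pE pD p).ip (ordWt pE pD p) = -1 := by
  rcases h.exists_pos hp with ⟨i, rfl⟩ | ⟨j, rfl⟩
  · exact Or.inl (h.ip_self_E i)
  · exact Or.inr (h.ip_self_D j)

theorem IsOrd.ip_vac {pE : Fin m → ℕ} {pD : Fin n → ℕ} (h : IsOrd pE pD) (tw : Bool) {p : ℕ}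
    (hp : p < m + n) : (vacWt m n tw).ip (ordWt pE pD p) = twc tw :=
  h.ip_eq (L := fun _ => twc tw) (fun _ => rfl) (fun _ => neg_neg _) hp

theorem IsOrd.ip_opWt_pss {pE : Fin m → ℕ} {pD : Fin n → ℕ} (h : IsOrd pE pD) (i : Fin m) {p : ℕ}
    (hp : p < m + n) : (opWt true ((.pss i, 0) : J m n e × ℤ)).ip (ordWt pE pD p) =
      if p = pE i then -1 / 2 else 1 / 2 := by
  refine h.ip_eq (L := fun p => if p = pE i then -1 / 2 else 1 / 2) (fun a => ?_) (fun j => ?_) hp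
  · simp only [opWt, chi, J.conj, h.injE.eq_iff, twc]
    by_cases hi : i = a
    · subst hi; simp; try norm_num
    · simp [hi, Ne.symm hi]
  · simp [opWt, chi, J.conj, twc, (h.ne _ _).symm]

theorem IsOrd.ip_opWt_ps {pE : Fin m → ℕ} {pD : Fin n → ℕ} (h : IsOrd pE pD) (i : Fin m) {p : ℕ}
    (hp : p < m + n) : (opWt false ((.ps i, -1) : J m n e × ℤ)).ip (ordWt pE pD p) =
      if p = pE i then 1 else 0 := by
  refine h.ip_eq (L := fun p => if p = pE i then 1 else 0) (fun a => ?_) (fun j => ?_) hp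
  · simp only [opWt, chi, J.conj, h.injE.eq_iff, twc]
    by_cases hi : i = a
    · subst hi; simp; try norm_num
    · simp [hi, Ne.symm hi]
  · simp [opWt, chi, J.conj, twc, (h.ne _ _).symm]

/-- The weight of the twisted vacuum is a fundamental weight for even `M`. -/
theorem IsOrd.isFund_spin {pE : Fin m → ℕ} {pD : Fin n → ℕ} (h : IsOrd pE pD) (hmn : 2 ≤ m + n)
    {θ : Wt m n} (hθ : (vacWt m n true).ip θ = 1) {i : Fin m} (hi : pE i = m + n - 1) :
    IsFund (affRoots 0 (ordWt pE pD) θ) (m + n) (vacWt m n true) := by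
  refine isFund_affRoots ?_ (fun p hp => ?_) ?_
  · rw [if_neg (by omega), Wt.coroot_eq_zero]
    rw [Wt.ip_sub_right, Wt.ip_imag, hθ]
    exact sub_self _
  · rw [if_neg (by omega), Wt.coroot_eq_zero]
    rw [Wt.ip_sub_right, h.ip_vac _ hp, h.ip_vac _ (by omega), sub_self]
  · rw [if_neg (by norm_num), if_pos rfl, Wt.coroot_eq_one]
    · rw [Wt.ip_add_right, h.ip_vac _ (by omega), h.ip_vac _ (by omega)]
      norm_num [twc]
    · rw [h.norm_add (by omega) (by omega) (by omega), ← hi, h.ip_self_E]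
      rcases h.norm_or (p := m + n - 2) (by omega) with h1 | h1 <;> rw [h1] <;> norm_num

theorem IsOrd.isFund_cospin {pE : Fin m → ℕ} {pD : Fin n → ℕ} (h : IsOrd pE pD) (hmn : 2 ≤ m + n)
    {θ : Wt m n} {i : Fin m} (hi : pE i = m + n - 1)
    (hθ : (opWt true ((.pss i, 0) : J m n 0 × ℤ)).ip θ = 1) :
    IsFund (affRoots 0 (ordWt pE pD) θ) (m + n - 1) (opWt true ((.pss i, 0) : J m n 0 × ℤ)) := by
  refine isFund_affRoots ?_ (fun p hp => ?_) ?_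
  · rw [if_neg (by omega), Wt.coroot_eq_zero]
    rw [Wt.ip_sub_right, Wt.ip_imag, hθ]
    exact sub_self _
  · by_cases hp1 : p + 1 = m + n - 1
    · rw [if_pos hp1, Wt.coroot_eq_one]
      · rw [Wt.ip_sub_right, h.ip_opWt_pss _ hp, h.ip_opWt_pss _ (by omega), hi, if_pos hp1,
          if_neg (by omega)]
        norm_num
      · rw [h.norm_sub (by omega) (by omega) (by omega), hp1, ← hi, h.ip_self_E]
        rcases h.norm_or (p := p) (by omega) with h1 | h1 <;> rw [h1] <;> norm_num
    · rw [if_neg hp1, Wt.coroot_eq_zero]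
      rw [Wt.ip_sub_right, h.ip_opWt_pss _ hp, h.ip_opWt_pss _ (by omega), hi, if_neg hp1,
          if_neg (by omega), sub_self]
  · rw [if_neg (by norm_num), if_neg (by omega), Wt.coroot_eq_zero]
    rw [Wt.ip_add_right, h.ip_opWt_pss _ (by omega), h.ip_opWt_pss _ (by omega), hi, if_pos rfl,
      if_neg (by omega)]
    norm_num

section Int

theorem norm_alpha_zero (he : e ≤ 1) (hn : 1 ≤ n) (hmn : n < m ∨ m = n ∧ e = 1) :
    let w := ordWt (intE m n e) (intD m n e)
    (Wt.imag - (w 0 + w 1)).ip (Wt.imag - (w 0 + w 1)) = 1 + intSg m n e 1 := by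
  have h := isOrd_int (m := m) (n := n) he (by omega)
  intro w
  rw [IsOrd.norm_imag_sub _ (add_zero _), h.norm_add (by omega) (by omega) (by omega),
    norm_int he (by omega) (by omega), norm_int he (by omega) (by omega)]
  congr 1
  rw [intSg, if_pos]
  omega

theorem isFund_int_zero (he : e ≤ 1) (hn : 1 ≤ n) (hmn : n < m ∨ m = n ∧ e = 1) :
    IsFund (intRoots m n e) 0 (vacWt m n false) := by
  have h := isOrd_int (m := m) (n := n) he (by omega)
  have hL : ∀ p < m + n, (vacWt m n false).ip (ordWt (intE m n e) (intD m n e) p) = 0 :=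
    fun p hp => h.ip_vac false hp
  rw [intRoots_eq]
  refine isFund_affRoots ?_ (fun p hp => ?_) ?_
  · rw [if_pos rfl, Wt.coroot_eq_one]
    · rw [Wt.ip_sub_right, Wt.ip_add_right, Wt.ip_imag, hL _ (by omega), hL _ (by omega)]
      simp [vacWt]
    · rw [norm_alpha_zero he hn hmn]
      exact one_add_intSg _ _ _ _
  · rw [if_neg (by omega), Wt.coroot_eq_zero]
    rw [Wt.ip_sub_right, hL _ hp, hL _ (by omega), sub_self]
  · rw [if_neg (show ¬ m + n = _ by omega), Wt.coroot_eq_zero]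
    split_ifs
    · rw [hL _ (by omega)]
    · rw [Wt.ip_add_right, hL _ (by omega), hL _ (by omega), add_zero]

theorem isFund_int_one (he : e ≤ 1) (hn : 1 ≤ n) (hmn : n < m ∨ m = n ∧ e = 1) {i : Fin m}
    (hi : intE m n e i = 0) : IsFund (intRoots m n e) 1 (opWt false ((.ps i, -1) : J m n e × ℤ)) := by
  have h := isOrd_int (m := m) (n := n) he (by omega)
  have hL : ∀ p < m + n, (opWt false ((.ps i, -1) : J m n e × ℤ)).ip
      (ordWt (intE m n e) (intD m n e) p) = if p = 0 then 1 else 0 :=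
    fun p hp => by rw [h.ip_opWt_ps i hp, hi]
  rw [intRoots_eq]
  refine isFund_affRoots ?_ (fun p hp => ?_) ?_
  · rw [if_neg (by omega), Wt.coroot_eq_zero]
    rw [Wt.ip_sub_right, Wt.ip_add_right, Wt.ip_imag, hL _ (by omega), hL _ (by omega)]
    simp [opWt]
  · by_cases hp0 : p = 0
    · subst hp0
      rw [if_pos rfl, Wt.coroot_eq_one]
      · rw [Wt.ip_sub_right, hL _ hp, hL _ (by omega)]
        norm_num
      · rw [h.norm_sub (by omega) (by omega) (by omega), norm_int he (by omega) (by omega),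
          norm_int he (by omega) (by omega)]
        have : intSg m n e 0 = 1 := if_pos (by omega)
        rw [this]
        exact one_add_intSg _ _ _ _
    · rw [if_neg (by omega), Wt.coroot_eq_zero]
      rw [Wt.ip_sub_right, hL _ hp, hL _ (by omega), if_neg hp0, if_neg (by omega), sub_self]
  · rw [if_neg (show ¬ m + n = _ by omega), Wt.coroot_eq_zero]
    split_ifs
    · rw [hL _ (by omega), if_neg (by omega)]
    · rw [Wt.ip_add_right, hL _ (by omega), hL _ (by omega), if_neg (by omega), if_neg (by omega),
        add_zero]

theorem isFund_int_odd_spin (hn : 1 ≤ n) (hmn : n ≤ m) :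
    IsFund (intRoots m n 1) (m + n) (-vacWt m n true) := by
  have h := isOrd_int (m := m) (n := n) (e := 1) le_rfl hmn
  have hL : ∀ p < m + n, (-vacWt m n true).ip (ordWt (intE m n 1) (intD m n 1) p) = -1 / 2 :=
    fun p hp => h.ip_eq (L := fun _ => -1 / 2)
      (fun _ => by change -twc true = _; norm_num [twc])
      (fun _ => by change - -(-twc true) = _; norm_num [twc]) hp
  rw [intRoots_eq]
  refine isFund_affRoots ?_ (fun p hp => ?_) ?_
  · rw [if_neg (by omega), Wt.coroot_eq_zero]
    rw [Wt.ip_sub_right, Wt.ip_add_right, Wt.ip_imag, hL _ (by omega), hL _ (by omega)]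
    change (-1 : ℂ) - _ = _
    norm_num
  · rw [if_neg (by omega), Wt.coroot_eq_zero]
    rw [Wt.ip_sub_right, hL _ hp, hL _ (by omega), sub_self]
  · rw [if_pos rfl, if_pos rfl, Wt.coroot, norm_int le_rfl hmn (by omega), hL _ (by omega)]
    have : intSg m n 1 (m + n - 1) = -1 := if_neg (by omega)
    rw [this]
    norm_num

end Int

/-! ### The Weyl vector -/

/-- The affine Weyl vector for the simple roots adapted to integrable modules, `n < m`. -/
def intRho (m n e : ℕ) : Wt m n :=
  ⟨fun i => if i.val < n then -(e : ℂ) / 2 else i.val - n + (e : ℂ) / 2, fun _ => (e : ℂ) / 2,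
    2 * ((m : ℂ) - n) - 2 + e, 0⟩

theorem isRho_intRho (he : e ≤ 1) (hn : 1 ≤ n) (hmn : n < m) :
    IsRho (intRoots m n e) (intRho m n e) := by
  have h := isOrd_int (m := m) (n := n) he hmn.le
  obtain ⟨d, rfl⟩ : ∃ d, m = n + d + 1 := ⟨m - n - 1, by omega⟩
  have hL : ∀ p < (n + d + 1) + n, (intRho (n + d + 1) n e).ip
      (ordWt (intE (n + d + 1) n e) (intD (n + d + 1) n e) p) =
        if p ≤ d then (d : ℂ) - p + e / 2 else -(e : ℂ) / 2 := by
    intro p hp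
    refine h.ip_eq (L := fun p => if p ≤ d then (d : ℂ) - p + e / 2 else -(e : ℂ) / 2)
      (fun i => ?_) (fun j => ?_) hp
    · have hi := i.2
      by_cases hin : i.val < n
      · have e1 : d < intE (n + d + 1) n e i := by simp only [intE]; split_ifs <;> omega
        simp only [intRho]
        rw [if_pos hin, if_neg (by omega)]
      · have e1 : intE (n + d + 1) n e i + i = n + d := by simp only [intE]; split_ifs <;> omega
        have e2 : (intE (n + d + 1) n e i : ℂ) = n + d - i := by
          rw [eq_sub_iff_add_eq]; exact_mod_cast e1
        simp only [intRho]
        rw [if_neg hin, if_pos (by omega), e2]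
        ring
    · have hj := j.2
      have e1 : d < intD (n + d + 1) n e j := by simp only [intD]; omega
      simp only [intRho]
      rw [if_neg (by omega)]
      ring
  have hN : ∀ p < (n + d + 1) + n, (ordWt (intE (n + d + 1) n e) (intD (n + d + 1) n e) p).ip
      (ordWt (intE (n + d + 1) n e) (intD (n + d + 1) n e) p) =
        if p ≤ d ∨ (p - (d + 1)) % 2 = 1 - e then 1 else -1 := by
    intro p hp
    rw [norm_int he hmn.le hp, intSg, show n + d + 1 - n = d + 1 by omega]
    simp only [Nat.lt_succ_iff]
  refine ⟨fun j => ?_, rfl⟩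
  have hj := j.2
  rw [intRoots_eq]
  unfold affRoots
  by_cases h1 : j.val = 0
  · rw [if_pos h1, norm_alpha_zero he hn (Or.inl hmn), Wt.ip_sub_right, Wt.ip_add_right,
      Wt.ip_imag, hL _ (by omega), hL _ (by omega), ← norm_int he hmn.le (by omega),
      hN _ (by omega), if_pos (by omega)]
    simp only [intRho]
    rcases Nat.le_one_iff_eq_zero_or_eq_one.mp he with rfl | rfl
    · by_cases h2 : 1 ≤ d
      · rw [if_pos h2, if_pos (by omega)]; push_cast; ring
      · rw [if_neg h2, if_neg (by omega)]
        obtain rfl : d = 0 := by omega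
        push_cast; ring
    · by_cases h2 : 1 ≤ d
      · rw [if_pos h2, if_pos (by omega)]; push_cast; ring
      · rw [if_neg h2, if_pos (by omega)]
        obtain rfl : d = 0 := by omega
        push_cast; ring
  rw [if_neg h1]
  by_cases h2 : j.val < n + d + 1 + n
  · obtain ⟨p, hp⟩ : ∃ p, j.val = p + 1 := ⟨j.val - 1, by omega⟩
    rw [if_pos h2, h.norm_sub (by omega) (by omega) h2, Wt.ip_sub_right, hL _ (by omega), hL _ h2,
      hN _ (by omega), hN _ h2, hp, Nat.add_sub_cancel]
    rcases Nat.le_one_iff_eq_zero_or_eq_one.mp he with rfl | rfl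
    · rcases lt_trichotomy p d with h3 | h3 | h3
      · rw [if_pos (by omega), if_pos (by omega), if_pos (by omega), if_pos (by omega)]
        push_cast; ring
      · subst h3
        rw [if_pos (by omega), if_neg (by omega), if_pos (by omega), if_neg (by omega)]
        push_cast; ring
      · rw [if_neg (by omega), if_neg (by omega)]
        rcases Nat.mod_two_eq_zero_or_one (p - (d + 1)) with h4 | h4
        · rw [if_neg (by omega), if_pos (by omega)]; ring
        · rw [if_pos (by omega), if_neg (by omega)]; ring
    · rcases lt_trichotomy p d with h3 | h3 | h3
      · rw [if_pos (by omega), if_pos (by omega), if_pos (by omega), if_pos (by omega)]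
        push_cast; ring
      · subst h3
        rw [if_pos (by omega), if_neg (by omega), if_pos (by omega), if_pos (by omega)]
        push_cast; ring
      · rw [if_neg (by omega), if_neg (by omega)]
        rcases Nat.mod_two_eq_zero_or_one (p - (d + 1)) with h4 | h4
        · rw [if_pos (by omega), if_neg (by omega)]; ring
        · rw [if_neg (by omega), if_pos (by omega)]; ring
  rw [if_neg h2]
  have h3 : j.val = n + d + 1 + n := by omega
  rw [h3]
  rcases Nat.le_one_iff_eq_zero_or_eq_one.mp he with rfl | rfl
  · rw [if_neg (by norm_num), h.norm_add (by omega) (by omega) (by omega), Wt.ip_add_right,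
      hL _ (by omega), hL _ (by omega), hN _ (by omega), hN _ (by omega),
      if_neg (show ¬ n + d + 1 + n - 2 ≤ d by omega),
      if_neg (show ¬ n + d + 1 + n - 1 ≤ d by omega),
      if_neg (show ¬ (n + d + 1 + n - 2 ≤ d ∨ (n + d + 1 + n - 2 - (d + 1)) % 2 = 1 - 0) by omega),
      if_pos (show n + d + 1 + n - 1 ≤ d ∨ (n + d + 1 + n - 1 - (d + 1)) % 2 = 1 - 0 by omega)]
    push_cast; ring
  · rw [if_pos rfl, hL _ (by omega), hN _ (by omega), if_neg (by omega), if_neg (by omega)]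
    push_cast; ring

/-! ### The highest weight vectors -/

namespace SuperFock

variable {tw : Bool} {W : Type} [AddCommGroup W] [Module ℂ W]
variable {pE : Fin m → ℕ} {pD : Fin n → ℕ} {θ : Wt m n}

theorem isHW_affRoots_vac (F : SuperFock m n e tw W) (he : e ≤ 1) (hn : 1 ≤ n)
    (hmn : 2 ≤ m + n + e) (h : IsOrd pE pD) (hθ : θ.u = 0) :
    F.rep.IsHW (F.degSub 0) 0 (affRoots e (ordWt pE pD) θ) (vacWt m n tw) F.vac :=
  F.isHW_vac he ⟨0, hn⟩ (h.hasHgt he hmn hθ)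

theorem isHW_affRoots_op (F : SuperFock m n e tw W) (he : e ≤ 1) (hn : 1 ≤ n)
    (hmn : 2 ≤ m + n + e) (h : IsOrd pE pD) (hθ : θ.u = 0) {p : J m n e × ℤ} (hp : Cr tw p)
    (h1 : hgtW (fun i => m + n - 1 + e - pE i) (fun j => m + n - 1 + e - pD j) p =
      (m + n - 1 + e : ℕ) * enW tw p) (h2 : enW tw p ≤ 1) :
    F.rep.IsHW (F.degSub 1) p.1.par (affRoots e (ordWt pE pD) θ) (opWt tw p) (F.op p F.vac) :=
  F.isHW_op he ⟨0, hn⟩ (h.hasHgt he hmn hθ) (fun _ => Nat.sub_le _ _) (fun _ => Nat.sub_le _ _)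
    hp h1 h2

theorem isHW_z (F : SuperFock m n 1 true W) (hn : 1 ≤ n) (h : IsOrd pE pD) (hθ : θ.u = 0) :
    F.rep.IsHW (F.degSub 1) 1 (affRoots 1 (ordWt pE pD) θ) (vacWt m n true)
      (F.op (.z 0, 0) F.vac) := by
  have h1 := F.isHW_affRoots_op le_rfl hn (by omega) h hθ (p := (.z 0, 0)) (Or.inr ⟨rfl, rfl, rfl⟩)
    (by rw [hgtW_eq]; simp [enW, shift]) (by simp [enW, shift])
  have h2 : vacWt m n true = opWt true ((.z 0, 0) : J m n 1 × ℤ) := by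
    ext <;> simp [opWt, vacWt, chi, J.conj, modeNum, shift]
  rw [h2]
  exact h1

theorem isHW_pss (F : SuperFock m n 0 true W) (hn : 1 ≤ n) (h : IsOrd pE pD) (hθ : θ.u = 0)
    {i : Fin m} (hi : pE i = m + n - 1) :
    F.rep.IsHW (F.degSub 1) 1 (affRoots 0 (ordWt pE pD) θ) (opWt true ((.pss i, 0) : J m n 0 × ℤ))
      (F.op (.pss i, 0) F.vac) := by
  have := i.2
  exact F.isHW_affRoots_op zero_le_one hn (by omega) h hθ (p := (.pss i, 0))
    (Or.inr ⟨rfl, rfl, rfl⟩) (by rw [hgtW_eq]; simp [enW, shift, hi]) (by simp [enW, shift])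

theorem isHW_ps (F : SuperFock m n e false W) (he : e ≤ 1) (hn : 1 ≤ n) (h : IsOrd pE pD)
    (hθ : θ.u = 0) {i : Fin m} (hi : pE i = 0) :
    F.rep.IsHW (F.degSub 1) 1 (affRoots e (ordWt pE pD) θ) (opWt false ((.ps i, -1) : J m n e × ℤ))
      (F.op (.ps i, -1) F.vac) := by
  have := i.2
  exact F.isHW_affRoots_op he hn (by omega) h hθ (p := (.ps i, -1))
    (Or.inl (by norm_num)) (by rw [hgtW_eq]; simp [enW, shift, hi]) (by simp [enW, shift])

end SuperFock

theorem intE_last (he : e ≤ 1) (hmn : n < m ∨ m = n ∧ e = 1) {i : Fin m} (hi : i.val + 1 = m) :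
    intE m n e i = 0 := by
  simp only [intE]
  split_ifs <;> omega

theorem intE_zero (hn : 1 ≤ n) (hmn : n < m) {i : Fin m} (hi : i.val = 0) :
    intE m n 0 i = m + n - 1 := by
  simp only [intE]
  split_ifs <;> omega

/-! ### The domain of convergence -/

namespace Wt

theorem eval_add (a b : Wt m n) (p : Pt m n) : (a + b).eval p = a.eval p + b.eval p := by
  have h1 : (a + b).e = a.e + b.e := rfl
  have h2 : (a + b).f = a.f + b.f := rfl
  have h3 : (a + b).k = a.k + b.k := rfl
  have h4 : (a + b).u = a.u + b.u := rfl
  simp only [eval, h1, h2, h3, h4, Pi.add_apply, mul_add, Finset.sum_add_distrib]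
  ring

theorem eval_sub (a b : Wt m n) (p : Pt m n) : (a - b).eval p = a.eval p - b.eval p := by
  have h1 : (a - b).e = a.e - b.e := rfl
  have h2 : (a - b).f = a.f - b.f := rfl
  have h3 : (a - b).k = a.k - b.k := rfl
  have h4 : (a - b).u = a.u - b.u := rfl
  simp only [eval, h1, h2, h3, h4, Pi.sub_apply, mul_sub, Finset.sum_sub_distrib]
  ring

end Wt

theorem mem_dom_int (he : e ≤ 1) (hn : 1 ≤ n) (hmn : n < m ∨ m = n ∧ e = 1) {p : Pt m n}
    (hp : p ∈ dom (intRoots m n e)) (j : Fin n) :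
    0 < (p.2.2.1 j).im ∧ 2 * (p.2.2.1 j).im < p.1.im := by
  have h := isOrd_int (m := m) (n := n) he (by omega)
  have hp' : ∀ i, 0 < ((intRoots m n e i).eval p).re := hp
  rw [intRoots_eq] at hp'
  have hj := j.2
  have hD : ((ordWt (intE m n e) (intD m n e) (intD m n e j)).eval p).re =
      2 * Real.pi * (p.2.2.1 j).im := by
    simp only [Wt.eval, ordWt, h.injD.eq_iff, h.ne]
    simp
  have hI : ((Wt.imag : Wt m n).eval p).re = 2 * Real.pi * p.1.im := by
    simp [Wt.eval, Wt.imag]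
  set w := ordWt (intE m n e) (intD m n e) with hw
  have hstep : ∀ q, q + 1 < m + n → ((w (q + 1)).eval p).re < ((w q).eval p).re := by
    intro q hq
    have h1 := hp' ⟨q + 1, by omega⟩
    unfold affRoots at h1
    rw [if_neg (by simp), if_pos hq, Wt.eval_sub, sub_re, sub_pos] at h1
    exact h1
  have hanti : ∀ k q, q + k < m + n → ((w (q + k)).eval p).re ≤ ((w q).eval p).re := by
    intro k q
    induction k with
    | zero => intro _; exact le_rfl
    | succ k ih => intro hk; exact (hstep (q + k) hk).le.trans (ih (by omega))
  have h0 := hp' ⟨0, by omega⟩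
  unfold affRoots at h0
  rw [if_pos rfl, Wt.eval_sub, Wt.eval_add, sub_re, add_re, hI] at h0
  have hl := hp' ⟨m + n, by omega⟩
  unfold affRoots at hl
  rw [if_neg (show ¬ m + n = 0 by omega), if_neg (lt_irrefl _)] at hl
  have h01 := hstep 0 (by omega)
  have hpos : 0 < ((w (intD m n e j)).eval p).re := by
    rcases Nat.le_one_iff_eq_zero_or_eq_one.mp he with rfl | rfl
    · rw [if_neg (by norm_num), Wt.eval_add, add_re] at hl
      have e1 : intD m n 0 j ≤ m + n - 2 := by simp only [intD]; omega
      have h3 := hstep (m + n - 2) (by omega)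
      rw [show m + n - 2 + 1 = m + n - 1 by omega] at h3
      have h4 := hanti (m + n - 2 - intD m n 0 j) (intD m n 0 j) (by omega)
      rw [Nat.add_sub_cancel' e1] at h4
      simp only at hl
      linarith
    · rw [if_pos rfl] at hl
      have e1 := h.ltD j
      have h4 := hanti (m + n - 1 - intD m n 1 j) (intD m n 1 j) (by omega)
      rw [show intD m n 1 j + (m + n - 1 - intD m n 1 j) = m + n - 1 by omega] at h4
      exact lt_of_lt_of_le hl h4
  have hle : ((w (intD m n e j)).eval p).re ≤ ((w 1).eval p).re := by
    have e1 : 1 ≤ intD m n e j := by simp only [intD]; omega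
    have h4 := hanti (intD m n e j - 1) 1 (by have := h.ltD j; omega)
    rwa [Nat.add_sub_cancel' e1] at h4
  rw [hD] at hpos hle
  have hπ := Real.two_pi_pos
  refine ⟨pos_of_mul_pos_right hpos hπ.le, ?_⟩
  have : 2 * Real.pi * (2 * (p.2.2.1 j).im) < 2 * Real.pi * p.1.im := by linarith
  exact lt_of_mul_lt_mul_left this hπ.le

/-! ### The superdimension -/

/-- The projection of matrices onto the homogeneous part of parity `s` of `osp(M|N)`. -/
def ospProj (m n e : ℕ) (s : ZMod 2) :
    Matrix (J m n e) (J m n e) ℂ →ₗ[ℂ] Matrix (J m n e) (J m n e) ℂ where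
  toFun X := Matrix.of fun a b => if a.par + b.par = s then
    (X a b - kz s b.par * b.sgn * a.sgn * X b.conj a.conj) / 2 else 0
  map_add' X Y := by
    ext a b
    simp only [Matrix.of_apply, Matrix.add_apply]
    split_ifs <;> ring
  map_smul' r X := by
    ext a b
    simp only [Matrix.of_apply, Matrix.smul_apply, smul_eq_mul, RingHom.id_apply]
    split_ifs <;> ring

theorem mem_osp_of_apply {s : ZMod 2} {X : Matrix (J m n e) (J m n e) ℂ}
    (h1 : ∀ a b, a.par + b.par ≠ s → X a b = 0)
    (h2 : ∀ a b, X a b = -kz s b.par * b.sgn * a.sgn * X b.conj a.conj) : X ∈ osp m n e s := by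
  refine ⟨h1, fun u v => ?_⟩
  rw [Finset.sum_eq_single v.conj, Finset.sum_eq_single u.conj, B_conj_left, B_conj]
  · rw [h2 v.conj u, J.conj_conj]
    linear_combination -(kz s u.par * u.sgn * X u.conj v) * J.sgn_mul_self v.conj
  · intro c _ hc
    rw [B_eq_zero hc, zero_mul]
  · simp
  · intro c _ hc
    rw [B_eq_zero fun h => hc (by rw [h, J.conj_conj]), mul_zero]
  · simp

theorem isProj_ospProj (s : ZMod 2) : LinearMap.IsProj (osp m n e s) (ospProj m n e s) where
  map_mem X := by
    refine mem_osp_of_apply (fun a b h => if_neg h) fun a b => ?_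
    simp only [ospProj, LinearMap.coe_mk, AddHom.coe_mk, Matrix.of_apply, J.conj_conj, par_conj,
      add_comm b.par a.par]
    split_ifs with h
    · have h3 : kz s b.par * kz s a.par * (b.sgn * a.sgn * b.conj.sgn * a.conj.sgn) = 1 := by
        have h4 : ∀ c : J m n e, c.sgn * c.conj.sgn = kz 1 c.par * -1 := by
          intro c; cases c <;> simp [J.sgn, J.conj, J.par, kz]
        have h5 : kz s b.par * kz s a.par = kz 1 a.par * kz 1 b.par := by
          rw [← h]
          generalize a.par = x
          generalize b.par = y
          rcases zmod_two_cases x with rfl | rfl <;> rcases zmod_two_cases y with rfl | rfl <;>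
            simp [kz]
        rw [h5, show b.sgn * a.sgn * b.conj.sgn * a.conj.sgn =
          (a.sgn * a.conj.sgn) * (b.sgn * b.conj.sgn) by ring, h4, h4]
        linear_combination kz_sq 1 a.par + kz 1 a.par * kz 1 a.par * kz_sq 1 b.par
      linear_combination (-X a b / 2) * h3
    · ring
  map_id X hX := by
    ext a b
    simp only [ospProj, LinearMap.coe_mk, AddHom.coe_mk, Matrix.of_apply]
    split_ifs with h
    · have := osp_apply (⟨X, hX⟩ : osp m n e s) a b
      simp only at this
      linear_combination -this / 2
    · exact (hX.1 a b h).symm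

theorem finrank_osp (s : ZMod 2) : (Module.finrank ℂ (osp m n e s) : ℂ) =
    ∑ a : J m n e, ∑ b : J m n e, if a.par + b.par = s then
      (1 - kz s b.par * b.sgn * a.sgn * (if a = b.conj then 1 else 0)) / 2 else 0 := by
  rw [← (isProj_ospProj s).trace, LinearMap.trace_eq_matrix_trace ℂ (Matrix.stdBasis ℂ _ _),
    Matrix.trace, Fintype.sum_prod_type]
  refine Finset.sum_congr rfl fun a _ => Finset.sum_congr rfl fun b _ => ?_
  have hr : ∀ Y : Matrix (J m n e) (J m n e) ℂ,
      (Matrix.stdBasis ℂ (J m n e) (J m n e)).repr Y (a, b) = Y a b := fun Y => by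
    simp [Matrix.stdBasis]
  rw [Matrix.diag_apply, LinearMap.toMatrix_apply, hr, Matrix.stdBasis_eq_single]
  simp only [ospProj, LinearMap.coe_mk, AddHom.coe_mk, Matrix.of_apply, Matrix.single_apply]
  have : (a = b.conj ∧ b = a.conj) = (a = b.conj) := by
    simp only [eq_iff_iff, and_iff_left_iff_imp]
    rintro rfl
    rw [J.conj_conj]
  simp only [this, and_self, if_true]

/-- The basis of `V` as a disjoint union. -/
def J.equiv (m n e : ℕ) : ((Fin n ⊕ Fin n) ⊕ (Fin m ⊕ Fin m)) ⊕ Fin e ≃ J m n e where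
  toFun := Sum.elim (Sum.elim (Sum.elim .ph .phs) (Sum.elim .ps .pss)) .z
  invFun
    | .ph i => .inl (.inl (.inl i))
    | .phs i => .inl (.inl (.inr i))
    | .ps i => .inl (.inr (.inl i))
    | .pss i => .inl (.inr (.inr i))
    | .z i => .inr i
  left_inv := by rintro (((i | i) | (i | i)) | i) <;> rfl
  right_inv a := by cases a <;> rfl

@[to_additive]
theorem J.prod_eq {A : Type} [CommMonoid A] (f : J m n e → A) : ∏ a, f a =
    ((∏ i, f (.ph i)) * ∏ i, f (.phs i)) * ((∏ i, f (.ps i)) * ∏ i, f (.pss i)) *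
      ∏ i, f (.z i) := by
  rw [← (J.equiv m n e).prod_comp]
  simp [Fintype.prod_sum_type, J.equiv]

theorem sdim_eq (m n e : ℕ) :
    sdim m n e = (2 * m + e - 2 * n) * (2 * m + e - 2 * n - 1) / 2 := by
  have h11 : (1 : ZMod 2) + 1 = 0 := by decide
  have h : sdim m n e = ∑ a : J m n e, ∑ b : J m n e, kz 1 a.par * kz 1 b.par / 2 -
      ∑ b : J m n e, b.sgn * b.conj.sgn / 2 := by
    have h2 : ∀ b : J m n e, b.sgn * b.conj.sgn / 2 =
        ∑ a : J m n e, if a = b.conj then b.sgn * a.sgn / 2 else 0 := fun b => by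
      rw [Finset.sum_ite_eq' Finset.univ, if_pos (Finset.mem_univ _)]
    simp only [h2]
    rw [Finset.sum_comm (f := fun b a : J m n e => if a = b.conj then b.sgn * a.sgn / 2 else 0),
      sdim, finrank_osp, finrank_osp, ← Finset.sum_sub_distrib, ← Finset.sum_sub_distrib]
    refine Finset.sum_congr rfl fun a _ => ?_
    rw [← Finset.sum_sub_distrib, ← Finset.sum_sub_distrib]
    refine Finset.sum_congr rfl fun b _ => ?_
    by_cases hab : a = b.conj
    · subst hab
      rw [par_conj, CharTwo.add_self_eq_zero, if_pos rfl, if_neg zero_ne_one, if_pos rfl,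
        if_pos rfl, kz_sq]
      simp [kz]
      ring
    · rw [if_neg hab, if_neg hab]
      generalize a.par = x
      generalize b.par = y
      rcases zmod_two_cases x with rfl | rfl <;> rcases zmod_two_cases y with rfl | rfl <;>
        simp [kz, h11, neg_div]
  rw [h]
  simp only [J.sum_eq]
  simp [J.par, J.sgn, J.conj, kz]
  ring

/-! ### The exponents of the normalized supercharacters -/

theorem sum_add_sq (D : ℕ) (c : ℂ) : ∑ k : Fin D, ((k.val : ℂ) + c) ^ 2 =
    D * (D - 1) * (2 * D - 1) / 6 + c * D * (D - 1) + D * c ^ 2 := by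
  rw [Fin.sum_univ_eq_sum_range (fun k => ((k : ℂ) + c) ^ 2)]
  induction D with
  | zero => simp
  | succ D ih => rw [Finset.sum_range_succ, ih]; push_cast; ring

theorem Wt.ip_self (a : Wt m n) : a.ip a = ∑ i, a.e i ^ 2 - ∑ j, a.f j ^ 2 + 2 * a.k * a.u := by
  simp only [ip, sq]
  ring

theorem Wt.ip_self_add_single (a : Wt m n) (i : Fin m) (x u : ℂ) :
    (⟨fun b => a.e b + if b = i then x else 0, a.f, a.k, a.u + u⟩ : Wt m n).ip
      ⟨fun b => a.e b + if b = i then x else 0, a.f, a.k, a.u + u⟩ =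
    a.ip a + 2 * (x * a.e i + u * a.k) + x ^ 2 := by
  rw [ip_self, ip_self]
  simp only [add_sq, Finset.sum_add_distrib, ite_pow, mul_ite, mul_zero, Finset.sum_ite_eq',
    Finset.mem_univ, if_true, ne_eq, OfNat.ofNat_ne_zero, not_false_eq_true, zero_pow]
  ring

theorem vacWt_add_intRho_ip (hmn : n ≤ m) (tw : Bool) :
    (vacWt m n tw + intRho m n e).ip (vacWt m n tw + intRho m n e) =
      ∑ k : Fin (m - n), ((k.val : ℂ) + (e / 2 + twc tw)) ^ 2 := by
  obtain ⟨D, rfl⟩ := Nat.exists_eq_add_of_le hmn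
  have h1 : ∀ i, (vacWt (n + D) n tw + intRho (n + D) n e).e i =
    twc tw + (intRho (n + D) n e).e i := fun _ => rfl
  have h2 : ∀ i, (vacWt (n + D) n tw + intRho (n + D) n e).f i = -twc tw + e / 2 := fun _ => rfl
  have h3 : (vacWt (n + D) n tw + intRho (n + D) n e).u = 0 := add_zero 0
  rw [Wt.ip_self, h3, Nat.add_sub_cancel_left, Fin.sum_univ_add]
  simp only [h1, h2]
  simp only [intRho, Fin.val_castAdd, Fin.val_natAdd, Fin.is_lt, if_true]
  have h4 : ∀ x : Fin D, ¬ n + x.val < n := fun x => by omega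
  simp only [h4, if_false]
  have h5 : ∀ x : Fin D, (twc tw + (((n + x.val : ℕ) : ℂ) - n + (e : ℂ) / 2)) ^ 2 =
      ((x.val : ℂ) + (e / 2 + twc tw)) ^ 2 := fun x => by push_cast; ring
  simp only [h5, Finset.sum_const, nsmul_eq_mul]
  ring

theorem vacWt_add_intRho_k (tw : Bool) :
    (vacWt m n tw + intRho m n e).k = 2 * ((m : ℂ) - n) - 1 + e := by
  change (1 : ℂ) + (2 * ((m : ℂ) - n) - 2 + e) = _
  ring

theorem two_mul_sub_one_ne_zero (m n : ℕ) : 2 * ((m : ℂ) - n) - 1 ≠ 0 := by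
  intro h
  have : ((2 * ((m : ℤ) - n) - 1 : ℤ) : ℂ) = 0 := by push_cast; exact h
  have := Int.cast_eq_zero.mp this
  omega

theorem normExp_vac_even (hmn : n < m) (tw : Bool) : normExp 0 (intRho m n 0) (vacWt m n tw) =
    if tw then ((m : ℂ) - n) / 12 else ((n : ℂ) - m) / 24 := by
  have hk := two_mul_sub_one_ne_zero m n
  rw [normExp, vacWt_add_intRho_ip hmn.le, vacWt_add_intRho_k, sdim_eq, sum_add_sq,
    Nat.cast_sub hmn.le]
  obtain ⟨K, hK⟩ : ∃ K : ℂ, (m : ℂ) = (K + 1) / 2 + n := ⟨2 * (m - n) - 1, by ring⟩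
  have h2 : 2 * ((K + 1) / 2) - 1 = K := by ring
  rw [hK, add_sub_cancel_right, h2] at hk
  simp only [hK, add_sub_cancel_right, h2]
  rcases tw with _ | _
  · rw [if_neg (by simp)]
    simp only [twc, Nat.cast_zero, Bool.false_eq_true, if_false, add_zero, zero_div]
    field_simp
    ring
  · rw [if_pos rfl]
    simp only [twc, Nat.cast_zero, if_true, add_zero, zero_div]
    field_simp
    ring

theorem normExp_vac_odd (hmn : n < m) (tw : Bool) : normExp 1 (intRho m n 1) (vacWt m n tw) =
    if tw then (2 * ((m : ℂ) - n) + 1) / 24 else -(2 * ((m : ℂ) - n) + 1) / 48 := by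
  have hk : (m : ℂ) - n ≠ 0 := sub_ne_zero.mpr (by exact_mod_cast hmn.ne')
  rw [normExp, vacWt_add_intRho_ip hmn.le, vacWt_add_intRho_k, sdim_eq, sum_add_sq,
    Nat.cast_sub hmn.le]
  obtain ⟨D, hD⟩ : ∃ D : ℂ, (m : ℂ) = D + n := ⟨m - n, by ring⟩
  rw [hD, add_sub_cancel_right] at hk
  simp only [hD, add_sub_cancel_right]
  rcases tw with _ | _
  · rw [if_neg (by simp)]
    simp only [twc, Nat.cast_one, Bool.false_eq_true, if_false, add_zero]
    field_simp
    ring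
  · rw [if_pos rfl]
    simp only [twc, Nat.cast_one, if_true]
    field_simp
    ring

theorem normExp_ps (hmn : n < m) {i : Fin m} (hi : i.val + 1 = m) :
    normExp e (intRho m n e) (opWt false ((.ps i, -1) : J m n e × ℤ)) =
      normExp e (intRho m n e) (vacWt m n false) := by
  have h := Wt.ip_self_add_single (vacWt m n false + intRho m n e) i 1 (-1 / 2)
  have h1 : opWt false ((.ps i, -1) : J m n e × ℤ) + intRho m n e =
      ⟨fun b => (vacWt m n false + intRho m n e).e b + if b = i then 1 else 0,
        (vacWt m n false + intRho m n e).f, (vacWt m n false + intRho m n e).k,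
        (vacWt m n false + intRho m n e).u + (-1 / 2)⟩ := by
    refine Wt.ext (funext fun a => ?_) (funext fun j => ?_) rfl ?_
    · change (chi (.ps a) (.ps i, -1) : ℂ) + twc false + _ = twc false + _ + _
      rw [chi_cast]
      simp only [J.conj, J.ps.injEq, reduceCtorEq, if_false, @eq_comm _ i]
      ring
    · change (chi (.ph j) (.ps i, -1) : ℂ) - twc false + _ = -twc false + _
      rw [chi_cast]
      simp [J.conj]
    · change (modeNum false (J.ps i, -1) : ℂ) + 0 = 0 + 0 + -1 / 2
      norm_num [modeNum, shift]
  have h2 : (vacWt m n false + intRho m n e).e i = (m - 1 - n) + (e : ℂ) / 2 := by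
    change (0 : ℂ) + (if i.val < n then _ else _) = _
    have h3 : (m : ℂ) = i.val + 1 := by exact_mod_cast hi.symm
    rw [if_neg (by omega), zero_add, h3]
    ring
  rw [normExp, normExp, h1, h, h2, vacWt_add_intRho_k]
  ring

theorem normExp_pss (hn : 1 ≤ n) {i : Fin m} (hi : i.val = 0) :
    normExp 0 (intRho m n 0) (opWt true ((.pss i, 0) : J m n 0 × ℤ)) =
      normExp 0 (intRho m n 0) (vacWt m n true) := by
  have h := Wt.ip_self_add_single (vacWt m n true + intRho m n 0) i (-1) 0
  have h1 : opWt true ((.pss i, 0) : J m n 0 × ℤ) + intRho m n 0 =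
      ⟨fun b => (vacWt m n true + intRho m n 0).e b + if b = i then -1 else 0,
        (vacWt m n true + intRho m n 0).f, (vacWt m n true + intRho m n 0).k,
        (vacWt m n true + intRho m n 0).u + 0⟩ := by
    refine Wt.ext (funext fun a => ?_) (funext fun j => ?_) rfl ?_
    · change (chi (.ps a) (.pss i, 0) : ℂ) + twc true + _ = twc true + _ + _
      rw [chi_cast]
      simp only [J.conj, J.pss.injEq, reduceCtorEq, if_false, @eq_comm _ i]
      split_ifs <;> ring
    · change (chi (.ph j) (.pss i, 0) : ℂ) - twc true + _ = -twc true + _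
      rw [chi_cast]
      simp [J.conj]
    · change (modeNum true (J.pss i, 0) : ℂ) + 0 = 0 + 0 + 0
      norm_num [modeNum, shift]
  have h2 : (vacWt m n true + intRho m n 0).e i = 1 / 2 := by
    change twc true + (if i.val < n then _ else _) = _
    rw [if_pos (by omega)]
    norm_num [twc]
  rw [normExp, normExp, h1, h, h2]
  ring

/-! ### Generating functions -/

section GenFun

variable {ι : Type}

theorem _root_.HasSum.mul_of_complex {κ : Type} {f : ι → ℂ} {g : κ → ℂ} {a b : ℂ}
    (hf : HasSum f a) (hg : HasSum g b) : HasSum (fun x : ι × κ => f x.1 * g x.2) (a * b) :=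
  have hm : Summable fun x : ι × κ => f x.1 * g x.2 :=
    summable_mul_of_summable_norm hf.summable.norm hg.summable.norm
  hf.mul hg hm

theorem hasSum_finset_prod {w : ι → ℂ} (hw : Summable fun c => ‖w c‖) {b : ℂ}
    (hb : HasProd (fun c => 1 + w c) b) : HasSum (fun S : Finset ι => ∏ c ∈ S, w c) b := by
  have h := (summable_finsetProd_of_summable_norm hw).hasSum
  rwa [(hasProd_one_add_of_hasSum_prod h).unique hb] at h

/-- The monomials in finitely many variables. -/
theorem hasSum_monomials_finset [DecidableEq ι] {y : ι → ℂ} (h1 : ∀ c, ‖y c‖ < 1)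
    (T : Finset ι) :
    HasSum (fun f : ι →₀ ℕ => if f.support ⊆ T then f.prod fun c k => y c ^ k else 0)
      (∏ c ∈ T, (1 - y c)⁻¹) := by
  induction T using Finset.induction_on with
  | empty =>
    have h : ∀ f : ι →₀ ℕ, f ≠ 0 → (if f.support ⊆ ∅ then f.prod fun c k => y c ^ k else 0) = 0 :=
      fun f hf => if_neg fun h => hf (Finsupp.support_eq_empty.mp (Finset.subset_empty.mp h))
    convert hasSum_single 0 h using 1
    simp
  | insert c T hc ih =>
    set g : ℕ × (ι →₀ ℕ) → ℂ := fun x =>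
      y c ^ x.1 * if x.2.support ⊆ T then x.2.prod fun c k => y c ^ k else 0 with hg
    have hgeo := hasSum_geometric_of_norm_lt_one (h1 c)
    have hsum : HasSum g ((1 - y c)⁻¹ * ∏ c ∈ T, (1 - y c)⁻¹) := by
      have := hgeo.mul_of_complex ih
      exact this
    have hsupp : ∀ x : ℕ × (ι →₀ ℕ), g x ≠ 0 → x.2.support ⊆ T := fun x hx => by
      by_contra h
      refine hx ?_
      simp only [hg]
      rw [if_neg h, mul_zero]
    have hval : ∀ x : ℕ × (ι →₀ ℕ), x.2.support ⊆ T →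
        (if (x.2 + Finsupp.single c x.1).support ⊆ insert c T then
          (x.2 + Finsupp.single c x.1).prod fun c k => y c ^ k else 0) = g x := by
      intro x hx
      have h2 : (x.2 + Finsupp.single c x.1).support ⊆ insert c T := by
        refine Finsupp.support_add.trans (Finset.union_subset (hx.trans (Finset.subset_insert _ _)) ?_)
        exact Finsupp.support_single_subset.trans (by simp)
      rw [if_pos h2, Finsupp.prod_add_index' (by simp) (by simp [pow_add]),
        Finsupp.prod_single_index (by simp), mul_comm]
      simp only [hg]
      rw [if_pos hx]
    have hinj : Function.Injective fun x : Function.support g => x.1.2 + Finsupp.single c x.1.1 := by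
      rintro ⟨⟨k, f⟩, hf⟩ ⟨⟨k', f'⟩, hf'⟩ h
      have e1 : ∀ x : ℕ × (ι →₀ ℕ), g x ≠ 0 → x.2 c = 0 := fun x hx =>
        Finsupp.notMem_support_iff.mp fun h => hc (hsupp x hx h)
      have e2 : f c = 0 := e1 _ hf
      have e3 : f' c = 0 := e1 _ hf'
      simp only at h
      have h4 : k = k' := by
        simpa [e2, e3] using DFunLike.congr_fun h c
      subst h4
      simp only [Subtype.mk.injEq, Prod.mk.injEq, true_and]
      exact add_right_cancel h
    rw [Finset.prod_insert hc]
    refine (hasSum_iff_hasSum_of_ne_zero_bij _ hinj (fun f hf => ?_)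
      fun x => hval _ (hsupp _ x.2)).mpr hsum
    have h3 : f.support ⊆ insert c T := by
      by_contra h
      exact hf (if_neg h)
    have h4 : (f.erase c).support ⊆ T := fun d hd => by
      rw [Finsupp.support_erase, Finset.mem_erase] at hd
      exact (Finset.mem_insert.mp (h3 hd.2)).resolve_left hd.1
    have h5 : f.erase c + Finsupp.single c (f c) = f := by
      rw [add_comm, Finsupp.single_add_erase]
    have h6 := hval (f c, f.erase c) h4
    simp only [h5] at h6
    exact ⟨⟨(f c, f.erase c), by rw [Function.mem_support, ← h6]; exact hf⟩, h5⟩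

theorem summable_norm_monomials {y : ι → ℂ} (h1 : ∀ c, ‖y c‖ < 1) (hy : Summable fun c => ‖y c‖) :
    Summable fun f : ι →₀ ℕ => ‖f.prod fun c k => y c ^ k‖ := by
  classical
  have hs : Summable fun c => ‖y c‖ / (1 - ‖y c‖) := by
    have h2 : ∀ᶠ c in Filter.cofinite, ‖y c‖ < 1 / 2 :=
      hy.tendsto_cofinite_zero.eventually_lt_const (by norm_num)
    refine Summable.of_norm_bounded_eventually (hy.mul_left 2) ?_
    filter_upwards [h2] with c hc
    have : 0 < 1 - ‖y c‖ := by linarith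
    rw [Real.norm_of_nonneg (by positivity), div_le_iff₀ this]
    nlinarith [norm_nonneg (y c)]
  refine summable_of_sum_le (c := Real.exp (∑' c, ‖y c‖ / (1 - ‖y c‖)))
    (fun _ => norm_nonneg _) fun 𝓕 => ?_
  set T := 𝓕.biUnion Finsupp.support with hT
  have h3 : HasSum (fun f : ι →₀ ℕ => if f.support ⊆ T then ‖f.prod fun c k => y c ^ k‖ else 0)
      (∏ c ∈ T, (1 - ‖y c‖)⁻¹) := by
    have := hasSum_monomials_finset (y := fun c => (‖y c‖ : ℂ)) (by simpa using h1) T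
    rw [← Complex.hasSum_ofReal]
    push_cast
    convert this using 2 with f
    split_ifs
    · simp [Finsupp.prod]
    · simp
  have h4 : ∑ f ∈ 𝓕, ‖f.prod fun c k => y c ^ k‖ ≤ ∏ c ∈ T, (1 - ‖y c‖)⁻¹ := by
    rw [← h3.tsum_eq]
    refine le_trans (Finset.sum_le_sum fun f hf => ?_) (h3.summable.sum_le_tsum 𝓕 fun f _ => ?_)
    · rw [if_pos (Finset.subset_biUnion_of_mem Finsupp.support hf)]
    · split_ifs <;> positivity
  have h5 : ∀ c, (1 - ‖y c‖)⁻¹ = 1 + ‖y c‖ / (1 - ‖y c‖) := fun c => by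
    have : 1 - ‖y c‖ ≠ 0 := by linarith [h1 c]
    field_simp
    ring
  have h6 : ∀ c, 0 ≤ ‖y c‖ / (1 - ‖y c‖) := fun c => div_nonneg (norm_nonneg _) (by linarith [h1 c])
  simp only [h5] at h4
  exact h4.trans ((Real.prod_one_add_le_exp_sum _ h6).trans
    (Real.exp_le_exp.mpr (hs.sum_le_tsum _ fun c _ => h6 c)))

theorem hasSum_monomials {y : ι → ℂ} (h1 : ∀ c, ‖y c‖ < 1) (hy : Summable fun c => ‖y c‖) {a : ℂ}
    (ha : HasProd (fun c => (1 - y c)⁻¹) a) :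
    HasSum (fun f : ι →₀ ℕ => f.prod fun c k => y c ^ k) a := by
  classical
  have hs := summable_norm_monomials h1 hy
  have h2 : Filter.Tendsto (fun T : Finset ι => ∏ c ∈ T, (1 - y c)⁻¹) Filter.atTop
      (nhds (∑' f : ι →₀ ℕ, f.prod fun c k => y c ^ k)) := by
    have h3 := tendsto_tsum_of_dominated_convergence (𝓕 := Filter.atTop)
      (f := fun (T : Finset ι) (f : ι →₀ ℕ) =>
        if f.support ⊆ T then f.prod fun c k => y c ^ k else 0) hs
      (fun f => tendsto_const_nhds.congr' ((Filter.eventually_ge_atTop f.support).mono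
        fun T hT => (if_pos hT).symm)) (Filter.Eventually.of_forall fun T f => ?_)
    · exact h3.congr fun T => (hasSum_monomials_finset h1 T).tsum_eq
    · split_ifs
      · exact le_rfl
      · simp
  rw [tendsto_nhds_unique ha h2]
  exact hs.of_norm.hasSum

/-- The generating function of the monomial basis of a Fock space. -/
theorem hasSum_fock {κ : Type} {y : ι → ℂ} {w : κ → ℂ} (h1 : ∀ c, ‖y c‖ < 1)
    (hy : Summable fun c => ‖y c‖) (hw : Summable fun c => ‖w c‖) {a b : ℂ}
    (ha : HasProd (fun c => (1 - y c)⁻¹) a) (hb : HasProd (fun c => 1 + w c) b) :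
    HasSum (fun i : (ι →₀ ℕ) × Finset κ => (i.1.prod fun c k => y c ^ k) * ∏ c ∈ i.2, w c)
      (a * b) := by
  have h := (hasSum_monomials h1 hy ha).mul_of_complex (hasSum_finset_prod hw hb)
  exact h

end GenFun

/-! ### The generating function of weights -/

section Gen

variable {tw : Bool}

theorem prod_tot {A : Type} [AddCommMonoid A] (φ : AddChar A ℂ) (ω : J m n e × ℤ → A)
    (i : Idx m n e tw) :
    (i.1.prod fun c k => φ (ω c.1) ^ k) * ∏ c ∈ i.2, φ (ω c.1) = φ (tot ω i) := by
  classical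
  have h : ∀ {ι : Type} (T : Finset ι) (g : ι → A), φ (∑ c ∈ T, g c) = ∏ c ∈ T, φ (g c) := by
    intro ι T g
    induction T using Finset.cons_induction with
    | empty => simp
    | cons c T hc ih => rw [Finset.sum_cons, Finset.prod_cons, AddChar.map_add_eq_mul, ih]
  rw [tot, AddChar.map_add_eq_mul, h, Finsupp.sum, h]
  simp only [AddChar.map_nsmul_eq_pow, Finsupp.prod]

/-- The coordinates `x_i`, `y_j` as functions on the basis of `V`. -/
def J.ang (p : Pt m n) : J m n e → ℂ
  | .ph j => p.2.2.1 j
  | .phs j => -p.2.2.1 j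
  | .ps i => p.2.1 i
  | .pss i => -p.2.1 i
  | .z _ => 0

/-- The value on `p` of the weight of a mode. -/
def modeEval (tw : Bool) (p : Pt m n) (q : J m n e × ℤ) : ℂ :=
  -(2 * Real.pi * I) * ((p.1 : ℂ) * modeNum tw q + q.1.ang p)

theorem eval_bwt (p : Pt m n) (i : Idx m n e tw) : (bwt tw i).eval p =
    2 * Real.pi * I * (p.2.2.2 - twc tw * (∑ a, p.2.1 a - ∑ j, p.2.2.1 j)) +
      tot (modeEval tw p) i := by
  have h : modeEval tw p = fun q : J m n e × ℤ => (-(2 * Real.pi * I) * (p.1 : ℂ)) * modeNum tw q +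
      (∑ a, (-(2 * Real.pi * I) * p.2.1 a) * (chi (.ps a) q : ℂ) +
        ∑ j, (-(2 * Real.pi * I) * p.2.2.1 j) * (chi (.ph j) q : ℂ)) := by
    funext ⟨a, k⟩
    have : (J.ang p a : ℂ) = ∑ b, p.2.1 b * (chi (.ps b) (a, k) : ℂ) +
        ∑ j, p.2.2.1 j * (chi (.ph j) (a, k) : ℂ) := by
      simp only [chi_cast]
      cases a <;> simp [J.ang, J.conj]
    simp only [modeEval, this, mul_assoc, ← Finset.mul_sum]
    ring
  rw [h, tot_add, tot_add, tot_sum, tot_sum]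
  simp only [tot_mul_left, tot_intCast, Wt.eval, bwt]
  simp only [mul_add, mul_sub, Finset.sum_add_distrib, Finset.sum_sub_distrib, mul_assoc,
    ← Finset.mul_sum, ← Finset.sum_mul]
  ring

/-- One for the fields whose creation operators include a zero mode. -/
def zeroOff (tw : Bool) (a : J m n e) : ℤ := if tw = true ∧ a.low = true then 1 else 0

theorem cr_iff (a : J m n e) (k : ℤ) : Cr tw (a, k) ↔ k < zeroOff tw a := by
  unfold Cr zeroOff
  split_ifs with h
  · simp only [h.1, h.2, and_true, true_and]; omega
  · have : ¬ (tw = true ∧ k = 0 ∧ a.low = true) := fun h' => h ⟨h'.1, h'.2.2⟩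
    simp only [this, or_false]

/-- The creation operators are indexed by fields and natural numbers. -/
def crEquiv (m n e : ℕ) (tw : Bool) (u : ZMod 2) :
    {a : J m n e // a.par = u} × ℕ ≃ CrMode m n e tw u where
  toFun x := ⟨(x.1.1, zeroOff tw x.1.1 - 1 - x.2), x.1.2, (cr_iff _ _).mpr (by omega)⟩
  invFun c := (⟨c.1.1, c.2.1⟩, (zeroOff tw c.1.1 - 1 - c.1.2).toNat)
  left_inv x := by
    ext
    · rfl
    · simp
  right_inv c := by
    have := (cr_iff (tw := tw) c.1.1 c.1.2).mp c.2.2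
    refine Subtype.ext (Prod.ext rfl ?_)
    simp only
    omega

/-- The value of the character of the first creation operator of a field. -/
def J.fug (tw : Bool) (p : Pt m n) (a : J m n e) : ℂ :=
  exp (2 * Real.pi * I * ((p.1 : ℂ) * (1 - (zeroOff tw a : ℂ) - (shift tw : ℂ) / 2) - a.ang p))

theorem exp_modeEval (p : Pt m n) (u : ZMod 2) (x : {a : J m n e // a.par = u} × ℕ) :
    exp (modeEval tw p (crEquiv m n e tw u x).1) =
      x.1.1.fug tw p * exp (2 * Real.pi * I * p.1) ^ x.2 := by
  rw [← Complex.exp_nat_mul, J.fug, ← Complex.exp_add]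
  congr 1
  simp only [crEquiv, Equiv.coe_fn_mk, modeEval, modeNum]
  push_cast
  ring

theorem norm_nome_lt (τ : UpperHalfPlane) : ‖exp (2 * Real.pi * I * (τ : ℂ))‖ < 1 := by
  rw [Complex.norm_exp, Real.exp_lt_one_iff]
  have : (2 * Real.pi * I * (τ : ℂ)).re = -(2 * Real.pi * τ.im) := by simp
  rw [this]
  have := mul_pos Real.two_pi_pos τ.im_pos
  linarith

theorem summable_exp_modeEval (p : Pt m n) (u : ZMod 2) (z : ℂ) :
    Summable fun c : CrMode m n e tw u => ‖z * exp (modeEval tw p c.1)‖ := by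
  rw [← (crEquiv m n e tw u).summable_iff]
  have h : Summable fun x : {a : J m n e // a.par = u} × ℕ =>
      ‖z * x.1.1.fug tw p‖ * ‖exp (2 * Real.pi * I * p.1) ^ x.2‖ := by
    refine Summable.mul_of_nonneg (f := fun x : {a : J m n e // a.par = u} => ‖z * x.1.fug tw p‖)
      (g := fun l : ℕ => ‖exp (2 * Real.pi * I * p.1) ^ l‖) (Summable.of_finite) ?_
      (fun _ => norm_nonneg _) (fun _ => norm_nonneg _)
    simpa using summable_geometric_of_lt_one (norm_nonneg _) (norm_nome_lt p.1)
  refine h.congr fun x => ?_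
  rw [Function.comp_apply, exp_modeEval, ← norm_mul, mul_assoc]

theorem hasProd_modes (p : Pt m n) (u : ZMod 2) (z : ℂ) :
    HasProd (fun c : CrMode m n e tw u => 1 + z * exp (modeEval tw p c.1))
      (∏ a : {a : J m n e // a.par = u},
        poch (z * a.1.fug tw p) (exp (2 * Real.pi * I * p.1))) := by
  have hm := (multipliable_one_add_of_summable_prod
    (summable_finsetProd_of_summable_norm (summable_exp_modeEval (tw := tw) (e := e) p u z))).hasProd
  have h1 := hm
  rw [← (crEquiv m n e tw u).hasProd_iff] at h1
  have h2 := h1.prod_fiberwise (g := fun a => poch (z * a.1.fug tw p) (exp (2 * Real.pi * I * p.1)))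
    fun a => by
      simp only [Function.comp_apply, exp_modeEval, ← mul_assoc]
      exact (multipliable_one_add_mul_pow (norm_nome_lt p.1) _).hasProd
  rwa [h2.unique (hasProd_fintype _)] at hm

theorem norm_fug_lt {p : Pt m n} (hp : ∀ j, 0 < (p.2.2.1 j).im ∧ 2 * (p.2.2.1 j).im < p.1.im)
    {a : J m n e} (ha : a.par = 0) : ‖a.fug tw p‖ < 1 := by
  rw [J.fug, Complex.norm_exp, Real.exp_lt_one_iff]
  have h : ∀ w : ℂ, (2 * Real.pi * I * w).re = -(2 * Real.pi * w.im) := by simp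
  rw [h, neg_lt_zero]
  refine mul_pos Real.two_pi_pos ?_
  have hτ := p.1.im_pos
  have hτ' : (p.1 : ℂ).im = p.1.im := rfl
  have key : ∀ r : ℝ, ((p.1 : ℂ) * r - a.ang p).im = p.1.im * r - (a.ang p).im := fun r => by
    rw [sub_im, mul_im, ofReal_re, ofReal_im, hτ']; ring
  have hc : (1 - (zeroOff tw a : ℂ) - (shift tw : ℂ) / 2) =
      ((1 - (zeroOff tw a : ℝ) - (shift tw : ℝ) / 2 : ℝ) : ℂ) := by push_cast; rfl
  rw [hc, key]
  rcases tw with _ | _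
  · cases a with
    | ph j => have := hp j; norm_num [zeroOff, shift, J.ang]; linarith
    | phs j => have := hp j; norm_num [zeroOff, shift, J.ang]; linarith
    | _ => exact absurd ha one_ne_zero
  · cases a with
    | ph j => have := hp j; norm_num [zeroOff, shift, J.ang, J.low]; linarith
    | phs j => have := hp j; norm_num [zeroOff, shift, J.ang, J.low]; linarith
    | _ => exact absurd ha one_ne_zero

/-- The supercharacter of the Fock space, twisted by `z` to the degree. -/
def genFun (e : ℕ) (tw : Bool) (z : ℂ) (p : Pt m n) : ℂ :=
  exp (2 * Real.pi * I * (p.2.2.2 - twc tw * (∑ a, p.2.1 a - ∑ j, p.2.2.1 j))) *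
    ((∏ a : {a : J m n e // a.par = 0}, poch (-z * a.1.fug tw p) (exp (2 * Real.pi * I * p.1)))⁻¹ *
      ∏ a : {a : J m n e // a.par = 1}, poch (-z * a.1.fug tw p) (exp (2 * Real.pi * I * p.1)))

theorem kz_one_eq (s : ZMod 2) : kz 1 s = if s = 1 then -1 else 1 := by simp [kz]

/-- The characters of `ZMod 2`. -/
def signChar (s : ZMod 2) : AddChar (ZMod 2) ℂ where
  toFun := kz s
  map_zero_eq_one' := by simp [kz]
  map_add_eq_mul' x y := by rw [kz_comm, kz_mul, kz_comm x, kz_comm y]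

/-- The exponential as an additive character. -/
def expChar : AddChar ℂ ℂ where
  toFun := exp
  map_zero_eq_one' := Complex.exp_zero
  map_add_eq_mul' := Complex.exp_add

theorem hasSum_genFun {p : Pt m n}
    (hp : ∀ j, 0 < (p.2.2.1 j).im ∧ 2 * (p.2.2.1 j).im < p.1.im) (s : ZMod 2) :
    HasSum (fun i : Idx m n e tw =>
      kz s (tot degW i) * kz 1 (tot parW i) * exp ((bwt tw i).eval p)) (genFun e tw (kz 1 s) p) := by
  have hz : ‖kz 1 s‖ = 1 := by
    rw [kz_one_eq]; split_ifs <;> simp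
  have hb : ∏ a : {a : J m n e // a.par = 0},
      poch (-kz 1 s * a.1.fug tw p) (exp (2 * Real.pi * I * p.1)) ≠ 0 := by
    refine Finset.prod_ne_zero_iff.mpr fun a _ => poch_ne_zero (norm_nome_lt p.1) ?_ fun h => ?_
    · rw [norm_mul, norm_neg, hz, one_mul]
      exact (norm_fug_lt hp a.2).le
    · have h1 := congrArg norm h
      rw [norm_mul, norm_neg, hz, one_mul, norm_neg, norm_one] at h1
      exact (norm_fug_lt hp a.2).ne h1
  have ha := (hasProd_modes (tw := tw) (e := e) p 0 (-kz 1 s)).inv₀ hb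
  have hlt : ∀ c : CrMode m n e tw 0, ‖kz 1 s * exp (modeEval tw p c.1)‖ < 1 := by
    intro c
    obtain ⟨x, rfl⟩ := (crEquiv m n e tw 0).surjective c
    rw [exp_modeEval, norm_mul, hz, one_mul, norm_mul, norm_pow]
    exact (mul_le_of_le_one_right (norm_nonneg _) (pow_le_one₀ (norm_nonneg _)
      (norm_nome_lt p.1).le)).trans_lt (norm_fug_lt hp x.1.2)
  have ha' : HasProd (fun c : CrMode m n e tw 0 => (1 - kz 1 s * exp (modeEval tw p c.1))⁻¹)
      (∏ a : {a : J m n e // a.par = 0},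
        poch (-kz 1 s * a.1.fug tw p) (exp (2 * Real.pi * I * p.1)))⁻¹ := by
    simp only [neg_mul, ← sub_eq_add_neg] at ha ⊢
    exact ha
  have h := (hasSum_fock hlt (summable_exp_modeEval p 0 _) (summable_exp_modeEval p 1 _) ha'
    (hasProd_modes (tw := tw) (e := e) p 1 (-kz 1 s))).mul_left
      (exp (2 * Real.pi * I * (p.2.2.2 - twc tw * (∑ a, p.2.1 a - ∑ j, p.2.2.1 j))))
  refine HasSum.congr_fun h fun i => ?_
  have e1 : _ = kz s (tot degW i) := prod_tot (signChar s) degW i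
  have e2 : _ = kz 1 (tot parW i) := prod_tot (signChar 1) parW i
  have e3 : _ = exp (tot (modeEval tw p) i) := prod_tot expChar (modeEval tw p) i
  have h0 : ∀ c : CrMode m n e tw 0, kz 1 s * exp (modeEval tw p c.1) =
      signChar s (degW c.1) * signChar 1 (parW c.1) * expChar (modeEval tw p c.1) := by
    intro c
    change _ = kz s 1 * kz 1 c.1.1.par * exp _
    rw [c.2.1, kz_comm s]
    simp [kz]
  have h1 : ∀ c : CrMode m n e tw 1, -kz 1 s * exp (modeEval tw p c.1) =
      signChar s (degW c.1) * signChar 1 (parW c.1) * expChar (modeEval tw p c.1) := by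
    intro c
    change _ = kz s 1 * kz 1 c.1.1.par * exp _
    rw [c.2.1, kz_comm s]
    simp [kz]
  rw [eval_bwt, Complex.exp_add, ← e1, ← e2, ← e3]
  simp only [h0, h1, Finsupp.prod, mul_pow, Finset.prod_mul_distrib]
  ring

end Gen

/-! ### Supercharacters -/

theorem finite_bwt_eq (tw : Bool) (μ : Wt m n) : {i : Idx m n e tw | bwt tw i = μ}.Finite := by
  rcases Set.eq_empty_or_nonempty {i : Idx m n e tw | bwt tw i = μ} with h | ⟨i0, rfl⟩
  · rw [h]; exact Set.finite_empty
  refine (finite_tot_le tw (tot (finW tw) i0)).subset fun i hi => ?_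
  have hi' : bwt tw i = bwt tw i0 := hi
  have hW : ∀ i : Idx m n e tw, ((tot (finW tw) i : ℤ) : ℂ) = -4 * (bwt tw i).u -
      ∑ j, ((bwt tw i).f j + twc tw) := by
    intro i
    have h1 : finW tw = fun p : J m n e × ℤ => 2 * enW tw p + (-1) * ∑ j : Fin n, chi (J.ph j) p := by
      funext p
      simp only [finW]
      ring
    have h2 := tot_modeNum i
    rw [h1, tot_add, tot_mul_left, tot_mul_left, tot_sum]
    push_cast
    rw [h2]
    simp only [bwt, sub_add_cancel]
    ring
  have h3 : ((tot (finW tw) i : ℤ) : ℂ) = (tot (finW tw) i0 : ℤ) := by rw [hW, hW, hi']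
  exact (Int.cast_injective h3).le

namespace SuperFock

variable {tw : Bool} {W : Type} [AddCommGroup W] [Module ℂ W] (F : SuperFock m n e tw W)

theorem degSub_inf_wtSpace (s : ZMod 2) (μ : Wt m n) : F.degSub s ⊓ F.rep.wtSpace μ =
    Submodule.span ℂ (F.bas '' {i | tot degW i = s ∧ bwt tw i = μ}) := by
  ext v
  rw [Submodule.mem_inf, degSub_eq, mem_gr_iff, mem_wtSpace, F.bas.mem_span_image]
  exact ⟨fun h i hi => ⟨h.1 i (Finsupp.mem_support_iff.mp hi), h.2 i (Finsupp.mem_support_iff.mp hi)⟩,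
    fun h => ⟨fun i hi => (h (Finsupp.mem_support_iff.mpr hi)).1,
      fun i hi => (h (Finsupp.mem_support_iff.mpr hi)).2⟩⟩

theorem degSub_inf_wtSpace_inf_par (s ω : ZMod 2) (μ : Wt m n) :
    F.degSub s ⊓ F.rep.wtSpace μ ⊓ F.rep.par ω =
      Submodule.span ℂ (F.bas '' {i | (tot degW i = s ∧ bwt tw i = μ) ∧ tot parW i = ω}) := by
  ext v
  have h0 : v ∈ F.rep.par ω ↔ ∀ i, F.bas.repr v i ≠ 0 → tot parW i = ω := by
    rw [← mem_gr_iff, ← parSub_eq]; exact Iff.rfl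
  rw [Submodule.mem_inf, degSub_inf_wtSpace, h0, F.bas.mem_span_image, F.bas.mem_span_image]
  exact ⟨fun h i hi => ⟨h.1 hi, h.2 i (Finsupp.mem_support_iff.mp hi)⟩,
    fun h => ⟨fun i hi => (h hi).1, fun i hi => (h (Finsupp.mem_support_iff.mpr hi)).2⟩⟩

theorem finrank_span_bas (T : Finset (Idx m n e tw)) :
    Module.finrank ℂ (Submodule.span ℂ (F.bas '' (T : Set (Idx m n e tw)))) = T.card := by
  have h := finrank_span_eq_card (F.bas.linearIndependent.comp (fun i : T => i.1)
    Subtype.val_injective)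
  rw [Set.range_comp, Subtype.range_coe_subtype, Fintype.card_coe] at h
  exact h

theorem hasNormSch {α : Fin (m + n + 1) → Wt m n}
    (hα : ∀ p ∈ dom α, ∀ j, 0 < (p.2.2.1 j).im ∧ 2 * (p.2.2.1 j).im < p.1.im) {s : ZMod 2} {x : ℂ}
    {G : Pt m n → ℂ} (hG : ∀ p ∈ dom α, G p = exp (2 * Real.pi * I * p.1 * x) *
      (kz 1 s * (genFun e tw 1 p + kz 1 s * genFun e tw (-1) p) / 2)) :
    F.rep.HasNormSch (F.degSub s) s α x G := by
  classical
  refine ⟨fun μ => ?_, ?_, fun p hp => ?_⟩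
  · rw [degSub_inf_wtSpace]
    exact Module.Finite.span_of_finite ℂ (((finite_bwt_eq tw μ).subset fun i hi => hi.2).image _)
  · refine le_antisymm ?_ (iSup_le fun μ => inf_le_left)
    rw [degSub_eq, gr]
    refine Submodule.span_le.mpr ?_
    rintro _ ⟨i, hi, rfl⟩
    refine Submodule.mem_iSup_of_mem (bwt tw i) ?_
    rw [← gr, ← degSub_eq, degSub_inf_wtSpace]
    exact Submodule.subset_span ⟨i, ⟨hi, rfl⟩, rfl⟩
  · rw [hG p hp]
    refine HasSum.mul_left _ ?_
    have h0 := hasSum_genFun (tw := tw) (e := e) (hα p hp) 0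
    have h1 := hasSum_genFun (tw := tw) (e := e) (hα p hp) 1
    have h11 : (1 : ZMod 2) + 1 = 0 := by decide
    have e0 : kz 1 0 = 1 := by simp [kz]
    have e1 : kz 1 1 = -1 := by simp [kz]
    rw [e0] at h0
    rw [e1] at h1
    have h2 := ((h0.add (h1.mul_left (kz 1 s))).mul_left (kz 1 s / 2)).tsum_fiberwise (bwt tw)
    rw [div_mul_eq_mul_div] at h2
    refine h2.congr_fun fun μ => ?_
    set T := (finite_bwt_eq (e := e) tw μ).toFinset with hT
    have hTm : ∀ i, i ∈ T ↔ bwt tw i = μ := fun i => by rw [hT, Set.Finite.mem_toFinset]; rfl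
    have hset : ∀ ω, {i : Idx m n e tw | (tot degW i = s ∧ bwt tw i = μ) ∧ tot parW i = ω} =
        ((T.filter fun i => tot degW i = s ∧ tot parW i = ω : Finset _) : Set _) := by
      intro ω
      ext i
      rw [Finset.mem_coe, Finset.mem_filter, hTm, Set.mem_ofPred_eq]
      tauto
    rw [degSub_inf_wtSpace_inf_par, degSub_inf_wtSpace_inf_par, hset, hset, finrank_span_bas,
      finrank_span_bas]
    have hpre : bwt tw ⁻¹' {μ} = (T : Set (Idx m n e tw)) := by
      ext i
      rw [Finset.mem_coe, hTm]; rfl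
    rw [hpre, Finset.tsum_subtype' T fun i => kz 1 s / 2 *
        (kz 0 (tot degW i) * kz 1 (tot parW i) * exp ((bwt tw i).eval p) +
          kz 1 s * (kz 1 (tot degW i) * kz 1 (tot parW i) * exp ((bwt tw i).eval p))),
      Finset.card_filter, Finset.card_filter]
    push_cast
    rw [← Finset.sum_sub_distrib, Finset.sum_mul]
    refine Finset.sum_congr rfl fun i hi => ?_
    rw [(hTm i).mp hi]
    rcases zmod_two_cases s with rfl | rfl <;> rcases zmod_two_cases (tot degW i) with h3 | h3 <;>
      rcases zmod_two_cases (tot parW i) with h4 | h4 <;> rw [h3, h4] <;>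
      simp [kz, h11] <;> ring

end SuperFock

/-! ### The supercharacters as theta quotients -/

theorem prod_par (P : J m n e → ℂ) (u : ZMod 2) : ∏ a : {a : J m n e // a.par = u}, P a.1 =
    if u = 0 then ∏ j, (P (.ph j) * P (.phs j)) else (∏ i, (P (.ps i) * P (.pss i))) * ∏ i, P (.z i) := by
  rw [← Finset.prod_subtype (Finset.univ.filter fun a : J m n e => a.par = u) (by simp) P,
    Finset.prod_filter, J.prod_eq]
  rcases zmod_two_cases u with rfl | rfl <;> simp [J.par, Finset.prod_mul_distrib]

/-- The prefactor of the product formula of a theta function. -/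
def thetaC (tw : Bool) (b : ℕ) (τ : ℂ) : ℂ :=
  (if tw then exp (Real.pi * I * τ / 4) * (-I) ^ b else 1) * euler (exp (2 * Real.pi * I * τ))

theorem theta_eq_fug (tw : Bool) (b : ℕ) (w : ℂ) (p : Pt m n) {a a' : J m n e} (ha : a.low = false)
    (ha' : a'.low = true) (hw : a.ang p = w) (hw' : a'.ang p = -w) :
    theta (if tw then 1 else 0) b p.1 w =
      thetaC tw b p.1 * exp (-(2 * Real.pi * I * (twc tw * w))) *
        (poch ((-1) ^ b * a.fug tw p) (exp (2 * Real.pi * I * p.1)) *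
          poch ((-1) ^ b * a'.fug tw p) (exp (2 * Real.pi * I * p.1))) := by
  have hτ : 0 < (p.1 : ℂ).im := p.1.im_pos
  rcases tw with _ | _
  · have e1 : a.fug false p = exp (Real.pi * I * p.1) * exp (-(2 * Real.pi * I * w)) := by
      rw [J.fug, hw, ← Complex.exp_add]
      congr 1
      simp [zeroOff, shift]
      ring
    have e2 : a'.fug false p = exp (Real.pi * I * p.1) * exp (2 * Real.pi * I * w) := by
      rw [J.fug, hw', ← Complex.exp_add]
      congr 1
      simp [zeroOff, shift]
      ring
    rw [if_neg (by simp), theta_zero_eq_poch b w hτ, e1, e2]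
    simp only [thetaC, twc, Bool.false_eq_true, if_false, zero_mul, mul_zero, neg_zero,
      Complex.exp_zero, one_mul, mul_one]
    ring
  · have e1 : a.fug true p = exp (2 * Real.pi * I * p.1) * exp (-(2 * Real.pi * I * w)) := by
      rw [J.fug, hw, ← Complex.exp_add]
      congr 1
      simp [zeroOff, shift, ha]
      ring
    have e2 : a'.fug true p = exp (2 * Real.pi * I * w) := by
      rw [J.fug, hw']
      congr 1
      simp [zeroOff, shift, ha']
    have e3 : -(2 * Real.pi * I * (twc true * w)) = -(Real.pi * I * w) := by
      simp only [twc, if_true]; ring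
    rw [if_pos rfl, theta_one_eq_poch b w hτ, e1, e2, e3, thetaC, if_pos rfl]
    ring

/-- The normalization of the supercharacters, for `m - n = 1`. -/
def nomeExp (tw : Bool) : ℂ := if tw then 1 / 12 else -1 / 24

theorem thetaC_eq (tw : Bool) (b : ℕ) (τ : ℂ) : thetaC tw b τ =
    ModularForm.eta τ * exp (2 * Real.pi * I * τ * nomeExp tw) * (if tw then (-I) ^ b else 1) := by
  rw [thetaC, eta_eq_euler]
  rcases tw with _ | _
  · have h : exp (Real.pi * I * τ / 12) * exp (2 * Real.pi * I * τ * nomeExp false) = 1 := by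
      rw [← Complex.exp_add, Complex.exp_eq_one_iff]
      exact ⟨0, by simp only [nomeExp]; push_cast; simp; ring⟩
    simp only [Bool.false_eq_true, if_false]
    linear_combination -euler (exp (2 * Real.pi * I * τ)) * h
  · have h : exp (Real.pi * I * τ / 12) * exp (2 * Real.pi * I * τ * nomeExp true) =
        exp (Real.pi * I * τ / 4) := by
      rw [← Complex.exp_add]
      congr 1
      simp only [nomeExp, if_true]
      ring
    simp only [if_true]
    linear_combination -euler (exp (2 * Real.pi * I * τ)) * (-I) ^ b * h

theorem genFun_eq (e : ℕ) (tw : Bool) (b : ℕ) {z : ℂ} (hz : -z = (-1) ^ b) (p : Pt m n) :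
    exp (2 * Real.pi * I * p.1 * (nomeExp tw * ((m : ℂ) - n))) * genFun e tw z p =
      (if tw then (-I) ^ b else 1) ^ ((n : ℤ) - m) * thetaQuot (if tw then 1 else 0) b p *
        ∏ i : Fin e, poch ((-1) ^ b * (J.z i : J m n e).fug tw p) (exp (2 * Real.pi * I * p.1)) := by
  have hx : ∀ i, theta (if tw then 1 else 0) b p.1 (p.2.1 i) = _ := fun i =>
    theta_eq_fug (e := e) tw b (p.2.1 i) p (a := .ps i) (a' := .pss i) rfl rfl rfl rfl
  have hy : ∀ j, theta (if tw then 1 else 0) b p.1 (p.2.2.1 j) = _ := fun j =>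
    theta_eq_fug (e := e) tw b (p.2.2.1 j) p (a := .ph j) (a' := .phs j) rfl rfl rfl rfl
  rw [genFun, hz, prod_par (fun a => poch ((-1) ^ b * a.fug tw p) (exp (2 * Real.pi * I * p.1))),
    prod_par (fun a => poch ((-1) ^ b * a.fug tw p) (exp (2 * Real.pi * I * p.1))), if_pos rfl,
    if_neg one_ne_zero, thetaQuot]
  have hprod : ∀ {k : ℕ} (w Q : Fin k → ℂ),
      ∏ i, (thetaC tw b p.1 * exp (-(2 * Real.pi * I * (twc tw * w i))) * Q i) =
        thetaC tw b p.1 ^ k * exp (-(2 * Real.pi * I * (twc tw * ∑ i, w i))) * ∏ i, Q i := by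
    intro k w Q
    rw [Finset.prod_mul_distrib, Finset.prod_mul_distrib, Finset.prod_const, Finset.card_univ,
      Fintype.card_fin, ← Complex.exp_sum, Finset.mul_sum, Finset.mul_sum, Finset.sum_neg_distrib]
  simp only [hx, hy, hprod]
  rw [thetaC_eq]
  have hE : exp (2 * Real.pi * I * p.1 * (nomeExp tw * ((m : ℂ) - n))) =
      exp (2 * Real.pi * I * p.1 * nomeExp tw) ^ ((m : ℤ) - n) := by
    rw [← Complex.exp_int_mul]
    congr 1
    push_cast
    ring
  have hexp : exp (2 * Real.pi * I * (p.2.2.2 - twc tw * (∑ a, p.2.1 a - ∑ j, p.2.2.1 j))) =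
      exp (2 * Real.pi * I * p.2.2.2) * exp (-(2 * Real.pi * I * (twc tw * ∑ i, p.2.1 i))) *
        (exp (-(2 * Real.pi * I * (twc tw * ∑ j, p.2.2.1 j))))⁻¹ := by
    rw [← Complex.exp_neg, ← Complex.exp_add, ← Complex.exp_add]
    congr 1
    ring
  have hκ : (if tw then (-I) ^ b else 1) ≠ 0 := by
    split_ifs
    · exact pow_ne_zero _ (neg_ne_zero.mpr I_ne_zero)
    · exact one_ne_zero
  have hη : ModularForm.eta p.1 ≠ 0 := by
    rw [eta_eq_euler]
    exact mul_ne_zero (Complex.exp_ne_zero _) (euler_ne_zero (norm_nome_lt p.1))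
  have hE0 := Complex.exp_ne_zero (2 * Real.pi * I * p.1 * nomeExp tw)
  have hy0 := Complex.exp_ne_zero (-(2 * Real.pi * I * (twc tw * ∑ j, p.2.2.1 j)))
  rw [hE, hexp, zpow_sub₀ hE0, zpow_sub₀ hκ, zpow_sub₀ hη, mul_pow, mul_pow, mul_pow, mul_pow]
  simp only [zpow_natCast]
  generalize exp (2 * Real.pi * I * p.1 * nomeExp tw) = E at *
  generalize (if tw then (-I) ^ b else 1) = κ at *
  generalize ModularForm.eta p.1 = η at *
  generalize exp (-(2 * Real.pi * I * (twc tw * ∑ j, p.2.2.1 j))) = y at *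
  rw [div_eq_mul_inv _ (_ * _), mul_inv, mul_inv, mul_inv, mul_inv]
  field_simp

theorem chEven_eq (tw : Bool) (s : ZMod 2) (p : Pt m n) :
    chEven m n (if tw then (if s = 0 then 2 else 3) else (if s = 0 then 0 else 1)) p =
      exp (2 * Real.pi * I * p.1 * (nomeExp tw * ((m : ℂ) - n))) *
        (kz 1 s * (genFun 0 tw 1 p + kz 1 s * genFun 0 tw (-1) p) / 2) := by
  have h0 := genFun_eq 0 tw 0 (z := -1) (by norm_num) p
  have h1 := genFun_eq 0 tw 1 (z := 1) (by norm_num) p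
  rw [Finset.univ_eq_empty, Finset.prod_empty, mul_one] at h0 h1
  have hs : ∀ A a b : ℂ, A * (kz 1 s * (a + kz 1 s * b) / 2) =
      (A * b + kz 1 s * (A * a)) / 2 := fun A a b => by
    linear_combination (A * b / 2) * kz_sq 1 s
  rw [hs, h0, h1]
  have hI : (-I) ^ ((n : ℤ) + -m) = I ^ ((m : ℤ) + -n) := by
    rw [← Complex.inv_I, inv_zpow']
    congr 1
    ring
  rcases tw with _ | _ <;> rcases zmod_two_cases s with rfl | rfl <;>
    simp [chEven, evenTwMinus, kz, hI, sub_eq_add_neg]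

theorem eta_prefactor_plus {τ : ℂ} (hτ : 0 < τ.im) :
    exp (2 * Real.pi * I * τ * (-1 / 48)) *
      poch (exp (Real.pi * I * τ)) (exp (2 * Real.pi * I * τ)) =
    ModularForm.eta τ ^ 2 / (ModularForm.eta (τ / 2) * ModularForm.eta (2 * τ)) := by
  set x := exp (Real.pi * I * τ) with hx
  have hx1 : ‖x‖ < 1 := norm_exp_pi hτ
  have e2 : exp (2 * Real.pi * I * τ) = x ^ 2 := by
    rw [hx, ← Complex.exp_nat_mul]; congr 1; push_cast; ring
  have e4 : exp (2 * Real.pi * I * (2 * τ)) = x ^ 4 := by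
    rw [hx, ← Complex.exp_nat_mul]; congr 1; push_cast; ring
  have e1 : exp (2 * Real.pi * I * (τ / 2)) = x := by rw [hx]; congr 1; ring
  have n4 : ‖x ^ 4‖ < 1 := by rw [norm_pow]; exact pow_lt_one₀ (norm_nonneg _) hx1 (by norm_num)
  have h1 := euler_ne_zero hx1
  have h4 := euler_ne_zero n4
  have hE : exp (2 * Real.pi * I * τ * (-1 / 48)) * (exp (Real.pi * I * (τ / 2) / 12) *
      exp (Real.pi * I * (2 * τ) / 12)) = exp (Real.pi * I * τ / 12) ^ 2 := by
    rw [← Complex.exp_add, ← Complex.exp_add, ← Complex.exp_nat_mul]; congr 1; push_cast; ring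
  rw [eq_div_iff (by
    rw [eta_eq_euler, eta_eq_euler, e1, e4]
    exact mul_ne_zero (mul_ne_zero (Complex.exp_ne_zero _) h1)
      (mul_ne_zero (Complex.exp_ne_zero _) h4)), eta_eq_euler, eta_eq_euler, eta_eq_euler, e1, e2, e4,
    mul_pow, ← poch_mul_euler hx1, ← hE]
  ring

theorem eta_prefactor_minus {τ : ℂ} (hτ : 0 < τ.im) :
    exp (2 * Real.pi * I * τ * (-1 / 48)) *
      poch (-exp (Real.pi * I * τ)) (exp (2 * Real.pi * I * τ)) =
    ModularForm.eta (τ / 2) / ModularForm.eta τ := by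
  set x := exp (Real.pi * I * τ) with hx
  have hx1 : ‖x‖ < 1 := norm_exp_pi hτ
  have e2 : exp (2 * Real.pi * I * τ) = x ^ 2 := by
    rw [hx, ← Complex.exp_nat_mul]; congr 1; push_cast; ring
  have e1 : exp (2 * Real.pi * I * (τ / 2)) = x := by rw [hx]; congr 1; ring
  have hE : exp (2 * Real.pi * I * τ * (-1 / 48)) * exp (Real.pi * I * τ / 12) =
      exp (Real.pi * I * (τ / 2) / 12) := by
    rw [← Complex.exp_add]; congr 1; ring
  rw [eq_div_iff (by
    rw [eta_eq_euler, e2]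
    exact mul_ne_zero (Complex.exp_ne_zero _) (euler_ne_zero (norm_sq_lt hx1))), eta_eq_euler,
    eta_eq_euler, e1, e2, euler_eq_poch_neg_mul hx1, ← hE]
  ring

theorem poch_eq_mul {x : ℂ} (hx : ‖x‖ < 1) (c : ℂ) : poch c x = (1 + c) * poch (c * x) x := by
  have e : (fun k : ℕ => 1 + c * x ^ (k + 1)) = fun k : ℕ => 1 + c * x * x ^ k :=
    funext fun k => by rw [pow_succ', mul_assoc]
  have hm : Multipliable fun k : ℕ => 1 + c * x ^ (k + 1) := by
    rw [e]
    exact multipliable_one_add_mul_pow hx (c * x)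
  have key : ∏' k : ℕ, (1 + c * x ^ k) = (1 + c * x ^ 0) * ∏' k : ℕ, (1 + c * x ^ (k + 1)) :=
    tprod_eq_zero_mul' (f := fun k : ℕ => 1 + c * x ^ k) hm
  rw [e, pow_zero, mul_one] at key
  exact key

theorem eta_prefactor_tw {τ : ℂ} (hτ : 0 < τ.im) :
    exp (2 * Real.pi * I * τ * (1 / 24)) * poch 1 (exp (2 * Real.pi * I * τ)) =
    2 * (ModularForm.eta (2 * τ) / ModularForm.eta τ) := by
  set q := exp (2 * Real.pi * I * τ) with hq
  have hq1 : ‖q‖ < 1 := norm_exp_two_pi hτ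
  have e2 : exp (2 * Real.pi * I * (2 * τ)) = q ^ 2 := by
    rw [hq, ← Complex.exp_nat_mul]; congr 1; push_cast; ring
  have hE : exp (2 * Real.pi * I * τ * (1 / 24)) * exp (Real.pi * I * τ / 12) =
      exp (Real.pi * I * (2 * τ) / 12) := by
    rw [← Complex.exp_add]; congr 1; ring
  have h1 : poch 1 q = 2 * poch q q := by
    rw [poch_eq_mul hq1, one_mul, one_add_one_eq_two]
  rw [← mul_div_assoc 2, eq_div_iff (by
    rw [eta_eq_euler]
    exact mul_ne_zero (Complex.exp_ne_zero _) (euler_ne_zero hq1)), eta_eq_euler,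
    eta_eq_euler, e2, h1, ← poch_self_mul_euler hq1, ← hE]
  ring

theorem chOdd_eq (tw : Bool) (s : ZMod 2) (p : Pt m n) :
    chOdd m n (if tw then 2 else (if s = 0 then 0 else 1)) p =
      exp (2 * Real.pi * I * p.1 * (nomeExp tw * ((m : ℂ) - n) + if tw then 1 / 24 else -1 / 48)) *
        (kz 1 s * (genFun 1 tw 1 p + kz 1 s * genFun 1 tw (-1) p) / 2) := by
  have hτ : 0 < (p.1 : ℂ).im := p.1.im_pos
  have h0 := genFun_eq 1 tw 0 (z := -1) (by norm_num) p
  have h1 := genFun_eq 1 tw 1 (z := 1) (by norm_num) p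
  rw [Finset.univ_unique, Finset.prod_singleton] at h0 h1
  rw [mul_add, Complex.exp_add]
  have hs : ∀ A E a b : ℂ, A * E * (kz 1 s * (a + kz 1 s * b) / 2) =
      (E * (A * b) + kz 1 s * (E * (A * a))) / 2 := fun A E a b => by
    linear_combination (A * E * b / 2) * kz_sq 1 s
  rw [hs, h0, h1]
  rcases tw with _ | _
  · have hf : (J.z default : J m n 1).fug false p = exp (Real.pi * I * p.1) := by
      rw [J.fug]
      congr 1
      simp [zeroOff, shift, J.ang]
      ring
    have e0 := eta_prefactor_plus hτ
    have e1 := eta_prefactor_minus hτ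
    have hp : chOdd m n (if s = 0 then 0 else 1) p = (oddPlus p + kz 1 s * oddMinus p) / 2 := by
      rcases zmod_two_cases s with rfl | rfl <;> simp [chOdd, kz, sub_eq_add_neg]
    simp only [Bool.false_eq_true, if_false, hf, pow_zero, pow_one, one_zpow, one_mul, neg_mul]
    rw [hp, oddPlus, oddMinus, ← e0, ← e1]
    ring
  · have hf : (J.z default : J m n 1).fug true p = 1 := by
      rw [J.fug, Complex.exp_eq_one_iff]
      exact ⟨0, by simp [zeroOff, shift, J.ang, J.low]⟩
    have e0 := eta_prefactor_tw hτ
    have hp : chOdd m n 2 p = oddTw p := rfl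
    simp only [if_true, hf, pow_zero, pow_one, one_zpow, one_mul, mul_one,
      poch_eq_mul (norm_nome_lt p.1) (-1), add_neg_cancel, zero_mul, mul_zero, add_zero]
    rw [hp, oddTw, mul_left_comm, e0]
    ring

/-! ### The modules for the distinguished simple roots -/

theorem Wt.neg_neg (a : Wt m n) : -(-a) = a :=
  Wt.ext (_root_.neg_neg a.e) (_root_.neg_neg a.f) (_root_.neg_neg a.k) (_root_.neg_neg a.u)

namespace SuperFock

variable {tw : Bool} {W : Type} [AddCommGroup W] [Module ℂ W]

theorem dist_odd (F : SuperFock m n 1 true W) (hn : 1 ≤ n) :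
    (∃ Λ, F.rep.IsHW (F.degSub 0) 0 (distRoots m n 1) Λ F.vac) ∧
      ∃ Λ, F.rep.IsHW (F.degSub 1) 1 (distRoots m n 1) Λ (F.op (.z 0, 0) F.vac) :=
  ⟨⟨_, F.isHW_affRoots_vac le_rfl hn (by omega) (isOrd_dist m n) (add_zero 0)⟩,
    ⟨_, F.isHW_z hn (isOrd_dist m n) (add_zero 0)⟩⟩

theorem dist_even (F : SuperFock m n 0 true W) (hn : 1 ≤ n) {i : Fin m} (hi : i.val + 1 = m) :
    (∃ Λ, IsFund (distRoots m n 0) (m + n) Λ ∧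
      F.rep.IsHW (F.degSub 0) 0 (distRoots m n 0) Λ F.vac) ∧
    ∃ Λ, IsFund (distRoots m n 0) (m + n - 1) Λ ∧
      F.rep.IsHW (F.degSub 1) 1 (distRoots m n 0) Λ (F.op (.pss i, 0) F.vac) := by
  have h := isOrd_dist m n
  have hp : n + i.val = m + n - 1 := by omega
  refine ⟨⟨_, h.isFund_spin (by omega) ?_ hp,
    F.isHW_affRoots_vac zero_le_one hn (by omega) h (add_zero 0)⟩,
    ⟨_, h.isFund_cospin (by omega) hp ?_, F.isHW_pss hn h (add_zero 0) hp⟩⟩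
  · rw [Wt.ip_add_right, h.ip_vac _ (by omega)]
    norm_num [twc]
  · rw [Wt.ip_add_right, h.ip_opWt_pss _ (by omega), if_neg (by omega)]
    norm_num

end SuperFock

/-! ### The modules for the simple roots adapted to integrable modules -/

theorem Wt.ip_eps_sub_del {i : ℕ} (him : i < m) (hin : i < n) (a : Wt m n) :
    a.ip (eps i - del i) = a.e ⟨i, him⟩ + a.f ⟨i, hin⟩ := by
  have h1 := a.ip_eps ⟨i, him⟩
  have h2 := a.ip_del ⟨i, hin⟩
  simp only at h1 h2
  rw [ip_sub_right, h1, h2, sub_neg_eq_add]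

theorem Wt.ip_del_add_eps {i : ℕ} (him : i < m) (hin : i < n) (a : Wt m n) :
    a.ip (del i + eps i) = a.e ⟨i, him⟩ - a.f ⟨i, hin⟩ := by
  have h1 := a.ip_eps ⟨i, him⟩
  have h2 := a.ip_del ⟨i, hin⟩
  simp only at h1 h2
  rw [ip_add_right, h1, h2, neg_add_eq_sub]

theorem Wt.ip_del_sub_eps {i : ℕ} (him : i < m) (hin : i < n) (a : Wt m n) :
    a.ip (del i - eps i) = -(a.e ⟨i, him⟩ + a.f ⟨i, hin⟩) := by
  rw [← ip_eps_sub_del him hin, ip_sub_right, ip_sub_right, neg_sub]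

theorem vacWt_e_add_f (tw : Bool) (i : Fin m) (j : Fin n) :
    (vacWt m n tw).e i + (vacWt m n tw).f j = 0 := add_neg_cancel _

theorem opWt_ps_e_add_f {a i : Fin m} (h : a ≠ i) (j : Fin n) :
    (opWt false ((.ps a, -1) : J m n e × ℤ)).e i +
      (opWt false ((.ps a, -1) : J m n e × ℤ)).f j = 0 := by
  simp [opWt, chi, J.conj, twc, h]

theorem opWt_pss_e_add_f {a i : Fin m} (h : a ≠ i) (j : Fin n) :
    (opWt true ((.pss a, 0) : J m n e × ℤ)).e i +
      (opWt true ((.pss a, 0) : J m n e × ℤ)).f j = 0 := by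
  simp [opWt, chi, J.conj, twc, h]

theorem opWt_pss_e_sub_f (a : Fin m) (j : Fin n) :
    (opWt true ((.pss a, 0) : J m n e × ℤ)).e a -
      (opWt true ((.pss a, 0) : J m n e × ℤ)).f j = 0 := by
  simp [opWt, chi, J.conj, twc]
  norm_num

theorem intRho_k_ne_zero (he : e ≤ 1) (hmn : n < m) : (1 : ℂ) + (intRho m n e).k ≠ 0 := by
  have h : (1 : ℂ) + (intRho m n e).k = ((2 * ((m : ℤ) - n) - 1 + e : ℤ) : ℂ) := by
    simp only [intRho]
    push_cast
    ring
  rw [h, Int.cast_ne_zero]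
  omega

namespace SuperFock

variable {W W' : Type} [AddCommGroup W] [Module ℂ W] [AddCommGroup W'] [Module ℂ W']

theorem int_odd (F : SuperFock m n 1 false W) (F' : SuperFock m n 1 true W') (hn : 1 ≤ n)
    (hmn : n < m ∨ (m = 1 ∧ n = 1)) :
    ∃ Λ₀ Λ₁ Λs : Wt m n, IsFund (intRoots m n 1) 0 Λ₀ ∧ IsFund (intRoots m n 1) 1 Λ₁ ∧
      IsFund (intRoots m n 1) (m + n) Λs ∧
      F.rep.IsL (F.degSub 0) 0 (intRoots m n 1) Λ₀ ∧
      F.rep.IsL (F.degSub 1) 1 (intRoots m n 1) Λ₁ ∧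
      F'.rep.IsL (F'.degSub 0) 0 (intRoots m n 1) (-Λs) ∧
      F'.rep.IsL (F'.degSub 1) 1 (intRoots m n 1) (-Λs) ∧
      (n < m → ∀ i < n, Λ₀.ip (Wt.eps i - Wt.del i) = 0 ∧ Λ₁.ip (Wt.eps i - Wt.del i) = 0 ∧
        (-Λs).ip (Wt.eps i - Wt.del i) = 0) ∧
      ∃ s₀ s₁ s₂ : ℂ,
        (n < m → ∃ r, IsRho (intRoots m n 1) r ∧ (Λ₀ + r).k ≠ 0 ∧ (Λ₁ + r).k ≠ 0 ∧
          (-Λs + r).k ≠ 0 ∧ s₀ = normExp 1 r Λ₀ ∧ s₁ = normExp 1 r Λ₁ ∧ s₂ = normExp 1 r (-Λs)) ∧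
        (m = n → s₀ = -1 / 48 ∧ s₁ = -1 / 48 ∧ s₂ = 1 / 24) ∧
        F.rep.HasNormSch (F.degSub 0) 0 (intRoots m n 1) s₀ (chOdd m n 0) ∧
        F.rep.HasNormSch (F.degSub 1) 1 (intRoots m n 1) s₁ (chOdd m n 1) ∧
        F'.rep.HasNormSch (F'.degSub 0) 0 (intRoots m n 1) s₂ (chOdd m n 2) ∧
        F'.rep.HasNormSch (F'.degSub 1) 1 (intRoots m n 1) s₂ (chOdd m n 2) := by
  have hmn' : n < m ∨ m = n ∧ 1 = 1 := by omega
  have h := isOrd_int (m := m) (n := n) (e := 1) le_rfl (by omega)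
  obtain ⟨i, hi⟩ : ∃ i : Fin m, i.val + 1 = m := ⟨⟨m - 1, by omega⟩, by simp only; omega⟩
  have hi0 := intE_last le_rfl hmn' hi
  have hdom : ∀ p ∈ dom (intRoots m n 1), ∀ j, _ := fun p hp j => mem_dom_int le_rfl hn hmn' hp j
  refine ⟨vacWt m n false, opWt false ((.ps i, -1) : J m n 1 × ℤ), -vacWt m n true,
    isFund_int_zero le_rfl hn hmn', isFund_int_one le_rfl hn hmn' hi0,
    isFund_int_odd_spin hn (by omega), ?_⟩
  rw [Wt.neg_neg]
  refine ⟨⟨_, F.isHW_affRoots_vac le_rfl hn (by omega) h (add_zero 0)⟩,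
    ⟨_, F.isHW_ps le_rfl hn h (add_zero 0) hi0⟩,
    ⟨_, F'.isHW_affRoots_vac le_rfl hn (by omega) h (add_zero 0)⟩,
    ⟨_, F'.isHW_z hn h (add_zero 0)⟩, fun hlt a ha => ?_,
    nomeExp false * ((m : ℂ) - n) + -1 / 48, nomeExp false * ((m : ℂ) - n) + -1 / 48,
    nomeExp true * ((m : ℂ) - n) + 1 / 24, fun hlt => ?_, fun hEq => ?_,
    F.hasNormSch hdom fun p _ => chOdd_eq false 0 p, F.hasNormSch hdom fun p _ => chOdd_eq false 1 p,
    F'.hasNormSch hdom fun p _ => chOdd_eq true 0 p, F'.hasNormSch hdom fun p _ => chOdd_eq true 1 p⟩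
  · have ham : a < m := by omega
    have hai : i ≠ ⟨a, ham⟩ := fun h => by rw [h] at hi; simp only at hi; omega
    rw [Wt.ip_eps_sub_del ham ha, Wt.ip_eps_sub_del ham ha, Wt.ip_eps_sub_del ham ha]
    exact ⟨vacWt_e_add_f _ _ _, opWt_ps_e_add_f hai _, vacWt_e_add_f _ _ _⟩
  · have hk := intRho_k_ne_zero (e := 1) le_rfl hlt
    refine ⟨intRho m n 1, isRho_intRho le_rfl hn hlt, hk, hk, hk, ?_⟩
    rw [normExp_ps hlt hi, normExp_vac_odd hlt, normExp_vac_odd hlt]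
    simp only [nomeExp, Bool.false_eq_true, if_false, if_true]
    refine ⟨?_, ?_, ?_⟩ <;> ring
  · rw [hEq, sub_self, mul_zero, mul_zero, zero_add, zero_add]
    exact ⟨rfl, rfl, rfl⟩

theorem int_even (F : SuperFock m n 0 false W) (F' : SuperFock m n 0 true W') (hn : 1 ≤ n)
    (hmn : n < m) :
    ∃ Λ₀ Λ₁ Λs Λc r : Wt m n, IsFund (intRoots m n 0) 0 Λ₀ ∧ IsFund (intRoots m n 0) 1 Λ₁ ∧
      IsFund (intRoots m n 0) (m + n) Λs ∧ IsFund (intRoots m n 0) (m + n - 1) Λc ∧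
      F.rep.IsL (F.degSub 0) 0 (intRoots m n 0) Λ₀ ∧
      F.rep.IsL (F.degSub 1) 1 (intRoots m n 0) Λ₁ ∧
      F'.rep.IsL (F'.degSub 0) 0 (intRoots m n 0) Λs ∧
      F'.rep.IsL (F'.degSub 1) 1 (intRoots m n 0) Λc ∧
      (∀ i < n, Λ₀.ip (Wt.del i - Wt.eps i) = 0 ∧ Λ₁.ip (Wt.del i - Wt.eps i) = 0 ∧
        Λs.ip (Wt.del i - Wt.eps i) = 0 ∧
        Λc.ip (if i = 0 then Wt.del i + Wt.eps i else Wt.del i - Wt.eps i) = 0) ∧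
      IsRho (intRoots m n 0) r ∧
      (Λ₀ + r).k ≠ 0 ∧ (Λ₁ + r).k ≠ 0 ∧ (Λs + r).k ≠ 0 ∧ (Λc + r).k ≠ 0 ∧
      F.rep.HasNormSch (F.degSub 0) 0 (intRoots m n 0) (normExp 0 r Λ₀) (chEven m n 0) ∧
      F.rep.HasNormSch (F.degSub 1) 1 (intRoots m n 0) (normExp 0 r Λ₁) (chEven m n 1) ∧
      F'.rep.HasNormSch (F'.degSub 0) 0 (intRoots m n 0) (normExp 0 r Λs) (chEven m n 2) ∧
      F'.rep.HasNormSch (F'.degSub 1) 1 (intRoots m n 0) (normExp 0 r Λc) (chEven m n 3) := by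
  have h := isOrd_int (m := m) (n := n) (e := 0) zero_le_one hmn.le
  obtain ⟨i, hi⟩ : ∃ i : Fin m, i.val + 1 = m := ⟨⟨m - 1, by omega⟩, by simp only; omega⟩
  obtain ⟨i', hi'⟩ : ∃ i : Fin m, i.val = 0 := ⟨⟨0, by omega⟩, rfl⟩
  have hi0 := intE_last (e := 0) zero_le_one (Or.inl hmn) hi
  have hl := intE_zero hn hmn hi'
  have hdom : ∀ p ∈ dom (intRoots m n 0), ∀ j, _ := fun p hp j =>
    mem_dom_int zero_le_one hn (Or.inl hmn) hp j
  have hk := intRho_k_ne_zero (e := 0) zero_le_one hmn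
  have hx : ∀ tw, normExp 0 (intRho m n 0) (vacWt m n tw) = nomeExp tw * ((m : ℂ) - n) := by
    intro tw
    rw [normExp_vac_even hmn, nomeExp]
    split_ifs <;> ring
  refine ⟨vacWt m n false, opWt false ((.ps i, -1) : J m n 0 × ℤ), vacWt m n true,
    opWt true ((.pss i', 0) : J m n 0 × ℤ), intRho m n 0,
    isFund_int_zero zero_le_one hn (Or.inl hmn), isFund_int_one zero_le_one hn (Or.inl hmn) hi0,
    h.isFund_spin (by omega) ?_ hl, h.isFund_cospin (by omega) hl ?_,
    ⟨_, F.isHW_affRoots_vac zero_le_one hn (by omega) h (add_zero 0)⟩,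
    ⟨_, F.isHW_ps zero_le_one hn h (add_zero 0) hi0⟩,
    ⟨_, F'.isHW_affRoots_vac zero_le_one hn (by omega) h (add_zero 0)⟩,
    ⟨_, F'.isHW_pss hn h (add_zero 0) hl⟩, fun a ha => ?_,
    isRho_intRho zero_le_one hn hmn, hk, hk, hk, hk, ?_⟩
  · change (vacWt m n true).ip (ordWt (intE m n 0) (intD m n 0) 0 +
      ordWt (intE m n 0) (intD m n 0) 1) = 1
    rw [Wt.ip_add_right, h.ip_vac _ (by omega), h.ip_vac _ (by omega)]
    norm_num [twc]
  · change (opWt true ((.pss i', 0) : J m n 0 × ℤ)).ip (ordWt (intE m n 0) (intD m n 0) 0 +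
      ordWt (intE m n 0) (intD m n 0) 1) = 1
    rw [Wt.ip_add_right, h.ip_opWt_pss _ (by omega), h.ip_opWt_pss _ (by omega), hl,
      if_neg (by omega), if_neg (by omega)]
    norm_num
  · have ham : a < m := by omega
    have hai : i ≠ ⟨a, ham⟩ := fun h => by rw [h] at hi; simp only at hi; omega
    rw [Wt.ip_del_sub_eps ham ha, Wt.ip_del_sub_eps ham ha, Wt.ip_del_sub_eps ham ha,
      vacWt_e_add_f, opWt_ps_e_add_f hai, vacWt_e_add_f, neg_zero]
    refine ⟨rfl, rfl, rfl, ?_⟩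
    by_cases ha0 : a = 0
    · subst ha0
      rw [if_pos rfl, Wt.ip_del_add_eps ham ha, show i' = ⟨0, ham⟩ from Fin.ext hi',
        opWt_pss_e_sub_f]
    · rw [if_neg ha0, Wt.ip_del_sub_eps ham ha, opWt_pss_e_add_f, neg_zero]
      exact fun h => ha0 (by rw [h] at hi'; exact hi')
  · rw [normExp_ps hmn hi, normExp_pss hn hi', hx, hx]
    exact ⟨F.hasNormSch hdom fun p _ => chEven_eq false 0 p,
      F.hasNormSch hdom fun p _ => chEven_eq false 1 p,
      F'.hasNormSch hdom fun p _ => chEven_eq true 0 p,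
      F'.hasNormSch hdom fun p _ => chEven_eq true 1 p⟩

end SuperFock

end OspFermions

end

theorem mainTheorem8 :
    -- the superspaces of (twisted) superfermions and the representations of `osp(M|N)^` in them
    (∀ (m n e : ℕ) (tw : Bool), e ≤ 1 → 1 ≤ n → 1 ≤ 2 * m + e →
      OspFermions.IsFreeFieldModule m n e tw ∧
      (∃! R : OspFermions.AffRep m n e (OspFermions.Fock m n e tw), OspFermions.IsFermionic R) ∧
      IsCompl (OspFermions.degSub m n e tw 0) (OspFermions.degSub m n e tw 1) ∧
      ∀ R : OspFermions.AffRep m n e (OspFermions.Fock m n e tw), OspFermions.IsFermionic R →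
        R.SoIntegrable) ∧
    -- irreducibility of the twisted modules, distinguished simple roots, `M = 2m + 1`
    (∀ m n : ℕ, 1 ≤ n →
      ∀ R : OspFermions.AffRep m n 1 (OspFermions.Fock m n 1 true), OspFermions.IsFermionic R →
        (∃ Λ, R.IsHW (OspFermions.degSub m n 1 true 0) 0 (OspFermions.distRoots m n 1) Λ
          (OspFermions.vac m n 1 true)) ∧
        ∃ Λ, R.IsHW (OspFermions.degSub m n 1 true 1) 1 (OspFermions.distRoots m n 1) Λ
          (OspFermions.mode true (.z 0) 0 (OspFermions.vac m n 1 true))) ∧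
    -- irreducibility of the twisted modules, distinguished simple roots, `M = 2m`
    (∀ m n : ℕ, 1 ≤ n →
      ∀ R : OspFermions.AffRep m n 0 (OspFermions.Fock m n 0 true), OspFermions.IsFermionic R →
        ∀ i : Fin m, i.val + 1 = m →
          (∃ Λ, OspFermions.IsFund (OspFermions.distRoots m n 0) (m + n) Λ ∧
            R.IsHW (OspFermions.degSub m n 0 true 0) 0 (OspFermions.distRoots m n 0) Λ
              (OspFermions.vac m n 0 true)) ∧
          ∃ Λ, OspFermions.IsFund (OspFermions.distRoots m n 0) (m + n - 1) Λ ∧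
            R.IsHW (OspFermions.degSub m n 0 true 1) 1 (OspFermions.distRoots m n 0) Λ
              (OspFermions.mode true (.pss i) 0 (OspFermions.vac m n 0 true))) ∧
    -- `M = 2m + 1`: the modules `L(Λ₀)`, `L(Λ₁)`, `L(-Λ_{m+n})` and their supercharacters
    (∀ m n : ℕ, 1 ≤ n → (n < m ∨ (m = 1 ∧ n = 1)) →
      ∀ R : OspFermions.AffRep m n 1 (OspFermions.Fock m n 1 false), OspFermions.IsFermionic R →
      ∀ R' : OspFermions.AffRep m n 1 (OspFermions.Fock m n 1 true), OspFermions.IsFermionic R' →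
      ∃ Λ₀ Λ₁ Λs : OspFermions.Wt m n,
        OspFermions.IsFund (OspFermions.intRoots m n 1) 0 Λ₀ ∧
        OspFermions.IsFund (OspFermions.intRoots m n 1) 1 Λ₁ ∧
        OspFermions.IsFund (OspFermions.intRoots m n 1) (m + n) Λs ∧
        R.IsL (OspFermions.degSub m n 1 false 0) 0 (OspFermions.intRoots m n 1) Λ₀ ∧
        R.IsL (OspFermions.degSub m n 1 false 1) 1 (OspFermions.intRoots m n 1) Λ₁ ∧
        R'.IsL (OspFermions.degSub m n 1 true 0) 0 (OspFermions.intRoots m n 1) (-Λs) ∧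
        R'.IsL (OspFermions.degSub m n 1 true 1) 1 (OspFermions.intRoots m n 1) (-Λs) ∧
        (n < m → ∀ i < n,
          Λ₀.ip (OspFermions.Wt.eps i - OspFermions.Wt.del i) = 0 ∧
          Λ₁.ip (OspFermions.Wt.eps i - OspFermions.Wt.del i) = 0 ∧
          (-Λs).ip (OspFermions.Wt.eps i - OspFermions.Wt.del i) = 0) ∧
        ∃ s₀ s₁ s₂ : ℂ,
          -- the exponents `m_Λ` of the normalization, and their values at the critical level
          (n < m → ∃ r, OspFermions.IsRho (OspFermions.intRoots m n 1) r ∧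
            (Λ₀ + r).k ≠ 0 ∧ (Λ₁ + r).k ≠ 0 ∧ (-Λs + r).k ≠ 0 ∧
            s₀ = OspFermions.normExp 1 r Λ₀ ∧ s₁ = OspFermions.normExp 1 r Λ₁ ∧
            s₂ = OspFermions.normExp 1 r (-Λs)) ∧
          (m = n → s₀ = -1 / 48 ∧ s₁ = -1 / 48 ∧ s₂ = 1 / 24) ∧
          R.HasNormSch (OspFermions.degSub m n 1 false 0) 0 (OspFermions.intRoots m n 1) s₀
            (OspFermions.chOdd m n 0) ∧
          R.HasNormSch (OspFermions.degSub m n 1 false 1) 1 (OspFermions.intRoots m n 1) s₁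
            (OspFermions.chOdd m n 1) ∧
          R'.HasNormSch (OspFermions.degSub m n 1 true 0) 0 (OspFermions.intRoots m n 1) s₂
            (OspFermions.chOdd m n 2) ∧
          R'.HasNormSch (OspFermions.degSub m n 1 true 1) 1 (OspFermions.intRoots m n 1) s₂
            (OspFermions.chOdd m n 2)) ∧
    -- `M = 2m`: the modules `L(Λ₀)`, `L(Λ₁)`, `L(Λ_{m+n})`, `L(Λ_{m+n-1})`
    (∀ m n : ℕ, 1 ≤ n → n < m →
      ∀ R : OspFermions.AffRep m n 0 (OspFermions.Fock m n 0 false), OspFermions.IsFermionic R →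
      ∀ R' : OspFermions.AffRep m n 0 (OspFermions.Fock m n 0 true), OspFermions.IsFermionic R' →
      ∃ Λ₀ Λ₁ Λs Λc r : OspFermions.Wt m n,
        OspFermions.IsFund (OspFermions.intRoots m n 0) 0 Λ₀ ∧
        OspFermions.IsFund (OspFermions.intRoots m n 0) 1 Λ₁ ∧
        OspFermions.IsFund (OspFermions.intRoots m n 0) (m + n) Λs ∧
        OspFermions.IsFund (OspFermions.intRoots m n 0) (m + n - 1) Λc ∧
        R.IsL (OspFermions.degSub m n 0 false 0) 0 (OspFermions.intRoots m n 0) Λ₀ ∧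
        R.IsL (OspFermions.degSub m n 0 false 1) 1 (OspFermions.intRoots m n 0) Λ₁ ∧
        R'.IsL (OspFermions.degSub m n 0 true 0) 0 (OspFermions.intRoots m n 0) Λs ∧
        R'.IsL (OspFermions.degSub m n 0 true 1) 1 (OspFermions.intRoots m n 0) Λc ∧
        (∀ i < n,
          Λ₀.ip (OspFermions.Wt.del i - OspFermions.Wt.eps i) = 0 ∧
          Λ₁.ip (OspFermions.Wt.del i - OspFermions.Wt.eps i) = 0 ∧
          Λs.ip (OspFermions.Wt.del i - OspFermions.Wt.eps i) = 0 ∧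
          Λc.ip (if i = 0 then OspFermions.Wt.del i + OspFermions.Wt.eps i
            else OspFermions.Wt.del i - OspFermions.Wt.eps i) = 0) ∧
        OspFermions.IsRho (OspFermions.intRoots m n 0) r ∧
        (Λ₀ + r).k ≠ 0 ∧ (Λ₁ + r).k ≠ 0 ∧ (Λs + r).k ≠ 0 ∧ (Λc + r).k ≠ 0 ∧
        R.HasNormSch (OspFermions.degSub m n 0 false 0) 0 (OspFermions.intRoots m n 0)
          (OspFermions.normExp 0 r Λ₀) (OspFermions.chEven m n 0) ∧
        R.HasNormSch (OspFermions.degSub m n 0 false 1) 1 (OspFermions.intRoots m n 0)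
          (OspFermions.normExp 0 r Λ₁) (OspFermions.chEven m n 1) ∧
        R'.HasNormSch (OspFermions.degSub m n 0 true 0) 0 (OspFermions.intRoots m n 0)
          (OspFermions.normExp 0 r Λs) (OspFermions.chEven m n 2) ∧
        R'.HasNormSch (OspFermions.degSub m n 0 true 1) 1 (OspFermions.intRoots m n 0)
          (OspFermions.normExp 0 r Λc) (OspFermions.chEven m n 3)) ∧
    -- meromorphy and modular transformations, `M = 2m + 1`
    (∀ m n : ℕ,
      (∀ i, OspFermions.IsMero (OspFermions.chOdd m n i)) ∧
      (∀ p, OspFermions.chOdd m n 0 (OspFermions.slAct ModularGroup.S p) +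
          OspFermions.chOdd m n 1 (OspFermions.slAct ModularGroup.S p) =
        OspFermions.chOdd m n 0 p + OspFermions.chOdd m n 1 p) ∧
      (∀ p, OspFermions.chOdd m n 0 (OspFermions.slAct ModularGroup.S p) -
          OspFermions.chOdd m n 1 (OspFermions.slAct ModularGroup.S p) =
        (Real.sqrt 2 : ℂ) * OspFermions.chOdd m n 2 p) ∧
      (∀ p, OspFermions.chOdd m n 2 (OspFermions.slAct ModularGroup.S p) =
        1 / (Real.sqrt 2 : ℂ) * (OspFermions.chOdd m n 0 p - OspFermions.chOdd m n 1 p)) ∧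
      (∀ p, OspFermions.chOdd m n 0 (OspFermions.slAct ModularGroup.T p) =
        exp (Real.pi * I / 12 * ((n : ℂ) - m - 1 / 2)) * OspFermions.chOdd m n 0 p) ∧
      (∀ p, OspFermions.chOdd m n 1 (OspFermions.slAct ModularGroup.T p) =
        -exp (Real.pi * I / 12 * ((n : ℂ) - m - 1 / 2)) * OspFermions.chOdd m n 1 p) ∧
      (∀ p, OspFermions.chOdd m n 2 (OspFermions.slAct ModularGroup.T p) =
        exp (Real.pi * I / 6 * ((m : ℂ) - n + 1 / 2)) * OspFermions.chOdd m n 2 p) ∧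
      OspFermions.SpanInvariant (OspFermions.chOdd m n)) ∧
    -- meromorphy and modular transformations, `M = 2m`
    (∀ m n : ℕ,
      (∀ i, OspFermions.IsMero (OspFermions.chEven m n i)) ∧
      (∀ p, OspFermions.chEven m n 0 (OspFermions.slAct ModularGroup.S p) +
          OspFermions.chEven m n 1 (OspFermions.slAct ModularGroup.S p) =
        OspFermions.chEven m n 0 p + OspFermions.chEven m n 1 p) ∧
      (∀ p, OspFermions.chEven m n 0 (OspFermions.slAct ModularGroup.S p) -
          OspFermions.chEven m n 1 (OspFermions.slAct ModularGroup.S p) =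
        OspFermions.chEven m n 2 p + OspFermions.chEven m n 3 p) ∧
      (∀ p, OspFermions.chEven m n 2 (OspFermions.slAct ModularGroup.S p) +
          OspFermions.chEven m n 3 (OspFermions.slAct ModularGroup.S p) =
        OspFermions.chEven m n 0 p - OspFermions.chEven m n 1 p) ∧
      (∀ p, OspFermions.chEven m n 2 (OspFermions.slAct ModularGroup.S p) -
          OspFermions.chEven m n 3 (OspFermions.slAct ModularGroup.S p) =
        (-I) ^ ((m : ℤ) - n) * (OspFermions.chEven m n 2 p - OspFermions.chEven m n 3 p)) ∧
      (∀ p, OspFermions.chEven m n 0 (OspFermions.slAct ModularGroup.T p) =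
        exp (Real.pi * I / 12 * ((n : ℂ) - m)) * OspFermions.chEven m n 0 p) ∧
      (∀ p, OspFermions.chEven m n 1 (OspFermions.slAct ModularGroup.T p) =
        -exp (Real.pi * I / 12 * ((n : ℂ) - m)) * OspFermions.chEven m n 1 p) ∧
      (∀ p, OspFermions.chEven m n 2 (OspFermions.slAct ModularGroup.T p) =
        exp (-(Real.pi * I) / 6 * ((n : ℂ) - m)) * OspFermions.chEven m n 2 p) ∧
      (∀ p, OspFermions.chEven m n 3 (OspFermions.slAct ModularGroup.T p) =
        exp (-(Real.pi * I) / 6 * ((n : ℂ) - m)) * OspFermions.chEven m n 3 p) ∧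
      OspFermions.SpanInvariant (OspFermions.chEven m n)) := by
  refine ⟨fun m n e tw he hn _ => ⟨OspFermions.isFreeFieldModule m n e tw he,
      OspFermions.existsUnique_fermionic m n e tw, OspFermions.degSub_isCompl m n e tw,
      fun R hR => ?_⟩,
    fun m n hn R hR => ?_, fun m n hn R hR i hi => ?_, fun m n hn hmn R hR R' hR' => ?_,
    fun m n hn hmn R hR R' hR' => ?_, OspFermions.chOdd_modular, OspFermions.chEven_modular⟩
  · obtain rfl := OspFermions.SuperFock.IsFermionic.eq_rep
      (F := OspFermions.superFock m n e tw) hR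
    exact (OspFermions.superFock m n e tw).soIntegrable
  · obtain rfl := OspFermions.SuperFock.IsFermionic.eq_rep
      (F := OspFermions.superFock m n 1 true) hR
    exact (OspFermions.superFock m n 1 true).dist_odd hn
  · obtain rfl := OspFermions.SuperFock.IsFermionic.eq_rep
      (F := OspFermions.superFock m n 0 true) hR
    exact (OspFermions.superFock m n 0 true).dist_even hn hi
  · obtain rfl := OspFermions.SuperFock.IsFermionic.eq_rep
      (F := OspFermions.superFock m n 1 false) hR
    obtain rfl := OspFermions.SuperFock.IsFermionic.eq_rep
      (F := OspFermions.superFock m n 1 true) hR'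
    exact (OspFermions.superFock m n 1 false).int_odd (OspFermions.superFock m n 1 true) hn hmn
  · obtain rfl := OspFermions.SuperFock.IsFermionic.eq_rep
      (F := OspFermions.superFock m n 0 false) hR
    obtain rfl := OspFermions.SuperFock.IsFermionic.eq_rep
      (F := OspFermions.superFock m n 0 true) hR'
    exact (OspFermions.superFock m n 0 false).int_even (OspFermions.superFock m n 0 true) hn hmn
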